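/- An instance of connected $k$-center consists of a finite set $V$ of $n$ vertices with a metric $d:V\times V\to\mathbb{R}_{\ge 0}$, an undirected graph $G=(V,E)$ and a natural number $k$. A feasible solution is a partition of $V$ into exactly $k$ clusters $P_1,\dots,P_k$ with centers $c_i\in P_i$ such that every $P_i$ induces a connected (non-empty) subgraph of $G$; it is optimal if it minimizes $\max_{i}\max_{v\in P_i} d(v,c_i)$ among all feasible solutions. A nice tree decomposition of $G$ is a tree decomposition $(T,\{B_t\}_{t\in V_T})$ (the bags cover $V$, every edge is contained in a bag, and for each vertex the nodes whose bags contain it induce a connected subtree of $T$) that is rooted at a node $z$ with $B_z=\emptyset$ and in which every node $t$ is of one of these types: a leaf (no children, $B_t=\emptyset$); an introduce vertex node (one child $s$, $B_t=B_s\cup\{v\}$ with $v\notin B_s$); an introduce edge node (labelled with an edge $\{u,v\}\in E$, $u,v\in B_t$, one child $s$, $B_t=B_s$); a forget node (one child $s$, $B_t=B_s\setminus\{v\}$ with $v\in B_s$); a join node (exactly two children $s_1,s_2$, $B_{s_1}=B_{s_2}=B_t$). Every edge is introduced exactly once and every vertex is forgotten exactly once. Its width is $\max_t|B_t|-1$.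 Let $b_m$ denote the $m$-th Bell number. **Theorem.** There are one algorithm and one polynomial $p$ such that for every constant $c$ there is a constant $C$ with the following property. Given any instance $(V,d,G,k)$ of connected $k$-center with $n\ge 2$ vertices and a nice tree decomposition of $G$ of width $w$ with at most $c\cdot n\cdot(w+1)$ nodes, the algorithm computes an optimal connected $k$-center solution, or reports that no feasible solution exists, in at most $$C\cdot\log(n)\cdot n^{w+2}\cdot (b_{w+1})^2\cdot p(w)$$ steps. Here the algorithm is a program for a random access machine on natural numbers whose unit-cost operations are addition, truncated subtraction, comparison, indirect reading and writing of memory, and comparison of two input distances (the distances are accessed in no other way). The vertices are $0,\dots,n-1$; the input consists of $n$, $k$, the number of nodes, the distance matrix, the adjacency matrix of $G$, and for the decomposition the root, the parent of every node, the bags as an incidence matrix, and the types and labels of the nodes. -/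

import Mathlib

open scoped NNReal

namespace ConnectedKCenter

/-! ## The machine model

A random access machine, programmed by structured programs.  The memory consists of natural
number registers and of natural number arrays, all addressable indirectly; a program can name only
finitely many registers and arrays.  The only arithmetic is addition and truncated subtraction
(there is no unit-cost multiplication, division or bit operation).  In addition there is one
read-only array of real input numbers, and the only thing that a program can do with real numbers
is to compare two cells of that array. -/

/-- Arithmetic expressions. -/
inductive Expr : Type
  /-- a constant -/
  | lit (c : ℕ)
  /-- the content of register `x` -/
  | var (x : ℕ)
  /-- the content of cell `i` of array `a` -/
  | get (a : ℕ) (i : Expr)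
  | add (e f : Expr)
  /-- truncated subtraction -/
  | sub (e f : Expr)

/-- Tests. -/
inductive Test : Type
  | lt (e f : Expr)
  | eq (e f : Expr)
  /-- is the real number in input cell `e` at most the one in input cell `f`? -/
  | realLe (e f : Expr)
  | not (b : Test)
  | and (b c : Test)

/-- Programs. -/
inductive Cmd : Type
  | nop
  /-- register `x` gets the value of `e` -/
  | assign (x : ℕ) (e : Expr)
  /-- cell `i` of array `a` gets the value of `e` -/
  | store (a : ℕ) (i e : Expr)
  | seq (p q : Cmd)
  | ite (b : Test) (p q : Cmd)
  /-- repeat `p` as long as `b` holds -/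
  | loop (b : Test) (p : Cmd)

/-- The writable memory: registers and arrays. -/
structure State where
  reg : ℕ → ℕ
  arr : ℕ → ℕ → ℕ

namespace Expr

/-- The value of an expression. -/
def eval (s : State) : Expr → ℕ
  | lit c => c
  | var x => s.reg x
  | get a i => s.arr a (i.eval s)
  | add e f => e.eval s + f.eval s
  | sub e f => e.eval s - f.eval s

/-- The number of elementary operations needed to evaluate an expression. -/
def cost : Expr → ℕ
  | lit _ => 1
  | var _ => 1
  | get _ i => i.cost + 1
  | add e f => e.cost + f.cost + 1
  | sub e f => e.cost + f.cost + 1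

end Expr

namespace Test

/-- The truth value of a test, where `D` is the array of real input numbers. -/
def Holds (D : ℕ → ℝ≥0) (s : State) : Test → Prop
  | lt e f => e.eval s < f.eval s
  | eq e f => e.eval s = f.eval s
  | realLe e f => D (e.eval s) ≤ D (f.eval s)
  | not b => ¬ b.Holds D s
  | and b c => b.Holds D s ∧ c.Holds D s

/-- The number of elementary operations needed to evaluate a test. -/
def cost : Test → ℕ
  | lt e f => e.cost + f.cost + 1
  | eq e f => e.cost + f.cost + 1
  | realLe e f => e.cost + f.cost + 1
  | not b => b.cost + 1
  | and b c => b.cost + c.cost + 1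

end Test

/-- `s.setReg x v`: register `x` is overwritten by `v`. -/
def State.setReg (s : State) (x v : ℕ) : State :=
  { s with reg := Function.update s.reg x v }

/-- `s.setArr a i v`: cell `i` of array `a` is overwritten by `v`. -/
def State.setArr (s : State) (a i v : ℕ) : State :=
  { s with arr := Function.update s.arr a (Function.update (s.arr a) i v) }

/-- `Exec D p s t s'`: with the real input array `D`, the program `p` started in the memory state
`s` halts after exactly `t` elementary steps in the memory state `s'`. -/
inductive Exec (D : ℕ → ℝ≥0) : Cmd → State → ℕ → State → Prop
  | nop (s : State) : Exec D .nop s 1 s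
  | assign (s : State) (x : ℕ) (e : Expr) :
      Exec D (.assign x e) s (e.cost + 1) (s.setReg x (e.eval s))
  | store (s : State) (a : ℕ) (i e : Expr) :
      Exec D (.store a i e) s (i.cost + e.cost + 1) (s.setArr a (i.eval s) (e.eval s))
  | seq {p q : Cmd} {s s' s'' : State} {t t' : ℕ} :
      Exec D p s t s' → Exec D q s' t' s'' → Exec D (.seq p q) s (t + t') s''
  | ite_true {b : Test} {p q : Cmd} {s s' : State} {t : ℕ} :
      b.Holds D s → Exec D p s t s' → Exec D (.ite b p q) s (b.cost + t) s'
  | ite_false {b : Test} {p q : Cmd} {s s' : State} {t : ℕ} :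
      ¬ b.Holds D s → Exec D q s t s' → Exec D (.ite b p q) s (b.cost + t) s'
  | loop_done {b : Test} {p : Cmd} {s : State} :
      ¬ b.Holds D s → Exec D (.loop b p) s b.cost s
  | loop_step {b : Test} {p : Cmd} {s s' s'' : State} {t t' : ℕ} :
      b.Holds D s → Exec D p s t s' → Exec D (.loop b p) s' t' s'' →
      Exec D (.loop b p) s (b.cost + t + t') s''

/-! ## Connected `k`-center -/

/-- The clusters `P 0, …, P (k - 1)` with the centers `c 0, …, c (k - 1)` form a feasible solution:
the clusters partition the vertex set, each induces a connected subgraph (hence is non-empty), and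
each contains its center. -/
structure IsSolution {V : Type*} [Fintype V] (G : SimpleGraph V) {k : ℕ}
    (P : Fin k → Finset V) (c : Fin k → V) : Prop where
  disjoint : ∀ i j, i ≠ j → Disjoint (P i) (P j)
  cover : ∀ v, ∃ i, v ∈ P i
  connected : ∀ i, (G.induce (P i : Set V)).Connected
  center_mem : ∀ i, c i ∈ P i

/-- The distance of two points in the metric `M`. -/
def distance {V : Type*} (M : MetricSpace V) (u v : V) : ℝ≥0 :=
  @nndist V M.toPseudoMetricSpace.toNNDist u v

/-- The `k`-center objective: the largest distance of a vertex to the center of its cluster. -/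
noncomputable def cost {V : Type*} (M : MetricSpace V) {k : ℕ}
    (P : Fin k → Finset V) (c : Fin k → V) : ℝ≥0 :=
  Finset.univ.sup fun i => (P i).sup fun v => distance M v (c i)

/-- A feasible solution of minimum cost. -/
def IsOptimalSolution {V : Type*} [Fintype V] (M : MetricSpace V) (G : SimpleGraph V) {k : ℕ}
    (P : Fin k → Finset V) (c : Fin k → V) : Prop :=
  IsSolution G P c ∧
    ∀ (P' : Fin k → Finset V) (c' : Fin k → V), IsSolution G P' c' → cost M P c ≤ cost M P' c'

/-! ## Nice tree decompositions -/

/-- A tree decomposition of `G` with node set `Node`. -/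
structure TreeDecomposition {V : Type*} [Fintype V] (G : SimpleGraph V)
    (Node : Type*) [Fintype Node] where
  tree : SimpleGraph Node
  isTree : tree.IsTree
  bag : Node → Finset V
  bag_cover : ∀ v, ∃ t, v ∈ bag t
  edge_cover : ∀ u v, G.Adj u v → ∃ t, u ∈ bag t ∧ v ∈ bag t
  bag_connected : ∀ v, (tree.induce {t | v ∈ bag t}).Connected

/-- The width of a tree decomposition: the size of the largest bag minus one. -/
def TreeDecomposition.width {V : Type*} [Fintype V] {G : SimpleGraph V}
    {Node : Type*} [Fintype Node] (T : TreeDecomposition G Node) : ℕ :=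
  (Finset.univ.sup fun t => (T.bag t).card) - 1

/-- The type of a node of a nice tree decomposition, with its label. -/
inductive NodeKind (V : Type*) : Type _
  | leaf
  | introVertex (v : V)
  | introEdge (u v : V)
  | forget (v : V)
  | join

/-- A nice tree decomposition of `G`.  The field `parent` is determined by the tree and the root: the
parent of a node other than the root is its neighbour that is closer to the root; by convention
the root is its own parent. -/
structure NiceTreeDecomposition {V : Type*} [Fintype V] [DecidableEq V] (G : SimpleGraph V)
    (Node : Type*) [Fintype Node] extends TreeDecomposition G Node where
  root : Node
  root_bag : bag root = ∅
  parent : Node → Node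
  parent_root : parent root = root
  parent_spec : ∀ t, t ≠ root →
    tree.Adj t (parent t) ∧ tree.dist root t = tree.dist root (parent t) + 1
  kind : Node → NodeKind V
  kind_spec : ∀ t,
    let children : Set Node := {s | s ≠ root ∧ parent s = t}
    match kind t with
    | .leaf => children = ∅ ∧ bag t = ∅
    | .introVertex v => ∃ s, children = {s} ∧ v ∉ bag s ∧ bag t = insert v (bag s)
    | .introEdge u v =>
        G.Adj u v ∧ u ∈ bag t ∧ v ∈ bag t ∧ ∃ s, children = {s} ∧ bag t = bag s
    | .forget v => ∃ s, children = {s} ∧ v ∈ bag s ∧ bag t = (bag s).erase v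
    | .join => ∃ s₁ s₂, s₁ ≠ s₂ ∧ children = {s₁, s₂} ∧ bag s₁ = bag t ∧ bag s₂ = bag t
  introEdge_unique : ∀ u v, G.Adj u v → ∃! t, kind t = .introEdge u v ∨ kind t = .introEdge v u
  forget_unique : ∀ v, ∃! t, kind t = .forget v

/-! ## Input and output of the machine -/

/-- The array that holds the entries of `f`; the cells behind them hold `0`. -/
def vecArray {α : Type*} [Zero α] {m : ℕ} (f : Fin m → α) : ℕ → α :=
  fun i => if h : i < m then f ⟨i, h⟩ else 0

/-- The array that holds the entries of an `m × n` matrix row by row, that is, `f i j` in cell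
`i * n + j`; the cells behind them hold `0`. -/
def matArray {α : Type*} [Zero α] {m n : ℕ} (f : Fin m → Fin n → α) : ℕ → α :=
  vecArray fun x : Fin (m * n) => f x.divNat x.modNat

/-- The real input array: the distance matrix of the vertices. -/
noncomputable def distArray {n : ℕ} (M : MetricSpace (Fin n)) : ℕ → ℝ≥0 :=
  matArray fun u v : Fin n => distance M u v

/-- The numeric code of the type of a node. -/
def NodeKind.code {V : Type*} : NodeKind V → ℕ
  | leaf => 0
  | introVertex _ => 1
  | introEdge _ _ => 2
  | forget _ => 3
  | join => 4

/-- The first vertex in the label of a node (`0` if there is none). -/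
def NodeKind.label₁ {n : ℕ} : NodeKind (Fin n) → ℕ
  | leaf => 0
  | introVertex v => v
  | introEdge u _ => u
  | forget v => v
  | join => 0

/-- The second vertex in the label of a node (`0` if there is none). -/
def NodeKind.label₂ {n : ℕ} : NodeKind (Fin n) → ℕ
  | introEdge _ v => v
  | _ => 0

open Classical in
/-- The initial memory.  Registers `0, 1, 2, 3` hold the number `n` of vertices, the number `k` of
clusters, the number `N` of nodes and the root.  Array `0` holds the adjacency matrix of `G`, array
`1` the parents of the nodes, array `2` the bags as an incidence matrix, array `3` the types of the
nodes and arrays `4` and `5` their labels.  Everything else is `0`. -/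
noncomputable def inputState {n N : ℕ} (k : ℕ) {G : SimpleGraph (Fin n)}
    (T : NiceTreeDecomposition G (Fin N)) : State where
  reg x := match x with
    | 0 => n
    | 1 => k
    | 2 => N
    | 3 => T.root
    | _ => 0
  arr a := match a with
    | 0 => matArray fun u v : Fin n => if G.Adj u v then 1 else 0
    | 1 => vecArray fun t : Fin N => (T.parent t : ℕ)
    | 2 => matArray fun (t : Fin N) (v : Fin n) => if v ∈ T.bag t then 1 else 0
    | 3 => vecArray fun t : Fin N => (T.kind t).code
    | 4 => vecArray fun t : Fin N => (T.kind t).label₁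
    | 5 => vecArray fun t : Fin N => (T.kind t).label₂
    | _ => fun _ => 0

/-- The final memory `s` describes a solution with the clusters `P i` and the centers `c i`:
cell `v` of array `0` holds the index of the cluster of the vertex `v`, and cell `i` of array `1`
holds the center of the `i`-th cluster. -/
def State.Describes {n k : ℕ} (s : State) (P : Fin k → Finset (Fin n)) (c : Fin k → Fin n) : Prop :=
  (∀ (i : Fin k) (v : Fin n), v ∈ P i ↔ s.arr 0 v = (i : ℕ)) ∧ ∀ i : Fin k, s.arr 1 i = (c i : ℕ)

/-- The final memory `s` is a correct answer to the instance: if there is a feasible solution, then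
register `0` holds `1` and `s` describes an optimal solution; if there is none, then register `0`
holds `0`. -/
def IsCorrectOutput {n : ℕ} (M : MetricSpace (Fin n)) (G : SimpleGraph (Fin n)) (k : ℕ)
    (s : State) : Prop :=
  ((∃ (P : Fin k → Finset (Fin n)) (c : Fin k → Fin n), IsSolution G P c) →
    s.reg 0 = 1 ∧ ∃ (P : Fin k → Finset (Fin n)) (c : Fin k → Fin n),
      IsOptimalSolution M G P c ∧ s.Describes P c) ∧
  ((¬ ∃ (P : Fin k → Finset (Fin n)) (c : Fin k → Fin n), IsSolution G P c) → s.reg 0 = 0)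

end ConnectedKCenter

/-! A partition with centers is encoded as a map `a` that sends each vertex to the center of its
cluster. Such a map comes from a solution exactly if every vertex is connected to its center along
edges whose ends have the same color under `a` (`Centered`).

Two reductions lead to a decision problem. The optimal radius is one of the `n * n` input distances
and feasibility of a radius is monotone, so the distances are sorted and searched with about `log n`
tests. And "exactly `k` centers" may be replaced by "at most `k`": starting with all vertices as
singletons, vertices are moved back one by one to their cluster under `a`, along an edge to a vertex
that is already there. Each move removes exactly one center, and no vertex gets farther from its
center than under `a` (`Splits.exists_edge`, `Splits.update`). Hence every number of centers from
that of `a` up to `n` is attained.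

For a fixed radius a dynamic program minimizes the number of centers. Below a node of the
decomposition lies a `Piece` of the graph, attached to the rest at the bag only. A partial
assignment is `Valid` if each vertex is connected to its center or can still become so, both
components touching the bag. What the rest of the graph can see of it is its key: the centers of the
bag vertices and the partition of the bag into monochromatic components. The lemmas
`IsIntro.valid_iff`, `IsForget.valid_iff`, `IsJoin.valid_iff` and `IsEdge.valid_iff` express
validity after each step by validity before and a test on the key; the `table` lemmas conclude that
it suffices to keep the least value for each key.

The value of a partial assignment is `n ^ n` times the number of forgotten centers, plus the
assignment of the forgotten vertices written in base `n`. So a least value at the root has the least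
number of centers, and an optimal assignment is read off its digits without any back pointers.

A bag of size `b` has at most `n ^ b * bell b` keys. Introducing a vertex tries `n` centers, but for
a child whose bag is smaller by one. A join combines only entries with equal centers, at most `bell
b` for each entry of the first table. So every node costs about `n ^ (w + 1) * bell (w + 1) ^ 2`
(`fillTable_runs`), and the number of nodes contributes the remaining `n`. Keys are looked up in
constant time in an array addressed by their numeric code; the memory is zero initially and every
table gets a fresh block, so nothing has to be initialized. The cubic preprocessing is harmless,
because a graph with an edge has `w ≥ 1`; edgeless graphs are treated separately.

All programs are verified by `Runs`, a Hoare triple with a time bound, together with the frame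
condition `Keeps`. -/

namespace ConnectedKCenter

/-! ## A program logic for the machine -/

@[simp] theorem State.setReg_reg (s : State) (x v y : ℕ) :
    (s.setReg x v).reg y = if y = x then v else s.reg y := by
  simp [State.setReg, Function.update_apply]

@[simp] theorem State.setReg_arr (s : State) (x v : ℕ) : (s.setReg x v).arr = s.arr := rfl

@[simp] theorem State.setArr_reg (s : State) (a i v : ℕ) : (s.setArr a i v).reg = s.reg := rfl

@[simp] theorem State.setArr_arr (s : State) (a i v b : ℕ) :
    (s.setArr a i v).arr b = if b = a then Function.update (s.arr a) i v else s.arr b := by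
  simp [State.setArr, Function.update_apply]

namespace Cmd

infixr:60 " ;; " => Cmd.seq

/-- Does the program mention register `x` as the target of an assignment? -/
def writesReg : Cmd → ℕ → Bool
  | nop, _ => false
  | assign x _, y => Nat.beq x y
  | store _ _ _, _ => false
  | seq p q, y => p.writesReg y || q.writesReg y
  | ite _ p q, y => p.writesReg y || q.writesReg y
  | loop _ p, y => p.writesReg y

/-- Does the program mention array `a` as the target of a store instruction? -/
def writesArr : Cmd → ℕ → Bool
  | nop, _ => false
  | assign _ _, _ => false
  | store a _ _, b => Nat.beq a b
  | seq p q, b => p.writesArr b || q.writesArr b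
  | ite _ p q, b => p.writesArr b || q.writesArr b
  | loop _ p, b => p.writesArr b

/-- The registers and arrays that `p` does not write agree in `s` and `s'`. -/
structure Keeps (p : Cmd) (s s' : State) : Prop where
  reg : ∀ x, p.writesReg x = false → s'.reg x = s.reg x
  arr : ∀ a, p.writesArr a = false → s'.arr a = s.arr a

theorem Keeps.refl (p : Cmd) (s : State) : p.Keeps s s := ⟨fun _ _ => rfl, fun _ _ => rfl⟩

theorem Keeps.trans {p : Cmd} {s s' s'' : State} (h : p.Keeps s s') (h' : p.Keeps s' s'') :
    p.Keeps s s'' :=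
  ⟨fun x hx => (h'.reg x hx).trans (h.reg x hx), fun a ha => (h'.arr a ha).trans (h.arr a ha)⟩

theorem Keeps.mono {p q : Cmd} {s s' : State} (h : p.Keeps s s')
    (hr : ∀ x, q.writesReg x = false → p.writesReg x = false)
    (ha : ∀ x, q.writesArr x = false → p.writesArr x = false) : q.Keeps s s' :=
  ⟨fun x hx => h.reg x (hr x hx), fun a h' => h.arr a (ha a h')⟩

/-- The frame rule of the logic. As `writesReg` and `writesArr` are computed from the syntax, it is
later a matter of `rfl` that a concrete program leaves a register or an array alone. -/
theorem _root_.ConnectedKCenter.Exec.keeps {D : ℕ → ℝ≥0} {p : Cmd} {s s' : State} {t : ℕ}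
    (h : Exec D p s t s') : p.Keeps s s' := by
  induction h with
  | nop s => exact .refl _ _
  | assign s x e =>
    refine ⟨fun y hy => ?_, fun _ _ => rfl⟩
    have : y ≠ x := by rintro rfl; simp [writesReg] at hy
    simp [this]
  | store s a i e =>
    refine ⟨fun _ _ => rfl, fun b hb => ?_⟩
    have : b ≠ a := by rintro rfl; simp [writesArr] at hb
    simp [this]
  | seq _ _ h1 h2 =>
    exact (h1.mono (by simp +contextual [writesReg]) (by simp +contextual [writesArr])).trans
      (h2.mono (by simp +contextual [writesReg]) (by simp +contextual [writesArr]))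
  | ite_true _ _ h1 =>
    exact h1.mono (by simp +contextual [writesReg]) (by simp +contextual [writesArr])
  | ite_false _ _ h1 =>
    exact h1.mono (by simp +contextual [writesReg]) (by simp +contextual [writesArr])
  | loop_done _ => exact .refl _ _
  | loop_step _ _ _ h1 h2 =>
    exact Keeps.trans (h1.mono (by simp [writesReg]) (by simp [writesArr])) h2

/-- `for x := 0, …, e - 1 do p`. -/
def forc (x : ℕ) (e : Expr) (p : Cmd) : Cmd :=
  .assign x (.lit 0) ;; .loop (.lt (.var x) e) (p ;; .assign x (.add (.var x) (.lit 1)))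

open Classical in
/-- The effect of a loop-free program. -/
noncomputable def run (D : ℕ → ℝ≥0) : Cmd → State → State
  | nop, s => s
  | assign x e, s => s.setReg x (e.eval s)
  | store a i e, s => s.setArr a (i.eval s) (e.eval s)
  | seq p q, s => q.run D (p.run D s)
  | ite b p q, s => if b.Holds D s then p.run D s else q.run D s
  | loop _ _, s => s

/-- A bound for the running time of a loop-free program. -/
def time : Cmd → ℕ
  | nop => 1
  | assign _ e => e.cost + 1
  | store _ i e => i.cost + e.cost + 1
  | seq p q => p.time + q.time
  | ite b p q => b.cost + (p.time + q.time)
  | loop _ _ => 0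

/-- Is the program loop-free? -/
def straight : Cmd → Bool
  | seq p q => p.straight && q.straight
  | ite _ p q => p.straight && q.straight
  | loop _ _ => false
  | _ => true

end Cmd

/-- Started in `s`, the program `p` halts after at most `T` steps in a state that satisfies `Q`. -/
def Runs (D : ℕ → ℝ≥0) (p : Cmd) (s : State) (T : ℕ) (Q : State → Prop) : Prop :=
  ∃ t s', Exec D p s t s' ∧ t ≤ T ∧ Q s'

namespace Runs

variable {D : ℕ → ℝ≥0} {p q : Cmd} {s : State} {T T' : ℕ} {Q R : State → Prop}

/-- The new postcondition may also use what `p` does not write, which is why `Keeps` is handed to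
`hQ`. -/
theorem mono (h : Runs D p s T Q) (hT : T ≤ T') (hQ : ∀ s', p.Keeps s s' → Q s' → R s') :
    Runs D p s T' R := by
  obtain ⟨t, s', h1, h2, h3⟩ := h
  exact ⟨t, s', h1, h2.trans hT, hQ s' h1.keeps h3⟩

theorem seq {T₁ T₂ : ℕ} (hp : Runs D p s T₁ Q)
    (hq : ∀ s', p.Keeps s s' → Q s' → Runs D q s' T₂ R) : Runs D (p ;; q) s (T₁ + T₂) R := by
  obtain ⟨t, s', h1, h2, h3⟩ := hp
  obtain ⟨t', s'', h1', h2', h3'⟩ := hq s' h1.keeps h3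
  exact ⟨t + t', s'', h1.seq h1', by omega, h3'⟩

theorem seq_le {T₁ T₂ : ℕ} (hp : Runs D p s T₁ Q)
    (hq : ∀ s', p.Keeps s s' → Q s' → Runs D q s' T₂ R) (hT : T₁ + T₂ ≤ T) :
    Runs D (p ;; q) s T R :=
  (seq hp hq).mono hT fun _ _ h => h

theorem ite {b : Test} {T₁ T₂ : ℕ} (hp : b.Holds D s → Runs D p s T₁ Q)
    (hq : ¬ b.Holds D s → Runs D q s T₂ Q) : Runs D (.ite b p q) s (b.cost + max T₁ T₂) Q := by
  by_cases hb : b.Holds D s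
  · obtain ⟨t, s', h1, h2, h3⟩ := hp hb
    exact ⟨_, s', .ite_true hb h1, by omega, h3⟩
  · obtain ⟨t, s', h1, h2, h3⟩ := hq hb
    exact ⟨_, s', .ite_false hb h1, by omega, h3⟩

theorem ite_le {b : Test} {T₁ : ℕ} (hp : b.Holds D s → Runs D p s T₁ Q)
    (hq : ¬ b.Holds D s → Runs D q s T₁ Q) (hT : b.cost + T₁ ≤ T) :
    Runs D (.ite b p q) s T Q :=
  (ite hp hq).mono (by omega) fun _ _ h => h

/-- Loop-free code is verified by symbolic execution: `Cmd.run` is a function that `simp` can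
evaluate, and the time bound is a numeral. -/
theorem of_straight (hp : p.straight = true) (hQ : Q (p.run D s)) : Runs D p s p.time Q := by
  induction p generalizing s Q with
  | nop => exact ⟨_, _, .nop s, le_rfl, hQ⟩
  | assign x e => exact ⟨_, _, .assign s x e, le_rfl, hQ⟩
  | store a i e => exact ⟨_, _, .store s a i e, le_rfl, hQ⟩
  | seq p q hp' hq' =>
    simp only [Cmd.straight, Bool.and_eq_true] at hp
    exact seq (hp' (Q := fun s' => s' = p.run D s) hp.1 rfl)
      fun s' _ h => hq' hp.2 (by rw [h]; exact hQ)
  | ite b p q hp' hq' =>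
    simp only [Cmd.straight, Bool.and_eq_true] at hp
    refine (ite (fun hb => hp' hp.1 ?_) fun hb => hq' hp.2 ?_).mono ?_ fun _ _ h => h
    · simpa [Cmd.run, hb] using hQ
    · simpa [Cmd.run, hb] using hQ
    · simp only [Cmd.time]; omega
  | loop b p _ => simp [Cmd.straight] at hp

theorem straight_le (hp : p.straight = true) (hT : p.time ≤ T) (hQ : Q (p.run D s)) :
    Runs D p s T Q :=
  (of_straight hp hQ).mono hT fun _ _ h => h

/-- The rule for loops: `I i` holds after `i` iterations, and there are at most `m`. -/
theorem loop {b : Test} (I : ℕ → State → Prop) (m : ℕ) (h0 : I 0 s)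
    (hs : ∀ i s', (Cmd.loop b p).Keeps s s' → I i s' → b.Holds D s' →
      i < m ∧ Runs D p s' T (I (i + 1))) :
    Runs D (.loop b p) s (m * (b.cost + T) + b.cost)
      fun s' => ∃ i ≤ m, I i s' ∧ ¬ b.Holds D s' := by
  -- Induction on the number `k` of iterations that are still allowed, for all states that can be
  -- reached.
  suffices h : ∀ k i s', (Cmd.loop b p).Keeps s s' → I i s' → i + k = m →
      Runs D (.loop b p) s' (k * (b.cost + T) + b.cost)
        fun s' => ∃ i ≤ m, I i s' ∧ ¬ b.Holds D s' from h m 0 s (.refl _ _) h0 (by omega)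
  intro k
  induction k with
  | zero =>
    intro i s' hk hi hik
    by_cases hb : b.Holds D s'
    · have := (hs i s' hk hi hb).1
      omega
    · exact ⟨_, s', .loop_done hb, by omega, i, by omega, hi, hb⟩
  | succ k ih =>
    intro i s' hk hi hik
    by_cases hb : b.Holds D s'
    · obtain ⟨_, t, s'', h1, h2, h3⟩ := hs i s' hk hi hb
      have hk' : (Cmd.loop b p).Keeps s' s'' :=
        h1.keeps.mono (by simp [Cmd.writesReg]) (by simp [Cmd.writesArr])
      obtain ⟨t', s₃, h1', h2', h3'⟩ := ih (i + 1) s'' (hk.trans hk') h3 (by omega)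
      exact ⟨_, s₃, .loop_step hb h1 h1', by rw [add_mul, one_mul]; omega, h3'⟩
    · exact ⟨_, s', .loop_done hb, by omega, i, by omega, hi, hb⟩

/-- The rule for counting loops. -/
theorem forc {x : ℕ} {e : Expr} (I : ℕ → State → Prop) (m : ℕ) (hx : p.writesReg x = false)
    (he : ∀ s', (Cmd.forc x e p).Keeps s s' → e.eval s' = m)
    (h0 : I 0 (s.setReg x 0))
    (hs : ∀ i s', i < m → (Cmd.forc x e p).Keeps s s' → s'.reg x = i → I i s' →
      Runs D p s' T fun s'' => I (i + 1) (s''.setReg x (i + 1)))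
    (hT : m * (T + e.cost + 6) + e.cost + 4 ≤ T') :
    Runs D (Cmd.forc x e p) s T' fun s' => I m s' ∧ s'.reg x = m := by
  refine seq_le (T₁ := 2) (T₂ := m * (T + e.cost + 6) + e.cost + 2)
    (Q := fun s' => s' = s.setReg x 0) (straight_le rfl le_rfl rfl) ?_ (by omega)
  rintro _ hk0 rfl
  have key : ∀ s', (Cmd.loop (.lt (.var x) e) (p ;; .assign x (.add (.var x) (.lit 1)))).Keeps
      (s.setReg x 0) s' → (Cmd.forc x e p).Keeps s s' := by
    intro s' hk
    refine Cmd.Keeps.trans (s' := s.setReg x 0) ⟨fun y hy => ?_, fun _ _ => rfl⟩ (hk.mono ?_ ?_)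
    · have : y ≠ x := by rintro rfl; simp [Cmd.forc, Cmd.writesReg] at hy
      simp [this]
    · simp +contextual [Cmd.forc, Cmd.writesReg]
    · simp +contextual [Cmd.forc, Cmd.writesArr]
  -- The body of the loop is followed by the increment of `x`, which takes 4 steps.
  refine (loop (T := T + 4) (fun i s' => s'.reg x = i ∧ i ≤ m ∧ I i s') m ⟨by simp, by omega, h0⟩
    ?_).mono ?_ ?_
  · rintro i s' hk ⟨hi, him, hI⟩ hb
    simp only [Test.Holds, Expr.eval, hi, he s' (key s' hk)] at hb
    refine ⟨hb, seq_le (hs i s' hb (key s' hk) hi hI) (T₂ := 4) ?_ le_rfl⟩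
    intro s'' hk'' hI'
    have hi' : s''.reg x = i := (hk''.reg x hx).trans hi
    refine straight_le rfl le_rfl ?_
    simp only [Cmd.run, Expr.eval, hi']
    exact ⟨by simp, by omega, hI'⟩
  · simp only [Test.cost, Expr.cost]
    have : m * (1 + e.cost + 1 + (T + 4)) = m * (T + e.cost + 6) := by ring
    omega
  · rintro s' hk ⟨i, hi, ⟨h1, h2, h3⟩, h4⟩
    simp only [Test.Holds, Expr.eval, h1, he s' (key s' hk)] at h4
    have : i = m := by omega
    subst this
    exact ⟨h3, h1⟩

end Runs

end ConnectedKCenter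

namespace ConnectedKCenter

/-! ## Partial solutions on a part of the graph -/

/-- A part of a graph: a set of vertices with some edges among them, and a set of boundary
vertices, the only ones at which the rest of the graph is attached. -/
structure Piece (V : Type*) where
  bag : Finset V
  verts : Finset V
  E : V → V → Prop
  bag_sub : bag ⊆ verts
  E_sub : ∀ u v, E u v → u ∈ verts ∧ v ∈ verts

namespace Piece

variable {V : Type*} {ok : V → V → Prop}

/-- Connectedness by edges with endpoints of the same colour. -/
def Conn (P : Piece V) (a : V → V) : V → V → Prop :=
  Relation.EqvGen fun u v => P.E u v ∧ a u = a v

/-! ### Connectedness inside color classes. -/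

section Conn

variable {P Q : Piece V} {a a' : V → V} {x y z : V}

theorem Conn.refl (P : Piece V) (a : V → V) (x : V) : P.Conn a x x :=
  Relation.EqvGen.refl x

theorem Conn.symm (h : P.Conn a x y) : P.Conn a y x :=
  Relation.EqvGen.symm _ _ h

theorem Conn.trans (h : P.Conn a x y) (h' : P.Conn a y z) : P.Conn a x z :=
  Relation.EqvGen.trans _ _ _ h h'

/-- The form in which induction on `Conn` is used throughout: a property that no monochromatic edge
changes is constant on components. -/
theorem Conn.iff_of_closed {C : V → Prop} (hC : ∀ u v, P.E u v → a u = a v → (C u ↔ C v))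
    (h : P.Conn a x y) : C x ↔ C y := by
  induction h with
  | rel u v h => exact hC u v h.1 h.2
  | refl u => rfl
  | symm u v _ h => exact h.symm
  | trans u v w _ _ h1 h2 => exact h1.trans h2

theorem Conn.color (h : P.Conn a x y) : a x = a y :=
  ((h.iff_of_closed (C := fun u => a x = a u) fun u v _ h => by rw [h]).1 rfl)

theorem Conn.mem (h : P.Conn a x y) (hx : x ∈ P.verts) : y ∈ P.verts :=
  (h.iff_of_closed (C := fun u => u ∈ P.verts) fun u v h _ => by
    simp [(P.E_sub u v h).1, (P.E_sub u v h).2]).1 hx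

/-- Edges have both ends in `P.verts`, so any other vertex is isolated. -/
theorem Conn.eq_or_mem (h : P.Conn a x y) : x = y ∨ x ∈ P.verts ∧ y ∈ P.verts := by
  by_cases hx : x ∈ P.verts
  · exact .inr ⟨hx, h.mem hx⟩
  · refine .inl ((h.iff_of_closed (C := fun u => x = u) fun u v h _ => ?_).1 rfl)
    have := P.E_sub u v h
    constructor <;> rintro rfl <;> tauto

theorem conn_congr (h : ∀ x ∈ P.verts, a x = a' x) : P.Conn a = P.Conn a' := by
  unfold Conn
  congr 1
  funext u v
  refine propext (and_congr_right fun hE => ?_)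
  rw [h u (P.E_sub u v hE).1, h v (P.E_sub u v hE).2]

theorem Conn.of_le (hE : ∀ u v, P.E u v → Q.E u v) (h : P.Conn a x y) : Q.Conn a x y :=
  (h.iff_of_closed (C := Q.Conn a x) fun u v h1 h2 =>
    have h3 : Q.Conn a u v := .rel _ _ ⟨hE u v h1, h2⟩
    ⟨fun h => h.trans h3, fun h => h.trans h3.symm⟩).1 (.refl _ _ _)

end Conn

/-- The component of `x` reaches the boundary. -/
def Meets (P : Piece V) (a : V → V) (x : V) : Prop := ∃ y ∈ P.bag, P.Conn a x y

theorem Meets.of_conn {P : Piece V} {a : V → V} {x y : V} (h : P.Meets a x) (h' : P.Conn a x y) :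
    P.Meets a y :=
  let ⟨z, hz, hxz⟩ := h; ⟨z, hz, h'.symm.trans hxz⟩

theorem meets_of_mem {P : Piece V} {x : V} (a : V → V) (h : x ∈ P.bag) : P.Meets a x :=
  ⟨x, h, .refl _ _ _⟩

/-- The component of `x` contains its center `a x`, or can still be connected to it. -/
def Good (P : Piece V) (a : V → V) (x : V) : Prop :=
  (a x ∈ P.verts → P.Conn a x (a x) ∨ P.Meets a x ∧ P.Meets a (a x) ∧ a (a x) = a x) ∧
    (a x ∉ P.verts → P.Meets a x)

/-- The assignment `a` of centers to the vertices of the piece is a partial solution. -/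
def Valid (ok : V → V → Prop) (P : Piece V) (a : V → V) : Prop :=
  ∀ x ∈ P.verts, ok x (a x) ∧ P.Good a x

theorem Good.fix {P : Piece V} {a : V → V} {x : V} (h : P.Good a x) (hx : a x ∈ P.verts) :
    a (a x) = a x := by
  rcases h.1 hx with h | h
  · exact h.color.symm
  · exact h.2.2

theorem Good.meets {P : Piece V} {a : V → V} {x : V} (h : P.Good a x) (hx : a x ∈ P.verts)
    (hm : P.Meets a x) : P.Meets a (a x) := by
  rcases h.1 hx with h | h
  · exact hm.of_conn h
  · exact h.2.1

theorem valid_congr {P : Piece V} {a a' : V → V} (h : ∀ x ∈ P.verts, a x = a' x) :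
    P.Valid ok a ↔ P.Valid ok a' := by
  refine forall₂_congr fun x hx => ?_
  simp only [Good, Meets, conn_congr h, h x hx]
  refine and_congr_right fun _ => and_congr_left fun _ => forall_congr' fun hx' => ?_
  rw [h _ hx']

/-! ### The four ways in which a piece grows, and how they affect validity. -/

variable [DecidableEq V]

/-- `Q` is `P` with the new vertex `v`. -/
structure IsIntro (v : V) (P Q : Piece V) : Prop where
  notMem : v ∉ P.verts
  bag : Q.bag = insert v P.bag
  verts : Q.verts = insert v P.verts
  E : Q.E = P.E

/-- `Q` is `P` with the new edge `{u, v}` between boundary vertices. -/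
structure IsEdge (u v : V) (P Q : Piece V) : Prop where
  left : u ∈ P.bag
  right : v ∈ P.bag
  bag : Q.bag = P.bag
  verts : Q.verts = P.verts
  E : ∀ x y, Q.E x y ↔ P.E x y ∨ x = u ∧ y = v

/-- `Q` is `P` with `v` no longer on the boundary. -/
structure IsForget (v : V) (P Q : Piece V) : Prop where
  mem : v ∈ P.bag
  bag : Q.bag = P.bag.erase v
  verts : Q.verts = P.verts
  E : Q.E = P.E

/-- `Q` is obtained by gluing `P₁` and `P₂` together at their boundary. -/
structure IsJoin (P₁ P₂ Q : Piece V) : Prop where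
  bag₁ : P₁.bag = Q.bag
  bag₂ : P₂.bag = Q.bag
  verts : Q.verts = P₁.verts ∪ P₂.verts
  inter : P₁.verts ∩ P₂.verts ⊆ Q.bag
  E : ∀ x y, Q.E x y ↔ P₁.E x y ∨ P₂.E x y

section

variable {P P₁ P₂ Q : Piece V} {a : V → V} {u v x y : V}

theorem IsIntro.conn (h : IsIntro v P Q) (a : V → V) : Q.Conn a = P.Conn a := by
  unfold Conn; rw [h.E]

theorem IsForget.conn (h : IsForget v P Q) (a : V → V) : Q.Conn a = P.Conn a := by
  unfold Conn; rw [h.E]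

theorem IsIntro.conn_left (h : IsIntro v P Q) : P.Conn a v x ↔ v = x :=
  ⟨fun h' => h'.eq_or_mem.resolve_right fun h'' => h.notMem h''.1, fun h => h ▸ .refl _ _ _⟩

theorem IsIntro.meets (h : IsIntro v P Q) (hx : x ∈ P.verts) : Q.Meets a x ↔ P.Meets a x := by
  simp only [Meets, h.conn, h.bag, Finset.mem_insert, exists_eq_or_imp, or_iff_right_iff_imp]
  intro h'
  rw [← h.conn_left.1 h'.symm] at hx
  exact absurd hx h.notMem

/-- The new vertex is isolated and lies on the boundary. If it is the center of an old vertex, it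
has to be its own center. If its center is a different, old vertex, the component of that center
must not be closed off, that is, it has to touch the bag. Both conditions are visible on the bag: a
vertex whose center lies outside `P`, and a center that reaches the boundary, are connected to a bag
vertex of the same color. -/
theorem IsIntro.valid_iff (h : IsIntro v P Q) :
    Q.Valid ok a ↔ P.Valid ok a ∧ ok v (a v) ∧
      (a v = v ∨ (¬ ∃ y ∈ P.bag, a y = v) ∧ (a v ∈ P.verts → ∃ y ∈ P.bag, a y = a v)) := by
  have hne : ∀ x ∈ P.verts, x ≠ v := fun x hx => by rintro rfl; exact h.notMem hx
  have hvQ : v ∈ Q.verts := by simp [h.verts]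
  have hPQ : ∀ x ∈ P.verts, x ∈ Q.verts := fun x hx => by simp [h.verts, hx]
  have hvm : Q.Meets a v := meets_of_mem _ (by simp [h.bag])
  constructor
  · intro hQ
    have hP : P.Valid ok a := by
      intro x hx
      obtain ⟨h1, h2⟩ := hQ x (hPQ x hx)
      refine ⟨h1, fun hax => ?_, fun hax => ?_⟩
      · have := h2.1 (hPQ _ hax)
        rwa [h.conn, h.meets hx, h.meets hax] at this
      · rw [← h.meets hx]
        by_cases hav : a x = v
        · rcases h2.1 (hav ▸ hvQ) with h3 | h3
          · exact hvm.of_conn (hav ▸ h3.symm)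
          · exact h3.1
        · exact h2.2 (by simp [h.verts, hav, hax])
    refine ⟨hP, (hQ v hvQ).1, ?_⟩
    by_cases hv : a v = v
    · exact .inl hv
    refine .inr ⟨?_, fun hav => ?_⟩
    · rintro ⟨y, hy, hyv⟩
      have := (hQ y (hPQ y (P.bag_sub hy))).2.fix (hyv ▸ hvQ)
      rw [hyv] at this
      exact hv this
    · have hg := (hQ v hvQ).2
      have hm := hg.meets (hPQ _ hav) hvm
      rw [h.meets hav] at hm
      obtain ⟨y, hy, hc⟩ := hm
      exact ⟨y, hy, by rw [← hc.color, hg.fix (hPQ _ hav)]⟩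
  · rintro ⟨hP, hok, hc⟩ x hx
    rw [h.verts, Finset.mem_insert] at hx
    rcases hx with rfl | hx
    · refine ⟨hok, fun hax => ?_, fun _ => hvm⟩
      by_cases hxx : a x = x
      · rw [hxx]; exact .inl (.refl _ _ _)
      have hax : a x ∈ P.verts := by simpa [h.verts, hxx] using hax
      obtain ⟨y, hy, hyc⟩ := (hc.resolve_left hxx).2 hax
      have hg := (hP y (P.bag_sub hy)).2
      refine .inr ⟨hvm, ?_, ?_⟩
      · rw [h.meets hax, ← hyc]
        exact hg.meets (hyc ▸ hax) (meets_of_mem _ hy)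
      · rw [← hyc]; exact hg.fix (hyc ▸ hax)
    · obtain ⟨h1, h2⟩ := hP x hx
      refine ⟨h1, fun hax => ?_, fun hax => ?_⟩
      · rw [h.verts, Finset.mem_insert] at hax
        rcases hax with hax | hax
        · have hm : P.Meets a x := h2.2 (hax ▸ h.notMem)
          rw [h.meets hx, hax]
          refine .inr ⟨hm, hvm, ?_⟩
          -- The center of `x` is `v`, so a bag vertex in its component has the center `v` too,
          -- which the test tolerates only if `v` is its own center.
          by_contra hvv
          obtain ⟨y, hy, hxy⟩ := hm
          exact (hc.resolve_left hvv).1 ⟨y, hy, by rw [← hxy.color, hax]⟩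
        · rw [h.conn, h.meets hx, h.meets hax]
          exact h2.1 hax
      · rw [h.meets hx]
        exact h2.2 fun h' => hax (hPQ _ h')

theorem IsForget.meets_of (h : IsForget v P Q) (hm : Q.Meets a x) : P.Meets a x := by
  obtain ⟨y, hy, hxy⟩ := hm
  rw [h.conn] at hxy
  rw [h.bag] at hy
  exact ⟨y, Finset.mem_of_mem_erase hy, hxy⟩

theorem IsForget.meets_or (h : IsForget v P Q) (hm : P.Meets a x) : Q.Meets a x ∨ P.Conn a x v := by
  obtain ⟨y, hy, hxy⟩ := hm
  by_cases hyv : y = v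
  · exact .inr (hyv ▸ hxy)
  · exact .inl ⟨y, by simp [h.bag, hy, hyv], by rwa [h.conn]⟩

/-- If the component of `v` no longer touches the bag, it is final and must contain its center. Then
no remaining bag vertex may have the same center, since it could never be connected to it.
Conversely, if no remaining bag vertex has the color of `v`, all components of this color that
reached the boundary did so at `v`, so they are one and the same. -/
theorem IsForget.valid_iff (h : IsForget v P Q) :
    Q.Valid ok a ↔ P.Valid ok a ∧
      ((∃ y ∈ Q.bag, P.Conn a v y) ∨ (¬ ∃ y ∈ Q.bag, a y = a v) ∧ a v ∈ P.verts) := by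
  have hvP : v ∈ P.verts := P.bag_sub h.mem
  constructor
  · intro hQ
    refine ⟨fun x hx => ?_, ?_⟩
    · obtain ⟨h1, h2⟩ := hQ x (by rwa [h.verts])
      refine ⟨h1, ?_, fun hax => h.meets_of (h2.2 (by rwa [h.verts]))⟩
      intro hax
      rcases h2.1 (by rwa [h.verts]) with h3 | h3
      · exact .inl (by rwa [← h.conn])
      · exact .inr ⟨h.meets_of h3.1, h.meets_of h3.2.1, h3.2.2⟩
    · by_cases hm : ∃ y ∈ Q.bag, P.Conn a v y
      · exact .inl hm
      have hm' : ¬ Q.Meets a v := by simpa only [Meets, h.conn] using hm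
      have hg := (hQ v (by rwa [h.verts])).2
      have hav : a v ∈ Q.verts := by
        by_contra hav
        exact hm' (hg.2 hav)
      have hcv : Q.Conn a v (a v) := (hg.1 hav).resolve_right fun h' => hm' h'.1
      refine .inr ⟨?_, by rwa [← h.verts]⟩
      rintro ⟨y, hy, hyv⟩
      have hgy := (hQ y (Q.bag_sub hy)).2
      have := hgy.meets (hyv ▸ hav) (meets_of_mem _ hy)
      rw [hyv] at this
      exact hm' (this.of_conn hcv.symm)
  · rintro ⟨hP, hc⟩ x hx
    rw [h.verts] at hx
    obtain ⟨h1, h2⟩ := hP x hx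
    refine ⟨h1, ?_⟩
    rcases hc with ⟨y, hy, hvy⟩ | ⟨hc, hav⟩
    -- Whoever reached the boundary at `v` now reaches it at `y`.
    · have hm : ∀ z, P.Meets a z → Q.Meets a z := by
        intro z hz
        rcases h.meets_or hz with h' | h'
        · exact h'
        · exact ⟨y, hy, by rw [h.conn]; exact h'.trans hvy⟩
      refine ⟨fun hax => ?_, fun hax => hm _ (h2.2 (by rwa [← h.verts]))⟩
      rw [h.conn]
      exact (h2.1 (by rwa [← h.verts])).imp id fun h' => ⟨hm _ h'.1, hm _ h'.2.1, h'.2.2⟩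
    -- A component with the color of `v` can touch the old bag only at `v`, no other bag vertex
    -- having that color.
    · have hkey : ∀ z ∈ P.verts, a z = a v → P.Meets a z → P.Conn a z v := by
        intro z hz hzv hm
        rcases h.meets_or hm with ⟨y, hy, hzy⟩ | h'
        · rw [h.conn] at hzy
          exact absurd ⟨y, hy, by rw [← hzy.color, hzv]⟩ hc
        · exact h'
      have hav' : a (a v) = a v := (hP v hvP).2.fix hav
      have hvav : P.Conn a v (a v) := by
        rcases (hP v hvP).2.1 hav with h3 | h3
        · exact h3
        · exact (hkey _ hav hav' h3.2.1).symm
      by_cases hxv : P.Conn a x v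
      · refine ⟨fun _ => .inl ?_, fun hax => absurd hav ?_⟩
        · rw [h.conn, hxv.color]; exact hxv.trans hvav
        · rw [← hxv.color, ← h.verts]; exact hax
      · have hm : P.Meets a x → Q.Meets a x := fun hm => (h.meets_or hm).resolve_right hxv
        refine ⟨fun hax => ?_, fun hax => hm (h2.2 (by rwa [← h.verts]))⟩
        rw [h.verts] at hax
        rw [h.conn]
        rcases h2.1 hax with h3 | h3
        · exact .inl h3
        refine .inr ⟨hm h3.1, (h.meets_or h3.2.1).resolve_right fun h4 => hxv ?_, h3.2.2⟩
        exact hkey x hx (by rw [← h3.2.2, h4.color]) h3.1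

theorem IsJoin.symm (h : IsJoin P₁ P₂ Q) : IsJoin P₂ P₁ Q :=
  ⟨h.bag₂, h.bag₁, by rw [h.verts, Finset.union_comm], by rw [Finset.inter_comm]; exact h.inter,
    fun x y => by rw [h.E, or_comm]⟩

theorem IsJoin.conn_left (h : IsJoin P₁ P₂ Q) (hc : P₁.Conn a x y) : Q.Conn a x y :=
  hc.of_le fun u v h' => (h.E u v).2 (.inl h')

/-- A path of `Q` leaves `P₁` only through the common bag. If the component of `x` in `P₁` avoids
the bag, it is closed under all monochromatic edges of `Q`. -/
theorem IsJoin.conn_or (h : IsJoin P₁ P₂ Q) (hx : x ∈ P₁.verts) (hc : Q.Conn a x y) :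
    P₁.Conn a x y ∨ P₁.Meets a x := by
  by_cases hm : P₁.Meets a x
  · exact .inr hm
  refine .inl ((hc.iff_of_closed (C := P₁.Conn a x) ?_).1 (.refl _ _ _))
  have key : ∀ z, z ∈ P₂.verts → ¬ P₁.Conn a x z := fun z hz hxz =>
    hm ⟨z, by rw [h.bag₁]; exact h.inter (Finset.mem_inter.2 ⟨hxz.mem hx, hz⟩), hxz⟩
  intro u v hE huv
  rcases (h.E u v).1 hE with hE | hE
  · have : P₁.Conn a u v := .rel _ _ ⟨hE, huv⟩
    exact ⟨fun h => h.trans this, fun h => h.trans this.symm⟩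
  · have := P₂.E_sub u v hE
    exact iff_of_false (key u this.1) (key v this.2)

theorem IsJoin.meets_left (h : IsJoin P₁ P₂ Q) (hm : P₁.Meets a x) : Q.Meets a x := by
  obtain ⟨y, hy, hxy⟩ := hm
  exact ⟨y, h.bag₁ ▸ hy, h.conn_left hxy⟩

theorem IsJoin.meets_iff (h : IsJoin P₁ P₂ Q) (hx : x ∈ P₁.verts) :
    Q.Meets a x ↔ P₁.Meets a x := by
  refine ⟨?_, h.meets_left⟩
  rintro ⟨y, hy, hxy⟩
  rcases h.conn_or hx hxy with h' | h'
  · exact ⟨y, h.bag₁ ▸ hy, h'⟩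
  · exact h'

theorem IsJoin.mem_bag (h : IsJoin P₁ P₂ Q) (h1 : x ∈ P₁.verts) (h2 : x ∈ P₂.verts) : x ∈ Q.bag :=
  h.inter (Finset.mem_inter.2 ⟨h1, h2⟩)

theorem IsJoin.valid_left (h : IsJoin P₁ P₂ Q) (hQ : Q.Valid ok a) : P₁.Valid ok a := by
  intro x hx
  obtain ⟨h1, h2⟩ := hQ x (by simp [h.verts, hx])
  refine ⟨h1, fun hax => ?_, fun hax => ?_⟩
  · have haxQ : a x ∈ Q.verts := by simp [h.verts, hax]
    by_cases hc : P₁.Conn a x (a x)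
    · exact .inl hc
    refine .inr ?_
    rcases h2.1 haxQ with h3 | h3
    · exact ⟨(h.conn_or hx h3).resolve_left hc,
        (h.conn_or hax h3.symm).resolve_left fun h' => hc h'.symm, h3.color.symm⟩
    · exact ⟨(h.meets_iff hx).1 h3.1, (h.meets_iff hax).1 h3.2.1, h3.2.2⟩
  · by_cases haxQ : a x ∈ Q.verts
    · rcases h2.1 haxQ with h3 | h3
      · exact (h.conn_or hx h3).resolve_left fun h' => hax (h'.mem hx)
      · exact (h.meets_iff hx).1 h3.1
    · exact (h.meets_iff hx).1 (h2.2 haxQ)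

theorem IsJoin.good_left (h : IsJoin P₁ P₂ Q) (h1 : P₁.Valid ok a) (h2 : P₂.Valid ok a)
    (hx : x ∈ P₁.verts) : Q.Good a x := by
  have hg := (h1 x hx).2
  refine ⟨fun hax => ?_, fun hax => h.meets_left (hg.2 fun h' => hax (by simp [h.verts, h']))⟩
  by_cases hax1 : a x ∈ P₁.verts
  · rcases hg.1 hax1 with h3 | h3
    · exact .inl (h.conn_left h3)
    · exact .inr ⟨h.meets_left h3.1, h.meets_left h3.2.1, h3.2.2⟩
  · have hax2 : a x ∈ P₂.verts := by
      rw [h.verts, Finset.mem_union] at hax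
      exact hax.resolve_left hax1
    have hm := hg.2 hax1
    obtain ⟨y, hy, hxy⟩ := hm
    have hy2 : y ∈ P₂.bag := by rwa [h.bag₂, ← h.bag₁]
    have hgy := (h2 y (P₂.bag_sub hy2)).2
    rw [hxy.color] at hax2 ⊢
    exact .inr ⟨h.meets_left (hg.2 hax1),
      h.symm.meets_left (hgy.meets hax2 (meets_of_mem _ hy2)), hgy.fix hax2⟩

/-- `Good` is content with contact to the boundary, and gluing preserves the boundary. A path of `Q`
either stays in its piece or gives contact with the bag. Conversely, a center that lies only in `P₂`
touches the bag there, because the component of `x` contains a bag vertex with the same center, and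
this vertex is `Good` in `P₂`. -/
theorem IsJoin.valid_iff (h : IsJoin P₁ P₂ Q) :
    Q.Valid ok a ↔ P₁.Valid ok a ∧ P₂.Valid ok a := by
  refine ⟨fun hQ => ⟨h.valid_left hQ, h.symm.valid_left hQ⟩, fun ⟨h1, h2⟩ x hx => ?_⟩
  rw [h.verts, Finset.mem_union] at hx
  rcases hx with hx | hx
  · exact ⟨(h1 x hx).1, h.good_left h1 h2 hx⟩
  · exact ⟨(h2 x hx).1, h.symm.good_left h2 h1 hx⟩

/-- Every vertex carries the set of labels of the bag vertices to which it is connected within one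
of the two pieces. An edge of either piece does not change this set, and for a bag vertex it
consists of its own label only. This is how components of `Q` are compared with the partitions
generated by the two pieces. -/
theorem IsJoin.label_eq {α : Type*} (h : IsJoin P₁ P₂ Q) {R : V → α}
    (hR : ∀ x ∈ Q.bag, ∀ y ∈ Q.bag, P₁.Conn a x y ∨ P₂.Conn a x y → R x = R y)
    (hx : x ∈ Q.bag) (hy : y ∈ Q.bag) (hc : Q.Conn a x y) : R x = R y := by
  let S : V → Set α := fun x => {l | ∃ z ∈ Q.bag, R z = l ∧ (P₁.Conn a x z ∨ P₂.Conn a x z)}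
  have main : ∀ {P₁ P₂ : Piece V}, IsJoin P₁ P₂ Q →
      (∀ x ∈ Q.bag, ∀ y ∈ Q.bag, P₁.Conn a x y ∨ P₂.Conn a x y → R x = R y) →
      ∀ u v, P₁.Conn a u v → u ∈ P₁.verts → ∀ l,
      (∃ z ∈ Q.bag, R z = l ∧ (P₁.Conn a u z ∨ P₂.Conn a u z)) →
      ∃ z ∈ Q.bag, R z = l ∧ (P₁.Conn a v z ∨ P₂.Conn a v z) := by
    rintro P₁ P₂ h hR u v huv hu l ⟨z, hz, rfl, hc⟩
    rcases hc with hc | hc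
    · exact ⟨z, hz, rfl, .inl (huv.symm.trans hc)⟩
    -- The vertex `u` of `P₁` sees `z` through `P₂`, so it lies in the bag and has the same label as
    -- `z`.
    · have huB : u ∈ Q.bag := by
        rcases hc.eq_or_mem with rfl | h'
        · exact hz
        · exact h.mem_bag hu h'.1
      exact ⟨u, huB, hR u huB z hz (.inr hc), .inl huv.symm⟩
  have hS : ∀ u v, Q.E u v → a u = a v → S u = S v := by
    intro u v hE huv
    rcases (h.E u v).1 hE with hE | hE
    · have hc : P₁.Conn a u v := .rel _ _ ⟨hE, huv⟩
      have hm := P₁.E_sub u v hE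
      ext l
      exact ⟨main h hR u v hc hm.1 l, main h hR v u hc.symm hm.2 l⟩
    · have hc : P₂.Conn a u v := .rel _ _ ⟨hE, huv⟩
      have hm := P₂.E_sub u v hE
      ext l
      have hR' : ∀ x ∈ Q.bag, ∀ y ∈ Q.bag, P₂.Conn a x y ∨ P₁.Conn a x y → R x = R y :=
        fun x hx y hy h => hR x hx y hy h.symm
      have m1 := main h.symm hR' u v hc hm.1 l
      have m2 := main h.symm hR' v u hc.symm hm.2 l
      simp only [S, Set.mem_ofPred_eq, or_comm (a := P₁.Conn _ _ _)]
      exact ⟨m1, m2⟩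
  have hxy : S x = S y :=
    ((hc.iff_of_closed (C := fun z => S x = S z) fun u v h1 h2 => by rw [hS u v h1 h2]).1 rfl)
  have : R x ∈ S y := hxy ▸ ⟨x, hx, rfl, .inl (.refl _ _ _)⟩
  obtain ⟨z, hz, hzx, hc'⟩ := this
  rw [← hzx]
  exact (hR y hy z hz hc').symm

/-- The piece that consists of the bag of `P` and the single edge `{u, v}`. -/
def edgePiece (P : Piece V) (u v : V) (hu : u ∈ P.bag) (hv : v ∈ P.bag) : Piece V where
  bag := P.bag
  verts := P.bag
  E x y := x = u ∧ y = v
  bag_sub := subset_rfl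
  E_sub := by rintro _ _ ⟨rfl, rfl⟩; exact ⟨hu, hv⟩

/-- An edge between bag vertices is glued on as a piece of its own, so that the lemmas on joins
cover edges as well. -/
theorem IsEdge.isJoin (h : IsEdge u v P Q) : IsJoin P (P.edgePiece u v h.left h.right) Q where
  bag₁ := h.bag.symm
  bag₂ := h.bag.symm
  verts := by rw [h.verts]; exact (Finset.union_eq_left.2 P.bag_sub).symm
  inter := by rw [h.bag]; exact Finset.inter_subset_right
  E := h.E

theorem edgePiece_conn (hu : u ∈ P.bag) (hv : v ∈ P.bag) :
    (P.edgePiece u v hu hv).Conn a x y ↔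
      x = y ∨ a u = a v ∧ (x = u ∧ y = v ∨ x = v ∧ y = u) := by
  constructor
  · intro h
    by_cases huv : a u = a v
    · have := h.iff_of_closed (C := fun z => z = u ∨ z = v) (by rintro _ _ ⟨rfl, rfl⟩; simp)
      have h3 := h.iff_of_closed (C := fun z => z = x ∨ z = u ∨ z = v)
        (by rintro _ _ ⟨rfl, rfl⟩; simp)
      simp only [true_or, true_iff] at h3
      grind
    · exact .inl ((h.iff_of_closed (C := fun z => x = z)
        (by rintro _ _ ⟨rfl, rfl⟩ h'; exact absurd h' huv)).1 rfl)
  · have huv : a u = a v → (P.edgePiece u v hu hv).Conn a u v := fun h => .rel _ _ ⟨⟨rfl, rfl⟩, h⟩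
    rintro (rfl | ⟨h, ⟨rfl, rfl⟩ | ⟨rfl, rfl⟩⟩)
    · exact .refl _ _ _
    · exact huv h
    · exact (huv h).symm

/-- Every vertex of the glued piece is on its boundary. So the only demand there is `a (a x) = a x`,
which `P` already guarantees. -/
theorem IsEdge.valid_iff (h : IsEdge u v P Q) : Q.Valid ok a ↔ P.Valid ok a := by
  rw [h.isJoin.valid_iff, and_iff_left_iff_imp]
  intro hP x hx
  obtain ⟨h1, h2⟩ := hP x (P.bag_sub hx)
  refine ⟨h1, fun hax => .inr ⟨meets_of_mem _ hx, meets_of_mem _ hax, h2.fix (P.bag_sub hax)⟩,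
    fun _ => meets_of_mem _ hx⟩

end

/-! ## States -/

/-- `R` labels the classes of the connectedness relation on the bag. -/
def Labels (P : Piece V) (a : V → V) (R : V → ℕ) : Prop :=
  ∀ x ∈ P.bag, ∀ y ∈ P.bag, R x = R y ↔ P.Conn a x y

/-- Replace the label of `y` by the label of `x`. -/
def mergeLabel (R : V → ℕ) (x y : V) : V → ℕ := fun z => if R z = R y then R x else R z

variable {P P₁ P₂ Q : Piece V} {a : V → V} {u v x y : V} {R R₂ : V → ℕ}

theorem IsIntro.labels (h : IsIntro v P Q) (hR : P.Labels a R) (hv : ∀ x ∈ P.bag, R x ≠ R v) :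
    Q.Labels a R := by
  intro x hx y hy
  rw [h.conn]
  rw [h.bag, Finset.mem_insert] at hx hy
  rcases hx with rfl | hx
  · rw [h.conn_left]
    rcases hy with rfl | hy
    · simp
    · exact iff_of_false (fun h' => hv y hy h'.symm) (by rintro rfl; exact hv x hy rfl)
  · rcases hy with rfl | hy
    · exact iff_of_false (hv x hx)
        fun h' => hv x hx (by rw [h.conn_left.1 h'.symm])
    · exact hR x hx y hy

theorem IsForget.labels (h : IsForget v P Q) (hR : P.Labels a R) : Q.Labels a R := by
  intro x hx y hy
  rw [h.bag] at hx hy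
  rw [h.conn]
  exact hR x (Finset.mem_of_mem_erase hx) y (Finset.mem_of_mem_erase hy)

theorem IsEdge.labels_of_ne (h : IsEdge u v P Q) (hR : P.Labels a R) (huv : a u ≠ a v) :
    Q.Labels a R := by
  intro x hx y hy
  refine ⟨fun h' => h.isJoin.conn_left ((hR x (h.bag ▸ hx) y (h.bag ▸ hy)).1 h'), fun hc => ?_⟩
  refine h.isJoin.label_eq (fun x hx y hy hc => ?_) hx hy hc
  rw [edgePiece_conn] at hc
  rcases hc with hc | rfl | hc
  · exact (hR x (h.bag ▸ hx) y (h.bag ▸ hy)).2 hc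
  · rfl
  · exact absurd hc.1 huv

theorem IsEdge.labels_of_eq (h : IsEdge u v P Q) (hR : P.Labels a R) (huv : a u = a v) :
    Q.Labels a (mergeLabel R u v) := by
  have hconn : Q.Conn a u v := h.isJoin.symm.conn_left ((edgePiece_conn _ _).2 (by simp [huv]))
  intro x hx y hy
  constructor
  · have h1 : ∀ x ∈ Q.bag, ∀ y ∈ Q.bag, R x = R y → Q.Conn a x y := fun x hx y hy h' =>
      h.isJoin.conn_left ((hR x (h.bag ▸ hx) y (h.bag ▸ hy)).1 h')
    have hu := h.left
    have hv := h.right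
    rw [← h.bag] at hu hv
    unfold mergeLabel
    split_ifs with hx' hy' hy'
    · intro _
      exact h1 x hx y hy (hx'.trans hy'.symm)
    · intro h'
      exact (h1 x hx v hv hx').trans (hconn.symm.trans (h1 u hu y hy h'))
    · intro h'
      exact (h1 x hx u hu h').trans (hconn.trans (h1 v hv y hy hy'.symm))
    · exact h1 x hx y hy
  · intro hc
    refine h.isJoin.label_eq (fun x hx y hy hc => ?_) hx hy hc
    rw [edgePiece_conn] at hc
    unfold mergeLabel
    rcases hc with hc | rfl | ⟨_, ⟨rfl, rfl⟩ | ⟨rfl, rfl⟩⟩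
    · rw [(hR x (h.bag ▸ hx) y (h.bag ▸ hy)).2 hc]
    · rfl
    · simp
    · simp

end Piece

end ConnectedKCenter

namespace ConnectedKCenter

/-! ## Tables of partial solutions -/

/-- A state of the dynamic program: the centers of the vertices in the bag, and a label for the
component of each of them. -/
abbrev Key (n : ℕ) : Type := (Fin n → ℕ) × (Fin n → ℕ)

variable {n : ℕ}

open Classical in
/-- The labels `R` on the bag `B` in canonical form: the label of a class is its least element. -/
noncomputable def canon (B : Finset (Fin n)) (R : Fin n → ℕ) : Fin n → ℕ := fun v =>
  if v ∈ B then sInf {u : ℕ | ∃ w ∈ B, (w : ℕ) = u ∧ R w = R v} else 0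

/-- The state with centers `F` and component labels `R`, in canonical form. -/
noncomputable def mkKey (B : Finset (Fin n)) (F R : Fin n → ℕ) : Key n :=
  (fun v => if v ∈ B then F v else 0, canon B R)

section canon

variable {B : Finset (Fin n)} {R R' F F' : Fin n → ℕ} {v x y : Fin n}

theorem canon_spec (R : Fin n → ℕ) (hv : v ∈ B) : ∃ w ∈ B, (w : ℕ) = canon B R v ∧ R w = R v := by
  have : sInf {u : ℕ | ∃ w ∈ B, (w : ℕ) = u ∧ R w = R v} ∈
      {u : ℕ | ∃ w ∈ B, (w : ℕ) = u ∧ R w = R v} := Nat.sInf_mem ⟨v, v, hv, rfl, rfl⟩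
  simpa [canon, hv] using this

theorem canon_le (hv : v ∈ B) (hx : x ∈ B) (h : R x = R v) : canon B R v ≤ x := by
  simp only [canon, hv, if_true]
  exact Nat.sInf_le ⟨x, hx, rfl, h⟩

theorem canon_eq_iff (hx : x ∈ B) (hy : y ∈ B) : canon B R x = canon B R y ↔ R x = R y := by
  constructor
  · intro h
    obtain ⟨w, _, hw, hwx⟩ := canon_spec R hx
    obtain ⟨w', _, hw', hwy⟩ := canon_spec R hy
    have : w = w' := Fin.ext (by rw [hw, hw', h])
    rw [← hwx, ← hwy, this]
  · intro h
    simp only [canon, hx, hy, if_true, h]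

/-- The purpose of canonical labels: they depend on the partition of the bag alone, so equal states
have equal keys. -/
theorem canon_congr (h : ∀ x ∈ B, ∀ y ∈ B, R x = R y ↔ R' x = R' y) : canon B R = canon B R' := by
  funext v
  by_cases hv : v ∈ B
  · simp only [canon, hv, if_true]
    congr 1
    ext u
    constructor <;> rintro ⟨w, hw, hwu, hwv⟩
    · exact ⟨w, hw, hwu, (h w hw v hv).1 hwv⟩
    · exact ⟨w, hw, hwu, (h w hw v hv).2 hwv⟩
  · simp [canon, hv]

theorem canon_lt (R : Fin n → ℕ) (hv : v ∈ B) : canon B R v < n := by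
  obtain ⟨w, -, hw, -⟩ := canon_spec R hv
  exact hw ▸ w.2

theorem canon_of_notMem (hv : v ∉ B) : canon B R v = 0 := by simp [canon, hv]

theorem mkKey_congr (hF : ∀ x ∈ B, F x = F' x)
    (h : ∀ x ∈ B, ∀ y ∈ B, R x = R y ↔ R' x = R' y) : mkKey B F R = mkKey B F' R' := by
  unfold mkKey
  rw [canon_congr h]
  congr 1
  funext v
  by_cases hv : v ∈ B
  · simp [hv, hF v hv]
  · simp [hv]

theorem mkKey_fst (hv : v ∈ B) : (mkKey B F R).1 v = F v := by simp [mkKey, hv]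

theorem mkKey_snd_eq_iff (hx : x ∈ B) (hy : y ∈ B) :
    (mkKey B F R).2 x = (mkKey B F R).2 y ↔ R x = R y := canon_eq_iff hx hy

end canon

/-- Each class is labelled by its least element. -/
theorem exists_label {C : Fin n → Fin n → Prop} (hC : Equivalence C) :
    ∃ R : Fin n → ℕ, ∀ x y, R x = R y ↔ C x y := by
  refine ⟨fun x => sInf {u : ℕ | ∃ w : Fin n, (w : ℕ) = u ∧ C w x}, fun x y => ?_⟩
  have hmem : ∀ x, sInf {u : ℕ | ∃ w : Fin n, (w : ℕ) = u ∧ C w x} ∈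
      {u : ℕ | ∃ w : Fin n, (w : ℕ) = u ∧ C w x} := fun x => Nat.sInf_mem ⟨x, x, rfl, hC.refl x⟩
  constructor
  · intro h
    obtain ⟨w, hw, hwx⟩ := hmem x
    obtain ⟨w', hw', hwy⟩ := hmem y
    have : w = w' := Fin.ext (by rw [hw, hw']; exact h)
    subst this
    exact hC.trans (hC.symm hwx) hwy
  · intro h
    simp only
    congr 1
    ext u
    constructor <;> rintro ⟨w, hw, hwx⟩
    · exact ⟨w, hw, hC.trans hwx h⟩
    · exact ⟨w, hw, hC.trans hwx (hC.symm h)⟩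

namespace Piece

variable {ok : Fin n → Fin n → Prop} {P P₁ P₂ Q : Piece (Fin n)} {a : Fin n → Fin n}
  {κ κ' κ₁ κ₂ : Key n} {R : Fin n → ℕ} {u v c : Fin n} {𝒯 𝒯' 𝒯₁ 𝒯₂ : Set (Key n × ℕ)}

/-- `κ` is the state of the partial solution `a`. -/
structure IsKey (P : Piece (Fin n)) (a : Fin n → Fin n) (κ : Key n) : Prop where
  color : ∀ v ∈ P.bag, κ.1 v = a v
  labels : P.Labels a κ.2
  eq : mkKey P.bag κ.1 κ.2 = κ

theorem isKey_mkKey {F : Fin n → ℕ} (hF : ∀ v ∈ P.bag, F v = a v) (hR : P.Labels a R) :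
    P.IsKey a (mkKey P.bag F R) where
  color v hv := by rw [mkKey_fst hv, hF v hv]
  labels x hx y hy := by rw [mkKey_snd_eq_iff hx hy, hR x hx y hy]
  eq := mkKey_congr (fun x hx => mkKey_fst hx) fun x hx y hy => mkKey_snd_eq_iff hx hy

theorem IsKey.unique (h : P.IsKey a κ) (h' : P.IsKey a κ') : κ = κ' := by
  rw [← h.eq, ← h'.eq]
  exact mkKey_congr (fun x hx => by rw [h.color x hx, h'.color x hx])
    fun x hx y hy => by rw [h.labels x hx y hy, h'.labels x hx y hy]

theorem exists_labels (P : Piece (Fin n)) (a : Fin n → Fin n) : ∃ R, P.Labels a R :=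
  let ⟨R, hR⟩ := exists_label ⟨fun x => Conn.refl P a x, Conn.symm, Conn.trans⟩
  ⟨R, fun x _ y _ => hR x y⟩

theorem exists_isKey (P : Piece (Fin n)) (a : Fin n → Fin n) : ∃ κ, P.IsKey a κ :=
  let ⟨_, hR⟩ := P.exists_labels a
  ⟨_, isKey_mkKey (F := fun v => a v) (fun _ _ => rfl) hR⟩

theorem IsKey.congr {a' : Fin n → Fin n} (h : P.IsKey a κ) (ha : ∀ x ∈ P.verts, a x = a' x) :
    P.IsKey a' κ where
  color v hv := by rw [h.color v hv, ha v (P.bag_sub hv)]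
  labels x hx y hy := by rw [← conn_congr ha]; exact h.labels x hx y hy
  eq := h.eq

/-- The summand of a vertex in the value of a partial solution. -/
def weight (v c : ℕ) : ℕ := c * n ^ v + if c = v then n ^ n else 0

/-- The value of a partial solution: the number of forgotten centers, and behind it the encoding
in base `n` of the assignment of the forgotten vertices. -/
def val (P : Piece (Fin n)) (a : Fin n → Fin n) : ℕ :=
  ∑ v ∈ P.verts \ P.bag, weight (n := n) v (a v)

theorem val_congr {a' : Fin n → Fin n} (ha : ∀ x ∈ P.verts, a x = a' x) : P.val a = P.val a' :=
  Finset.sum_congr rfl fun v hv => by rw [ha v (Finset.mem_sdiff.1 hv).1]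

/-- The table contains, for each state of a partial solution, the smallest value. -/
structure TableOK (ok : Fin n → Fin n → Prop) (P : Piece (Fin n)) (𝒯 : Set (Key n × ℕ)) :
    Prop where
  sound : ∀ κ x, (κ, x) ∈ 𝒯 → ∃ a, P.Valid ok a ∧ P.IsKey a κ ∧ P.val a = x
  complete : ∀ a κ, P.Valid ok a → P.IsKey a κ → ∃ x ≤ P.val a, (κ, x) ∈ 𝒯

end Piece

/-- The table `𝒯` contains the best entries of `S`. -/
structure Dominates (𝒯 S : Set (Key n × ℕ)) : Prop where
  sub : 𝒯 ⊆ S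
  le : ∀ κ x, (κ, x) ∈ S → ∃ x' ≤ x, (κ, x') ∈ 𝒯

/-! ### How the tables change from the children to their parent. -/

namespace Piece

variable {ok : Fin n → Fin n → Prop} {P P₁ P₂ Q : Piece (Fin n)} {a : Fin n → Fin n}
  {κ κ' κ₁ κ₂ : Key n} {R : Fin n → ℕ} {u v c : Fin n} {𝒯 𝒯' 𝒯₁ 𝒯₂ : Set (Key n × ℕ)}

theorem TableOK.of_dominates (h : P.TableOK ok 𝒯) (hd : Dominates 𝒯' 𝒯) : P.TableOK ok 𝒯' where
  sound κ x hx := h.sound κ x (hd.sub hx)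
  complete a κ ha hκ :=
    let ⟨x, hx, hm⟩ := h.complete a κ ha hκ
    let ⟨x', hx', hm'⟩ := hd.le κ x hm
    ⟨x', hx'.trans hx, hm'⟩

theorem tableOK_leaf (hb : P.bag = ∅) (hv : P.verts = ∅) (F R : Fin n → ℕ) :
    P.TableOK ok {(mkKey P.bag F R, 0)} where
  sound κ x h := by
    obtain ⟨rfl, rfl⟩ := Prod.mk_inj.1 h
    by_cases hn : Nonempty (Fin n → Fin n)
    · obtain ⟨a⟩ := hn
      exact ⟨a, by simp [Valid, hv], isKey_mkKey (by simp [hb]) (by simp [Labels, hb]),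
        by simp [val, hv]⟩
    · exact absurd ⟨id⟩ hn
  complete a κ _ hκ := by
    refine ⟨0, Nat.zero_le _, ?_⟩
    rw [← hκ.unique (isKey_mkKey (F := F) (R := R) (by simp [hb]) (by simp [Labels, hb]))]
    rfl

/-- The test whether `v` can get the center `c`. -/
def IntroTest (P : Piece (Fin n)) (v : Fin n) (κ : Key n) (c : Fin n) : Prop :=
  c = v ∨ (¬ ∃ y ∈ P.bag, κ.1 y = v) ∧ (c ∈ P.verts → ∃ y ∈ P.bag, κ.1 y = c)

/-- Canonical labels are themselves bag vertices, so a vertex outside the bag is a fresh label. -/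
theorem IsKey.snd_ne (h : P.IsKey a κ) (hv : v ∉ P.bag) {x : Fin n} (hx : x ∈ P.bag) :
    κ.2 x ≠ v := by
  intro hxv
  obtain ⟨w, hw, hw', -⟩ := canon_spec κ.2 hx
  rw [← h.eq] at hxv
  exact hv (Fin.ext (hw'.trans hxv) ▸ hw)

/-- The pattern of all `table` lemmas: the new key and the validity test depend on the old key only,
and the value changes by an amount that the key determines (at joins values are added). So an
assignment may be replaced by a cheaper one with the same key, and one entry of least value per key
suffices. -/
theorem IsIntro.table (h : IsIntro v P Q) (hT : P.TableOK ok 𝒯) :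
    Q.TableOK ok {e | ∃ κ x c, (κ, x) ∈ 𝒯 ∧ ok v c ∧ P.IntroTest v κ c ∧
      e = (mkKey Q.bag (Function.update κ.1 v c) (Function.update κ.2 v v), x)} := by
  have hne : ∀ x ∈ P.verts, x ≠ v := fun x hx => by rintro rfl; exact h.notMem hx
  have hvB : v ∉ P.bag := fun h' => h.notMem (P.bag_sub h')
  have hval : ∀ a, Q.val a = P.val a := by
    intro a
    unfold val
    congr 1
    rw [h.verts, h.bag]
    ext y
    simp only [Finset.mem_sdiff, Finset.mem_insert]
    have := hne y
    tauto
  have htest : ∀ a κ, P.IsKey a κ → (P.IntroTest v κ (a v) ↔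
      (a v = v ∨ (¬ ∃ y ∈ P.bag, a y = v) ∧ (a v ∈ P.verts → ∃ y ∈ P.bag, a y = a v))) := by
    intro a κ hκ
    have : ∀ w : Fin n, (∃ y ∈ P.bag, κ.1 y = w) ↔ ∃ y ∈ P.bag, a y = w := fun w =>
      exists_congr fun y => and_congr_right fun hy => by rw [hκ.color y hy, Fin.val_inj]
    simp only [IntroTest, this]
  have hkey : ∀ a κ, P.IsKey a κ → Q.IsKey a
      (mkKey Q.bag (Function.update κ.1 v (a v)) (Function.update κ.2 v v)) := by
    intro a κ hκ
    refine isKey_mkKey (fun y hy => ?_) (h.labels (fun x hx y hy => ?_) fun x hx => ?_)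
    · rw [h.bag, Finset.mem_insert] at hy
      rcases hy with rfl | hy
      · simp
      · rw [Function.update_of_ne (hne y (P.bag_sub hy)), hκ.color y hy]
    · rw [Function.update_of_ne (hne y (P.bag_sub hy)), Function.update_of_ne
        (hne x (P.bag_sub hx)), hκ.labels x hx y hy]
    · rw [Function.update_of_ne (hne x (P.bag_sub hx)), Function.update_self]
      exact hκ.snd_ne hvB hx
  constructor
  · rintro κ' x' ⟨κ, x, c, hκx, hok, ht, he⟩
    obtain ⟨rfl, rfl⟩ := Prod.mk_inj.1 he
    obtain ⟨a, ha, hκ, rfl⟩ := hT.sound κ x' hκx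
    -- The vertex `v` does not belong to `P`, so `a` may be redefined there.
    have haa : ∀ y ∈ P.verts, a y = Function.update a v c y := fun y hy => by
      rw [Function.update_of_ne (hne y hy)]
    have hκ' := hκ.congr haa
    have hk := hkey _ _ hκ'
    have htt := htest _ _ hκ'
    rw [Function.update_self] at hk htt
    refine ⟨Function.update a v c, h.valid_iff.2 ⟨(valid_congr haa).1 ha, ?_⟩, hk, ?_⟩
    · rw [Function.update_self]
      exact ⟨hok, htt.1 ht⟩
    · rw [hval, val_congr haa]
  · intro a κ' ha hκ'
    obtain ⟨ha', hok, ht⟩ := h.valid_iff.1 ha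
    obtain ⟨κ, hκ⟩ := P.exists_isKey a
    obtain ⟨x, hx, hm⟩ := hT.complete a κ ha' hκ
    exact ⟨x, by rwa [hval], κ, x, a v, hm, hok, (htest a κ hκ).2 ht,
      by rw [hκ'.unique (hkey a κ hκ)]⟩

/-- The state after the introduction of the edge `{u, v}`. -/
def edgeLabel (u v : Fin n) (κ : Key n) : Fin n → ℕ :=
  if κ.1 u = κ.1 v then mergeLabel κ.2 u v else κ.2

theorem IsEdge.table (h : IsEdge u v P Q) (hT : P.TableOK ok 𝒯) :
    Q.TableOK ok {e | ∃ κ x, (κ, x) ∈ 𝒯 ∧ e = (mkKey Q.bag κ.1 (edgeLabel u v κ), x)} := by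
  have hval : ∀ a, Q.val a = P.val a := fun a => by unfold val; rw [h.verts, h.bag]
  have hkey : ∀ a κ, P.IsKey a κ → Q.IsKey a (mkKey Q.bag κ.1 (edgeLabel u v κ)) := by
    intro a κ hκ
    refine isKey_mkKey (fun y hy => hκ.color y (h.bag ▸ hy)) ?_
    have := hκ.color u h.left
    have := hκ.color v h.right
    by_cases huv : a u = a v
    · have : κ.1 u = κ.1 v := by simp [*]
      rw [edgeLabel, if_pos this]
      exact h.labels_of_eq hκ.labels huv
    · have : κ.1 u ≠ κ.1 v := by simp [*, Fin.val_inj]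
      rw [edgeLabel, if_neg this]
      exact h.labels_of_ne hκ.labels huv
  constructor
  · rintro κ' x' ⟨κ, x, hκx, he⟩
    obtain ⟨rfl, rfl⟩ := Prod.mk_inj.1 he
    obtain ⟨a, ha, hκ, rfl⟩ := hT.sound κ x' hκx
    exact ⟨a, h.valid_iff.2 ha, hkey a κ hκ, hval a⟩
  · intro a κ' ha hκ'
    obtain ⟨κ, hκ⟩ := P.exists_isKey a
    obtain ⟨x, hx, hm⟩ := hT.complete a κ (h.valid_iff.1 ha) hκ
    exact ⟨x, by rwa [hval], κ, x, hm, by rw [hκ'.unique (hkey a κ hκ)]⟩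

/-- The test whether `v` can be forgotten. -/
def ForgetTest (P Q : Piece (Fin n)) (v : Fin n) (κ : Key n) : Prop :=
  (∃ y ∈ Q.bag, κ.2 y = κ.2 v) ∨
    (¬ ∃ y ∈ Q.bag, κ.1 y = κ.1 v) ∧ ∃ w ∈ P.verts, (w : ℕ) = κ.1 v

/-- Only here does the value grow. The summand of `v` depends on its center, which the key records
as long as `v` is in the bag. -/
theorem IsForget.table (h : IsForget v P Q) (hT : P.TableOK ok 𝒯) :
    Q.TableOK ok {e | ∃ κ x, (κ, x) ∈ 𝒯 ∧ P.ForgetTest Q v κ ∧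
      e = (mkKey Q.bag κ.1 κ.2, x + weight (n := n) v (κ.1 v))} := by
  have hval : ∀ a, Q.val a = P.val a + weight (n := n) v (a v) := by
    intro a
    unfold val
    have : Q.verts \ Q.bag = insert v (P.verts \ P.bag) := by
      rw [h.verts, h.bag]
      ext y
      have := P.bag_sub h.mem
      by_cases hy : y = v
      · subst hy; simp [this]
      · simp [hy]
    rw [this, Finset.sum_insert (by simp [h.mem]), add_comm]
  have hbag : ∀ y ∈ Q.bag, y ∈ P.bag := fun y hy => by
    rw [h.bag] at hy; exact Finset.mem_of_mem_erase hy
  have htest : ∀ a κ, P.IsKey a κ → (P.ForgetTest Q v κ ↔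
      ((∃ y ∈ Q.bag, P.Conn a v y) ∨ (¬ ∃ y ∈ Q.bag, a y = a v) ∧ a v ∈ P.verts)) := by
    intro a κ hκ
    unfold ForgetTest
    refine or_congr (exists_congr fun y => and_congr_right fun hy => ?_)
      (and_congr (not_congr (exists_congr fun y => and_congr_right fun hy => ?_)) ?_)
    · rw [eq_comm, hκ.labels v h.mem y (hbag y hy)]
    · rw [hκ.color y (hbag y hy), hκ.color v h.mem, Fin.val_inj]
    · simp [hκ.color v h.mem, Fin.val_inj]
  have hkey : ∀ a κ, P.IsKey a κ → Q.IsKey a (mkKey Q.bag κ.1 κ.2) := fun a κ hκ =>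
    isKey_mkKey (fun y hy => hκ.color y (hbag y hy)) (h.labels hκ.labels)
  constructor
  · rintro κ' x' ⟨κ, x, hκx, ht, he⟩
    obtain ⟨rfl, rfl⟩ := Prod.mk_inj.1 he
    obtain ⟨a, ha, hκ, rfl⟩ := hT.sound κ x hκx
    exact ⟨a, h.valid_iff.2 ⟨ha, (htest a κ hκ).1 ht⟩, hkey a κ hκ,
      by rw [hval, hκ.color v h.mem]⟩
  · intro a κ' ha hκ'
    obtain ⟨ha', ht⟩ := h.valid_iff.1 ha
    obtain ⟨κ, hκ⟩ := P.exists_isKey a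
    obtain ⟨x, hx, hm⟩ := hT.complete a κ ha' hκ
    exact ⟨x + weight (n := n) v (a v), by rw [hval]; omega, κ, x, hm, (htest a κ hκ).2 ht,
      by rw [hκ'.unique (hkey a κ hκ), hκ.color v h.mem]⟩

/-- `R` labels the classes of the join of the equivalence relations given by `κ₁` and `κ₂`. -/
structure JoinLabels (B : Finset (Fin n)) (κ₁ κ₂ : Key n) (R : Fin n → ℕ) : Prop where
  left : ∀ x ∈ B, ∀ y ∈ B, κ₁.2 x = κ₁.2 y → R x = R y
  right : ∀ x ∈ B, ∀ w ∈ B, κ₂.2 x = w → R x = R w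
  least : ∀ C : Fin n → Fin n → Prop, Equivalence C →
    (∀ x ∈ B, ∀ y ∈ B, κ₁.2 x = κ₁.2 y → C x y) → (∀ x ∈ B, ∀ w ∈ B, κ₂.2 x = w → C x w) →
    ∀ x ∈ B, ∀ y ∈ B, R x = R y → C x y

theorem exists_joinLabels (B : Finset (Fin n)) (κ₁ κ₂ : Key n) :
    ∃ R, JoinLabels B κ₁ κ₂ R := by
  obtain ⟨R, hR⟩ := exists_label (Relation.EqvGen.is_equivalence fun x y : Fin n =>
    x ∈ B ∧ y ∈ B ∧ (κ₁.2 x = κ₁.2 y ∨ κ₂.2 x = y))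
  refine ⟨R, fun x hx y hy h => (hR x y).2 (.rel _ _ ⟨hx, hy, .inl h⟩),
    fun x hx y hy h => (hR x y).2 (.rel _ _ ⟨hx, hy, .inr h⟩), ?_⟩
  intro C hC h1 h2 x _ y _ hxy
  refine (?_ : ∀ x y, Relation.EqvGen _ x y → C x y) x y ((hR x y).1 hxy)
  intro x y hxy
  induction hxy with
  | rel u v h => exact h.2.2.elim (h1 u h.1 v h.2.1) (h2 u h.1 v h.2.1)
  | refl u => exact hC.refl u
  | symm u v _ h => exact hC.symm h
  | trans u v w _ _ h h' => exact hC.trans h h'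

theorem IsKey.snd_mem (h : P.IsKey a κ) {x : Fin n} (hx : x ∈ P.bag) :
    ∃ w ∈ P.bag, κ.2 x = w ∧ κ.2 w = κ.2 x := by
  obtain ⟨w, hw, hw', hwx⟩ := canon_spec κ.2 hx
  refine ⟨w, hw, ?_, hwx⟩
  rw [hw']
  exact (congrFun (congrArg Prod.snd h.eq) x).symm

/-- The two pieces have only bag vertices in common, so assignments with the same centers on the bag
can be glued. Their forgotten vertices are disjoint, so the values add up. -/
theorem IsJoin.table (h : IsJoin P₁ P₂ Q) (hT₁ : P₁.TableOK ok 𝒯₁) (hT₂ : P₂.TableOK ok 𝒯₂) :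
    Q.TableOK ok {e | ∃ κ₁ κ₂ x₁ x₂ R, (κ₁, x₁) ∈ 𝒯₁ ∧ (κ₂, x₂) ∈ 𝒯₂ ∧ κ₁.1 = κ₂.1 ∧
      JoinLabels Q.bag κ₁ κ₂ R ∧ e = (mkKey Q.bag κ₁.1 R, x₁ + x₂)} := by
  have hval : ∀ a, Q.val a = P₁.val a + P₂.val a := by
    intro a
    unfold val
    rw [h.bag₁, h.bag₂, h.verts, Finset.union_sdiff_distrib, Finset.sum_union]
    rw [Finset.disjoint_left]
    intro y hy hy'
    rw [Finset.mem_sdiff] at hy hy'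
    exact hy.2 (h.mem_bag hy.1 hy'.1)
  have hkey : ∀ a κ₁ κ₂ R, P₁.IsKey a κ₁ → P₂.IsKey a κ₂ → JoinLabels Q.bag κ₁ κ₂ R →
      Q.IsKey a (mkKey Q.bag κ₁.1 R) := by
    intro a κ₁ κ₂ R h₁ h₂ hR
    refine isKey_mkKey (fun y hy => h₁.color y (h.bag₁ ▸ hy)) ?_
    have hb₁ : ∀ y ∈ Q.bag, y ∈ P₁.bag := fun y hy => h.bag₁ ▸ hy
    have hb₂ : ∀ y ∈ Q.bag, y ∈ P₂.bag := fun y hy => h.bag₂ ▸ hy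
    intro x hx y hy
    constructor
    · refine hR.least (Q.Conn a) ⟨fun _ => .refl _ _ _, Conn.symm, Conn.trans⟩ ?_ ?_ x hx y hy
      · intro x hx y hy hxy
        exact h.conn_left ((h₁.labels x (hb₁ x hx) y (hb₁ y hy)).1 hxy)
      · intro x hx w hw hxw
        obtain ⟨w', hw', h1, h2⟩ := h₂.snd_mem (hb₂ x hx)
        have : w' = w := Fin.ext (h1.symm.trans hxw)
        subst this
        exact h.symm.conn_left ((h₂.labels x (hb₂ x hx) w' hw').1 h2.symm)
    · refine h.label_eq (fun x hx y hy hc => ?_) hx hy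
      rcases hc with hc | hc
      · exact hR.left x hx y hy ((h₁.labels x (hb₁ x hx) y (hb₁ y hy)).2 hc)
      · have hl := (h₂.labels x (hb₂ x hx) y (hb₂ y hy)).2 hc
        obtain ⟨w, hw, h1, -⟩ := h₂.snd_mem (hb₂ x hx)
        have hw : w ∈ Q.bag := h.bag₂ ▸ hw
        rw [hR.right x hx w hw h1, hR.right y hy w hw (hl.symm.trans h1)]
  constructor
  · rintro κ' x' ⟨κ₁, κ₂, x₁, x₂, R, h1, h2, h12, hR, he⟩
    obtain ⟨rfl, rfl⟩ := Prod.mk_inj.1 he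
    obtain ⟨a₁, ha₁, hκ₁, rfl⟩ := hT₁.sound _ _ h1
    obtain ⟨a₂, ha₂, hκ₂, rfl⟩ := hT₂.sound _ _ h2
    set a : Fin n → Fin n := fun x => if x ∈ P₁.verts then a₁ x else a₂ x with ha
    have e1 : ∀ x ∈ P₁.verts, a₁ x = a x := fun x hx => by simp [ha, hx]
    have e2 : ∀ x ∈ P₂.verts, a₂ x = a x := fun x hx => by
      by_cases hx1 : x ∈ P₁.verts
      · have hxB := h.mem_bag hx1 hx
        simp only [ha, hx1, if_true]
        refine Fin.ext ?_
        rw [← hκ₁.color x (h.bag₁ ▸ hxB), ← hκ₂.color x (h.bag₂ ▸ hxB), h12]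
      · simp [ha, hx1]
    refine ⟨a, h.valid_iff.2 ⟨(valid_congr e1).1 ha₁, (valid_congr e2).1 ha₂⟩,
      hkey a κ₁ κ₂ R (hκ₁.congr e1) (hκ₂.congr e2) hR, ?_⟩
    rw [hval, val_congr e1, val_congr e2]
  · intro a κ' ha hκ'
    obtain ⟨ha₁, ha₂⟩ := h.valid_iff.1 ha
    obtain ⟨κ₁, hκ₁⟩ := P₁.exists_isKey a
    obtain ⟨κ₂, hκ₂⟩ := P₂.exists_isKey a
    obtain ⟨x₁, hx₁, hm₁⟩ := hT₁.complete a κ₁ ha₁ hκ₁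
    obtain ⟨x₂, hx₂, hm₂⟩ := hT₂.complete a κ₂ ha₂ hκ₂
    obtain ⟨R, hR⟩ := exists_joinLabels Q.bag κ₁ κ₂
    refine ⟨x₁ + x₂, by rw [hval]; omega, κ₁, κ₂, x₁, x₂, R, hm₁, hm₂, ?_, hR,
      by rw [hκ'.unique (hkey a κ₁ κ₂ R hκ₁ hκ₂ hR)]⟩
    rw [← hκ₁.eq, ← hκ₂.eq]
    funext y
    by_cases hy : y ∈ Q.bag
    · have hy1 : y ∈ P₁.bag := h.bag₁ ▸ hy
      have hy2 : y ∈ P₂.bag := h.bag₂ ▸ hy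
      rw [mkKey_fst hy1, mkKey_fst hy2, hκ₁.color y hy1, hκ₂.color y hy2]
    · simp [mkKey, h.bag₁, h.bag₂, hy]

end Piece

end ConnectedKCenter

namespace ConnectedKCenter

/-! ## The number of states -/

/-- Partial equivalence relations with domain `B`. -/
structure IsPER {V : Type*} (B : Finset V) (R : V → V → Prop) : Prop where
  symm : ∀ u v, R u v → R v u
  trans : ∀ u v w, R u v → R v w → R u w
  dom : ∀ u, R u u ↔ u ∈ B

theorem IsPER.mem {V : Type*} {B : Finset V} {R : V → V → Prop} (h : IsPER B R) {u v : V}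
    (huv : R u v) : u ∈ B ∧ v ∈ B :=
  ⟨(h.dom u).1 (h.trans u v u huv (h.symm u v huv)), (h.dom v).1 (h.trans v u v (h.symm u v huv) huv)⟩

-- The recurrence of the Bell numbers: fix `x ∈ B`, choose the rest `C` of its class, and delete the
-- whole class; a partial equivalence relation with domain `B \ {x}` without `C` remains. Relations
-- on all of `V` with a prescribed domain let the induction run without a change of type.
open Classical in
theorem card_isPER_le {V : Type*} [Fintype V] (B : Finset V) :
    (Finset.univ.filter fun R : V → V → Prop => IsPER B R).card ≤ Nat.bell B.card := by
  induction hm : B.card using Nat.strong_induction_on generalizing B with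
  | _ m ih =>
  rcases B.eq_empty_or_nonempty with rfl | ⟨x, hx⟩
  · simp only [Finset.card_empty] at hm
    rw [← hm, Nat.bell_zero, Finset.card_le_one]
    simp only [Finset.mem_filter, Finset.mem_univ, true_and]
    intro R hR R' hR'
    funext u v
    exact propext (iff_of_false (fun h => by simpa using (hR.mem h).1)
      fun h => by simpa using (hR'.mem h).1)
  · set B' := B.erase x with hB'
    have hcard : B'.card + 1 = m := by rw [hB', ← hm]; exact Finset.card_erase_add_one hx
    have hsub : (Finset.univ.filter fun R : V → V → Prop => IsPER B R) ⊆
        B'.powerset.biUnion fun C => (Finset.univ.filter fun R : V → V → Prop =>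
          IsPER (B' \ C) R).image fun R u v => R u v ∨ u ∈ insert x C ∧ v ∈ insert x C := by
      intro R hR
      simp only [Finset.mem_filter, Finset.mem_univ, true_and, Finset.mem_biUnion,
        Finset.mem_powerset, Finset.mem_image] at hR ⊢
      have hxx := (hR.dom x).2 hx
      refine ⟨B'.filter (R x), Finset.filter_subset _ _,
        fun u v => R u v ∧ ¬ R x u, ⟨?_, ?_, ?_⟩, ?_⟩
      · rintro u v ⟨h1, h2⟩
        exact ⟨hR.symm _ _ h1, fun h => h2 (hR.trans _ _ _ h (hR.symm _ _ h1))⟩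
      · rintro u v w ⟨h1, h2⟩ ⟨h3, -⟩
        exact ⟨hR.trans _ _ _ h1 h3, h2⟩
      · intro u
        rw [hR.dom]
        simp only [hB', Finset.mem_sdiff, Finset.mem_erase, Finset.mem_filter]
        constructor
        · rintro ⟨h1, h2⟩
          exact ⟨⟨by rintro rfl; exact h2 hxx, h1⟩, fun h => h2 h.2⟩
        · rintro ⟨⟨h1, h2⟩, h3⟩
          exact ⟨h2, fun h => h3 ⟨⟨h1, h2⟩, h⟩⟩
      · funext u v
        have hmem : ∀ u, u ∈ insert x (B'.filter (R x)) ↔ R x u := by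
          intro u
          simp only [Finset.mem_insert, Finset.mem_filter, hB', Finset.mem_erase]
          constructor
          · rintro (rfl | h)
            · exact hxx
            · exact h.2
          · intro h
            by_cases hux : u = x
            · exact .inl hux
            · exact .inr ⟨⟨hux, (hR.mem h).2⟩, h⟩
        rw [hmem, hmem]
        refine propext ⟨?_, fun h => ?_⟩
        · rintro (h | h)
          · exact h.1
          · exact hR.trans _ _ _ (hR.symm _ _ h.1) h.2
        · by_cases hxu : R x u
          · exact .inr ⟨hxu, hR.trans _ _ _ hxu h⟩
          · exact .inl ⟨h, hxu⟩
    calc _ ≤ _ := Finset.card_le_card hsub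
      _ ≤ ∑ C ∈ B'.powerset, Nat.bell (B'.card - C.card) := by
        refine Finset.card_biUnion_le.trans (Finset.sum_le_sum fun C hC => ?_)
        have hC := Finset.mem_powerset.1 hC
        have hc : (B' \ C).card = B'.card - C.card := Finset.card_sdiff_of_subset hC
        refine Finset.card_image_le.trans ?_
        rw [← hc]
        exact ih _ (by rw [hc]; omega) _ rfl
      _ = Nat.bell m := by
        rw [Finset.sum_powerset_apply_card (fun i => Nat.bell (B'.card - i)), ← hcard,
          Nat.bell_succ]
        refine Finset.sum_congr ?_ fun i _ => by rw [smul_eq_mul]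
        ext i; simp

theorem bell_pos (m : ℕ) : 0 < Nat.bell m := by
  induction m using Nat.strong_induction_on with
  | _ m ih =>
  cases m with
  | zero => simp
  | succ m =>
    rw [Nat.bell_succ]
    exact Finset.sum_pos (fun i hi => Nat.mul_pos (Nat.choose_pos (by simpa using hi))
      (ih _ (by omega))) ⟨0, by simp⟩

theorem bell_mono : Monotone Nat.bell := by
  refine monotone_nat_of_le_succ fun m => ?_
  rw [Nat.bell_succ]
  refine le_trans ?_ (Finset.single_le_sum (f := fun i => m.choose i * (m - i).bell)
    (fun _ _ => Nat.zero_le _) (a := 0) (by simp))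
  simp

variable {n : ℕ} {B : Finset (Fin n)} {K : Finset (Key n)}

/-- Bounds the number of entries with given centers, hence the inner loop at a join node. -/
theorem card_keys_fst_le (hK : ∀ κ ∈ K, mkKey B κ.1 κ.2 = κ) (f : Fin n → ℕ)
    (hf : ∀ κ ∈ K, κ.1 = f) : K.card ≤ Nat.bell B.card := by
  classical
  refine le_trans (Finset.card_le_card_of_injOn
    (fun κ u v => u ∈ B ∧ v ∈ B ∧ κ.2 u = κ.2 v) (fun κ _ => ?_) ?_) (card_isPER_le B)
  · simp only [Finset.coe_filter, Finset.mem_univ, true_and, Set.mem_ofPred_eq]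
    exact ⟨fun u v h => ⟨h.2.1, h.1, h.2.2.symm⟩,
      fun u v w h h' => ⟨h.1, h'.2.1, h.2.2.trans h'.2.2⟩, fun u => by simp⟩
  · intro κ hκ κ' hκ' h
    rw [← hK κ hκ, ← hK κ' hκ', hf κ hκ, hf κ' hκ']
    refine mkKey_congr (fun _ _ => rfl) fun x hx y hy => ?_
    have := congrFun (congrFun h x) y
    simp only [hx, hy, true_and, eq_iff_iff] at this
    exact this

theorem card_keys_le (hK : ∀ κ ∈ K, mkKey B κ.1 κ.2 = κ) (hlt : ∀ κ ∈ K, ∀ v ∈ B, κ.1 v < n) :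
    K.card ≤ n ^ B.card * Nat.bell B.card := by
  classical
  have h1 : K.card ≤ Nat.bell B.card * (K.image Prod.fst).card := by
    refine Finset.card_le_mul_card_image K _ fun f _ => ?_
    exact card_keys_fst_le (fun κ hκ => hK κ (Finset.mem_filter.1 hκ).1) f
      fun κ hκ => (Finset.mem_filter.1 hκ).2
  have h2 : (K.image Prod.fst).card ≤ n ^ B.card := by
    have hc : Fintype.card (B → Fin n) = n ^ B.card := by simp
    rw [← hc, ← Finset.card_univ]
    refine Finset.card_le_card_of_injOn (fun f v => if h : f v < n then ⟨f v, h⟩ else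
      ⟨0, v.1.pos⟩) (fun _ _ => Finset.mem_coe.2 (Finset.mem_univ _)) ?_
    intro f hf f' hf' h
    simp only [Finset.coe_image, Set.mem_image, Finset.mem_coe] at hf hf'
    obtain ⟨κ, hκ, rfl⟩ := hf
    obtain ⟨κ', hκ', rfl⟩ := hf'
    funext v
    by_cases hv : v ∈ B
    · have := congrFun h ⟨v, hv⟩
      simpa [hlt κ hκ v hv, hlt κ' hκ' v hv] using this
    · rw [← hK κ hκ, ← hK κ' hκ']
      simp [mkKey, hv]
  calc _ ≤ _ := h1
    _ ≤ Nat.bell B.card * n ^ B.card := Nat.mul_le_mul_left _ h2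
    _ = _ := mul_comm _ _

/-! ## The pieces below the nodes of a nice tree decomposition -/

namespace NiceTreeDecomposition

variable {V Node : Type*} [Fintype V] [DecidableEq V] [Fintype Node] {G : SimpleGraph V}
  (T : NiceTreeDecomposition G Node)

/-- `s` is a child of `t`. -/
def IsChild (s t : Node) : Prop := s ≠ T.root ∧ T.parent s = t

/-- `s` lies in the subtree below `t`. -/
def Below (s t : Node) : Prop := ∃ i, T.parent^[i] s = t

variable {T} {s t x y : Node} {v : V}

theorem Below.refl (t : Node) : T.Below t t := ⟨0, rfl⟩

theorem below_iff : T.Below s t ↔ s = t ∨ ∃ c, T.IsChild c t ∧ T.Below s c := by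
  constructor
  · rintro ⟨i, hi⟩
    induction i generalizing t with
    | zero => exact .inl hi
    | succ i ih =>
      rw [Function.iterate_succ_apply'] at hi
      by_cases h : T.parent^[i] s = T.root
      · rw [h, T.parent_root] at hi
        exact ih (h.trans hi)
      · exact .inr ⟨_, ⟨h, hi⟩, i, rfl⟩
  · rintro (rfl | ⟨c, hc, i, hi⟩)
    · exact .refl _
    · exact ⟨i + 1, by rw [Function.iterate_succ_apply', hi, hc.2]⟩

theorem Below.parent_of_ne (h : T.Below s t) (hst : s ≠ t) : T.Below (T.parent s) t := by
  obtain ⟨i, hi⟩ := h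
  cases i with
  | zero => exact absurd hi hst
  | succ i => exact ⟨i, hi⟩

theorem Below.of_parent (h : T.Below (T.parent s) t) : T.Below s t :=
  let ⟨i, hi⟩ := h; ⟨i + 1, hi⟩

theorem below_root (s : Node) : T.Below s T.root := by
  induction hd : T.tree.dist T.root s using Nat.strong_induction_on generalizing s with
  | _ d ih =>
  by_cases h : s = T.root
  · exact h ▸ .refl _
  · have := (T.parent_spec s h).2
    exact (ih _ (by omega) _ rfl).of_parent

theorem dist_child (h : T.IsChild s t) : T.tree.dist T.root s = T.tree.dist T.root t + 1 := by
  rw [← h.2]; exact (T.parent_spec s h.1).2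

theorem Below.dist_le (h : T.Below s t) : T.tree.dist T.root t ≤ T.tree.dist T.root s := by
  obtain ⟨i, hi⟩ := h
  induction i generalizing s with
  | zero => exact hi ▸ le_rfl
  | succ i ih =>
    have := ih hi
    by_cases h : s = T.root
    · rw [h, T.parent_root] at this; rwa [h]
    · have := (T.parent_spec s h).2
      omega

theorem not_below_child (h : T.IsChild s t) : ¬ T.Below t s := fun h' => by
  have := h'.dist_le
  have := dist_child h
  omega

/-- The subtrees of different children are disjoint. -/
theorem Below.child_unique {c c' : Node} (hc : T.IsChild c t) (hc' : T.IsChild c' t)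
    (h : T.Below s c) (h' : T.Below s c') : c = c' := by
  obtain ⟨i, hi⟩ := h
  induction i generalizing s with
  | zero =>
    have hi : s = c := hi
    subst hi
    by_contra hne
    have := h'.parent_of_ne hne
    rw [hc.2] at this
    exact not_below_child hc' this
  | succ i ih =>
    by_cases hs : s = c'
    · subst hs
      have hp : T.Below (T.parent s) c := ⟨i, hi⟩
      rw [hc'.2] at hp
      exact absurd hp (not_below_child hc)
    · exact ih (h'.parent_of_ne hs) hi

/-- The edges from the nodes other than the root to their parents are pairwise different, since the
distance to the root tells the child from the parent. A tree has no more edges than these. -/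
theorem adj_iff_parent (h : T.tree.Adj x y) : T.IsChild x y ∨ T.IsChild y x := by
  classical
  let f : Node → Sym2 Node := fun s => s(s, T.parent s)
  have hmem : ∀ s ∈ Finset.univ.erase T.root, f s ∈ T.tree.edgeFinset := by
    intro s hs
    rw [SimpleGraph.mem_edgeFinset, SimpleGraph.mem_edgeSet]
    exact (T.parent_spec s (Finset.ne_of_mem_erase hs)).1
  have hinj : Set.InjOn f (Finset.univ.erase T.root : Finset Node) := by
    intro s hs s' hs' he
    have hs := Finset.ne_of_mem_erase (Finset.mem_coe.1 hs)
    have hs' := Finset.ne_of_mem_erase (Finset.mem_coe.1 hs')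
    rcases Sym2.eq_iff.1 he with ⟨h1, -⟩ | ⟨h1, h2⟩
    · exact h1
    · have d1 := (T.parent_spec s hs).2
      have d2 := (T.parent_spec s' hs').2
      rw [h2] at d1
      rw [← h1] at d2
      omega
  have hcard := T.isTree.card_edgeFinset
  have himg : (Finset.univ.erase T.root).image f = T.tree.edgeFinset := by
    refine Finset.eq_of_subset_of_card_le (Finset.image_subset_iff.2 hmem) ?_
    rw [Finset.card_image_of_injOn hinj, Finset.card_erase_of_mem (Finset.mem_univ _),
      Finset.card_univ]
    omega
  have : s(x, y) ∈ T.tree.edgeFinset := by rwa [SimpleGraph.mem_edgeFinset]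
  rw [← himg, Finset.mem_image] at this
  obtain ⟨s, hs, he⟩ := this
  have hs := Finset.ne_of_mem_erase hs
  rcases Sym2.eq_iff.1 he with ⟨rfl, h2⟩ | ⟨rfl, h2⟩
  · exact .inl ⟨hs, h2⟩
  · exact .inr ⟨hs, h2⟩

/-- A vertex that occurs below `t` and also elsewhere lies in the bag of `t`. -/
theorem mem_bag_of_below (hx : T.Below x t) (hy : ¬ T.Below y t) (hvx : v ∈ T.bag x)
    (hvy : v ∈ T.bag y) : v ∈ T.bag t := by
  by_contra hv
  obtain ⟨p⟩ := (T.bag_connected v).preconnected ⟨x, hvx⟩ ⟨y, hvy⟩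
  -- The walk uses only nodes whose bags contain `v`. The only way out of the subtree leads from `t`
  -- to its parent, and `t` is not available.
  suffices h : ∀ (a b : {t | v ∈ T.bag t}), (T.tree.induce {t | v ∈ T.bag t}).Walk a b →
      T.Below a t → T.Below b t from hy (h _ _ p hx)
  intro a b p
  induction p with
  | nil => exact id
  | @cons a b c hab _ ih =>
    refine fun ha => ih ?_
    have hat : (a : Node) ≠ t := fun h => hv (h ▸ a.2)
    rcases adj_iff_parent (show T.tree.Adj (a : Node) b from hab) with h | h
    · have := ha.parent_of_ne hat
      rwa [h.2] at this
    · refine Below.of_parent ?_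
      rw [h.2]; exact ha

variable (T)

open Classical in
/-- The part of the graph that belongs to the subtree below `t`. -/
noncomputable def piece (t : Node) : Piece V where
  bag := T.bag t
  verts := Finset.univ.filter fun v => ∃ s, T.Below s t ∧ v ∈ T.bag s
  E u v := ∃ s, T.Below s t ∧ T.kind s = .introEdge u v
  bag_sub v hv := by simpa using ⟨t, .refl _, hv⟩
  E_sub u v := by
    rintro ⟨s, hs, hk⟩
    have := T.kind_spec s
    simp only [hk] at this
    simp only [Finset.mem_filter, Finset.mem_univ, true_and]
    exact ⟨⟨s, hs, this.2.1⟩, s, hs, this.2.2.1⟩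

variable {T}

theorem mem_piece_verts : v ∈ (T.piece t).verts ↔ ∃ s, T.Below s t ∧ v ∈ T.bag s := by
  simp [piece]

theorem piece_verts_iff : v ∈ (T.piece t).verts ↔
    v ∈ T.bag t ∨ ∃ c, T.IsChild c t ∧ v ∈ (T.piece c).verts := by
  simp only [mem_piece_verts]
  constructor
  · rintro ⟨s, hs, hv⟩
    rcases below_iff.1 hs with rfl | ⟨c, hc, h⟩
    · exact .inl hv
    · exact .inr ⟨c, hc, s, h, hv⟩
  · rintro (h | ⟨c, hc, s, h, hv⟩)
    · exact ⟨t, .refl _, h⟩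
    · exact ⟨s, below_iff.2 (.inr ⟨c, hc, h⟩), hv⟩

theorem piece_E_iff {u v : V} : (T.piece t).E u v ↔
    T.kind t = .introEdge u v ∨ ∃ c, T.IsChild c t ∧ (T.piece c).E u v := by
  simp only [piece]
  constructor
  · rintro ⟨s, hs, hv⟩
    rcases below_iff.1 hs with rfl | ⟨c, hc, h⟩
    · exact .inl hv
    · exact .inr ⟨c, hc, s, h, hv⟩
  · rintro (h | ⟨c, hc, s, h, hv⟩)
    · exact ⟨t, .refl _, h⟩
    · exact ⟨s, below_iff.2 (.inr ⟨c, hc, h⟩), hv⟩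

theorem piece_leaf (hk : T.kind t = .leaf) :
    (∀ c, ¬ T.IsChild c t) ∧ (T.piece t).bag = ∅ ∧ (T.piece t).verts = ∅ := by
  have h := T.kind_spec t
  simp only [hk] at h
  have hc : ∀ c, ¬ T.IsChild c t := fun c hc =>
    Set.eq_empty_iff_forall_notMem.1 h.1 c ⟨hc.1, hc.2⟩
  refine ⟨hc, h.2, Finset.eq_empty_iff_forall_notMem.2 fun v hv => ?_⟩
  rcases piece_verts_iff.1 hv with hv | ⟨c, h', -⟩
  · simp [h.2] at hv
  · exact hc c h'

theorem isChild_of_eq_singleton {c : Node} (h : {s | s ≠ T.root ∧ T.parent s = t} = {c})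
    (s : Node) : T.IsChild s t ↔ s = c := by
  have := Set.ext_iff.1 h s
  simpa [IsChild] using this

theorem piece_intro (hk : T.kind t = .introVertex v) :
    ∃ c, (∀ s, T.IsChild s t ↔ s = c) ∧ (T.piece c).IsIntro v (T.piece t) := by
  have h := T.kind_spec t
  simp only [hk] at h
  obtain ⟨c, hc, hv, hb⟩ := h
  have hc := isChild_of_eq_singleton hc
  refine ⟨c, hc, ?_, hb, ?_, ?_⟩
  · rw [mem_piece_verts]
    rintro ⟨s, hs, hvs⟩
    -- If `v` occurred anywhere below `c`, it would lie in the bag of `c`, because it also occurs at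
    -- `t`.
    exact hv (mem_bag_of_below hs (not_below_child ((hc c).2 rfl)) hvs (y := t) (by simp [hb]))
  · ext u
    rw [piece_verts_iff, hb]
    simp only [hc, exists_eq_left, Finset.mem_insert]
    have : u ∈ T.bag c → u ∈ (T.piece c).verts := fun h => (T.piece c).bag_sub h
    tauto
  · funext u w
    simp [piece_E_iff (t := t), hk, hc]

theorem piece_edge {u : V} (hk : T.kind t = .introEdge u v) :
    ∃ c, (∀ s, T.IsChild s t ↔ s = c) ∧ (T.piece c).IsEdge u v (T.piece t) := by
  have h := T.kind_spec t
  simp only [hk] at h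
  obtain ⟨-, hu, hv, c, hc, hb⟩ := h
  have hc := isChild_of_eq_singleton hc
  refine ⟨c, hc, by rw [hb] at hu; exact hu, by rw [hb] at hv; exact hv, hb, ?_, ?_⟩
  · ext u
    rw [piece_verts_iff, hb]
    simp only [hc, exists_eq_left]
    have : u ∈ T.bag c → u ∈ (T.piece c).verts := fun h => (T.piece c).bag_sub h
    tauto
  · intro x y
    rw [piece_E_iff, hk, or_comm]
    simp [hc, eq_comm]

theorem piece_forget (hk : T.kind t = .forget v) :
    ∃ c, (∀ s, T.IsChild s t ↔ s = c) ∧ (T.piece c).IsForget v (T.piece t) := by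
  have h := T.kind_spec t
  simp only [hk] at h
  obtain ⟨c, hc, hv, hb⟩ := h
  have hc := isChild_of_eq_singleton hc
  refine ⟨c, hc, hv, hb, ?_, ?_⟩
  · ext u
    rw [piece_verts_iff, hb]
    simp only [hc, exists_eq_left, Finset.mem_erase]
    have : u ∈ T.bag c → u ∈ (T.piece c).verts := fun h => (T.piece c).bag_sub h
    tauto
  · funext u w
    simp [piece_E_iff (t := t), hk, hc]

theorem piece_join (hk : T.kind t = .join) :
    ∃ c₁ c₂, c₁ ≠ c₂ ∧ (∀ s, T.IsChild s t ↔ s = c₁ ∨ s = c₂) ∧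
      (T.piece c₁).IsJoin (T.piece c₂) (T.piece t) := by
  have h := T.kind_spec t
  simp only [hk] at h
  obtain ⟨c₁, c₂, hne, hc, hb₁, hb₂⟩ := h
  have hc : ∀ s, T.IsChild s t ↔ s = c₁ ∨ s = c₂ := fun s => by
    have := Set.ext_iff.1 hc s
    simpa [IsChild] using this
  refine ⟨c₁, c₂, hne, hc, hb₁, hb₂, ?_, ?_, ?_⟩
  · ext u
    rw [piece_verts_iff, ← hb₁]
    simp only [hc, or_and_right, exists_or, exists_eq_left, Finset.mem_union]
    have : u ∈ T.bag c₁ → u ∈ (T.piece c₁).verts := fun h => (T.piece c₁).bag_sub h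
    tauto
  · intro u hu
    obtain ⟨h1, h2⟩ := Finset.mem_inter.1 hu
    obtain ⟨s, hs, hus⟩ := mem_piece_verts.1 h1
    obtain ⟨s', hs', hus'⟩ := mem_piece_verts.1 h2
    have : ¬ T.Below s' c₁ := fun h =>
      hne (Below.child_unique ((hc c₁).2 (.inl rfl)) ((hc c₂).2 (.inr rfl)) h hs')
    have := mem_bag_of_below hs this hus hus'
    rw [hb₁] at this
    exact this
  · intro x y
    rw [piece_E_iff, hk]
    simp [hc, or_and_right, exists_or]

theorem piece_root_bag : (T.piece T.root).bag = ∅ := T.root_bag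

theorem piece_root_verts : (T.piece T.root).verts = Finset.univ := by
  refine Finset.eq_univ_iff_forall.2 fun v => ?_
  obtain ⟨t, ht⟩ := T.bag_cover v
  exact mem_piece_verts.2 ⟨t, below_root t, ht⟩

theorem piece_root_E {u v : V} (h : G.Adj u v) :
    (T.piece T.root).E u v ∨ (T.piece T.root).E v u := by
  obtain ⟨t, ht, -⟩ := T.introEdge_unique u v h
  exact ht.imp (fun h => ⟨t, below_root t, h⟩) fun h => ⟨t, below_root t, h⟩

theorem piece_E_adj {u v : V} (h : (T.piece t).E u v) : G.Adj u v := by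
  obtain ⟨s, -, hs⟩ := h
  have := T.kind_spec s
  simp only [hs] at this
  exact this.1

theorem card_bag_le (t : Node) : (T.bag t).card ≤ T.width + 1 := by
  have : (T.bag t).card ≤ Finset.univ.sup fun t => (T.bag t).card :=
    Finset.le_sup (f := fun t => (T.bag t).card) (Finset.mem_univ t)
  unfold TreeDecomposition.width
  omega

end NiceTreeDecomposition

end ConnectedKCenter

namespace ConnectedKCenter

/-! ## Assignments of centers to all vertices -/

section

set_option linter.unusedSectionVars false

variable {V : Type*} [Fintype V] [DecidableEq V] {G : SimpleGraph V} {a a' : V → V} {x y v u : V}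

/-- The whole graph. -/
def fullPiece (G : SimpleGraph V) : Piece V where
  bag := ∅
  verts := Finset.univ
  E := G.Adj
  bag_sub := Finset.empty_subset _
  E_sub _ _ _ := ⟨Finset.mem_univ _, Finset.mem_univ _⟩

/-- Each component of vertices with the same center contains that center. -/
def Centered (G : SimpleGraph V) (a : V → V) : Prop := ∀ x, (fullPiece G).Conn a x (a x)

theorem Centered.fix (h : Centered G a) (x : V) : a (a x) = a x := (h x).color.symm

/-- The vertices that are centers. -/
def centers (a : V → V) : Finset V := Finset.univ.filter fun v => a v = v

theorem centered_id (G : SimpleGraph V) : Centered G id := fun x => .refl _ _ x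

/-- Two partial assignments of the same centers: `a'` arises from `a` by splitting off
single vertices. -/
structure Splits (G : SimpleGraph V) (a a' : V → V) : Prop where
  or : ∀ v, a' v = v ∨ a' v = a v
  centered : Centered G a'

/-- On a path from `x` to its center within the cluster, `a'` and `a` differ at the beginning and
agree at the end, as `a x` is its own center under both. Somewhere on the way this changes. -/
theorem Splits.exists_edge (ha : Centered G a) (h : Splits G a a') (hx : a' x ≠ a x) :
    ∃ v u, G.Adj v u ∧ a' v ≠ a v ∧ a' u = a u ∧ a u = a v := by
  by_contra! hcon
  refine hx (((ha x).iff_of_closed (C := fun u => a' u = a u) fun u v hE huv => ?_).2 ?_)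
  · constructor
    · intro h1
      by_contra h2
      exact hcon v u ((G.adj_comm _ _).1 hE) h2 h1 huv
    · intro h1
      by_contra h2
      exact hcon u v hE h2 h1 huv.symm
  · rw [ha.fix]
    rcases h.or (a x) with h' | h'
    · exact h'
    · rw [h', ha.fix]

theorem Splits.fix_of_ne (h : Splits G a a') (hv : a' v ≠ a v) : a' v = v :=
  (h.or v).resolve_right hv

/-- As `v` is not a center of `a`, no vertex but `v` itself has the center `v` under `a'`. Moving
this singleton over the edge to `u` keeps all other connections and destroys exactly one center. -/
theorem Splits.update (ha : Centered G a) (h : Splits G a a') (hvu : G.Adj v u) (hv : a' v ≠ a v)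
    (hu : a' u = a u) (huv : a u = a v) :
    Splits G a (Function.update a' v (a v)) ∧
      (centers (Function.update a' v (a v))).card + 1 = (centers a').card := by
  have hvv := h.fix_of_ne hv
  have hne : u ≠ v := by rintro rfl; exact hv hu
  have hcol : ∀ w, a' w = v → w = v := by
    intro w hw
    rcases h.or w with h' | h'
    · rw [← h', hw]
    · exfalso
      rw [h'] at hw
      have := ha.fix w
      rw [hw] at this
      exact hv (by rw [hvv, this])
  have hmono : ∀ x y, (fullPiece G).Conn a' x y →
      (fullPiece G).Conn (Function.update a' v (a v)) x y := by
    intro x y hxy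
    refine (hxy.iff_of_closed (C := (fullPiece G).Conn (Function.update a' v (a v)) x)
      fun p q hE hpq => ?_).1 (.refl _ _ _)
    have hpqne : p ≠ q := G.ne_of_adj hE
    have hp : p ≠ v := by
      rintro rfl
      exact hpqne (hcol q (by rw [← hpq, hvv])).symm
    have hq : q ≠ v := by
      rintro rfl
      exact hpqne (hcol p (by rw [hpq, hvv]))
    have : (fullPiece G).Conn (Function.update a' v (a v)) p q :=
      .rel _ _ ⟨hE, by rwa [Function.update_of_ne hp, Function.update_of_ne hq]⟩
    exact ⟨fun h => h.trans this, fun h => h.trans this.symm⟩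
  refine ⟨⟨fun w => ?_, fun w => ?_⟩, ?_⟩
  · by_cases hw : w = v
    · subst hw; simp
    · simpa [hw] using h.or w
  · by_cases hw : w = v
    · subst hw
      have h1 : (fullPiece G).Conn (Function.update a' w (a w)) w u :=
        .rel _ _ ⟨hvu, by simp [hne, hu, huv]⟩
      have h2 := hmono _ _ (h.centered u)
      rw [hu, huv] at h2
      simpa using h1.trans h2
    · simpa [hw] using hmono _ _ (h.centered w)
  · have : centers (Function.update a' v (a v)) = (centers a').erase v := by
      ext w
      by_cases hw : w = v
      · subst hw
        simp only [centers, Finset.mem_filter, Function.update_self, Finset.mem_erase]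
        rw [hvv] at hv
        simp [Ne.symm hv]
      · simp [centers, hw]
    rw [this]
    exact Finset.card_erase_add_one (by simp [centers, hvv])

theorem Splits.exists_ne (h : (centers a).card < (centers a').card) : ∃ x, a' x ≠ a x := by
  by_contra! hcon
  have : a' = a := funext hcon
  rw [this] at h
  omega

theorem Centered.isSolution {k : ℕ} (h : Centered G a) {c : Fin k → V}
    (hc : Function.Injective c) (hr : ∀ v, a v = v ↔ ∃ i, c i = v) :
    IsSolution G (fun i => Finset.univ.filter fun v => a v = c i) c where
  disjoint i j hij := by
    rw [Finset.disjoint_left]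
    intro v hv hv'
    simp only [Finset.mem_filter, Finset.mem_univ, true_and] at hv hv'
    exact hij (hc (hv.symm.trans hv'))
  cover v := by
    obtain ⟨i, hi⟩ := (hr (a v)).1 (h.fix v)
    exact ⟨i, by simp [hi]⟩
  center_mem i := by simpa using (hr (c i)).2 ⟨i, rfl⟩
  connected i := by
    have hci : c i ∈ ((Finset.univ.filter fun v => a v = c i : Finset V) : Set V) := by
      simpa using (hr (c i)).2 ⟨i, rfl⟩
    rw [SimpleGraph.connected_iff_exists_forall_reachable]
    refine ⟨⟨c i, hci⟩, ?_⟩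
    rintro ⟨v, hv⟩
    have hav : a v = c i := by simpa using hv
    have hcv : (fullPiece G).Conn a (c i) v := hav ▸ (h v).symm
    have key : ∀ u w, G.Adj u w → a u = a w →
          (∃ hu : u ∈ ((Finset.univ.filter fun v => a v = c i : Finset V) : Set V),
            (G.induce _).Reachable ⟨c i, hci⟩ ⟨u, hu⟩) →
          ∃ hu : w ∈ ((Finset.univ.filter fun v => a v = c i : Finset V) : Set V),
            (G.induce _).Reachable ⟨c i, hci⟩ ⟨w, hu⟩ := by
        rintro u w hE huw ⟨hu, hr⟩
        have hw : w ∈ ((Finset.univ.filter fun v => a v = c i : Finset V) : Set V) := by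
          simp only [Finset.coe_filter, Finset.mem_univ, true_and, Set.mem_ofPred_eq] at hu ⊢
          rw [← huw, hu]
        exact ⟨hw, hr.trans (SimpleGraph.Adj.reachable (show G.Adj u w from hE))⟩
    obtain ⟨_, hr⟩ := (hcv.iff_of_closed
      (C := fun u => ∃ hu : u ∈ ((Finset.univ.filter fun v => a v = c i : Finset V) : Set V),
        (G.induce _).Reachable ⟨c i, hci⟩ ⟨u, hu⟩) fun u w hE huw =>
          ⟨key u w hE huw, key w u ((G.adj_comm _ _).1 hE) huw.symm⟩).1 ⟨hci, .refl _⟩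
    exact hr

theorem IsSolution.exists_centered {k : ℕ} {P : Fin k → Finset V} {c : Fin k → V}
    (h : IsSolution G P c) : ∃ a : V → V, Centered G a ∧ (centers a).card = k ∧
      ∀ v, ∃ i, v ∈ P i ∧ a v = c i := by
  choose i hi using h.cover
  have huniq : ∀ v j, v ∈ P j → j = i v := by
    intro v j hj
    by_contra hne
    exact Finset.disjoint_left.1 (h.disjoint _ _ hne) hj (hi v)
  have hic : ∀ j, i (c j) = j := fun j => (huniq _ _ (h.center_mem j)).symm
  have hcinj : Function.Injective c := fun j j' hj => by rw [← hic j, ← hic j', hj]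
  refine ⟨fun v => c (i v), fun x => ?_, ?_, fun v => ⟨i v, hi v, rfl⟩⟩
  · have hP : ∀ p q : ((P (i x) : Finset V) : Set V), (G.induce _).Reachable p q →
        (fullPiece G).Conn (fun v => c (i v)) p q := by
      rintro p q ⟨w⟩
      induction w with
      | nil => exact .refl _ _ _
      | @cons p q r hpq _ ih =>
        refine Piece.Conn.trans (.rel _ _ ⟨(hpq : G.Adj (p : V) q), ?_⟩) ih
        change c (i (p : V)) = c (i (q : V))
        rw [← huniq p _ p.2, ← huniq q _ q.2]
    exact hP ⟨x, hi x⟩ ⟨c (i x), h.center_mem _⟩ ((h.connected (i x)).preconnected _ _)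
  · have : centers (fun v => c (i v)) = Finset.univ.image c := by
      ext v
      simp only [centers, Finset.mem_filter, Finset.mem_univ, true_and, Finset.mem_image]
      exact ⟨fun h => ⟨_, h⟩, by rintro ⟨j, rfl⟩; rw [hic]⟩
    rw [this, Finset.card_image_of_injective _ hcinj, Finset.card_univ, Fintype.card_fin]

theorem cost_le_iff {M : MetricSpace V} {k : ℕ} {P : Fin k → Finset V} {c : Fin k → V} {r : ℝ≥0} :
    cost M P c ≤ r ↔ ∀ i, ∀ v ∈ P i, distance M v (c i) ≤ r := by
  simp [cost, Finset.sup_le_iff]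

/-- Both suprema are taken over finite non-empty sets and hence attained. So only the entries of the
distance matrix are candidates for the optimal radius. -/
theorem exists_cost_eq {M : MetricSpace V} {k : ℕ} {P : Fin k → Finset V} {c : Fin k → V}
    (h : IsSolution G P c) [Nonempty V] : ∃ u v, cost M P c = distance M u v := by
  obtain ⟨v⟩ := ‹Nonempty V›
  obtain ⟨i, -⟩ := h.cover v
  obtain ⟨j, -, hj⟩ := Finset.exists_mem_eq_sup Finset.univ ⟨i, Finset.mem_univ _⟩
    fun i => (P i).sup fun v => distance M v (c i)
  obtain ⟨w, -, hw⟩ := Finset.exists_mem_eq_sup (P j) ⟨_, h.center_mem j⟩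
    fun v => distance M v (c j)
  exact ⟨w, c j, by rw [cost, hj, hw]⟩

/-- There is an assignment with at most `k` centers and radius at most `r`. -/
def Feasible (M : MetricSpace V) (G : SimpleGraph V) (k : ℕ) (r : ℝ≥0) : Prop :=
  ∃ a : V → V, Centered G a ∧ (∀ v, distance M v (a v) ≤ r) ∧ (centers a).card ≤ k

theorem IsSolution.feasible {M : MetricSpace V} {k : ℕ} {P : Fin k → Finset V} {c : Fin k → V}
    (h : IsSolution G P c) : Feasible M G k (cost M P c) := by
  obtain ⟨a, h1, h2, h3⟩ := h.exists_centered
  refine ⟨a, h1, fun v => ?_, h2.le⟩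
  obtain ⟨i, hi, hav⟩ := h3 v
  rw [hav]
  exact cost_le_iff.1 le_rfl i v hi

end

/-! ### Assignments and their values at the root. -/

section

variable {n : ℕ} {Node : Type*} [Fintype Node] {G : SimpleGraph (Fin n)}
  (T : NiceTreeDecomposition G Node)

theorem NiceTreeDecomposition.piece_root_conn (a : Fin n → Fin n) :
    (T.piece T.root).Conn a = (fullPiece G).Conn a := by
  funext x y
  refine propext ⟨fun h => h.of_le fun u v h => piece_E_adj h, fun h => ?_⟩
  refine (h.iff_of_closed (C := (T.piece T.root).Conn a x) fun u v hE huv => ?_).1 (.refl _ _ _)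
  have : (T.piece T.root).Conn a u v := by
    rcases piece_root_E (T := T) hE with h | h
    · exact .rel _ _ ⟨h, huv⟩
    · exact Piece.Conn.symm (.rel _ _ ⟨h, huv.symm⟩)
  exact ⟨fun h => h.trans this, fun h => h.trans this.symm⟩

/-- The bag of the root is empty, so no component touches the boundary and each must already contain
its center. -/
theorem NiceTreeDecomposition.valid_root_iff {ok : Fin n → Fin n → Prop} {a : Fin n → Fin n} :
    (T.piece T.root).Valid ok a ↔ Centered G a ∧ ∀ x, ok x (a x) := by
  have hm : ∀ x, ¬ (T.piece T.root).Meets a x := fun x ⟨y, hy, _⟩ => by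
    simp [piece_root_bag] at hy
  simp only [Piece.Valid, Piece.Good, hm, piece_root_verts, Finset.mem_univ, forall_true_left,
    false_and, or_false, not_true_eq_false, false_imp_iff, and_true,
    T.piece_root_conn, Centered]
  exact ⟨fun h => ⟨fun x => (h x).2, fun x => (h x).1⟩, fun h x => ⟨h.2 x, h.1 x⟩⟩

theorem sum_digits_lt (g : ℕ → ℕ) (m : ℕ) (hg : ∀ i < m, g i < n) :
    ∑ i ∈ Finset.range m, g i * n ^ i < n ^ m := by
  induction m with
  | zero => simp
  | succ m ih =>
    rw [Finset.sum_range_succ, pow_succ]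
    have h1 := ih fun i hi => hg i (by omega)
    have h2 : g m + 1 ≤ n := hg m (by omega)
    have h3 : (g m + 1) * n ^ m ≤ n * n ^ m := Nat.mul_le_mul_right _ h2
    rw [add_mul, one_mul] at h3
    rw [mul_comm (n ^ m)]
    omega

theorem sum_digits_inj (g g' : ℕ → ℕ) (m : ℕ) (hg : ∀ i < m, g i < n) (hg' : ∀ i < m, g' i < n)
    (h : ∑ i ∈ Finset.range m, g i * n ^ i = ∑ i ∈ Finset.range m, g' i * n ^ i) :
    ∀ i < m, g i = g' i := by
  induction m with
  | zero => intro i hi; omega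
  | succ m ih =>
    rw [Finset.sum_range_succ, Finset.sum_range_succ] at h
    have h1 := sum_digits_lt g m fun i hi => hg i (by omega)
    have h1' := sum_digits_lt g' m fun i hi => hg' i (by omega)
    have hm : g m = g' m := by
      have e : ∀ s d : ℕ, s < n ^ m → (s + d * n ^ m) / n ^ m = d := fun s d hs => by
        rw [Nat.add_mul_div_right _ _ (by omega), Nat.div_eq_of_lt hs, zero_add]
      rw [← e _ (g m) h1, h, e _ _ h1']
    have := ih (fun i hi => hg i (by omega)) (fun i hi => hg' i (by omega)) (by rw [hm] at h; omega)
    intro i hi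
    rcases Nat.lt_succ_iff_lt_or_eq.1 hi with h' | rfl
    · exact this i h'
    · exact hm

theorem NiceTreeDecomposition.val_root (a : Fin n → Fin n) :
    (T.piece T.root).val a = ∑ v : Fin n, (a v : ℕ) * n ^ (v : ℕ) + (centers a).card * n ^ n := by
  simp only [Piece.val, piece_root_verts, piece_root_bag, Finset.sdiff_empty, Piece.weight,
    Finset.sum_add_distrib, Fin.val_inj]
  congr 1
  rw [← Finset.sum_filter, Finset.sum_const, smul_eq_mul]
  rfl

theorem sum_fin_digits_lt (a : Fin n → Fin n) : ∑ v : Fin n, (a v : ℕ) * n ^ (v : ℕ) < n ^ n := by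
  have := sum_digits_lt (n := n) (fun i => if h : i < n then a ⟨i, h⟩ else 0) n
    (fun i hi => by simp [hi])
  rw [Finset.sum_range] at this
  simpa using this

/-- The digits of the assignment add up to less than `n ^ n`, so the number of centers dominates the
value. Thus one comparison decides whether `k` centers suffice. -/
theorem NiceTreeDecomposition.val_root_lt_iff (hn : 0 < n) (a : Fin n → Fin n) (k : ℕ) :
    (T.piece T.root).val a < (k + 1) * n ^ n ↔ (centers a).card ≤ k := by
  rw [T.val_root]
  have h1 := sum_fin_digits_lt a
  have h2 : 0 < n ^ n := Nat.pow_pos hn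
  constructor
  · intro h
    by_contra hk
    have : (k + 1) * n ^ n ≤ (centers a).card * n ^ n := Nat.mul_le_mul_right _ (by omega)
    omega
  · intro h
    have : (centers a).card * n ^ n ≤ k * n ^ n := Nat.mul_le_mul_right _ h
    rw [add_mul, one_mul]
    omega

end

end ConnectedKCenter

namespace ConnectedKCenter

/-! ## Names of registers and arrays -/

notation "rn" => 0
notation "rk" => 1
notation "rNodes" => 2
notation "rRoot" => 3
notation "rPtr" => 4
notation "rBase" => 5
notation "rBag" => 6
notation "rVal" => 7
notation "rFc" => 8
notation "rRc" => 9
notation "rMin" => 10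
notation "rI" => 11
notation "rV" => 12
notation "rJ" => 13
notation "rU" => 14
notation "rQ" => 15
notation "rT" => 16
notation "rS" => 17
notation "rS'" => 18
notation "rP" => 19
notation "rX" => 20
notation "rY" => 21
notation "rC" => 22
notation "rF" => 23
notation "rF'" => 24
notation "rQ'" => 25
notation "rNn" => 26
notation "rNnn" => 27
notation "rRad" => 28

notation "aAdj" => 0
notation "aPar" => 1
notation "aBag" => 2
notation "aKind" => 3
notation "aLab" => 4
notation "aLab'" => 5
notation "aMul" => 6
notation "aMP" => 7
notation "aWF" => 8
notation "aWR" => 9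
notation "aBL" => 10
notation "aCR" => 11
notation "aEF" => 12
notation "aER" => 13
notation "aVal" => 14
notation "aNxt" => 15
notation "aHead" => 16
notation "aHash" => 17
notation "aLo" => 18
notation "aHi" => 19
notation "aBase" => 20
notation "aVT" => 21
notation "aDone" => 22

attribute [simp] Cmd.run Expr.eval Test.Holds Function.update_apply

/-! ## Loops over a bag -/

/-- The array `aBL` lists the elements of `B`. -/
def BagList {n : ℕ} (s : State) (B : Finset (Fin n)) : Prop :=
  ∃ l : List (Fin n), l.Nodup ∧ l.toFinset = B ∧ s.reg rBag = l.length ∧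
    ∀ (i : ℕ) (h : i < l.length), s.arr aBL i = l[i]

theorem BagList.congr {n : ℕ} {s s' : State} {B : Finset (Fin n)} (h : BagList s B)
    (h1 : s'.reg rBag = s.reg rBag) (h2 : s'.arr aBL = s.arr aBL) : BagList s' B := by
  obtain ⟨l, hl⟩ := h
  exact ⟨l, by rwa [h1, h2]⟩

/-- Run `p` for all vertices `v` in the bag. -/
def Cmd.forBag (i v : ℕ) (p : Cmd) : Cmd := .forc i (.var rBag) (.assign v (.get aBL (.var i)) ;; p)

/-- The invariant speaks of the set of treated vertices and not of their order in the list. It has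
to survive any value of the loop counter, hence the quantifier over `j`. -/
theorem Runs.forBag {D : ℕ → ℝ≥0} {n : ℕ} {s : State} {B : Finset (Fin n)} (hB : BagList s B)
    {i rv : ℕ} {p : Cmd} {T T' : ℕ} (I : Finset (Fin n) → State → Prop)
    (hi : Cmd.writesReg (.assign rv (.get aBL (.var i)) ;; p) i = false)
    (hb : (Cmd.forBag i rv p).writesReg rBag = false)
    (hl : (Cmd.forBag i rv p).writesArr aBL = false)
    (h0 : I ∅ (s.setReg i 0))
    (hs : ∀ X v s', X ⊆ B → v ∈ B → v ∉ X → (Cmd.forBag i rv p).Keeps s s' → I X s' →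
      Runs D p (s'.setReg rv v) T fun s'' => ∀ j, I (insert v X) (s''.setReg i j))
    (hT : B.card * (T + 10) + 5 ≤ T') :
    Runs D (Cmd.forBag i rv p) s T' (I B) := by
  obtain ⟨l, hnd, hlB, hlen, hget⟩ := hB
  have hcard : B.card = l.length := by rw [← hlB, List.toFinset_card_of_nodup hnd]
  refine (Runs.forc (T := T + 3) (fun j s' => I (l.take j).toFinset s') l.length hi ?_
    (by simpa using h0) ?_ (T' := T') ?_).mono le_rfl ?_
  · intro s' hk
    simp only [Expr.eval]
    rw [hk.reg _ hb, hlen]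
  · intro j s' hj hk hij hI
    have hv : s'.arr aBL j = l[j] := by rw [hk.arr _ hl, hget j hj]
    have htake : (l.take (j + 1)).toFinset = insert l[j] (l.take j).toFinset := by
      rw [← List.take_append_getElem hj, List.toFinset_append]
      ext; simp [or_comm]
    refine Runs.seq_le (T₁ := 3) (T₂ := T) (Q := fun s'' => s'' = s'.setReg rv l[j])
      (Runs.straight_le rfl le_rfl (by simp [Cmd.run, Expr.eval, hij, hv])) ?_ (by omega)
    rintro _ _ rfl
    refine (hs (l.take j).toFinset l[j] s' ?_ ?_ ?_ hk hI).mono le_rfl fun s'' _ h => ?_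
    · intro x hx
      rw [← hlB, List.mem_toFinset]
      exact List.mem_of_mem_take (List.mem_toFinset.1 hx)
    · rw [← hlB, List.mem_toFinset]; exact List.getElem_mem hj
    · rw [List.mem_toFinset]
      intro hmem
      obtain ⟨i', hi', he⟩ := List.getElem_of_mem hmem
      rw [List.length_take] at hi'
      rw [List.getElem_take] at he
      have := (List.Nodup.getElem_inj_iff hnd).1 he
      omega
    · rw [htake]; exact h _
  · simp only [Expr.cost]
    rw [hcard] at hT
    have : l.length * (T + 3 + 1 + 6) = l.length * (T + 10) := by ring
    omega
  · intro s' _ h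
    have := h.1
    rwa [List.take_length, hlB] at this

/-! ## Tables in memory -/

variable {n : ℕ} {D : ℕ → ℝ≥0}

/-- The precomputed numbers: multiples of `n` and of powers of `n`. -/
structure Consts (n m : ℕ) (s : State) : Prop where
  n_eq : s.reg rn = n
  two_le : 2 ≤ n
  mul : ∀ i < 2 * n + m, s.arr aMul i = i * n
  pow : ∀ v < 2 * n, ∀ c < n, s.arr aMP (v * n + c) = c * n ^ v
  nn : s.reg rNn = n ^ n
  nnn : s.reg rNnn = n ^ (2 * n)

/-- The default arguments evaluate the write sets of a concrete program, so that a use needs nothing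
but `hk`. The later `congr` and `keeps` lemmas with default arguments work in the same way. -/
theorem Consts.congr {m : ℕ} {s s' : State} (h : Consts n m s) {p : Cmd} (hk : p.Keeps s s')
    (h0 : p.writesReg rn = false := by rfl) (h1 : p.writesReg rNn = false := by rfl)
    (h2 : p.writesReg rNnn = false := by rfl) (h3 : p.writesArr aMul = false := by rfl)
    (h4 : p.writesArr aMP = false := by rfl) : Consts n m s' where
  n_eq := by rw [hk.reg _ h0, h.n_eq]
  two_le := h.two_le
  mul := by rw [hk.arr _ h3]; exact h.mul
  pow := by rw [hk.arr _ h4]; exact h.pow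
  nn := by rw [hk.reg _ h1, h.nn]
  nnn := by rw [hk.reg _ h2, h.nnn]

/-- The code of the centers of a state. -/
def fcode (f : Fin n → ℕ) : ℕ := ∑ v : Fin n, f v * n ^ (v : ℕ)

/-- The code of the component labels of a state. -/
def rcode (r : Fin n → ℕ) : ℕ := ∑ v : Fin n, r v * n ^ (n + v : ℕ)

theorem fcode_lt {f : Fin n → ℕ} (hf : ∀ v, f v < n) : fcode f < n ^ n :=
  sum_fin_digits_lt fun v => ⟨f v, hf v⟩

theorem rcode_eq (r : Fin n → ℕ) : rcode r = n ^ n * fcode r := by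
  simp only [rcode, fcode, Finset.mul_sum]
  exact Finset.sum_congr rfl fun v _ => by rw [pow_add]; ring

theorem fcode_inj {f g : Fin n → ℕ} (hf : ∀ v, f v < n) (hg : ∀ v, g v < n)
    (h : fcode f = fcode g) : f = g := by
  funext v
  have e : ∀ f : Fin n → ℕ, ∑ i ∈ Finset.range n, (if h : i < n then f ⟨i, h⟩ else 0) * n ^ i =
      fcode f := fun f => by rw [Finset.sum_range]; simp [fcode]
  have := sum_digits_inj (n := n) (fun i => if h : i < n then f ⟨i, h⟩ else 0)
    (fun i => if h : i < n then g ⟨i, h⟩ else 0) n (fun i hi => by simp [hi, hf])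
    (fun i hi => by simp [hi, hg]) (by rw [e, e, h]) v v.2
  simpa using this

/-- Centers and labels are the two digits of the code in base `n ^ n`, so different states get
different cells of `aHash`. -/
theorem code_inj {κ κ' : Key n} (h1 : ∀ v, κ.1 v < n) (h2 : ∀ v, κ.2 v < n)
    (h1' : ∀ v, κ'.1 v < n) (h2' : ∀ v, κ'.2 v < n)
    (h : fcode κ.1 + rcode κ.2 = fcode κ'.1 + rcode κ'.2) : κ = κ' := by
  rw [rcode_eq, rcode_eq] at h
  have l1 := fcode_lt h1
  have l2 := fcode_lt h1'
  have e : ∀ x y : ℕ, x < n ^ n → (x + n ^ n * y) / n ^ n = y := fun x y hx => by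
    rw [Nat.add_mul_div_left _ _ (by omega), Nat.div_eq_of_lt hx, zero_add]
  have hr : fcode κ.2 = fcode κ'.2 := by rw [← e _ (fcode κ.2) l1, h, e _ _ l2]
  rw [hr] at h
  exact Prod.ext (fcode_inj h1 h1' (by omega)) (fcode_inj h2 h2' hr)

/-- The reason why a block of `n ^ (2 * n)` cells for each table is enough. -/
theorem code_lt {κ : Key n} (h1 : ∀ v, κ.1 v < n) (h2 : ∀ v, κ.2 v < n) :
    fcode κ.1 + rcode κ.2 < n ^ (2 * n) := by
  rw [rcode_eq]
  have l1 := fcode_lt h1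
  have l2 : fcode κ.2 + 1 ≤ n ^ n := fcode_lt h2
  have : n ^ n * (fcode κ.2 + 1) ≤ n ^ n * n ^ n := Nat.mul_le_mul_left _ l2
  rw [two_mul, pow_add]
  rw [mul_add, mul_one] at this
  omega

/-- The keys that occur in a table for the bag `B`. -/
structure GoodKey (B : Finset (Fin n)) (κ : Key n) : Prop where
  eq : mkKey B κ.1 κ.2 = κ
  lt : ∀ v ∈ B, κ.1 v < n

theorem GoodKey.fst_lt {B : Finset (Fin n)} {κ : Key n} (h : GoodKey B κ) (v : Fin n) :
    κ.1 v < n := by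
  by_cases hv : v ∈ B
  · exact h.lt v hv
  · rw [← h.eq]; simp [mkKey, hv, v.pos]

theorem GoodKey.snd_lt {B : Finset (Fin n)} {κ : Key n} (h : GoodKey B κ) (v : Fin n) :
    κ.2 v < n := by
  rw [← h.eq]
  by_cases hv : v ∈ B
  · exact canon_lt _ hv
  · simp [mkKey, canon_of_notMem hv, v.pos]

theorem goodKey_mkKey {B : Finset (Fin n)} {F R : Fin n → ℕ} (hF : ∀ v ∈ B, F v < n) :
    GoodKey B (mkKey B F R) where
  eq := mkKey_congr (fun x hx => mkKey_fst hx) fun x hx y hy => mkKey_snd_eq_iff hx hy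
  lt v hv := by rw [mkKey_fst hv]; exact hF v hv

/-- `e` is the address of the last of the first `i` entries whose centers have the code `c`, or `0`
if there is none; entry `j` has the address `lo + n * j`. -/
def LastEntry (ks : ℕ → Key n) (lo c i e : ℕ) : Prop :=
  (e = 0 ∧ ∀ j < i, fcode (ks j).1 ≠ c) ∨
    ∃ j < i, fcode (ks j).1 = c ∧ e = lo + n * j ∧ ∀ j', j < j' → j' < i → fcode (ks j').1 ≠ c

/-- The `m` entries with the states `ks i` and the values `vs i` are stored in memory from address
`lo` on. -/
structure Table (s : State) (B : Finset (Fin n)) (lo base m : ℕ) (ks : ℕ → Key n) (vs : ℕ → ℕ) :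
    Prop where
  -- Address `0` is reserved: in `aHash`, `aHead` and `aNxt` it means that there is no entry.
  lo_pos : 0 < lo
  good : ∀ i < m, GoodKey B (ks i)
  inj : ∀ i < m, ∀ j < m, ks i = ks j → i = j
  ef : ∀ i < m, ∀ v ∈ B, s.arr aEF (lo + n * i + v) = (ks i).1 v
  er : ∀ i < m, ∀ v ∈ B, s.arr aER (lo + n * i + v) = (ks i).2 v
  val : ∀ i < m, s.arr aVal (lo + n * i) = vs i
  head : ∀ c < n ^ n, LastEntry ks lo c m (s.arr aHead (base + c))
  -- Like `head`, but among the entries before `i`; this links all entries with equal centers to a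
  -- list.
  nxt : ∀ i < m, LastEntry ks lo (fcode (ks i).1) i (s.arr aNxt (lo + n * i))

/-- The set of entries of a table. -/
def tab (m : ℕ) (ks : ℕ → Key n) (vs : ℕ → ℕ) : Set (Key n × ℕ) := {e | ∃ i < m, e = (ks i, vs i)}

/-- The tables below address `lo` and the heads below `hb` are the same in `s` and `s'`. -/
structure SameBelow (lo hb : ℕ) (s s' : State) : Prop where
  ef : ∀ x < lo, s'.arr aEF x = s.arr aEF x
  er : ∀ x < lo, s'.arr aER x = s.arr aER x
  val : ∀ x < lo, s'.arr aVal x = s.arr aVal x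
  nxt : ∀ x < lo, s'.arr aNxt x = s.arr aNxt x
  head : ∀ x < hb, s'.arr aHead x = s.arr aHead x

theorem SameBelow.refl (lo hb : ℕ) (s : State) : SameBelow lo hb s s := by
  constructor <;> intros <;> rfl

theorem Table.congr {s s' : State} {B : Finset (Fin n)} {lo base m lo' hb : ℕ} {ks : ℕ → Key n}
    {vs : ℕ → ℕ} (h : Table s B lo base m ks vs) (hs : SameBelow lo' hb s s')
    (hn : 0 < n) (h1 : lo + n * m ≤ lo') (h2 : base + n ^ n ≤ hb) : Table s' B lo base m ks vs := by
  have key : ∀ i < m, ∀ v < n, lo + n * i + v < lo' := fun i hi v hv => by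
    have : n * (i + 1) ≤ n * m := Nat.mul_le_mul_left _ hi
    rw [mul_add, mul_one] at this
    omega
  exact ⟨h.lo_pos, h.good, h.inj,
    fun i hi v hv => by rw [hs.ef _ (key i hi v v.2), h.ef i hi v hv],
    fun i hi v hv => by rw [hs.er _ (key i hi v v.2), h.er i hi v hv],
    fun i hi => by rw [hs.val _ (by simpa using key i hi 0 hn), h.val i hi],
    fun c hc => by rw [hs.head _ (by omega)]; exact h.head c hc,
    fun i hi => by rw [hs.nxt _ (by simpa using key i hi 0 hn)]; exact h.nxt i hi⟩

/-- The table under construction, with entries that dominate `S`. -/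
structure Building (s₀ s : State) (B : Finset (Fin n)) (lo : ℕ) (m : ℕ) (ks : ℕ → Key n)
    (vs : ℕ → ℕ) : Prop where
  table : Table s B lo (s.reg rBase) m ks vs
  ptr : s.reg rPtr = lo + n * m
  same : SameBelow lo (s.reg rBase) s₀ s
  hash : ∀ i < m, s.arr aHash (s.reg rBase + (fcode (ks i).1 + rcode (ks i).2)) = lo + n * i
  -- A cell of the block is nonzero only if its state is present, which makes the lookup work
  -- without initialization.
  fresh : ∀ c, (∀ i < m, fcode (ks i).1 + rcode (ks i).2 ≠ c) →
    s.arr aHash (s.reg rBase + c) = 0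
  -- Center codes are below `n ^ n`, so the heads for later blocks are still untouched.
  fresh' : ∀ c, n ^ n ≤ c → s.arr aHead (s.reg rBase + c) = 0

/-- The postcondition of everything that inserts entries: `S` collects all entries offered so far,
of which the table keeps one of least value for each key. -/
def Filled (s₀ s : State) (B : Finset (Fin n)) (lo : ℕ) (S : Set (Key n × ℕ)) : Prop :=
  ∃ m ks vs, Building s₀ s B lo m ks vs ∧ Dominates (tab m ks vs) S

/-! ## Insertion into the table -/

/-- The least vertex with the same label as `rV`. -/
def findMin : Cmd :=
  .assign rMin (.var rV) ;;
  .forBag rJ rU (.ite (.and (.eq (.get aWR (.var rU)) (.get aWR (.var rV)))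
    (.lt (.var rU) (.var rMin))) (.assign rMin (.var rU)) .nop)

theorem findMin_runs {s : State} {B : Finset (Fin n)} (hB : BagList s B) {v : Fin n} (hv : v ∈ B)
    (hs : s.reg rV = v) :
    Runs D findMin s (22 * B.card + 7) fun s' =>
      s'.reg rMin = canon B (fun u => s.arr aWR u) v := by
  refine Runs.seq_le (T₁ := 2) (T₂ := 22 * B.card + 5) (Q := fun s' => s' = s.setReg rMin v)
    (Runs.straight_le rfl le_rfl (by simp [Cmd.run, Expr.eval, hs])) ?_ (by omega)
  rintro _ _ rfl
  refine (Runs.forBag (hB.congr (by simp) (by simp)) (T := 12) (T' := 22 * B.card + 5)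
    (fun X s' => (∃ w ∈ B, (w : ℕ) = s'.reg rMin ∧ s.arr aWR w = s.arr aWR v) ∧
      ∀ u ∈ X, s.arr aWR u = s.arr aWR v → s'.reg rMin ≤ u) rfl rfl rfl ?_ ?_ (by omega)).mono
      le_rfl ?_
  · simpa using ⟨v, hv, rfl, rfl⟩
  · rintro X u s' _ hu _ hk ⟨⟨w, hw, hwm, hwv⟩, h2⟩
    have e1 : s'.arr aWR = s.arr aWR := by rw [hk.arr _ rfl]; rfl
    have e2 : s'.reg rV = v := by rw [hk.reg _ rfl]; simpa using hs
    by_cases h : s.arr aWR u = s.arr aWR v ∧ (u : ℕ) < s'.reg rMin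
    · refine Runs.straight_le rfl (by decide) ?_
      simp [e1, e2, h]
      refine ⟨⟨u, hu, rfl, h.1⟩, fun x hx hxv => ?_⟩
      have := h2 x hx hxv
      omega
    · refine Runs.straight_le rfl (by decide) ?_
      simp [e1, e2, h]
      exact ⟨⟨w, hw, hwm, hwv⟩, fun h' => by simpa [h'] using h, h2⟩
  · rintro s' _ ⟨⟨w, hw, hwm, hwv⟩, h2⟩
    refine le_antisymm ?_ ?_
    · obtain ⟨w', hw', h3, h4⟩ := canon_spec (fun u : Fin n => s.arr aWR u) hv
      rw [← h3]
      exact h2 w' hw' h4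
    · rw [← hwm]
      exact canon_le hv hw hwv

/-- Compute the canonical labels and the codes of the state in the work area. -/
def computeCodes : Cmd :=
  .assign rFc (.lit 0) ;; .assign rRc (.lit 0) ;;
  .forBag rI rV (findMin ;; .store aCR (.var rV) (.var rMin) ;;
    .assign rFc (.add (.var rFc) (.get aMP (.add (.get aMul (.var rV)) (.get aWF (.var rV))))) ;;
    .assign rRc (.add (.var rRc)
      (.get aMP (.add (.get aMul (.add (.var rn) (.var rV))) (.var rMin)))))

theorem fcode_mkKey (B : Finset (Fin n)) (F R : Fin n → ℕ) :
    fcode (mkKey B F R).1 = ∑ v ∈ B, F v * n ^ (v : ℕ) := by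
  simp [fcode, mkKey, ite_mul]

theorem rcode_mkKey (B : Finset (Fin n)) (F R : Fin n → ℕ) :
    rcode (mkKey B F R).2 = ∑ v ∈ B, canon B R v * n ^ (n + v : ℕ) := by
  rw [rcode, ← Finset.sum_subset (Finset.subset_univ B) fun v _ hv => ?_]
  · rfl
  · simp [mkKey, canon_of_notMem hv]

theorem computeCodes_runs {N : ℕ} {s : State} {B : Finset (Fin n)} (hC : Consts n N s)
    (hB : BagList s B) (hF : ∀ v ∈ B, s.arr aWF v < n) :
    Runs D computeCodes s ((22 * B.card + 50) * B.card + 10) fun s' =>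
      s'.reg rFc = fcode (mkKey B (fun v => s.arr aWF v) fun v => s.arr aWR v).1 ∧
      s'.reg rRc = rcode (mkKey B (fun v => s.arr aWF v) fun v => s.arr aWR v).2 ∧
      ∀ v ∈ B, s'.arr aCR v = (mkKey B (fun v => s.arr aWF v) fun v => s.arr aWR v).2 v := by
  rw [fcode_mkKey, rcode_mkKey]
  set R : Fin n → ℕ := fun v => s.arr aWR v with hR
  refine Runs.seq_le (T₁ := 2) (T₂ := (22 * B.card + 50) * B.card + 8)
    (Q := fun s' => s' = s.setReg rFc 0) (Runs.straight_le rfl le_rfl rfl) ?_ (by omega)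
  rintro _ _ rfl
  refine Runs.seq_le (T₁ := 2) (T₂ := (22 * B.card + 50) * B.card + 6)
    (Q := fun s' => s' = (s.setReg rFc 0).setReg rRc 0) (Runs.straight_le rfl le_rfl rfl) ?_
    (by omega)
  rintro _ _ rfl
  refine (Runs.forBag (hB.congr (by simp) (by simp)) (T := 22 * B.card + 40)
    (fun X s' => s'.reg rFc = ∑ v ∈ X, s.arr aWF v * n ^ (v : ℕ) ∧
      s'.reg rRc = ∑ v ∈ X, canon B R v * n ^ (n + v : ℕ) ∧
      ∀ v ∈ X, s'.arr aCR v = canon B R v) rfl rfl rfl (by simp) ?_ (by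
        have : B.card * (22 * B.card + 40 + 10) = (22 * B.card + 50) * B.card := by ring
        omega)).mono le_rfl fun _ _ h => h
  rintro X v s' _ hv hvX hk ⟨h1, h2, h3⟩
  have e1 : s'.arr aWR = s.arr aWR := hk.arr _ rfl
  have e2 : s'.arr aWF = s.arr aWF := hk.arr _ rfl
  have eC : Consts n N s' := by
    refine Consts.congr (s := (s.setReg rFc 0).setReg rRc 0) ?_ hk
    exact ⟨by simpa using hC.n_eq, hC.two_le, hC.mul, hC.pow, by simpa using hC.nn,
      by simpa using hC.nnn⟩
  have eB : BagList s' B := hB.congr (hk.reg _ rfl) (hk.arr _ rfl)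
  refine Runs.seq_le (findMin_runs (eB.congr (by simp) (by simp)) hv (by simp)) (T₂ := 33) ?_
    (by omega)
  intro s'' hk' hm
  rw [State.setReg_arr, e1] at hm
  refine Runs.straight_le rfl (by decide) ?_
  have g1 : s''.arr aMul = s'.arr aMul := hk'.arr _ rfl
  have g2 : s''.arr aMP = s'.arr aMP := hk'.arr _ rfl
  have g3 : s''.arr aWF = s.arr aWF := (hk'.arr _ rfl).trans e2
  have g4 : s''.reg rV = v := by rw [hk'.reg _ rfl]; simp
  have g5 : s''.reg rn = n := by rw [hk'.reg _ rfl]; simpa using eC.n_eq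
  have g6 : s''.reg rFc = s'.reg rFc := by rw [hk'.reg _ rfl]; simp
  have g7 : s''.reg rRc = s'.reg rRc := by rw [hk'.reg _ rfl]; simp
  have g8 : s''.arr aCR = s'.arr aCR := by rw [hk'.arr _ rfl]; simp
  have hv2 : (v : ℕ) < n := v.2
  have c1 : s'.arr aMul v = v * n := eC.mul v (by omega)
  have c2 : s'.arr aMul (n + v) = (n + v) * n := eC.mul _ (by omega)
  have c3 := eC.pow v (by omega) _ (hF v hv)
  have c4 := eC.pow (n + v) (by omega) (canon B R v) (canon_lt _ hv)
  have hm' : s''.reg rMin = canon B R v := hm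
  intro j
  simp [g1, g2, g3, g4, g5, g6, g7, g8, hm', c1, c2, c3, c4, h1, h2, Finset.sum_insert hvX]
  refine ⟨by ring, by ring, fun u hu => ?_⟩
  have : (u : ℕ) ≠ v := fun h => hvX (Fin.ext h ▸ hu)
  simp [this, h3 u hu]

end ConnectedKCenter

namespace ConnectedKCenter

variable {n : ℕ} {D : ℕ → ℝ≥0}

theorem LastEntry.congr {ks ks' : ℕ → Key n} {lo c i e : ℕ} (h : LastEntry ks lo c i e)
    (hk : ∀ j < i, ks' j = ks j) : LastEntry ks' lo c i e := by
  rcases h with ⟨h1, h2⟩ | ⟨j, h1, h2, h3, h4⟩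
  · exact .inl ⟨h1, fun j hj => by rw [hk j hj]; exact h2 j hj⟩
  · exact .inr ⟨j, h1, by rw [hk j h1, h2], h3,
      fun j' hj hj' => by rw [hk j' hj']; exact h4 j' hj hj'⟩

theorem LastEntry.succ_of_eq {ks : ℕ → Key n} {lo c i : ℕ} (h : fcode (ks i).1 = c) :
    LastEntry ks lo c (i + 1) (lo + n * i) :=
  .inr ⟨i, by omega, h, rfl, fun _ _ _ => by omega⟩

theorem LastEntry.succ_of_ne {ks : ℕ → Key n} {lo c i e : ℕ} (h : LastEntry ks lo c i e)
    (hc : fcode (ks i).1 ≠ c) : LastEntry ks lo c (i + 1) e := by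
  have key : ∀ j < i + 1, j ≠ i → j < i := fun j _ _ => by omega
  rcases h with ⟨h1, h2⟩ | ⟨j, h1, h2, h3, h4⟩
  · refine .inl ⟨h1, fun j hj => ?_⟩
    by_cases h : j = i
    · exact h ▸ hc
    · exact h2 j (key j hj h)
  · refine .inr ⟨j, by omega, h2, h3, fun j' hj hj' => ?_⟩
    by_cases h : j' = i
    · exact h ▸ hc
    · exact h4 j' hj (key j' hj' h)

/-- The entry at a new address. -/
def newEntry : Cmd :=
  .assign rQ (.var rPtr) ;; .assign rPtr (.add (.var rPtr) (.var rn)) ;;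
  .store aHash (.add (.var rBase) (.add (.var rFc) (.var rRc))) (.var rQ) ;;
  .store aVal (.var rQ) (.var rVal) ;;
  .store aNxt (.var rQ) (.get aHead (.add (.var rBase) (.var rFc))) ;;
  .store aHead (.add (.var rBase) (.var rFc)) (.var rQ)

/-- Copy the state in the work area to the address `rQ`. -/
def copyState : Cmd :=
  .forBag rI rV (.store aEF (.add (.var rQ) (.var rV)) (.get aWF (.var rV)) ;;
    .store aER (.add (.var rQ) (.var rV)) (.get aCR (.var rV)))

/-- Insert the state in the work area with the value `rVal` into the table. -/
def insertState : Cmd :=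
  computeCodes ;;
  .assign rQ (.get aHash (.add (.var rBase) (.add (.var rFc) (.var rRc)))) ;;
  .ite (.eq (.var rQ) (.lit 0)) (newEntry ;; copyState)
    (.ite (.lt (.var rVal) (.get aVal (.var rQ))) (.store aVal (.var rQ) (.var rVal)) .nop)

theorem copyState_runs {s : State} {B : Finset (Fin n)} (hB : BagList s B) :
    Runs D copyState s (30 * B.card + 5) fun s' =>
      (∀ v ∈ B, s'.arr aEF (s.reg rQ + v) = s.arr aWF v ∧
        s'.arr aER (s.reg rQ + v) = s.arr aCR v) ∧
      ∀ x < s.reg rQ, s'.arr aEF x = s.arr aEF x ∧ s'.arr aER x = s.arr aER x := by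
  refine (Runs.forBag hB (T := 14) (fun X s' =>
      (∀ v ∈ X, s'.arr aEF (s.reg rQ + v) = s.arr aWF v ∧
        s'.arr aER (s.reg rQ + v) = s.arr aCR v) ∧
      ∀ x < s.reg rQ, s'.arr aEF x = s.arr aEF x ∧ s'.arr aER x = s.arr aER x)
      rfl rfl rfl (by simp) ?_ (by omega)).mono le_rfl fun _ _ h => h
  rintro X v s' _ _ hvX hk ⟨h1, h2⟩
  have e1 : s'.reg rQ = s.reg rQ := hk.reg _ rfl
  have e2 : s'.arr aWF = s.arr aWF := hk.arr _ rfl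
  have e3 : s'.arr aCR = s.arr aCR := hk.arr _ rfl
  refine Runs.straight_le rfl (by decide) ?_
  intro j
  simp [e1, e2, e3]
  refine ⟨fun u hu => ?_, fun x hx => ?_⟩
  · have : (u : ℕ) ≠ v := fun h => hvX (Fin.ext h ▸ hu)
    simp [this, h1 u hu]
  · have : x ≠ s.reg rQ + v := by omega
    simp [this, h2 x hx]

theorem Dominates.insert {m : ℕ} {ks : ℕ → Key n} {vs : ℕ → ℕ} {S : Set (Key n × ℕ)} {κ : Key n}
    {x : ℕ} (h : Dominates (tab m ks vs) S) :
    Dominates (tab (m + 1) (Function.update ks m κ) (Function.update vs m x)) (S ∪ {(κ, x)}) where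
  sub := by
    rintro _ ⟨i, hi, rfl⟩
    by_cases him : i = m
    · subst him
      exact .inr (by simp)
    · exact .inl (h.sub ⟨i, by omega, by simp [him]⟩)
  le κ' x' h' := by
    rcases h' with h' | h'
    · obtain ⟨y, hy, i, hi, he⟩ := h.le κ' x' h'
      exact ⟨y, hy, i, by omega, by rw [he]; simp [hi.ne]⟩
    · obtain ⟨rfl, rfl⟩ := Prod.mk_inj.1 h'
      exact ⟨_, le_rfl, m, by omega, by simp⟩

theorem Dominates.improve {m i : ℕ} {ks : ℕ → Key n} {vs : ℕ → ℕ} {S : Set (Key n × ℕ)}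
    {x : ℕ} (h : Dominates (tab m ks vs) S) (hi : i < m) :
    Dominates (tab m ks (Function.update vs i (min x (vs i)))) (S ∪ {(ks i, x)}) where
  sub := by
    rintro _ ⟨j, hj, rfl⟩
    by_cases hji : j = i
    · subst hji
      rcases le_total x (vs j) with hx | hx
      · exact .inr (by simp [hx])
      · exact .inl (h.sub ⟨j, hj, by simp [hx]⟩)
    · exact .inl (h.sub ⟨j, hj, by simp [hji]⟩)
  le κ' x' h' := by
    rcases h' with h' | h'
    · obtain ⟨y, hy, j, hj, he⟩ := h.le κ' x' h'
      obtain ⟨rfl, rfl⟩ := Prod.mk_inj.1 he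
      by_cases hji : j = i
      · subst hji
        exact ⟨min x (vs j), (min_le_right _ _).trans hy, j, hj, by simp⟩
      · exact ⟨vs j, hy, j, hj, by simp [hji]⟩
    · obtain ⟨rfl, rfl⟩ := Prod.mk_inj.1 h'
      exact ⟨min x' (vs i), min_le_left _ _, i, hi, by simp⟩

/-- The cell of `aHash` at the code of the state tells whether the state is present. If so, at most
its value is improved; otherwise an entry is appended at `rPtr` and becomes the head of the list for
its centers. The time is dominated by the canonical labels, which take a quadratic number of steps
in the size of the bag. -/
theorem insertState_runs {N : ℕ} {s₀ s : State} {B : Finset (Fin n)} {lo : ℕ}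
    {S : Set (Key n × ℕ)} (hC : Consts n N s) (hB : BagList s B) (hF : ∀ v ∈ B, s.arr aWF v < n)
    (hS : Filled s₀ s B lo S) :
    Runs D insertState s (100 * (B.card + 1) ^ 2) fun s' =>
      Filled s₀ s' B lo
        (S ∪ {(mkKey B (fun v => s.arr aWF v) (fun v => s.arr aWR v), s.reg rVal)}) := by
  obtain ⟨m, ks, vs, hb, hd⟩ := hS
  have hn : 0 < n := by have := hC.two_le; omega
  set κ := mkKey B (fun v => s.arr aWF v) (fun v => s.arr aWR v) with hκ
  have hgood : GoodKey B κ := goodKey_mkKey hF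
  refine Runs.seq_le (computeCodes_runs hC hB hF) (T₂ := 30 * B.card + 80) ?_ (by nlinarith)
  rintro s' hk ⟨h1, h2, h3⟩
  rw [← hκ] at h1 h2 h3
  have r1 : s'.reg rBase = s.reg rBase := hk.reg _ rfl
  have r2 : s'.arr aHash = s.arr aHash := hk.arr _ rfl
  have r3 : s'.reg rVal = s.reg rVal := hk.reg _ rfl
  have r4 : s'.arr aVal = s.arr aVal := hk.arr _ rfl
  have r5 : s'.arr aNxt = s.arr aNxt := hk.arr _ rfl
  have r6 : s'.arr aHead = s.arr aHead := hk.arr _ rfl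
  have r7 : s'.arr aEF = s.arr aEF := hk.arr _ rfl
  have r8 : s'.arr aER = s.arr aER := hk.arr _ rfl
  have r9 : s'.reg rPtr = lo + n * m := (hk.reg _ rfl).trans hb.ptr
  have r10 : s'.reg rn = n := (hk.reg _ rfl).trans hC.n_eq
  have r11 : s'.arr aWF = s.arr aWF := hk.arr _ rfl
  have r12 : BagList s' B := hB.congr (hk.reg _ rfl) (hk.arr _ rfl)
  set q := s.arr aHash (s.reg rBase + (fcode κ.1 + rcode κ.2)) with hq
  refine Runs.seq_le (T₁ := 7) (T₂ := 30 * B.card + 70) (Q := fun s'' => s'' = s'.setReg rQ q)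
    (Runs.straight_le rfl (by decide) (by simp [r1, r2, h1, h2, hq])) ?_ (by omega)
  rintro _ _ rfl
  have hcode : ∀ i < m, ks i ≠ κ → fcode (ks i).1 + rcode (ks i).2 ≠ fcode κ.1 + rcode κ.2 :=
    fun i hi hne h => hne (code_inj (hb.table.good i hi).fst_lt (hb.table.good i hi).snd_lt
      hgood.fst_lt hgood.snd_lt h)
  by_cases hex : ∃ i < m, ks i = κ
  · obtain ⟨i, hi, hik⟩ := hex
    have hqi : q = lo + n * i := by rw [hq, ← hik]; exact hb.hash i hi
    have hlo := hb.table.lo_pos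
    refine Runs.ite_le (T₁ := 20) (fun h => ?_) (fun _ => ?_) (by simp [Test.cost, Expr.cost])
    · simp [hqi] at h
      omega
    -- Storing the minimum describes both branches: if nothing is written, the cell holds the
    -- minimum already.
    refine Runs.mono (Q := fun s'' => s'' = (s'.setReg rQ q).setArr aVal q (min (s.reg rVal) (vs i)))
      (T := 20) (Runs.straight_le rfl (by decide) ?_) le_rfl ?_
    · have hv := hb.table.val i hi
      rw [← hqi] at hv
      by_cases hlt : s.reg rVal < vs i
      · simp [r3, r4, hv, hlt, hlt.le]
      · have hle : vs i ≤ s.reg rVal := by omega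
        simp only [Cmd.run, Test.Holds, Expr.eval, State.setReg_reg, State.setReg_arr, r3, r4,
          reduceIte]
        norm_num [r3, hv, hlt, hle]
        simp [State.setArr, State.setReg, ← hv, ← r4]
    · rintro _ _ rfl
      refine ⟨m, ks, _, ⟨⟨hlo, hb.table.good, hb.table.inj, ?_, ?_, ?_, ?_, ?_⟩, ?_,
        ⟨?_, ?_, ?_, ?_, ?_⟩, ?_, ?_, ?_⟩, hik ▸ hd.improve hi⟩
      · simpa [r7] using hb.table.ef
      · simpa [r8] using hb.table.er
      · intro j hj
        by_cases hji : j = i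
        · subst hji; simp [hqi]
        · have : ¬ (n * j = n * i) := fun h => hji (Nat.eq_of_mul_eq_mul_left hn h)
          simp [hqi, this, hji, r4, hb.table.val j hj]
      · simpa [r6, r1] using hb.table.head
      · simpa [r5] using hb.table.nxt
      · simpa using r9
      · simpa [r7] using hb.same.ef
      · simpa [r8] using hb.same.er
      · intro x hx
        have : x ≠ q := by omega
        simp [this, r4, hb.same.val x hx]
      · simpa [r5] using hb.same.nxt
      · simpa [r6, r1] using hb.same.head
      · simpa [r2, r1] using hb.hash
      · simpa [r2, r1] using hb.fresh
      · simpa [r6, r1] using hb.fresh'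
  · have hne : ∀ i < m, ks i ≠ κ := fun i hi h => hex ⟨i, hi, h⟩
    have hq0 : q = 0 := hb.fresh _ fun i hi => hcode i hi (hne i hi)
    refine Runs.ite_le (T₁ := 30 * B.card + 60) (fun _ => ?_) (fun h => ?_)
      (by simp [Test.cost, Expr.cost]; omega)
    swap
    · simp [hq0] at h
    have hfl := fcode_lt hgood.fst_lt
    refine Runs.seq_le (T₁ := 55) (T₂ := 30 * B.card + 5) (Q := fun s₂ =>
        s₂.reg rQ = lo + n * m ∧ s₂.reg rPtr = lo + n * (m + 1) ∧ s₂.reg rBase = s.reg rBase ∧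
        (∀ x, s₂.arr aHash x = if x = s.reg rBase + (fcode κ.1 + rcode κ.2) then lo + n * m
          else s.arr aHash x) ∧
        (∀ x, s₂.arr aVal x = if x = lo + n * m then s.reg rVal else s.arr aVal x) ∧
        (∀ x, s₂.arr aNxt x = if x = lo + n * m then s.arr aHead (s.reg rBase + fcode κ.1)
          else s.arr aNxt x) ∧
        ∀ x, s₂.arr aHead x = if x = s.reg rBase + fcode κ.1 then lo + n * m
          else s.arr aHead x)
      (Runs.straight_le rfl (by decide) ?_) ?_ (by omega)
    · simp [newEntry, r1, r2, r3, r4, r5, r6, r9, r10, h1, h2]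
      ring
    rintro s₂ hk₂ ⟨t1, t2, t3, t4, t5, t6, t7⟩
    have u7 : s₂.arr aEF = s.arr aEF := by rw [hk₂.arr _ rfl]; simpa using r7
    have u8 : s₂.arr aER = s.arr aER := by rw [hk₂.arr _ rfl]; simpa using r8
    have u11 : s₂.arr aWF = s.arr aWF := by rw [hk₂.arr _ rfl]; simpa using r11
    have u12 : s₂.arr aCR = s'.arr aCR := by rw [hk₂.arr _ rfl]; simp
    refine (copyState_runs (r12.congr (by rw [hk₂.reg _ rfl]; simp)
      (by rw [hk₂.arr _ rfl]; simp))).mono le_rfl ?_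
    rintro s₃ hk₃ ⟨hc1, hc2⟩
    rw [t1] at hc1 hc2
    have w1 : s₃.reg rPtr = lo + n * (m + 1) := (hk₃.reg _ rfl).trans t2
    have w2 : s₃.reg rBase = s.reg rBase := (hk₃.reg _ rfl).trans t3
    have w3 : s₃.arr aHash = s₂.arr aHash := hk₃.arr _ rfl
    have w4 : s₃.arr aVal = s₂.arr aVal := hk₃.arr _ rfl
    have w5 : s₃.arr aNxt = s₂.arr aNxt := hk₃.arr _ rfl
    have w6 : s₃.arr aHead = s₂.arr aHead := hk₃.arr _ rfl
    have hltm : ∀ i < m, ∀ v < n, lo + n * i + v < lo + n * m := fun i hi v hv => by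
      have : n * (i + 1) ≤ n * m := Nat.mul_le_mul_left _ hi
      rw [mul_add, mul_one] at this
      omega
    have hltm0 : ∀ i < m, lo + n * i < lo + n * m := fun i hi => by
      simpa using hltm i hi 0 hn
    have hold : ∀ i < m, Function.update ks m κ i = ks i := fun i hi => by simp [hi.ne]
    have hcase : ∀ {i}, i < m + 1 → i ≠ m → i < m := fun h h' => by omega
    refine ⟨m + 1, _, _, ⟨⟨hb.table.lo_pos, ?_, ?_, ?_, ?_, ?_, ?_, ?_⟩, w1,
      ⟨?_, ?_, ?_, ?_, ?_⟩, ?_, ?_, ?_⟩, hd.insert⟩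
    · intro i hi
      by_cases him : i = m
      · subst him; simpa using hgood
      · rw [hold i (hcase hi him)]; exact hb.table.good i (hcase hi him)
    · intro i hi j hj hij
      by_cases him : i = m
      · by_cases hjm : j = m
        · omega
        · rw [hold j (hcase hj hjm), him, Function.update_self] at hij
          exact absurd hij.symm (hne j (hcase hj hjm))
      · rw [hold i (hcase hi him)] at hij
        by_cases hjm : j = m
        · rw [hjm, Function.update_self] at hij
          exact absurd hij (hne i (hcase hi him))
        · rw [hold j (hcase hj hjm)] at hij
          exact hb.table.inj i (hcase hi him) j (hcase hj hjm) hij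
    · intro i hi v hv
      by_cases him : i = m
      · subst him
        rw [(hc1 v hv).1, Function.update_self, u11, hκ, mkKey_fst hv]
      · rw [hold i (hcase hi him), (hc2 _ (hltm i (hcase hi him) v v.2)).1, u7,
          hb.table.ef i (hcase hi him) v hv]
    · intro i hi v hv
      by_cases him : i = m
      · subst him
        rw [(hc1 v hv).2, Function.update_self, u12, h3 v hv]
      · rw [hold i (hcase hi him), (hc2 _ (hltm i (hcase hi him) v v.2)).2, u8,
          hb.table.er i (hcase hi him) v hv]
    · intro i hi
      by_cases him : i = m
      · subst him
        simp [w4, t5]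
      · have := hltm0 i (hcase hi him)
        rw [w4, t5, if_neg (by omega), hb.table.val i (hcase hi him)]
        simp [him]
    · intro c hc
      rw [w6, w2, t7]
      by_cases hcc : c = fcode κ.1
      · rw [if_pos (by rw [hcc])]
        exact LastEntry.succ_of_eq (by simp [hcc])
      · rw [if_neg (by omega)]
        exact ((hb.table.head c hc).congr hold).succ_of_ne (by simpa using Ne.symm hcc)
    · intro i hi
      by_cases him : i = m
      · subst him
        rw [w5, t6, if_pos rfl, Function.update_self]
        -- The old head of the list becomes the successor of the new entry; the property of a head
        -- among `m` entries is just what `nxt` demands of entry `m`.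
        exact (hb.table.head _ hfl).congr hold
      · have := hltm0 i (hcase hi him)
        rw [w5, t6, if_neg (by omega), hold i (hcase hi him)]
        exact (hb.table.nxt i (hcase hi him)).congr fun j hj => hold j (hj.trans (hcase hi him))
    · intro x hx
      rw [(hc2 x (by omega)).1, u7, hb.same.ef x hx]
    · intro x hx
      rw [(hc2 x (by omega)).2, u8, hb.same.er x hx]
    · intro x hx
      rw [w4, t5, if_neg (by omega), hb.same.val x hx]
    · intro x hx
      rw [w5, t6, if_neg (by omega), hb.same.nxt x hx]
    · intro x hx
      rw [w2] at hx
      rw [w6, t7, if_neg (by omega), hb.same.head x hx]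
    · intro i hi
      by_cases him : i = m
      · subst him
        simp [w3, w2, t4]
      · have := hcode i (hcase hi him) (hne i (hcase hi him))
        rw [hold i (hcase hi him), w3, w2, t4, if_neg (by omega), hb.hash i (hcase hi him)]
    · intro c hc
      have h1 := hc m (by omega)
      rw [Function.update_self] at h1
      rw [w3, w2, t4, if_neg (by omega)]
      exact hb.fresh c fun i hi => by rw [← hold i hi]; exact hc i (by omega)
    · intro c hc
      rw [w6, w2, t7, if_neg (by omega)]
      exact hb.fresh' c hc

end ConnectedKCenter

namespace ConnectedKCenter

variable {n : ℕ} {D : ℕ → ℝ≥0}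

/-! ## Loops over a table -/

/-- The union of the first `i` sets. -/
def upTo {α : Type*} (C : ℕ → Set α) (i : ℕ) : Set α := {e | ∃ j < i, e ∈ C j}

theorem upTo_zero {α : Type*} (C : ℕ → Set α) : upTo C 0 = ∅ := by
  ext; simp [upTo]

theorem upTo_succ {α : Type*} (C : ℕ → Set α) (i : ℕ) : upTo C (i + 1) = upTo C i ∪ C i := by
  ext e
  constructor
  · rintro ⟨j, hj, he⟩
    rcases Nat.lt_succ_iff_lt_or_eq.1 hj with h | rfl
    · exact .inl ⟨j, h, he⟩
    · exact .inr he
  · rintro (⟨j, hj, he⟩ | he)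
    · exact ⟨j, by omega, he⟩
    · exact ⟨i, by omega, he⟩

/-- Run `p` for the addresses `rP` of all entries of the table of the node `rS`. -/
def Cmd.forEntries (p : Cmd) : Cmd :=
  .assign rP (.get aLo (.var rS)) ;;
  .loop (.lt (.var rP) (.get aHi (.var rS))) (p ;; .assign rP (.add (.var rP) (.var rn)))

/-- Addresses advance by `n`, so no multiplication is needed. The end is read from `aHi`, which `p`
must not write, so entries that `p` appends elsewhere are not visited. -/
theorem Runs.forEntries {s : State} {p : Cmd} {T T' lo m : ℕ} (I : ℕ → State → Prop)
    (hn : s.reg rn = n) (hn0 : 0 < n)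
    (hlo : s.arr aLo (s.reg rS) = lo) (hhi : s.arr aHi (s.reg rS) = lo + n * m)
    (hp : p.writesReg rP = false) (hpS : p.writesReg rS = false) (hpn : p.writesReg rn = false)
    (hph : p.writesArr aHi = false) (h0 : I 0 (s.setReg rP lo))
    (hs : ∀ i s', i < m → (Cmd.forEntries p).Keeps s s' → s'.reg rP = lo + n * i → I i s' →
      Runs D p s' T fun s'' => I (i + 1) (s''.setReg rP (lo + n * (i + 1))))
    (hT : m * (T + 8) + 8 ≤ T') :
    Runs D (Cmd.forEntries p) s T' (I m) := by
  refine seq_le (T₁ := 3) (T₂ := m * (T + 8) + 4) (Q := fun s' => s' = s.setReg rP lo)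
    (straight_le rfl le_rfl (by simp [hlo])) ?_ (by omega)
  rintro _ hk0 rfl
  have key : ∀ s', (Cmd.loop (.lt (.var rP) (.get aHi (.var rS)))
      (p ;; .assign rP (.add (.var rP) (.var rn)))).Keeps (s.setReg rP lo) s' →
      (Cmd.forEntries p).Keeps s s' := by
    intro s' hk
    refine Cmd.Keeps.trans (s' := s.setReg rP lo) ⟨fun y hy => ?_, fun _ _ => rfl⟩ (hk.mono ?_ ?_)
    · have : y ≠ rP := by rintro rfl; simp [Cmd.forEntries, Cmd.writesReg] at hy
      simp [this]
    · simp +contextual [Cmd.forEntries, Cmd.writesReg]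
    · simp +contextual [Cmd.forEntries, Cmd.writesArr]
  have hS : (Cmd.forEntries p).writesReg rS = false := by simp [Cmd.forEntries, Cmd.writesReg, hpS, Nat.beq]
  have hN : (Cmd.forEntries p).writesReg rn = false := by simp [Cmd.forEntries, Cmd.writesReg, hpn, Nat.beq]
  have hH : (Cmd.forEntries p).writesArr aHi = false := by simp [Cmd.forEntries, Cmd.writesArr, hph]
  refine (loop (T := T + 4) (fun i s' => s'.reg rP = lo + n * i ∧ i ≤ m ∧ I i s') m
    ⟨by simp, by omega, h0⟩ ?_).mono ?_ ?_
  · rintro i s' hk ⟨hi, him, hI⟩ hb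
    have hk' := key s' hk
    simp only [Test.Holds, Expr.eval, hi, hk'.reg _ hS, hk'.arr _ hH, hhi] at hb
    have him : i < m := by
      by_contra h
      have : m = i := by omega
      subst this
      omega
    refine ⟨him, seq_le (hs i s' him hk' hi hI) (T₂ := 4) ?_ le_rfl⟩
    intro s'' hk'' hI'
    have e1 : s''.reg rP = lo + n * i := (hk''.reg _ hp).trans hi
    have e2 : s''.reg rn = n := (hk''.reg _ hpn).trans ((hk'.reg _ hN).trans hn)
    refine straight_le rfl le_rfl ?_
    have e3 : lo + n * i + n = lo + n * (i + 1) := by ring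
    simp only [Cmd.run, Expr.eval, e1, e2, e3]
    exact ⟨by simp, by omega, hI'⟩
  · simp only [Test.cost, Expr.cost]
    have : m * (1 + (1 + 1) + 1 + (T + 4)) = m * (T + 8) := by ring
    omega
  · rintro s' hk ⟨i, hi, ⟨h1, h2, h3⟩, h4⟩
    have hk' := key s' hk
    simp only [Test.Holds, Expr.eval, h1, hk'.reg _ hS, hk'.arr _ hH, hhi] at h4
    have : i = m := by
      by_contra hne
      have : n * i < n * m := Nat.mul_lt_mul_of_pos_left (by omega) hn0
      omega
    exact this ▸ h3

/-- Copy the entry at the address `rP` to the work area. -/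
def loadState : Cmd :=
  .forBag rI rV (.store aWF (.var rV) (.get aEF (.add (.var rP) (.var rV))) ;;
    .store aWR (.var rV) (.get aER (.add (.var rP) (.var rV))))

theorem loadState_runs {s : State} {B : Finset (Fin n)} (hB : BagList s B) :
    Runs D loadState s (30 * B.card + 5) fun s' => ∀ v ∈ B,
      s'.arr aWF v = s.arr aEF (s.reg rP + v) ∧ s'.arr aWR v = s.arr aER (s.reg rP + v) := by
  refine (Runs.forBag hB (T := 14) (fun X s' => ∀ v ∈ X,
      s'.arr aWF v = s.arr aEF (s.reg rP + v) ∧ s'.arr aWR v = s.arr aER (s.reg rP + v))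
      rfl rfl rfl (by simp) ?_ (by omega)).mono le_rfl fun _ _ h => h
  rintro X v s' _ _ hvX hk h1
  have e1 : s'.reg rP = s.reg rP := hk.reg _ rfl
  have e2 : s'.arr aEF = s.arr aEF := hk.arr _ rfl
  have e3 : s'.arr aER = s.arr aER := hk.arr _ rfl
  refine Runs.straight_le rfl (by decide) ?_
  intro j
  simp [e1, e2, e3]
  intro u hu
  have : (u : ℕ) ≠ v := fun h => hvX (Fin.ext h ▸ hu)
  simp [this, h1 u hu]

/-- Give the label `rMin` to all vertices with the label `rQ`. -/
def relabel : Cmd :=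
  .forBag rJ rU (.ite (.eq (.get aWR (.var rU)) (.var rQ)) (.store aWR (.var rU) (.var rMin)) .nop)

theorem relabel_runs {s : State} {B : Finset (Fin n)} (hB : BagList s B) :
    Runs D relabel s (30 * B.card + 5) fun s' => ∀ v ∈ B,
      s'.arr aWR v = if s.arr aWR v = s.reg rQ then s.reg rMin else s.arr aWR v := by
  refine (Runs.forBag hB (T := 14) (fun X s' => ∀ v : Fin n, s'.arr aWR v =
      if v ∈ X then (if s.arr aWR v = s.reg rQ then s.reg rMin else s.arr aWR v)
      else s.arr aWR v) rfl rfl rfl (by simp) ?_ (by omega)).mono le_rfl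
      fun _ _ h v hv => by simpa [hv] using h v
  rintro X v s' _ _ hvX hk h1
  have e1 : s'.reg rQ = s.reg rQ := hk.reg _ rfl
  have e2 : s'.reg rMin = s.reg rMin := hk.reg _ rfl
  have h2 := h1 v
  simp only [hvX, if_false] at h2
  by_cases h : s.arr aWR v = s.reg rQ
  · refine Runs.straight_le rfl (by decide) ?_
    intro j u
    simp [e1, e2, h2, h]
    by_cases hu : u = v
    · subst hu; simp [h]
    · have hu' : (u : ℕ) ≠ v := fun h => hu (Fin.ext h)
      simp [hu, hu', h1 u]
  · refine Runs.straight_le rfl (by decide) ?_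
    intro j u
    simp [e1, h2, h]
    by_cases hu : u = v
    · subst hu; simp [h, h2]
    · simp [hu, h1 u]

theorem Filled.congr {s₀ s s' : State} {B : Finset (Fin n)} {lo : ℕ} {S S' : Set (Key n × ℕ)}
    (h : Filled s₀ s B lo S) (hS : S = S')
    (h1 : s'.reg rBase = s.reg rBase) (h2 : s'.reg rPtr = s.reg rPtr)
    (h3 : s'.arr aEF = s.arr aEF) (h4 : s'.arr aER = s.arr aER) (h5 : s'.arr aVal = s.arr aVal)
    (h6 : s'.arr aNxt = s.arr aNxt) (h7 : s'.arr aHead = s.arr aHead)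
    (h8 : s'.arr aHash = s.arr aHash) : Filled s₀ s' B lo S' := by
  subst hS
  obtain ⟨m, ks, vs, hb, hd⟩ := h
  refine ⟨m, ks, vs, ⟨⟨hb.table.lo_pos, hb.table.good, hb.table.inj, ?_, ?_, ?_, ?_, ?_⟩, ?_,
    ⟨?_, ?_, ?_, ?_, ?_⟩, ?_, ?_, ?_⟩, hd⟩
  · rw [h3]; exact hb.table.ef
  · rw [h4]; exact hb.table.er
  · rw [h5]; exact hb.table.val
  · rw [h7, h1]; exact hb.table.head
  · rw [h6]; exact hb.table.nxt
  · rw [h2]; exact hb.ptr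
  · rw [h3]; exact hb.same.ef
  · rw [h4]; exact hb.same.er
  · rw [h5]; exact hb.same.val
  · rw [h6]; exact hb.same.nxt
  · rw [h7, h1]; exact hb.same.head
  · rw [h8, h1]; exact hb.hash
  · rw [h8, h1]; exact hb.fresh
  · rw [h7, h1]; exact hb.fresh'

theorem Filled.keeps {s₀ s s' : State} {B : Finset (Fin n)} {lo : ℕ} {S : Set (Key n × ℕ)}
    {p : Cmd} (h : Filled s₀ s B lo S) (hk : p.Keeps s s')
    (h1 : p.writesReg rBase = false := by rfl) (h2 : p.writesReg rPtr = false := by rfl)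
    (h3 : p.writesArr aEF = false := by rfl) (h4 : p.writesArr aER = false := by rfl)
    (h5 : p.writesArr aVal = false := by rfl) (h6 : p.writesArr aNxt = false := by rfl)
    (h7 : p.writesArr aHead = false := by rfl) (h8 : p.writesArr aHash = false := by rfl) :
    Filled s₀ s' B lo S :=
  h.congr rfl (hk.reg _ h1) (hk.reg _ h2) (hk.arr _ h3) (hk.arr _ h4) (hk.arr _ h5)
    (hk.arr _ h6) (hk.arr _ h7) (hk.arr _ h8)

/-- The table of the node `rS` with the bag `B'`, stored before the table under construction. -/
structure ChildTable (s : State) (c : ℕ) (B : Finset (Fin n)) (lo : ℕ) (m : ℕ)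
    (ks : ℕ → Key n) (vs : ℕ → ℕ) : Prop where
  table : Table s B (s.arr aLo c) (s.arr aBase c) m ks vs
  hi : s.arr aHi c = s.arr aLo c + n * m
  le : s.arr aLo c + n * m ≤ lo
  base : s.arr aBase c + n ^ n ≤ s.reg rBase

/-- The table under construction lies behind the tables of the children, which therefore survive all
insertions. -/
theorem Filled.childTable {s₀ s : State} {B B' : Finset (Fin n)} {lo m c : ℕ}
    {S : Set (Key n × ℕ)} {ks : ℕ → Key n} {vs : ℕ → ℕ} (h : Filled s₀ s B lo S) (hn : 0 < n)
    (hc : ChildTable s₀ c B' lo m ks vs) (hb : s.reg rBase = s₀.reg rBase) :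
    Table s B' (s₀.arr aLo c) (s₀.arr aBase c) m ks vs := by
  obtain ⟨_, _, _, hbd, _⟩ := h
  exact hc.table.congr hbd.same hn hc.le (by rw [hb]; exact hc.base)

/-! ## Introduction of a vertex -/

/-- Which of the centers `rX` and `rC` are used in the bag, not counting the vertex `rX`? -/
def introFlags : Cmd :=
  .assign rF (.lit 0) ;; .assign rF' (.lit 0) ;;
  .forBag rI rV (.ite (.eq (.var rV) (.var rX)) .nop
    (.ite (.eq (.get aWF (.var rV)) (.var rX)) (.assign rF (.lit 1)) .nop ;;
      .ite (.eq (.get aWF (.var rV)) (.var rC)) (.assign rF' (.lit 1)) .nop))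

theorem introFlags_runs {s : State} {B : Finset (Fin n)} (hB : BagList s B) :
    Runs D introFlags s (40 * B.card + 10) fun s' =>
      (s'.reg rF = 0 ↔ ∀ v ∈ B, (v : ℕ) ≠ s.reg rX → s.arr aWF v ≠ s.reg rX) ∧
      (s'.reg rF' = 0 ↔ ∀ v ∈ B, (v : ℕ) ≠ s.reg rX → s.arr aWF v ≠ s.reg rC) := by
  refine Runs.seq_le (T₁ := 2) (T₂ := 40 * B.card + 8)
    (Q := fun s' => s' = s.setReg rF 0) (Runs.straight_le rfl le_rfl rfl) ?_ (by omega)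
  rintro _ _ rfl
  refine Runs.seq_le (T₁ := 2) (T₂ := 40 * B.card + 6)
    (Q := fun s' => s' = (s.setReg rF 0).setReg rF' 0) (Runs.straight_le rfl le_rfl rfl) ?_
    (by omega)
  rintro _ _ rfl
  refine (Runs.forBag (hB.congr (by simp) (by simp)) (T := 30) (fun X s' =>
      (s'.reg rF = 0 ↔ ∀ v ∈ X, (v : ℕ) ≠ s.reg rX → s.arr aWF v ≠ s.reg rX) ∧
      (s'.reg rF' = 0 ↔ ∀ v ∈ X, (v : ℕ) ≠ s.reg rX → s.arr aWF v ≠ s.reg rC))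
      rfl rfl rfl (by simp) ?_ (by omega)).mono le_rfl fun _ _ h => h
  rintro X v s' _ _ hvX hk ⟨h1, h2⟩
  have e1 : s'.reg rX = s.reg rX := by rw [hk.reg _ rfl]; simp
  have e2 : s'.reg rC = s.reg rC := by rw [hk.reg _ rfl]; simp
  have e3 : s'.arr aWF = s.arr aWF := by rw [hk.arr _ rfl]; simp
  refine Runs.straight_le rfl (by decide) ?_
  intro j
  by_cases a1 : (v : ℕ) = s.reg rX
  · simp [e1, a1]
    exact ⟨h1, h2⟩
  by_cases a2 : s.arr aWF v = s.reg rX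
  · by_cases a3 : s.arr aWF v = s.reg rC
    · have a4 : s.reg rX = s.reg rC := a2.symm.trans a3
      have a5 : ¬ (v : ℕ) = s.reg rC := fun h => a1 (h.trans a4.symm)
      simp [e1, e2, e3, a3, a4, a5]
    · simp [e1, e2, e3, a1, a2, a2 ▸ a3]
      simpa using h2
  · by_cases a3 : s.arr aWF v = s.reg rC
    · simp [e1, e2, e3, a1, a3, a3 ▸ a2]
      simpa using h1
    · simp [e1, e2, e3, a1, a2, a3]
      exact ⟨h1, h2⟩

/-- Try the center `rC` for the new vertex `rX`. -/
def introTry : Cmd :=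
  loadState ;; introFlags ;;
  .ite (.not (.and (.not (.eq (.var rC) (.var rX))) (.not (.and (.eq (.var rF) (.lit 0))
    (.not (.and (.not (.eq (.get aVT (.add (.get aMul (.var rS)) (.var rC))) (.lit 0)))
      (.eq (.var rF') (.lit 0))))))))
    ((.store aWF (.var rX) (.var rC) ;; .store aWR (.var rX) (.var rX) ;;
      .assign rVal (.get aVal (.var rP))) ;; insertState) .nop

/-- The table of a node that introduces the vertex `rX`. -/
def introNode : Cmd :=
  .forEntries (.forc rC (.var rn)
    (.ite (.realLe (.add (.get aMul (.var rX)) (.var rC)) (.var rRad)) introTry .nop))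

theorem introTry_runs {N : ℕ} {s₀ s : State} {P Q : Piece (Fin n)} {lo loc bc m i : ℕ}
    {S : Set (Key n × ℕ)} {ks : ℕ → Key n} {vs : ℕ → ℕ} {v c : Fin n}
    (hC : Consts n N s) (hB : BagList s Q.bag) (hPQ : P.IsIntro v Q)
    (hS : Filled s₀ s Q.bag lo S) (hT : Table s P.bag loc bc m ks vs) (hi : i < m)
    (hP : s.reg rP = loc + n * i) (hX : s.reg rX = v) (hc : s.reg rC = c)
    (hVT : ∀ c : Fin n, s.arr aVT (s.arr aMul (s.reg rS) + c) ≠ 0 ↔ c ∈ P.verts) :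
    Runs D introTry s (300 * (Q.bag.card + 1) ^ 2) fun s' => Filled s₀ s' Q.bag lo
      (S ∪ {e | P.IntroTest v (ks i) c ∧ e = (mkKey Q.bag (Function.update (ks i).1 v c)
        (Function.update (ks i).2 v v), vs i)}) := by
  have hvB : v ∉ P.bag := fun h => hPQ.notMem (P.bag_sub h)
  refine Runs.seq_le (loadState_runs hB)
    (T₂ := 100 * (Q.bag.card + 1) ^ 2 + 40 * Q.bag.card + 60) ?_ (by nlinarith)
  intro s₁ hk₁ hw₁
  rw [hP] at hw₁
  have hB₁ : BagList s₁ Q.bag := hB.congr (hk₁.reg _ rfl) (hk₁.arr _ rfl)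
  refine Runs.seq_le (introFlags_runs hB₁) (T₂ := 100 * (Q.bag.card + 1) ^ 2 + 50) ?_ (by omega)
  rintro s₂ hk₂ ⟨hf, hf'⟩
  have hX₁ : s₁.reg rX = v := (hk₁.reg _ rfl).trans hX
  have hC₁ : s₁.reg rC = c := (hk₁.reg _ rfl).trans hc
  have hw : ∀ y ∈ P.bag, s₁.arr aWF y = (ks i).1 y ∧ s₁.arr aWR y = (ks i).2 y := fun y hy => by
    have hyQ : y ∈ Q.bag := by rw [hPQ.bag]; exact Finset.mem_insert_of_mem hy
    exact ⟨(hw₁ y hyQ).1.trans (hT.ef i hi y hy), (hw₁ y hyQ).2.trans (hT.er i hi y hy)⟩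
  -- `loadState` also fills the cells of the new vertex `v`, with meaningless contents. The flags
  -- skip `v` and thus speak about the bag of `P`.
  have hflag : ∀ x : ℕ, (∀ y ∈ Q.bag, (y : ℕ) ≠ v → s₁.arr aWF y ≠ x) ↔
      ¬ ∃ y ∈ P.bag, (ks i).1 y = x := by
    intro x
    push Not
    constructor
    · intro h y hy
      rw [← (hw y hy).1]
      exact h y (by rw [hPQ.bag]; exact Finset.mem_insert_of_mem hy)
        fun h' => hvB (Fin.ext h' ▸ hy)
    · intro h y hy hyv
      rw [hPQ.bag, Finset.mem_insert] at hy
      have hy := hy.resolve_left fun h' => hyv (by rw [h'])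
      rw [(hw y hy).1]
      exact h y hy
  rw [hX₁, hflag] at hf
  rw [hX₁, hC₁, hflag] at hf'
  have e1 : s₂.reg rC = c := (hk₂.reg _ rfl).trans hC₁
  have e2 : s₂.reg rX = v := (hk₂.reg _ rfl).trans hX₁
  have e3 : s₂.arr aVT (s₂.arr aMul (s₂.reg rS) + c) ≠ 0 ↔ c ∈ P.verts := by
    rw [hk₂.arr aVT rfl, hk₂.arr aMul rfl, hk₂.reg rS rfl, hk₁.arr aVT rfl, hk₁.arr aMul rfl,
      hk₁.reg rS rfl]
    exact hVT c
  have e4 : s₂.reg rP = loc + n * i := by rw [hk₂.reg _ rfl, hk₁.reg _ rfl, hP]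
  have e5 : s₂.arr aVal (loc + n * i) = vs i := by
    rw [hk₂.arr _ rfl, hk₁.arr _ rfl, hT.val i hi]
  have hS₂ : Filled s₀ s₂ Q.bag lo S := (hS.keeps hk₁).keeps hk₂
  have hB₂ : BagList s₂ Q.bag := hB₁.congr (hk₂.reg _ rfl) (hk₂.arr _ rfl)
  have hC₂ : Consts n N s₂ := (hC.congr hk₁).congr hk₂
  have htest : P.IntroTest v (ks i) c ↔ ¬ (¬ (c : ℕ) = v ∧ ¬ (s₂.reg rF = 0 ∧
      ¬ (¬ s₂.arr aVT (s₂.arr aMul (s₂.reg rS) + c) = 0 ∧ s₂.reg rF' = 0))) := by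
    rw [hf, hf', show (¬ s₂.arr aVT (s₂.arr aMul (s₂.reg rS) + c) = 0) ↔ c ∈ P.verts from e3,
      Fin.val_inj, Piece.IntroTest]
    -- Tests are built with negation and conjunction only, so the program uses this equivalent form.
    have aux : ∀ a b m e : Prop, (a ∨ (b ∧ (m → e))) ↔ ¬ (¬ a ∧ ¬ (b ∧ ¬ (m ∧ ¬ e))) := by
      intros; tauto
    exact aux _ _ _ _
  refine Runs.ite_le (T₁ := 100 * (Q.bag.card + 1) ^ 2 + 20) (fun h => ?_) (fun h => ?_) ?_
  · simp only [Test.Holds, Expr.eval, e1, e2] at h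
    rw [← htest] at h
    refine Runs.seq_le (T₁ := 20) (T₂ := 100 * (Q.bag.card + 1) ^ 2)
      (Q := fun s₃ => s₃ = ((s₂.setArr aWF v c).setArr aWR v v).setReg rVal (vs i))
      (Runs.straight_le rfl (by decide) (by simp [e1, e2, e4, e5])) ?_ (by omega)
    rintro _ _ rfl
    have hw₂ : ∀ y ∈ Q.bag, s₂.arr aWF y = s₁.arr aWF y ∧ s₂.arr aWR y = s₁.arr aWR y :=
      fun y hy => ⟨by rw [hk₂.arr _ rfl], by rw [hk₂.arr _ rfl]⟩
    have key : ∀ y ∈ Q.bag, (if (y : ℕ) = v then (c : ℕ) else s₂.arr aWF y) =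
        Function.update (ks i).1 v (c : ℕ) y ∧ (if (y : ℕ) = v then (v : ℕ) else s₂.arr aWR y) =
        Function.update (ks i).2 v (v : ℕ) y := by
      intro y hy
      by_cases hyv : y = v
      · subst hyv; simp
      · have hyP : y ∈ P.bag := by
          rw [hPQ.bag, Finset.mem_insert] at hy
          exact hy.resolve_left hyv
        have hyv' : (y : ℕ) ≠ v := fun h => hyv (Fin.ext h)
        rw [if_neg hyv', if_neg hyv', Function.update_of_ne hyv, Function.update_of_ne hyv,
          (hw₂ y hy).1, (hw₂ y hy).2]
        exact hw y hyP
    refine (insertState_runs (D := D) (N := N) (s₀ := s₀) (B := Q.bag)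
      (lo := lo) (S := S) (s := ((s₂.setArr aWF v c).setArr aWR v v).setReg rVal (vs i))
      ⟨by simpa using hC₂.n_eq, hC₂.two_le, by simpa using hC₂.mul, by simpa using hC₂.pow,
        by simpa using hC₂.nn, by simpa using hC₂.nnn⟩ (hB₂.congr (by simp) (by simp))
      (fun y hy => by
        have := (key y hy).1
        simp only [State.setReg_arr, State.setArr_arr]
        norm_num
        rw [this]
        by_cases hyv : y = v
        · subst hyv; simp
        · have hyP : y ∈ P.bag := by
            rw [hPQ.bag, Finset.mem_insert] at hy
            exact hy.resolve_left hyv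
          simp [hyv, (hT.good i hi).lt y hyP])
      (hS₂.congr rfl (by simp) (by simp) (by simp) (by simp) (by simp) (by simp) (by simp)
        (by simp))).mono le_rfl fun s₄ _ hf4 => ?_
    refine hf4.congr ?_ rfl rfl rfl rfl rfl rfl rfl rfl
    congr 1
    ext e
    simp only [h, true_and, Set.mem_singleton_iff, Set.mem_ofPred_eq]
    refine Iff.of_eq (congrArg _ (Prod.ext ?_ (by simp)))
    refine mkKey_congr (fun y hy => ?_) (fun y hy z hz => ?_)
    · have := (key y hy).1
      simpa using this
    · have h1 := (key y hy).2
      have h2 := (key z hz).2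
      rw [← h1, ← h2]
      simp
  · simp only [Test.Holds, Expr.eval, e1, e2] at h
    rw [← htest] at h
    refine Runs.straight_le rfl (by simp [Cmd.time]) ?_
    simpa [h] using hS₂
  · simp only [Test.cost, Expr.cost]
    omega

end ConnectedKCenter

namespace ConnectedKCenter

variable {n N : ℕ} {D : ℕ → ℝ≥0}

theorem Filled.setReg {s₀ s : State} {B : Finset (Fin n)} {lo : ℕ} {S : Set (Key n × ℕ)}
    (h : Filled s₀ s B lo S) (x v : ℕ) (h1 : rBase ≠ x := by decide)
    (h2 : rPtr ≠ x := by decide) : Filled s₀ (s.setReg x v) B lo S :=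
  h.congr rfl (by simp [h1]) (by simp [h2]) rfl rfl rfl rfl rfl rfl

theorem Consts.setReg {s : State} (h : Consts n N s) (x v : ℕ) (h1 : rn ≠ x := by decide)
    (h2 : rNn ≠ x := by decide) (h3 : rNnn ≠ x := by decide) : Consts n N (s.setReg x v) :=
  ⟨by simpa [h1] using h.n_eq, h.two_le, h.mul, h.pow, by simpa [h2] using h.nn,
    by simpa [h3] using h.nnn⟩

theorem BagList.setReg {s : State} {B : Finset (Fin n)} (h : BagList s B) (x v : ℕ)
    (h1 : rBag ≠ x := by decide) : BagList (s.setReg x v) B :=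
  h.congr (by simp [h1]) rfl

theorem Filled.cast {s₀ s : State} {B : Finset (Fin n)} {lo : ℕ} {S S' : Set (Key n × ℕ)}
    (h : Filled s₀ s B lo S) (hS : S = S') : Filled s₀ s B lo S' := hS ▸ h

theorem introNode_runs {s : State} {P Q : Piece (Fin n)} {lo m : ℕ} {ks : ℕ → Key n}
    {vs : ℕ → ℕ} {v : Fin n} (hC : Consts n N s) (hB : BagList s Q.bag) (hPQ : P.IsIntro v Q)
    (hS : Filled s s Q.bag lo ∅) (hT : ChildTable s (s.reg rS) P.bag lo m ks vs)
    (hX : s.reg rX = v)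
    (hVT : ∀ c : Fin n, s.arr aVT (s.arr aMul (s.reg rS) + c) ≠ 0 ↔ c ∈ P.verts) :
    Runs D introNode s (m * n * (500 * (Q.bag.card + 1) ^ 2) + 8 * m + 8) fun s' =>
      Filled s s' Q.bag lo {e | ∃ κ x, ∃ c : Fin n, (κ, x) ∈ tab m ks vs ∧
        D (v * n + c) ≤ D (s.reg rRad) ∧ P.IntroTest v κ c ∧
        e = (mkKey Q.bag (Function.update κ.1 v c) (Function.update κ.2 v v), x)} := by
  have hn : 0 < n := by have := hC.two_le; omega
  -- The contribution of entry `i` and center `c'`; it is empty if `c'` is too far from `v` or fails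
  -- the test. Two nested `upTo` follow the two loops.
  set F : ℕ → ℕ → Set (Key n × ℕ) := fun i c' => {e | ∃ c : Fin n, (c : ℕ) = c' ∧
    D (v * n + c) ≤ D (s.reg rRad) ∧ P.IntroTest v (ks i) c ∧
    e = (mkKey Q.bag (Function.update (ks i).1 v c) (Function.update (ks i).2 v v), vs i)} with hF
  refine (Runs.forEntries (T := n * (300 * (Q.bag.card + 1) ^ 2 + 20) + 5)
    (fun i s' => Filled s s' Q.bag lo (upTo (fun i => upTo (F i) n) i)) hC.n_eq hn rfl hT.hi
    rfl rfl rfl rfl (by rw [upTo_zero]; exact hS.setReg _ _) ?_ ?_).mono le_rfl ?_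
  · intro i s' hi hk hP hI
    refine (Runs.forc (T := 300 * (Q.bag.card + 1) ^ 2 + 10)
      (fun c s'' => Filled s s'' Q.bag lo (upTo (fun i => upTo (F i) n) i ∪ upTo (F i) c)) n
      rfl ?_ ?_ ?_ ?_).mono le_rfl ?_
    · intro s'' hk'
      simp only [Expr.eval]
      rw [hk'.reg _ rfl, hk.reg _ rfl, hC.n_eq]
    · rw [upTo_zero, Set.union_empty]
      exact hI.setReg _ _
    · intro c s'' hc hk' hcr hI'
      have hC' : Consts n N s'' := (hC.congr hk).congr hk'
      have hB' : BagList s'' Q.bag :=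
        (hB.congr (hk.reg _ rfl) (hk.arr _ rfl)).congr (hk'.reg _ rfl) (hk'.arr _ rfl)
      have e1 : s''.reg rX = v := by rw [hk'.reg _ rfl, hk.reg _ rfl, hX]
      have e2 : s''.reg rRad = s.reg rRad := by rw [hk'.reg _ rfl, hk.reg _ rfl]
      have e3 : s''.arr aMul v = v * n := hC'.mul _ (by have := v.2; omega)
      have e4 : s''.reg rP = s.arr aLo (s.reg rS) + n * i := by rw [hk'.reg _ rfl, hP]
      have e5 : s''.reg rBase = s.reg rBase := by rw [hk'.reg _ rfl, hk.reg _ rfl]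
      refine Runs.ite_le (T₁ := 300 * (Q.bag.card + 1) ^ 2 + 1) (fun h => ?_) (fun h => ?_)
        (by simp only [Test.cost, Expr.cost]; omega)
      · simp only [Test.Holds, Expr.eval, e1, e2, e3, hcr] at h
        refine (introTry_runs (c := ⟨c, hc⟩) hC' hB' hPQ hI' (hI'.childTable hn hT e5) hi e4 e1
          hcr ?_).mono (by omega) ?_
        · rw [hk'.arr _ rfl, hk.arr _ rfl, hk'.arr _ rfl, hk.arr _ rfl, hk'.reg _ rfl,
            hk.reg _ rfl]
          exact hVT
        · intro s₃ _ h3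
          refine (h3.setReg _ _).cast ?_
          rw [upTo_succ, Set.union_assoc]
          congr 2
          ext e
          constructor
          · rintro ⟨h1, h2⟩
            exact ⟨⟨c, hc⟩, rfl, h, h1, h2⟩
          · rintro ⟨c', rfl, _, h1, h2⟩
            exact ⟨h1, h2⟩
      · simp only [Test.Holds, Expr.eval, e1, e2, e3, hcr] at h
        refine Runs.straight_le rfl (by simp [Cmd.time]) ((hI'.setReg _ _).cast ?_)
        rw [upTo_succ]
        have : F i c = ∅ := by
          ext e
          simp only [Set.mem_empty_iff_false, iff_false]
          rintro ⟨c', rfl, h', _⟩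
          exact h h'
        rw [this, Set.union_empty]
    · simp only [Expr.cost]
      have : n * (300 * (Q.bag.card + 1) ^ 2 + 10 + 1 + 6) + 3 * n =
        n * (300 * (Q.bag.card + 1) ^ 2 + 20) := by ring
      omega
    · rintro s'' _ ⟨h, _⟩
      refine (h.setReg _ _).cast ?_
      rw [upTo_succ]
  · have h1 : m * (n * (300 * (Q.bag.card + 1) ^ 2 + 20) + 5 + 8) =
      m * n * (300 * (Q.bag.card + 1) ^ 2) + 20 * (m * n) + 13 * m := by ring
    have h2 : m * n * (500 * (Q.bag.card + 1) ^ 2) = m * n * (300 * (Q.bag.card + 1) ^ 2) +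
      m * n * (200 * (Q.bag.card + 1) ^ 2) := by ring
    have h3 : m * n * 200 ≤ m * n * (200 * (Q.bag.card + 1) ^ 2) :=
      Nat.mul_le_mul_left _ (by have := Nat.one_le_pow 2 (Q.bag.card + 1) (by omega); omega)
    have h4 : m * 1 ≤ m * n := Nat.mul_le_mul_left _ hn
    omega
  · rintro s' _ h
    refine h.cast ?_
    ext e
    constructor
    · rintro ⟨i, hi, c', -, c, rfl, h1, h2, h3⟩
      exact ⟨_, _, c, ⟨i, hi, rfl⟩, h1, h2, h3⟩
    · rintro ⟨κ, x, c, ⟨i, hi, he⟩, h1, h2, h3⟩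
      obtain ⟨rfl, rfl⟩ := Prod.mk_inj.1 he
      exact ⟨i, hi, c, c.2, c, rfl, h1, h2, h3⟩

/-! ## Forgetting a vertex -/

/-- Does the component of the vertex `rX` meet the bag?  Is its center used in the bag? -/
def forgetFlags : Cmd :=
  .assign rF (.lit 0) ;; .assign rF' (.lit 0) ;;
  .forBag rI rV (
    .ite (.eq (.get aWR (.var rV)) (.get aER (.add (.var rP) (.var rX)))) (.assign rF (.lit 1))
      .nop ;;
    .ite (.eq (.get aWF (.var rV)) (.var rC)) (.assign rF' (.lit 1)) .nop)

theorem forgetFlags_runs {s : State} {B : Finset (Fin n)} (hB : BagList s B) :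
    Runs D forgetFlags s (40 * B.card + 10) fun s' =>
      (s'.reg rF = 0 ↔ ∀ v ∈ B, s.arr aWR v ≠ s.arr aER (s.reg rP + s.reg rX)) ∧
      (s'.reg rF' = 0 ↔ ∀ v ∈ B, s.arr aWF v ≠ s.reg rC) := by
  refine Runs.seq_le (T₁ := 2) (T₂ := 40 * B.card + 8)
    (Q := fun s' => s' = s.setReg rF 0) (Runs.straight_le rfl le_rfl rfl) ?_ (by omega)
  rintro _ _ rfl
  refine Runs.seq_le (T₁ := 2) (T₂ := 40 * B.card + 6)
    (Q := fun s' => s' = (s.setReg rF 0).setReg rF' 0) (Runs.straight_le rfl le_rfl rfl) ?_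
    (by omega)
  rintro _ _ rfl
  refine (Runs.forBag (hB.congr (by simp) (by simp)) (T := 30) (fun X s' =>
      (s'.reg rF = 0 ↔ ∀ v ∈ X, s.arr aWR v ≠ s.arr aER (s.reg rP + s.reg rX)) ∧
      (s'.reg rF' = 0 ↔ ∀ v ∈ X, s.arr aWF v ≠ s.reg rC))
      rfl rfl rfl (by simp) ?_ (by omega)).mono le_rfl fun _ _ h => h
  rintro X v s' _ _ hvX hk ⟨h1, h2⟩
  have e1 : s'.reg rX = s.reg rX := by rw [hk.reg _ rfl]; simp
  have e2 : s'.reg rC = s.reg rC := by rw [hk.reg _ rfl]; simp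
  have e3 : s'.arr aWF = s.arr aWF := by rw [hk.arr _ rfl]; simp
  have e4 : s'.arr aWR = s.arr aWR := by rw [hk.arr _ rfl]; simp
  have e5 : s'.arr aER = s.arr aER := by rw [hk.arr _ rfl]; simp
  have e6 : s'.reg rP = s.reg rP := by rw [hk.reg _ rfl]; simp
  refine Runs.straight_le rfl (by decide) ?_
  intro j
  by_cases a1 : s.arr aWR v = s.arr aER (s.reg rP + s.reg rX) <;>
  by_cases a2 : s.arr aWF v = s.reg rC <;>
  simp [e1, e2, e3, e4, e5, e6, a1, a2] <;> first | exact h1 | exact h2 | exact ⟨h1, h2⟩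

/-- Treat the entry `rP`, when the vertex `rX` is forgotten. -/
def forgetTry : Cmd :=
  .assign rC (.get aEF (.add (.var rP) (.var rX))) ;; loadState ;; forgetFlags ;;
  .ite (.not (.and (.eq (.var rF) (.lit 0)) (.not (.and (.eq (.var rF') (.lit 0))
    (.not (.eq (.get aVT (.add (.get aMul (.var rS)) (.var rC))) (.lit 0)))))))
    ((.assign rVal (.add (.get aVal (.var rP)) (.get aMP (.add (.get aMul (.var rX)) (.var rC)))) ;;
      .ite (.eq (.var rC) (.var rX)) (.assign rVal (.add (.var rVal) (.var rNn))) .nop) ;;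
      insertState) .nop

/-- The table of a node that forgets the vertex `rX`. -/
def forgetNode : Cmd := .forEntries forgetTry

theorem forgetTry_runs {s₀ s : State} {P Q : Piece (Fin n)} {lo loc bc m i : ℕ}
    {S : Set (Key n × ℕ)} {ks : ℕ → Key n} {vs : ℕ → ℕ} {v : Fin n}
    (hC : Consts n N s) (hB : BagList s Q.bag) (hPQ : P.IsForget v Q)
    (hS : Filled s₀ s Q.bag lo S) (hT : Table s P.bag loc bc m ks vs) (hi : i < m)
    (hP : s.reg rP = loc + n * i) (hX : s.reg rX = v)
    (hVT : ∀ c : Fin n, s.arr aVT (s.arr aMul (s.reg rS) + c) ≠ 0 ↔ c ∈ P.verts) :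
    Runs D forgetTry s (300 * (Q.bag.card + 1) ^ 2) fun s' => Filled s₀ s' Q.bag lo
      (S ∪ {e | P.ForgetTest Q v (ks i) ∧ e = (mkKey Q.bag (ks i).1 (ks i).2,
        vs i + Piece.weight (n := n) v ((ks i).1 v))}) := by
  have hsub : ∀ y ∈ Q.bag, y ∈ P.bag := fun y hy => by
    rw [hPQ.bag] at hy; exact Finset.mem_of_mem_erase hy
  have hcl : (ks i).1 v < n := (hT.good i hi).lt v hPQ.mem
  have hef := hT.ef i hi v hPQ.mem
  have her := hT.er i hi v hPQ.mem
  -- The vertex `v` is not in the bag of `Q`, so `loadState` passes over it and its center is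
  -- fetched separately.
  refine Runs.seq_le (T₁ := 5) (Q := fun s' => s' = s.setReg rC ((ks i).1 v))
    (Runs.straight_le rfl (by decide) (by simp [hP, hX, hef]))
    (T₂ := 100 * (Q.bag.card + 1) ^ 2 + 70 * Q.bag.card + 95) ?_ (by nlinarith)
  rintro _ _ rfl
  refine Runs.seq_le (loadState_runs (hB.setReg _ _))
    (T₂ := 100 * (Q.bag.card + 1) ^ 2 + 40 * Q.bag.card + 90) ?_ (by omega)
  intro s₁ hk₁ hw₁
  have hB₁ : BagList s₁ Q.bag := (hB.setReg _ _).congr (hk₁.reg _ rfl) (hk₁.arr _ rfl)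
  refine Runs.seq_le (forgetFlags_runs hB₁) (T₂ := 100 * (Q.bag.card + 1) ^ 2 + 80) ?_ (by omega)
  rintro s₂ hk₂ ⟨hf, hf'⟩
  have hX₁ : s₁.reg rX = v := by rw [hk₁.reg _ rfl]; simpa using hX
  have hC₁ : s₁.reg rC = (ks i).1 v := by rw [hk₁.reg _ rfl]; simp
  have hP₁ : s₁.reg rP = loc + n * i := by rw [hk₁.reg _ rfl]; simpa using hP
  have hw : ∀ y ∈ Q.bag, s₁.arr aWF y = (ks i).1 y ∧ s₁.arr aWR y = (ks i).2 y := fun y hy => by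
    have := hw₁ y hy
    simp only [State.setReg_reg, State.setReg_arr] at this
    norm_num [hP] at this
    exact ⟨this.1.trans (hT.ef i hi y (hsub y hy)), this.2.trans (hT.er i hi y (hsub y hy))⟩
  have her₁ : s₁.arr aER (loc + n * i + v) = (ks i).2 v := by rw [hk₁.arr _ rfl]; exact her
  have hf1 : s₂.reg rF = 0 ↔ ¬ ∃ y ∈ Q.bag, (ks i).2 y = (ks i).2 v := by
    rw [hf, hX₁, hP₁, her₁]
    push Not
    exact forall₂_congr fun y hy => by rw [(hw y hy).2]
  have hf1' : s₂.reg rF' = 0 ↔ ¬ ∃ y ∈ Q.bag, (ks i).1 y = (ks i).1 v := by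
    rw [hf', hC₁]
    push Not
    exact forall₂_congr fun y hy => by rw [(hw y hy).1]
  have e1 : s₂.reg rC = (ks i).1 v := (hk₂.reg _ rfl).trans hC₁
  have e2 : s₂.reg rX = v := (hk₂.reg _ rfl).trans hX₁
  have e3 : (¬ s₂.arr aVT (s₂.arr aMul (s₂.reg rS) + (ks i).1 v) = 0) ↔
      ∃ w ∈ P.verts, (w : ℕ) = (ks i).1 v := by
    have : s₂.arr aVT (s₂.arr aMul (s₂.reg rS) + (ks i).1 v) =
        s.arr aVT (s.arr aMul (s.reg rS) + (ks i).1 v) := by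
      rw [hk₂.arr aVT rfl, hk₂.arr aMul rfl, hk₂.reg rS rfl, hk₁.arr aVT rfl, hk₁.arr aMul rfl,
        hk₁.reg rS rfl]
      simp
    rw [this]
    refine (hVT ⟨(ks i).1 v, hcl⟩).trans ⟨fun h => ⟨_, h, rfl⟩, ?_⟩
    rintro ⟨w, hw, he⟩
    have : w = ⟨(ks i).1 v, hcl⟩ := Fin.ext he
    exact this ▸ hw
  have e4 : s₂.reg rP = loc + n * i := (hk₂.reg _ rfl).trans hP₁
  have e5 : s₂.arr aVal (loc + n * i) = vs i := by
    rw [hk₂.arr _ rfl, hk₁.arr _ rfl]; exact hT.val i hi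
  have hS₂ : Filled s₀ s₂ Q.bag lo S := ((hS.setReg _ _).keeps hk₁).keeps hk₂
  have hB₂ : BagList s₂ Q.bag := hB₁.congr (hk₂.reg _ rfl) (hk₂.arr _ rfl)
  have hC₂ : Consts n N s₂ := ((hC.setReg _ _).congr hk₁).congr hk₂
  have e6 : s₂.arr aMul v = v * n := hC₂.mul _ (by have := v.2; omega)
  have e7 := hC₂.pow v (by have := v.2; omega) _ hcl
  have e8 := hC₂.nn
  have htest : P.ForgetTest Q v (ks i) ↔ ¬ (s₂.reg rF = 0 ∧ ¬ (s₂.reg rF' = 0 ∧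
      ¬ s₂.arr aVT (s₂.arr aMul (s₂.reg rS) + (ks i).1 v) = 0)) := by
    rw [hf1, hf1', e3, Piece.ForgetTest]
    have aux : ∀ a b m : Prop, (a ∨ (¬ b ∧ m)) ↔ ¬ (¬ a ∧ ¬ (¬ b ∧ m)) := by
      intros; tauto
    exact aux _ _ _
  refine Runs.ite_le (T₁ := 100 * (Q.bag.card + 1) ^ 2 + 40) (fun h => ?_) (fun h => ?_) ?_
  · simp only [Test.Holds, Expr.eval, e1] at h
    rw [← htest] at h
    refine Runs.seq_le (T₁ := 40) (T₂ := 100 * (Q.bag.card + 1) ^ 2)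
      (Q := fun s₃ => s₃.arr = s₂.arr ∧
        s₃.reg = (s₂.setReg rVal (vs i + Piece.weight (n := n) v ((ks i).1 v))).reg)
      (Runs.straight_le rfl (by decide) ?_) ?_ (by omega)
    · by_cases hcv : (ks i).1 v = v
      · rw [hcv] at e1 e7
        simp [e1, e2, e4, e5, e6, e7, e8, Piece.weight, hcv, State.setReg, add_assoc]
      · simp [e1, e2, e4, e5, e6, e7, Piece.weight, hcv, State.setReg]
    rintro s₃ _ ⟨ha, hr⟩
    have hs₃ : s₃ = s₂.setReg rVal (vs i + Piece.weight (n := n) v ((ks i).1 v)) := by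
      cases s₃; simp only at ha hr; subst ha hr; rfl
    subst hs₃
    have key : ∀ y ∈ Q.bag, s₂.arr aWF y = (ks i).1 y ∧ s₂.arr aWR y = (ks i).2 y :=
      fun y hy => by rw [hk₂.arr _ rfl, hk₂.arr _ rfl]; exact hw y hy
    refine (insertState_runs (hC₂.setReg _ _) (hB₂.setReg _ _) (fun y hy => ?_)
      (hS₂.setReg _ _)).mono le_rfl fun s₄ _ hf4 => hf4.cast ?_
    · rw [State.setReg_arr, (key y hy).1]
      exact (hT.good i hi).lt y (hsub y hy)
    congr 1
    ext e
    simp only [h, true_and, Set.mem_singleton_iff, Set.mem_ofPred_eq]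
    refine Iff.of_eq (congrArg _ (Prod.ext ?_ (by simp)))
    refine mkKey_congr (fun y hy => ?_) (fun y hy z hz => ?_)
    · simpa using (key y hy).1
    · have h1 := (key y hy).2
      have h2 := (key z hz).2
      simp [← h1, ← h2]
  · simp only [Test.Holds, Expr.eval, e1] at h
    rw [← htest] at h
    refine Runs.straight_le rfl (by simp [Cmd.time]) ?_
    simpa [h] using hS₂
  · simp only [Test.cost, Expr.cost]
    omega

theorem forgetNode_runs {s : State} {P Q : Piece (Fin n)} {lo m : ℕ} {ks : ℕ → Key n}
    {vs : ℕ → ℕ} {v : Fin n} (hC : Consts n N s) (hB : BagList s Q.bag) (hPQ : P.IsForget v Q)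
    (hS : Filled s s Q.bag lo ∅) (hT : ChildTable s (s.reg rS) P.bag lo m ks vs)
    (hX : s.reg rX = v)
    (hVT : ∀ c : Fin n, s.arr aVT (s.arr aMul (s.reg rS) + c) ≠ 0 ↔ c ∈ P.verts) :
    Runs D forgetNode s (m * (300 * (Q.bag.card + 1) ^ 2 + 8) + 8) fun s' =>
      Filled s s' Q.bag lo {e | ∃ κ x, (κ, x) ∈ tab m ks vs ∧ P.ForgetTest Q v κ ∧
        e = (mkKey Q.bag κ.1 κ.2, x + Piece.weight (n := n) v (κ.1 v))} := by
  have hn : 0 < n := by have := hC.two_le; omega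
  refine (Runs.forEntries (T := 300 * (Q.bag.card + 1) ^ 2)
    (fun i s' => Filled s s' Q.bag lo (upTo (fun i => {e | P.ForgetTest Q v (ks i) ∧
      e = (mkKey Q.bag (ks i).1 (ks i).2,
        vs i + Piece.weight (n := n) v ((ks i).1 v))}) i)) hC.n_eq hn rfl hT.hi
    rfl rfl rfl rfl (by rw [upTo_zero]; exact hS.setReg _ _) ?_ le_rfl).mono le_rfl ?_
  · intro i s' hi hk hP hI
    have e5 : s'.reg rBase = s.reg rBase := by rw [hk.reg _ rfl]
    refine (forgetTry_runs (hC.congr hk) (hB.congr (hk.reg _ rfl) (hk.arr _ rfl)) hPQ hI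
      (hI.childTable hn hT e5) hi hP (by rw [hk.reg _ rfl, hX]) ?_).mono le_rfl ?_
    · rw [hk.arr _ rfl, hk.arr _ rfl, hk.reg _ rfl]
      exact hVT
    · intro s'' _ h
      refine (h.setReg _ _).cast ?_
      rw [upTo_succ]
  · rintro s' _ h
    refine h.cast ?_
    ext e
    constructor
    · rintro ⟨i, hi, h1, h2⟩
      exact ⟨_, _, ⟨i, hi, rfl⟩, h1, h2⟩
    · rintro ⟨κ, x, ⟨i, hi, he⟩, h1, h2⟩
      obtain ⟨rfl, rfl⟩ := Prod.mk_inj.1 he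
      exact ⟨i, hi, h1, h2⟩

/-! ## Introduction of an edge -/

/-- Treat the entry `rP`, when the edge between `rX` and `rY` is introduced. -/
def edgeTry : Cmd :=
  loadState ;;
  .ite (.eq (.get aWF (.var rX)) (.get aWF (.var rY)))
    ((.assign rMin (.get aWR (.var rX)) ;; .assign rQ (.get aWR (.var rY))) ;; relabel) .nop ;;
  .assign rVal (.get aVal (.var rP)) ;;
  insertState

/-- The table of a node that introduces the edge between `rX` and `rY`. -/
def edgeNode : Cmd := .forEntries edgeTry

theorem edgeTry_runs {s₀ s : State} {P Q : Piece (Fin n)} {lo loc bc m i : ℕ}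
    {S : Set (Key n × ℕ)} {ks : ℕ → Key n} {vs : ℕ → ℕ} {u v : Fin n}
    (hC : Consts n N s) (hB : BagList s Q.bag) (hPQ : P.IsEdge u v Q)
    (hS : Filled s₀ s Q.bag lo S) (hT : Table s P.bag loc bc m ks vs) (hi : i < m)
    (hP : s.reg rP = loc + n * i) (hX : s.reg rX = u) (hY : s.reg rY = v) :
    Runs D edgeTry s (300 * (Q.bag.card + 1) ^ 2) fun s' => Filled s₀ s' Q.bag lo
      (S ∪ {(mkKey Q.bag (ks i).1 (Piece.edgeLabel u v (ks i)), vs i)}) := by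
  have hsub : ∀ y ∈ Q.bag, y ∈ P.bag := fun y hy => hPQ.bag ▸ hy
  have hu : u ∈ Q.bag := hPQ.bag ▸ hPQ.left
  have hv : v ∈ Q.bag := hPQ.bag ▸ hPQ.right
  refine Runs.seq_le (loadState_runs hB)
    (T₂ := 100 * (Q.bag.card + 1) ^ 2 + 30 * Q.bag.card + 90) ?_ (by nlinarith)
  intro s₁ hk₁ hw₁
  have hB₁ : BagList s₁ Q.bag := hB.congr (hk₁.reg _ rfl) (hk₁.arr _ rfl)
  have hX₁ : s₁.reg rX = u := by rw [hk₁.reg _ rfl, hX]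
  have hY₁ : s₁.reg rY = v := by rw [hk₁.reg _ rfl, hY]
  have hw : ∀ y ∈ Q.bag, s₁.arr aWF y = (ks i).1 y ∧ s₁.arr aWR y = (ks i).2 y := fun y hy => by
    have := hw₁ y hy
    rw [hP] at this
    exact ⟨this.1.trans (hT.ef i hi y (hsub y hy)), this.2.trans (hT.er i hi y (hsub y hy))⟩
  refine Runs.seq_le (T₁ := 30 * Q.bag.card + 40) (Q := fun s₂ => ∀ y ∈ Q.bag,
    s₂.arr aWR y = Piece.edgeLabel u v (ks i) y) (T₂ := 100 * (Q.bag.card + 1) ^ 2 + 20) ?_ ?_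
    (by omega)
  · refine Runs.ite_le (T₁ := 30 * Q.bag.card + 20) (fun h => ?_) (fun h => ?_) ?_
    · simp only [Test.Holds, Expr.eval, hX₁, hY₁, (hw u hu).1, (hw v hv).1] at h
      refine Runs.seq_le (T₁ := 10) (T₂ := 30 * Q.bag.card + 5)
        (Q := fun s₃ => s₃ = (s₁.setReg rMin ((ks i).2 u)).setReg rQ ((ks i).2 v))
        (Runs.straight_le rfl (by decide) (by simp [hX₁, hY₁, (hw u hu).2, (hw v hv).2])) ?_
        (by omega)
      rintro _ _ rfl
      refine (relabel_runs ((hB₁.setReg _ _).setReg _ _)).mono le_rfl fun s₄ _ h4 y hy => ?_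
      rw [h4 y hy, Piece.edgeLabel, if_pos h, Piece.mergeLabel]
      simp [(hw y hy).2]
    · simp only [Test.Holds, Expr.eval, hX₁, hY₁, (hw u hu).1, (hw v hv).1] at h
      refine Runs.straight_le rfl (by simp [Cmd.time]) fun y hy => ?_
      rw [Piece.edgeLabel, if_neg h]
      exact (hw y hy).2
    · simp only [Test.cost, Expr.cost]
      omega
  intro s₂ hk₂ hr
  have e4 : s₂.reg rP = loc + n * i := by rw [hk₂.reg _ rfl, hk₁.reg _ rfl, hP]
  have e5 : s₂.arr aVal (loc + n * i) = vs i := by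
    rw [hk₂.arr _ rfl, hk₁.arr _ rfl]; exact hT.val i hi
  have hS₂ : Filled s₀ s₂ Q.bag lo S := (hS.keeps hk₁).keeps hk₂
  have hB₂ : BagList s₂ Q.bag := hB₁.congr (hk₂.reg _ rfl) (hk₂.arr _ rfl)
  have hC₂ : Consts n N s₂ := (hC.congr hk₁).congr hk₂
  have key : ∀ y ∈ Q.bag, s₂.arr aWF y = (ks i).1 y := fun y hy => by
    rw [hk₂.arr _ rfl]; exact (hw y hy).1
  refine Runs.seq_le (T₁ := 20) (T₂ := 100 * (Q.bag.card + 1) ^ 2)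
      (Q := fun s₃ => s₃ = s₂.setReg rVal (vs i))
      (Runs.straight_le rfl (by decide) (by simp [e4, e5])) ?_ (by omega)
  rintro _ _ rfl
  refine (insertState_runs (hC₂.setReg _ _) (hB₂.setReg _ _) (fun y hy => ?_)
    (hS₂.setReg _ _)).mono le_rfl fun s₄ _ hf4 => hf4.cast ?_
  · rw [State.setReg_arr, key y hy]
    exact (hT.good i hi).lt y (hsub y hy)
  congr 2
  refine Prod.ext ?_ (by simp)
  refine mkKey_congr (fun y hy => ?_) (fun y hy z hz => ?_)
  · simpa using key y hy
  · have h1 := hr y hy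
    have h2 := hr z hz
    simp [← h1, ← h2]

theorem edgeNode_runs {s : State} {P Q : Piece (Fin n)} {lo m : ℕ} {ks : ℕ → Key n}
    {vs : ℕ → ℕ} {u v : Fin n} (hC : Consts n N s) (hB : BagList s Q.bag) (hPQ : P.IsEdge u v Q)
    (hS : Filled s s Q.bag lo ∅) (hT : ChildTable s (s.reg rS) P.bag lo m ks vs)
    (hX : s.reg rX = u) (hY : s.reg rY = v) :
    Runs D edgeNode s (m * (300 * (Q.bag.card + 1) ^ 2 + 8) + 8) fun s' =>
      Filled s s' Q.bag lo {e | ∃ κ x, (κ, x) ∈ tab m ks vs ∧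
        e = (mkKey Q.bag κ.1 (Piece.edgeLabel u v κ), x)} := by
  have hn : 0 < n := by have := hC.two_le; omega
  refine (Runs.forEntries (T := 300 * (Q.bag.card + 1) ^ 2)
    (fun i s' => Filled s s' Q.bag lo (upTo (fun i =>
      {(mkKey Q.bag (ks i).1 (Piece.edgeLabel u v (ks i)), vs i)}) i)) hC.n_eq hn rfl hT.hi
    rfl rfl rfl rfl (by rw [upTo_zero]; exact hS.setReg _ _) ?_ le_rfl).mono le_rfl ?_
  · intro i s' hi hk hP hI
    have e5 : s'.reg rBase = s.reg rBase := by rw [hk.reg _ rfl]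
    refine (edgeTry_runs (hC.congr hk) (hB.congr (hk.reg _ rfl) (hk.arr _ rfl)) hPQ hI
      (hI.childTable hn hT e5) hi hP (by rw [hk.reg _ rfl, hX])
      (by rw [hk.reg _ rfl, hY])).mono le_rfl ?_
    intro s'' _ h
    refine (h.setReg _ _).cast ?_
    rw [upTo_succ]
  · rintro s' _ h
    refine h.cast ?_
    ext e
    constructor
    · rintro ⟨i, hi, h1⟩
      exact ⟨_, _, ⟨i, hi, rfl⟩, h1⟩
    · rintro ⟨κ, x, ⟨i, hi, he⟩, h1⟩
      obtain ⟨rfl, rfl⟩ := Prod.mk_inj.1 he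
      exact ⟨i, hi, h1⟩

end ConnectedKCenter

namespace ConnectedKCenter

variable {n N : ℕ} {D : ℕ → ℝ≥0}

/-! ## Joining two tables -/

/-- Each labelling is coarser than the two given partitions and the other one is the finest of this
sort. So the partition is unique, whatever labels the program happens to use. -/
theorem Piece.JoinLabels.iff {B : Finset (Fin n)} {κ₁ κ₂ : Key n} {R R' : Fin n → ℕ}
    (h : JoinLabels B κ₁ κ₂ R) (h' : JoinLabels B κ₁ κ₂ R') {x y : Fin n} (hx : x ∈ B)
    (hy : y ∈ B) : R x = R y ↔ R' x = R' y :=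
  ⟨h.least (fun x y => R' x = R' y) ⟨fun _ => rfl, Eq.symm, Eq.trans⟩ h'.left h'.right x hx y hy,
    h'.least (fun x y => R x = R y) ⟨fun _ => rfl, Eq.symm, Eq.trans⟩ h.left h.right x hx y hy⟩

/-- Treat the entries `rP` and `rQ'` of the two tables, which have the same centers. -/
def joinTry : Cmd :=
  loadState ;;
  .forBag rI rV ((.assign rMin (.get aWR (.var rV)) ;;
    .assign rQ (.get aWR (.get aER (.add (.var rQ') (.var rV))))) ;; relabel) ;;
  .assign rVal (.add (.get aVal (.var rP)) (.get aVal (.var rQ'))) ;;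
  insertState

/-- The code of the centers of the entry `rP`. -/
def entryCode : Cmd :=
  .assign rFc (.lit 0) ;;
  .forBag rI rV (.assign rFc (.add (.var rFc)
    (.get aMP (.add (.get aMul (.var rV)) (.get aEF (.add (.var rP) (.var rV)))))))

/-- The table of a join node with the children `rS` and `rS'`. -/
def joinNode : Cmd :=
  .forEntries (entryCode ;;
    .assign rQ' (.get aHead (.add (.get aBase (.var rS')) (.var rFc))) ;;
    .loop (.not (.eq (.var rQ') (.lit 0)))
      (joinTry ;; .assign rQ' (.get aNxt (.var rQ'))))

/-- The entries that arise from two entries of the tables to be joined. -/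
def joined (B : Finset (Fin n)) (κ₁ κ₂ : Key n) (x : ℕ) : Set (Key n × ℕ) :=
  {e | ∃ R, Piece.JoinLabels B κ₁ κ₂ R ∧ e = (mkKey B κ₁.1 R, x)}

/-- Starting from the labels of `κ₁`, every bag vertex is merged with its canonical label under
`κ₂`, which is again a bag vertex. These pairs generate the partition of `κ₂`, so the result is the
join. -/
theorem joinLabels_runs {s : State} {B : Finset (Fin n)} {κ₁ κ₂ : Key n} (hB : BagList s B)
    (h₁ : ∀ y ∈ B, s.arr aWR y = κ₁.2 y) (h₂ : ∀ y ∈ B, s.arr aER (s.reg rQ' + y) = κ₂.2 y)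
    (hg : GoodKey B κ₂) :
    Runs D (.forBag rI rV ((.assign rMin (.get aWR (.var rV)) ;;
        .assign rQ (.get aWR (.get aER (.add (.var rQ') (.var rV))))) ;; relabel)) s
      ((30 * B.card + 30) * B.card + 5) fun s' =>
      Piece.JoinLabels B κ₁ κ₂ fun y => s'.arr aWR y := by
  refine (Runs.forBag hB (T := 30 * B.card + 20) (fun X s' =>
      (∀ x ∈ B, ∀ y ∈ B, κ₁.2 x = κ₁.2 y → s'.arr aWR x = s'.arr aWR y) ∧
      (∀ x ∈ X, ∀ w ∈ B, κ₂.2 x = w → s'.arr aWR x = s'.arr aWR w) ∧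
      -- Leastness is an invariant from the start: the labels never identify more than any
      -- equivalence relation that contains both partitions.
      ∀ C : Fin n → Fin n → Prop, Equivalence C →
        (∀ x ∈ B, ∀ y ∈ B, κ₁.2 x = κ₁.2 y → C x y) →
        (∀ x ∈ B, ∀ w ∈ B, κ₂.2 x = w → C x w) →
        ∀ x ∈ B, ∀ y ∈ B, s'.arr aWR x = s'.arr aWR y → C x y) rfl rfl rfl ?_ ?_ ?_).mono le_rfl
    fun s' _ h => ⟨h.1, h.2.1, h.2.2⟩
  · simp only [State.setReg_arr]
    refine ⟨fun x hx y hy h => by rw [h₁ x hx, h₁ y hy, h], by simp,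
      fun C _ hC _ x hx y hy h => hC x hx y hy ?_⟩
    rwa [h₁ x hx, h₁ y hy] at h
  · rintro X z s' hXB hz hzX hk ⟨i1, i2, i3⟩
    have e1 : s'.reg rQ' = s.reg rQ' := hk.reg _ rfl
    have e2 : s'.arr aER = s.arr aER := hk.arr _ rfl
    obtain ⟨w, hw, hwz, -⟩ := canon_spec κ₂.2 hz
    have hwz' : κ₂.2 z = w := by
      have : (mkKey B κ₁.1 κ₂.2).2 z = κ₂.2 z := by
        conv_rhs => rw [← hg.eq]
        rfl
      rw [← this]; exact hwz.symm
    refine Runs.seq_le (T₁ := 10) (T₂ := 30 * B.card + 5)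
      (Q := fun s₃ => s₃ = ((s'.setReg rV z).setReg rMin (s'.arr aWR z)).setReg rQ (s'.arr aWR w))
      (Runs.straight_le rfl (by decide) (by simp [e1, e2, h₂ z hz, hwz'])) ?_ (by omega)
    rintro _ _ rfl
    have hB' : BagList s' B := hB.congr (hk.reg _ rfl) (hk.arr _ rfl)
    refine (relabel_runs (((hB'.setReg _ _).setReg _ _).setReg _ _)).mono le_rfl
      fun s₄ _ h4 j => ?_
    simp only [State.setReg_arr]
    have key : ∀ y ∈ B, s₄.arr aWR y = if s'.arr aWR y = s'.arr aWR w then s'.arr aWR z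
        else s'.arr aWR y := fun y hy => by
      rw [h4 y hy]; simp
    refine ⟨fun x hx y hy h => ?_, fun x hx y hy h => ?_, fun C hC hl hr x hx y hy h => ?_⟩
    · rw [key x hx, key y hy, i1 x hx y hy h]
    · rcases Finset.mem_insert.1 hx with rfl | hx'
      · have : y = w := Fin.ext (h.symm.trans hwz')
        subst this
        rw [key x hz, key y hw, if_pos rfl]
        split_ifs <;> rfl
      · rw [key x (hXB hx'), key y hy, i2 x hx' y hy h]
    · have hzw : C z w := hr z hz w hw hwz'
      have i4 := i3 C hC hl hr
      rw [key x hx, key y hy] at h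
      split_ifs at h with h1 h2 h2
      · exact i4 x hx y hy (h1.trans h2.symm)
      · exact hC.trans (hC.trans (i4 x hx w hw h1) (hC.symm hzw)) (i4 z hz y hy h)
      · exact hC.trans (i4 x hx z hz h) (hC.trans hzw (i4 w hw y hy h2.symm))
      · exact i4 x hx y hy h
  · have : B.card * (30 * B.card + 20 + 10) = (30 * B.card + 30) * B.card := by ring
    omega

theorem joinTry_runs {s₀ s : State} {B : Finset (Fin n)} {lo lo₁ b₁ m₁ i lo₂ b₂ m₂ j : ℕ}
    {S : Set (Key n × ℕ)} {ks₁ ks₂ : ℕ → Key n} {vs₁ vs₂ : ℕ → ℕ}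
    (hC : Consts n N s) (hB : BagList s B) (hS : Filled s₀ s B lo S)
    (hT₁ : Table s B lo₁ b₁ m₁ ks₁ vs₁) (hi : i < m₁) (hP : s.reg rP = lo₁ + n * i)
    (hT₂ : Table s B lo₂ b₂ m₂ ks₂ vs₂) (hj : j < m₂) (hQ : s.reg rQ' = lo₂ + n * j) :
    Runs D joinTry s (300 * (B.card + 1) ^ 2) fun s' => Filled s₀ s' B lo
      (S ∪ joined B (ks₁ i) (ks₂ j) (vs₁ i + vs₂ j)) := by
  refine Runs.seq_le (loadState_runs hB)
    (T₂ := 100 * (B.card + 1) ^ 2 + (30 * B.card + 30) * B.card + 35) ?_ (by nlinarith)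
  intro s₁ hk₁ hw₁
  have hB₁ : BagList s₁ B := hB.congr (hk₁.reg _ rfl) (hk₁.arr _ rfl)
  have hw : ∀ y ∈ B, s₁.arr aWF y = (ks₁ i).1 y ∧ s₁.arr aWR y = (ks₁ i).2 y := fun y hy => by
    have := hw₁ y hy
    rw [hP] at this
    exact ⟨this.1.trans (hT₁.ef i hi y hy), this.2.trans (hT₁.er i hi y hy)⟩
  refine Runs.seq_le (joinLabels_runs hB₁ (fun y hy => (hw y hy).2) (fun y hy => ?_)
    (hT₂.good j hj)) (T₂ := 100 * (B.card + 1) ^ 2 + 30) ?_ (by omega)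
  · rw [hk₁.arr _ rfl, hk₁.reg _ rfl, hQ]
    exact hT₂.er j hj y hy
  intro s₂ hk₂ hr
  have e4 : s₂.reg rP = lo₁ + n * i := by rw [hk₂.reg _ rfl, hk₁.reg _ rfl, hP]
  have e5 : s₂.arr aVal (lo₁ + n * i) = vs₁ i := by
    rw [hk₂.arr _ rfl, hk₁.arr _ rfl]; exact hT₁.val i hi
  have e6 : s₂.reg rQ' = lo₂ + n * j := by rw [hk₂.reg _ rfl, hk₁.reg _ rfl, hQ]
  have e7 : s₂.arr aVal (lo₂ + n * j) = vs₂ j := by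
    rw [hk₂.arr _ rfl, hk₁.arr _ rfl]; exact hT₂.val j hj
  have hS₂ : Filled s₀ s₂ B lo S := (hS.keeps hk₁).keeps hk₂
  have hB₂ : BagList s₂ B := hB₁.congr (hk₂.reg _ rfl) (hk₂.arr _ rfl)
  have hC₂ : Consts n N s₂ := (hC.congr hk₁).congr hk₂
  have key : ∀ y ∈ B, s₂.arr aWF y = (ks₁ i).1 y := fun y hy => by
    rw [hk₂.arr _ rfl]; exact (hw y hy).1
  refine Runs.seq_le (T₁ := 20) (T₂ := 100 * (B.card + 1) ^ 2)
      (Q := fun s₃ => s₃ = s₂.setReg rVal (vs₁ i + vs₂ j))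
      (Runs.straight_le rfl (by decide) (by simp [e4, e5, e6, e7])) ?_ (by omega)
  rintro _ _ rfl
  refine (insertState_runs (hC₂.setReg _ _) (hB₂.setReg _ _) (fun y hy => ?_)
    (hS₂.setReg _ _)).mono le_rfl fun s₄ _ hf4 => hf4.cast ?_
  · rw [State.setReg_arr, key y hy]
    exact (hT₁.good i hi).lt y hy
  congr 1
  ext e
  have hE : ∀ R, Piece.JoinLabels B (ks₁ i) (ks₂ j) R →
      mkKey B (fun v => s₂.arr aWF v) (fun v => s₂.arr aWR v) = mkKey B (ks₁ i).1 R :=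
    fun R hR => mkKey_congr key fun x hx y hy => hr.iff hR hx hy
  simp only [State.setReg_arr, State.setReg_reg, if_true, Set.mem_singleton_iff, joined,
    Set.mem_ofPred_eq]
  constructor
  · rintro rfl
    exact ⟨_, hr, by rw [hE _ hr]⟩
  · rintro ⟨R, hR, rfl⟩
    rw [hE _ hR]

theorem entryCode_runs {s : State} {B : Finset (Fin n)} {lo base m i : ℕ} {ks : ℕ → Key n}
    {vs : ℕ → ℕ} (hC : Consts n N s) (hB : BagList s B) (hT : Table s B lo base m ks vs)
    (hi : i < m) (hP : s.reg rP = lo + n * i) :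
    Runs D entryCode s (30 * B.card + 7) fun s' => s'.reg rFc = fcode (ks i).1 := by
  have hg := hT.good i hi
  rw [← hg.eq, fcode_mkKey]
  refine Runs.seq_le (T₁ := 2) (T₂ := 30 * B.card + 5) (Q := fun s' => s' = s.setReg rFc 0)
    (Runs.straight_le rfl le_rfl rfl) ?_ (by omega)
  rintro _ _ rfl
  refine (Runs.forBag (hB.setReg _ _) (T := 20) (fun X s' =>
    s'.reg rFc = ∑ v ∈ X, (ks i).1 v * n ^ (v : ℕ)) rfl rfl rfl (by simp) ?_ (by omega)).mono
    le_rfl fun _ _ h => h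
  rintro X v s' _ hv hvX hk h1
  have hv2 : (v : ℕ) < n := v.2
  have e1 : s'.reg rP = lo + n * i := by rw [hk.reg _ rfl]; simpa using hP
  have e2 : s'.arr aEF (lo + n * i + v) = (ks i).1 v := by
    rw [hk.arr _ rfl]; exact hT.ef i hi v hv
  have e3 : s'.arr aMul v = v * n := by rw [hk.arr _ rfl]; exact hC.mul v (by omega)
  have e4 : s'.arr aMP (v * n + (ks i).1 v) = (ks i).1 v * n ^ (v : ℕ) := by
    rw [hk.arr _ rfl]; exact hC.pow v (by omega) _ (hg.lt v hv)
  refine Runs.straight_le rfl (by decide) fun j => ?_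
  simp [e1, e2, e3, e4, h1, Finset.sum_insert hvX]
  ring

theorem Table.card_le {s : State} {B : Finset (Fin n)} {lo base m : ℕ} {ks : ℕ → Key n}
    {vs : ℕ → ℕ} (hT : Table s B lo base m ks vs) : m ≤ n ^ B.card * Nat.bell B.card := by
  classical
  have h := card_keys_le (K := (Finset.range m).image ks) (B := B) (fun κ hκ => by
    obtain ⟨i, hi, rfl⟩ := Finset.mem_image.1 hκ
    exact (hT.good i (Finset.mem_range.1 hi)).eq) fun κ hκ => by
    obtain ⟨i, hi, rfl⟩ := Finset.mem_image.1 hκ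
    exact (hT.good i (Finset.mem_range.1 hi)).lt
  rwa [Finset.card_image_of_injOn, Finset.card_range] at h
  intro i hi j hj hij
  exact hT.inj i (by simpa using hi) j (by simpa using hj) hij

theorem Table.card_filter_le {s : State} {B : Finset (Fin n)} {lo base m : ℕ} {ks : ℕ → Key n}
    {vs : ℕ → ℕ} (hT : Table s B lo base m ks vs) (c : ℕ) :
    ((Finset.range m).filter fun i => fcode (ks i).1 = c).card ≤ Nat.bell B.card := by
  classical
  rcases ((Finset.range m).filter fun i => fcode (ks i).1 = c).eq_empty_or_nonempty with h | ⟨i, hi⟩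
  · simp [h]
  rw [Finset.mem_filter, Finset.mem_range] at hi
  have h := card_keys_fst_le (K := ((Finset.range m).filter fun i => fcode (ks i).1 = c).image ks)
    (B := B) (fun κ hκ => by
    obtain ⟨j, hj, rfl⟩ := Finset.mem_image.1 hκ
    rw [Finset.mem_filter, Finset.mem_range] at hj
    exact (hT.good j hj.1).eq) (ks i).1 fun κ hκ => by
    obtain ⟨j, hj, rfl⟩ := Finset.mem_image.1 hκ
    rw [Finset.mem_filter, Finset.mem_range] at hj
    exact fcode_inj (hT.good j hj.1).fst_lt (hT.good i hi.1).fst_lt (hj.2.trans hi.2.symm)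
  rwa [Finset.card_image_of_injOn] at h
  intro i hi j hj hij
  simp only [Finset.coe_filter, Finset.mem_range, Set.mem_ofPred_eq] at hi hj
  exact hT.inj i hi.1 j hj.1 hij

/-- For an entry of the first table only the list of those entries of the second table is traversed
that have the same centers. It has at most `Nat.bell B.card` members, and this avoids a product of
two full table sizes. -/
theorem joinNode_runs {s : State} {B : Finset (Fin n)} {lo m₁ m₂ : ℕ} {ks₁ ks₂ : ℕ → Key n}
    {vs₁ vs₂ : ℕ → ℕ} (hC : Consts n N s) (hB : BagList s B) (hS : Filled s s B lo ∅)
    (hT₁ : ChildTable s (s.reg rS) B lo m₁ ks₁ vs₁)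
    (hT₂ : ChildTable s (s.reg rS') B lo m₂ ks₂ vs₂) :
    Runs D joinNode s (m₁ * Nat.bell B.card * (500 * (B.card + 1) ^ 2) + 8) fun s' =>
      Filled s s' B lo {e | ∃ κ₁ κ₂ x₁ x₂ R, (κ₁, x₁) ∈ tab m₁ ks₁ vs₁ ∧
        (κ₂, x₂) ∈ tab m₂ ks₂ vs₂ ∧ κ₁.1 = κ₂.1 ∧ Piece.JoinLabels B κ₁ κ₂ R ∧
        e = (mkKey B κ₁.1 R, x₁ + x₂)} := by
  have hn : 0 < n := by have := hC.two_le; omega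
  set G : ℕ → ℕ → Set (Key n × ℕ) := fun i j =>
    {e | (ks₁ i).1 = (ks₂ j).1 ∧ e ∈ joined B (ks₁ i) (ks₂ j) (vs₁ i + vs₂ j)} with hG
  set F : ℕ → Set (Key n × ℕ) := fun i => {e | ∃ j < m₂, e ∈ G i j} with hF
  have hbell : 1 ≤ Nat.bell B.card := bell_pos _
  refine (Runs.forEntries (T := Nat.bell B.card * (400 * (B.card + 1) ^ 2))
    (fun i s' => Filled s s' B lo (upTo F i)) hC.n_eq hn rfl hT₁.hi
    rfl rfl rfl rfl (by rw [upTo_zero]; exact hS.setReg _ _) ?_ ?_).mono le_rfl ?_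
  · intro i s' hi hk hP hI
    have e5 : s'.reg rBase = s.reg rBase := by rw [hk.reg _ rfl]
    have hB' : BagList s' B := hB.congr (hk.reg _ rfl) (hk.arr _ rfl)
    have hC' : Consts n N s' := hC.congr hk
    refine Runs.seq_le (entryCode_runs hC' hB' (hI.childTable hn hT₁ e5) hi hP)
      (T₂ := Nat.bell B.card * (300 * (B.card + 1) ^ 2 + 20) + 20) ?_ ?_
    swap
    · have h1 : Nat.bell B.card * (400 * (B.card + 1) ^ 2) =
        Nat.bell B.card * (300 * (B.card + 1) ^ 2 + 20) +
          Nat.bell B.card * (100 * B.card ^ 2 + 200 * B.card + 80) := by ring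
      have h2 := Nat.mul_le_mul_right (100 * B.card ^ 2 + 200 * B.card + 80) hbell
      have h3 := Nat.zero_le (B.card ^ 2)
      omega
    intro s₁ hk₁ hfc
    have hI₁ : Filled s s₁ B lo (upTo F i) := hI.keeps hk₁
    have e6 : s₁.reg rBase = s.reg rBase := by rw [hk₁.reg _ rfl, e5]
    have tT₂ := hI₁.childTable hn hT₂ e6
    have hg₁ := hT₁.table.good i hi
    set c := fcode (ks₁ i).1 with hc
    refine Runs.seq_le (T₁ := 10) (T₂ := Nat.bell B.card * (300 * (B.card + 1) ^ 2 + 20) + 10)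
      (Q := fun s₂ => s₂ = s₁.setReg rQ' (s₁.arr aHead (s.arr aBase (s.reg rS') + c)))
      (Runs.straight_le rfl (by decide) ?_) ?_ (by omega)
    · have f1 : s₁.arr aBase = s.arr aBase := by rw [hk₁.arr _ rfl, hk.arr _ rfl]
      have f2 : s₁.reg rS' = s.reg rS' := by rw [hk₁.reg _ rfl, hk.reg _ rfl]
      simp [f1, f2, hfc]
    rintro _ _ rfl
    -- Invariant: `rQ'` is the last entry before `jj` with center code `c`, and the entries from
    -- `jj` on are done. The number of iterations plus the number of entries left is bounded by the
    -- Bell number.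
    refine (Runs.loop (T := 300 * (B.card + 1) ^ 2 + 10) (fun k s₃ => ∃ jj ≤ m₂,
      LastEntry ks₂ (s.arr aLo (s.reg rS')) c jj (s₃.reg rQ') ∧
      k + ((Finset.range jj).filter fun j => fcode (ks₂ j).1 = c).card ≤ Nat.bell B.card ∧
      Filled s s₃ B lo (upTo F i ∪ {e | ∃ j < m₂, jj ≤ j ∧ fcode (ks₂ j).1 = c ∧
        e ∈ joined B (ks₁ i) (ks₂ j) (vs₁ i + vs₂ j)})) (Nat.bell B.card) ?_ ?_).mono ?_ ?_
    · refine ⟨m₂, le_rfl, ?_, ?_, ?_⟩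
      · simpa using tT₂.head c (fcode_lt hg₁.fst_lt)
      · rw [zero_add]; exact tT₂.card_filter_le c
      · refine (hI₁.setReg _ _).cast ?_
        ext e
        simp only [Set.mem_union, Set.mem_ofPred_eq]
        refine ⟨.inl, ?_⟩
        rintro (h | ⟨j, h1, h2, _⟩)
        · exact h
        · omega
    · rintro k s₃ hk₃ ⟨jj, hjj, hl, hcard, hfill⟩ hb
      simp only [Test.Holds, Expr.eval] at hb
      rcases hl with ⟨h0, _⟩ | ⟨j, hj, hjc, hje, hjmax⟩
      · exact absurd h0 hb
      have hcard' : ((Finset.range jj).filter fun j => fcode (ks₂ j).1 = c).card =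
          ((Finset.range j).filter fun j => fcode (ks₂ j).1 = c).card + 1 := by
        rw [← Finset.card_insert_of_notMem (a := j) (by simp)]
        congr 1
        ext x
        simp only [Finset.mem_filter, Finset.mem_range, Finset.mem_insert]
        constructor
        · rintro ⟨h1, h2⟩
          by_cases hxj : x = j
          · exact .inl hxj
          · refine .inr ⟨?_, h2⟩
            by_contra hlt
            exact hjmax x (by omega) h1 h2
        · rintro (rfl | ⟨h1, h2⟩)
          · exact ⟨hj, hjc⟩
          · exact ⟨by omega, h2⟩
      refine ⟨by omega, ?_⟩
      have hB₃ : BagList s₃ B := ((hB'.congr (hk₁.reg _ rfl) (hk₁.arr _ rfl)).setReg _ _).congr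
        (hk₃.reg _ rfl) (hk₃.arr _ rfl)
      have hC₃ : Consts n N s₃ := ((hC'.congr hk₁).setReg _ _).congr hk₃
      have e7 : s₃.reg rBase = s.reg rBase := by rw [hk₃.reg _ rfl]; simpa using e6
      have e8 : s₃.reg rP = s.arr aLo (s.reg rS) + n * i := by
        rw [hk₃.reg _ rfl]; simp only [State.setReg_reg]; norm_num; rw [hk₁.reg _ rfl, hP]
      have hj₂ : j < m₂ := by omega
      refine Runs.seq_le (joinTry_runs hC₃ hB₃ hfill (hfill.childTable hn hT₁ e7) hi e8
        (hfill.childTable hn hT₂ e7) hj₂ hje) (T₂ := 10) ?_ le_rfl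
      intro s₄ hk₄ hf₄
      have e9 : s₄.reg rQ' = s.arr aLo (s.reg rS') + n * j := by rw [hk₄.reg _ rfl, hje]
      have e10 : s₄.reg rBase = s.reg rBase := by rw [hk₄.reg _ rfl, e7]
      have hnx := (hf₄.childTable hn hT₂ e10).nxt j hj₂
      rw [hjc] at hnx
      refine Runs.straight_le rfl (by decide) ?_
      simp only [Cmd.run, Expr.eval, e9]
      refine ⟨j, hj₂.le, by simpa using hnx, by omega, (hf₄.setReg _ _).cast ?_⟩
      rw [Set.union_assoc]
      congr 1
      ext e
      simp only [Set.mem_union, Set.mem_ofPred_eq]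
      constructor
      · rintro (⟨j', h1, h2, h3, h4⟩ | h)
        · exact ⟨j', h1, by omega, h3, h4⟩
        · exact ⟨j, hj₂, le_rfl, hjc, h⟩
      · rintro ⟨j', h1, h2, h3, h4⟩
        by_cases hjj' : j' = j
        · subst hjj'; exact .inr h4
        · refine .inl ⟨j', h1, ?_, h3, h4⟩
          by_contra hlt
          exact hjmax j' (by omega) (by omega) h3
    · simp only [Test.cost, Expr.cost]
      have : Nat.bell B.card * (1 + 1 + 1 + 1 + (300 * (B.card + 1) ^ 2 + 10)) ≤
        Nat.bell B.card * (300 * (B.card + 1) ^ 2 + 20) := Nat.mul_le_mul_left _ (by omega)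
      omega
    · rintro s₃ _ ⟨k, _, ⟨jj, hjj, hl, _, hfill⟩, hb⟩
      simp only [Test.Holds, Expr.eval, not_not] at hb
      have hnone : ∀ j < jj, fcode (ks₂ j).1 ≠ c := by
        rcases hl with ⟨_, h⟩ | ⟨j, hj, hjc, hje, hjmax⟩
        · exact h
        · have := tT₂.lo_pos
          omega
      refine (hfill.setReg _ _).cast ?_
      rw [upTo_succ]
      congr 1
      ext e
      simp only [hF, hG, Set.mem_ofPred_eq]
      constructor
      · rintro ⟨j, h1, _, h3, h4⟩
        exact ⟨j, h1, fcode_inj hg₁.fst_lt (hT₂.table.good j h1).fst_lt h3.symm, h4⟩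
      · rintro ⟨j, h1, h2, h3⟩
        have hjc : fcode (ks₂ j).1 = c := by rw [← h2]
        refine ⟨j, h1, ?_, hjc, h3⟩
        by_contra hlt
        exact hnone j (by omega) hjc
  · have h1 : m₁ * (Nat.bell B.card * (400 * (B.card + 1) ^ 2) + 8) ≤
        m₁ * (Nat.bell B.card * (500 * (B.card + 1) ^ 2)) := Nat.mul_le_mul_left _ (by
      have : Nat.bell B.card * (500 * (B.card + 1) ^ 2) = Nat.bell B.card * (400 * (B.card + 1) ^ 2)
        + Nat.bell B.card * (100 * (B.card + 1) ^ 2) := by ring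
      have h3 : 1 * (100 * 1) ≤ Nat.bell B.card * (100 * (B.card + 1) ^ 2) :=
        Nat.mul_le_mul hbell (Nat.mul_le_mul_left _ (Nat.one_le_pow _ _ (by omega)))
      omega)
    have h2 : m₁ * (Nat.bell B.card * (500 * (B.card + 1) ^ 2)) =
      m₁ * Nat.bell B.card * (500 * (B.card + 1) ^ 2) := by ring
    omega
  · rintro s' _ h
    refine h.cast ?_
    ext e
    constructor
    · rintro ⟨i, hi, j, hj, h1, R, h2, h3⟩
      exact ⟨_, _, _, _, R, ⟨i, hi, rfl⟩, ⟨j, hj, rfl⟩, h1, h2, h3⟩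
    · rintro ⟨κ₁, κ₂, x₁, x₂, R, ⟨i, hi, he⟩, ⟨j, hj, he'⟩, h1, h2, h3⟩
      obtain ⟨rfl, rfl⟩ := Prod.mk_inj.1 he
      obtain ⟨rfl, rfl⟩ := Prod.mk_inj.1 he'
      exact ⟨i, hi, j, hj, h1, R, h2, h3⟩

end ConnectedKCenter

namespace ConnectedKCenter

variable {n N : ℕ} {D : ℕ → ℝ≥0} {G : SimpleGraph (Fin n)}

theorem mul_add_inj {x y a b : ℕ} (ha : a < n) (hb : b < n) (h : x * n + a = y * n + b) :
    x = y ∧ a = b := by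
  have hn : 0 < n := by omega
  have e : ∀ x a, a < n → (x * n + a) / n = x := fun x a ha => by
    rw [mul_comm, Nat.mul_add_div hn, Nat.div_eq_of_lt ha, add_zero]
  have : x = y := by rw [← e x a ha, h, e y b hb]
  subst this
  exact ⟨rfl, by omega⟩

/-- The memory contains the nice tree decomposition `T`. -/
structure Inputs (T : NiceTreeDecomposition G (Fin N)) (s : State) : Prop where
  nodes : s.reg rNodes = N
  root : s.reg rRoot = T.root
  par : ∀ t : Fin N, s.arr aPar t = T.parent t
  bag : ∀ (t : Fin N) (v : Fin n), s.arr aBag (t * n + v) ≠ 0 ↔ v ∈ T.bag t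
  kind : ∀ t : Fin N, s.arr aKind t = (T.kind t).code
  lab : ∀ t : Fin N, s.arr aLab t = (T.kind t).label₁
  lab' : ∀ t : Fin N, s.arr aLab' t = (T.kind t).label₂

theorem Inputs.congr {T : NiceTreeDecomposition G (Fin N)} {s s' : State} (h : Inputs T s)
    {p : Cmd} (hk : p.Keeps s s') (h0 : p.writesReg rNodes = false := by rfl)
    (h1 : p.writesReg rRoot = false := by rfl) (h2 : p.writesArr aPar = false := by rfl)
    (h3 : p.writesArr aBag = false := by rfl) (h4 : p.writesArr aKind = false := by rfl)
    (h5 : p.writesArr aLab = false := by rfl) (h6 : p.writesArr aLab' = false := by rfl) :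
    Inputs T s' where
  nodes := by rw [hk.reg _ h0, h.nodes]
  root := by rw [hk.reg _ h1, h.root]
  par := by rw [hk.arr _ h2]; exact h.par
  bag := by rw [hk.arr _ h3]; exact h.bag
  kind := by rw [hk.arr _ h4]; exact h.kind
  lab := by rw [hk.arr _ h5]; exact h.lab
  lab' := by rw [hk.arr _ h6]; exact h.lab'

theorem Inputs.setReg {T : NiceTreeDecomposition G (Fin N)} {s : State} (h : Inputs T s)
    (x v : ℕ) (h1 : rNodes ≠ x := by decide) (h2 : rRoot ≠ x := by decide) :
    Inputs T (s.setReg x v) :=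
  ⟨by simpa [h1] using h.nodes, by simpa [h2] using h.root, h.par, h.bag, h.kind, h.lab, h.lab'⟩

/-! ## Preparations at a node -/

/-- List the bag of the node `rT`. -/
def listBag : Cmd :=
  .assign rBag (.lit 0) ;;
  .forc rV (.var rn) (.ite (.eq (.get aBag (.add (.get aMul (.var rT)) (.var rV))) (.lit 0)) .nop
    (.store aBL (.var rBag) (.var rV) ;; .assign rBag (.add (.var rBag) (.lit 1))))

theorem listBag_runs {s : State} {B : Finset (Fin n)} (hn : s.reg rn = n)
    (hB : ∀ v : Fin n, s.arr aBag (s.arr aMul (s.reg rT) + v) ≠ 0 ↔ v ∈ B) :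
    Runs D listBag s (30 * n + 10) fun s' => BagList s' B := by
  refine Runs.seq_le (T₁ := 2) (T₂ := 30 * n + 8) (Q := fun s' => s' = s.setReg rBag 0)
    (Runs.straight_le rfl le_rfl rfl) ?_ (by omega)
  rintro _ _ rfl
  refine (Runs.forc (T := 20) (fun i s' => BagList s' (B.filter fun v : Fin n => (v : ℕ) < i)) n
    rfl ?_ ?_ ?_ (by simp only [Expr.cost]; omega)).mono le_rfl ?_
  · intro s' hk
    simp only [Expr.eval]
    rw [hk.reg _ rfl]; simpa using hn
  · exact ⟨[], by simp, by simp, by simp, by simp⟩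
  · rintro i s' hi hk hV ⟨l, h1, h2, h3, h4⟩
    have e1 : s'.arr aBag = s.arr aBag := hk.arr _ rfl
    have e2 : s'.arr aMul = s.arr aMul := hk.arr _ rfl
    have e3 : s'.reg rT = s.reg rT := by rw [hk.reg _ rfl]; simp
    have hB' := hB ⟨i, hi⟩
    by_cases h : s.arr aBag (s.arr aMul (s.reg rT) + i) = 0
    · refine Runs.straight_le rfl (by decide) ?_
      simp only [Cmd.run, Test.Holds, Expr.eval, e1, e2, e3, hV, h, if_true]
      have : (B.filter fun v : Fin n => (v : ℕ) < i + 1) = B.filter fun v : Fin n => (v : ℕ) < i := by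
        ext v
        simp only [Finset.mem_filter]
        refine and_congr_right fun hv => ⟨fun hlt => ?_, fun hlt => by omega⟩
        by_contra hge
        have : v = ⟨i, hi⟩ := Fin.ext (show (v : ℕ) = i by omega)
        subst this
        exact hB'.2 hv h
      rw [this]
      exact ⟨l, h1, h2, by simpa using h3, by simpa using h4⟩
    · refine Runs.straight_le rfl (by decide) ?_
      simp only [Cmd.run, Test.Holds, Expr.eval, e1, e2, e3, hV, h, if_false]
      have hmem : (⟨i, hi⟩ : Fin n) ∈ B := hB'.1 h
      have hnot : (⟨i, hi⟩ : Fin n) ∉ l := by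
        rw [← List.mem_toFinset, h2]; simp
      refine ⟨l ++ [⟨i, hi⟩], ?_, ?_, by simp [h3], ?_⟩
      · rw [List.nodup_append]
        refine ⟨h1, by simp, ?_⟩
        intro a ha b hb
        rw [List.mem_singleton] at hb
        subst hb
        rintro rfl
        exact hnot ha
      · rw [List.toFinset_append, h2]
        ext v
        simp only [Finset.mem_union, Finset.mem_filter, List.toFinset_cons, List.toFinset_nil,
          insert_empty_eq, Finset.mem_singleton]
        constructor
        · rintro (⟨h5, h6⟩ | rfl)
          · exact ⟨h5, by omega⟩
          · exact ⟨hmem, by simp⟩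
        · rintro ⟨h5, h6⟩
          by_cases hv : (v : ℕ) = i
          · exact .inr (Fin.ext hv)
          · exact .inl ⟨h5, by omega⟩
      · intro j hj
        rw [List.length_append, List.length_singleton] at hj
        by_cases hjl : j < l.length
        · have : j ≠ l.length := by omega
          simp [h3, this, List.getElem_append_left hjl, h4 j hjl]
        · have : j = l.length := by omega
          subst this
          simp [h3]
  · rintro s' _ ⟨h, _⟩
    have : (B.filter fun v : Fin n => (v : ℕ) < n) = B := by
      ext v; simp
    rwa [this] at h

/-- The numbers `a` and `b` are the children of `t`, or `N`, if there are less than two. -/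
def Children (T : NiceTreeDecomposition G (Fin N)) (t : Fin N) (a b : ℕ) : Prop :=
  (a = N ∧ b = N ∧ ∀ c, ¬ T.IsChild c t) ∨
  (∃ c : Fin N, a = c ∧ b = N ∧ ∀ c', T.IsChild c' t ↔ c' = c) ∨
  ∃ c₁ c₂ : Fin N, a = c₁ ∧ b = c₂ ∧ c₁ ≠ c₂ ∧ ∀ c', T.IsChild c' t ↔ c' = c₁ ∨ c' = c₂

/-- Two different children identify the node as a join node, which has no others. -/
theorem NiceTreeDecomposition.isChild_iff_of_ne {T : NiceTreeDecomposition G (Fin N)}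
    {t c₁ c₂ : Fin N} (h₁ : T.IsChild c₁ t) (h₂ : T.IsChild c₂ t) (hne : c₁ ≠ c₂) (c : Fin N) :
    T.IsChild c t ↔ c = c₁ ∨ c = c₂ := by
  have one : ∀ d, (∀ s, T.IsChild s t ↔ s = d) → False := fun d hd =>
    hne (((hd _).1 h₁).trans ((hd _).1 h₂).symm)
  cases hk : T.kind t with
  | leaf => exact absurd h₁ ((piece_leaf hk).1 _)
  | introVertex v => obtain ⟨d, hd, -⟩ := piece_intro hk; exact (one d hd).elim
  | introEdge u v => obtain ⟨d, hd, -⟩ := piece_edge hk; exact (one d hd).elim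
  | forget v => obtain ⟨d, hd, -⟩ := piece_forget hk; exact (one d hd).elim
  | join =>
    obtain ⟨d₁, d₂, -, hd, -⟩ := piece_join hk
    rw [hd]
    rcases (hd _).1 h₁ with rfl | rfl <;> rcases (hd _).1 h₂ with rfl | rfl
    · exact absurd rfl hne
    · exact Iff.rfl
    · exact or_comm
    · exact absurd rfl hne

/-- Find the children of the node `rT`. -/
def findChildren : Cmd :=
  (.assign rS (.var rNodes) ;; .assign rS' (.var rNodes)) ;;
  .forc rI (.var rNodes) (.ite (.and (.not (.eq (.var rI) (.var rRoot)))
      (.eq (.get aPar (.var rI)) (.var rT)))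
    (.ite (.eq (.var rS) (.var rNodes)) (.assign rS (.var rI)) (.assign rS' (.var rI))) .nop)

theorem findChildren_runs {T : NiceTreeDecomposition G (Fin N)} {s : State} (hI : Inputs T s)
    {t : Fin N} (ht : s.reg rT = t) :
    Runs D findChildren s (40 * N + 20) fun s' => Children T t (s'.reg rS) (s'.reg rS') := by
  refine Runs.seq_le (T₁ := 5) (T₂ := 40 * N + 8)
    (Q := fun s' => s' = (s.setReg rS N).setReg rS' N)
    (Runs.straight_le rfl (by decide) (by simp [hI.nodes])) ?_ (by omega)
  rintro _ _ rfl
  refine (Runs.forc (T := 30) (fun i s' =>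
    (s'.reg rS = N ∧ s'.reg rS' = N ∧ ∀ c : Fin N, (c : ℕ) < i → ¬ T.IsChild c t) ∨
    (∃ c : Fin N, (c : ℕ) < i ∧ s'.reg rS = c ∧ s'.reg rS' = N ∧ T.IsChild c t ∧
      ∀ c' : Fin N, (c' : ℕ) < i → T.IsChild c' t → c' = c) ∨
    ∃ c₁ c₂ : Fin N, (c₁ : ℕ) < i ∧ s'.reg rS = c₁ ∧ s'.reg rS' = c₂ ∧ c₁ ≠ c₂ ∧ T.IsChild c₁ t ∧
      T.IsChild c₂ t) N rfl ?_ ?_ ?_ (by simp only [Expr.cost]; omega)).mono le_rfl ?_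
  · intro s' hk
    simp only [Expr.eval]
    rw [hk.reg _ rfl]; simpa using hI.nodes
  · left
    simp
  · rintro i s' hi hk hi' h
    have hI' : Inputs T s' := ((hI.setReg _ _).setReg _ _).congr hk
    have e1 : s'.reg rT = t := by rw [hk.reg _ rfl]; simpa using ht
    have e2 := hI'.par ⟨i, hi⟩
    have e3 := hI'.nodes
    have e4 := hI'.root
    have htest : (¬ i = (T.root : ℕ) ∧ (T.parent ⟨i, hi⟩ : ℕ) = t) ↔ T.IsChild ⟨i, hi⟩ t := by
      exact ⟨fun h => ⟨fun h' => h.1 (by rw [← h']), Fin.ext h.2⟩,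
        fun h => ⟨fun h' => h.1 (Fin.ext h'), by rw [h.2]⟩⟩
    by_cases hc : T.IsChild ⟨i, hi⟩ t
    · have hc1 := htest.2 hc
      rcases h with ⟨h1, h2, h3⟩ | ⟨c, hci, h1, h2, h3, h4⟩ | ⟨c₁, c₂, hci, h1, h2, h3, h4, h5⟩
      · refine Runs.straight_le rfl (by decide) (.inr (.inl ⟨⟨i, hi⟩, by simp, ?_, ?_, hc, ?_⟩))
        · simp only [Cmd.run, Test.Holds, Expr.eval, hi', e1, e2, e3, e4, h1, hc1]
          simp
        · simp only [Cmd.run, Test.Holds, Expr.eval, hi', e1, e2, e3, e4, h1, hc1]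
          simpa using h2
        · intro c' hc' hcc
          by_contra hne
          have : (c' : ℕ) ≠ i := fun h => hne (Fin.ext h)
          exact h3 c' (by omega) hcc
      · have hcN : ¬ (c : ℕ) = N := by omega
        refine Runs.straight_le rfl (by decide) (.inr (.inr ⟨c, ⟨i, hi⟩, by omega, ?_, ?_, ?_, h3, hc⟩))
        · simp only [Cmd.run, Test.Holds, Expr.eval, hi', e1, e2, e3, e4, h1, hc1, hcN]
          simpa using h1
        · simp only [Cmd.run, Test.Holds, Expr.eval, hi', e1, e2, e3, e4, h1, hc1, hcN]
          simp
        · rintro rfl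
          simp at hci
      · have hcN : ¬ (c₁ : ℕ) = N := by omega
        refine Runs.straight_le rfl (by decide) (.inr (.inr ⟨c₁, ⟨i, hi⟩, by omega, ?_, ?_, ?_, h4, hc⟩))
        · simp only [Cmd.run, Test.Holds, Expr.eval, hi', e1, e2, e3, e4, h1, hc1, hcN]
          simpa using h1
        · simp only [Cmd.run, Test.Holds, Expr.eval, hi', e1, e2, e3, e4, h1, hc1, hcN]
          simp
        · rintro rfl
          simp at hci
    · have hc1 : ¬ (¬ i = (T.root : ℕ) ∧ (T.parent ⟨i, hi⟩ : ℕ) = t) := fun h => hc (htest.1 h)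
      have hskip : ∀ c : Fin N, (c : ℕ) < i + 1 → T.IsChild c t → (c : ℕ) < i := by
        intro c hlt hcc
        by_contra hge
        have : c = ⟨i, hi⟩ := Fin.ext (show (c : ℕ) = i by omega)
        exact hc (this ▸ hcc)
      refine Runs.straight_le rfl (by decide) ?_
      simp only [Cmd.run, Test.Holds, Expr.eval, hi', e1, e2, e4, hc1, if_false]
      rcases h with ⟨h1, h2, h3⟩ | ⟨c, hci, h1, h2, h3, h4⟩ | ⟨c₁, c₂, hci, h1, h2, h3, h4, h5⟩
      · exact .inl ⟨by simpa using h1, by simpa using h2,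
          fun c hlt hcc => h3 c (hskip c hlt hcc) hcc⟩
      · exact .inr (.inl ⟨c, by omega, by simpa using h1, by simpa using h2, h3,
          fun c' hlt hcc => h4 c' (hskip c' hlt hcc) hcc⟩)
      · exact .inr (.inr ⟨c₁, c₂, by omega, by simpa using h1, by simpa using h2, h3, h4, h5⟩)
  · rintro s' _ ⟨h, -⟩
    rcases h with ⟨h1, h2, h3⟩ | ⟨c, hci, h1, h2, h3, h4⟩ | ⟨c₁, c₂, hci, h1, h2, h3, h4, h5⟩
    · exact .inl ⟨h1, h2, fun c => h3 c c.2⟩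
    · exact .inr (.inl ⟨c, h1, h2, fun c' => ⟨h4 c' c'.2, fun h => h ▸ h3⟩⟩)
    · exact .inr (.inr ⟨c₁, c₂, h1, h2, h3, fun c => T.isChild_iff_of_ne h4 h5 h3 c⟩)

/-- Compute the set of vertices below the node `rT`. -/
def markVerts : Cmd :=
  .forc rV (.var rn) (.store aVT (.add (.get aMul (.var rT)) (.var rV))
    (.add (.get aBag (.add (.get aMul (.var rT)) (.var rV)))
      (.add (.get aVT (.add (.get aMul (.var rS)) (.var rV)))
        (.get aVT (.add (.get aMul (.var rS')) (.var rV))))))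

/-- Sums serve as disjunctions: only whether a cell is zero matters. Row `N` stands for a missing
child, hence `c ≤ N`; the later invariants keep it zero. -/
theorem markVerts_runs {s : State} {t c c' : ℕ} (hC : Consts n N s)
    (ht : s.reg rT = t) (hc : s.reg rS = c) (hc' : s.reg rS' = c') (htN : t < N) (hcN : c ≤ N)
    (hcN' : c' ≤ N) (hct : c ≠ t) (hct' : c' ≠ t) :
    Runs D markVerts s (40 * n + 10) fun s' =>
      (∀ v < n, s'.arr aVT (t * n + v) =
        s.arr aBag (t * n + v) + (s.arr aVT (c * n + v) + s.arr aVT (c' * n + v))) ∧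
      ∀ d ≠ t, ∀ v < n, s'.arr aVT (d * n + v) = s.arr aVT (d * n + v) := by
  have hn := hC.two_le
  refine (Runs.forc (T := 30) (fun i s' => (∀ v < i, s'.arr aVT (t * n + v) =
        s.arr aBag (t * n + v) + (s.arr aVT (c * n + v) + s.arr aVT (c' * n + v))) ∧
      ∀ d ≠ t, ∀ v < n, s'.arr aVT (d * n + v) = s.arr aVT (d * n + v)) n rfl ?_ ?_ ?_
      (by simp only [Expr.cost]; omega)).mono le_rfl fun _ _ h => h.1
  · intro s' hk
    simp only [Expr.eval]
    rw [hk.reg _ rfl, hC.n_eq]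
  · simp
  · rintro i s' hi hk hV ⟨h1, h2⟩
    have hC' : Consts n N s' := hC.congr hk
    have e1 : s'.reg rT = t := by rw [hk.reg _ rfl, ht]
    have e2 : s'.reg rS = c := by rw [hk.reg _ rfl, hc]
    have e3 : s'.reg rS' = c' := by rw [hk.reg _ rfl, hc']
    have e4 := hC'.mul t (by omega)
    have e5 := hC'.mul c (by omega)
    have e6 := hC'.mul c' (by omega)
    have e7 : s'.arr aBag = s.arr aBag := hk.arr _ rfl
    have e8 := h2 c hct i hi
    have e9 := h2 c' hct' i hi
    refine Runs.straight_le rfl (by decide) ?_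
    simp only [Cmd.run, Expr.eval, hV, e1, e2, e3, e4, e5, e6, e7, e8, e9]
    refine ⟨fun v hv => ?_, fun d hd v hv => ?_⟩
    · by_cases hvi : v = i
      · subst hvi; simp
      · simp [hvi, h1 v (by omega)]
    · have : ¬ d * n + v = t * n + i := fun h => hd (mul_add_inj hv hi h).1
      simp [this, h2 d hd v hv]

end ConnectedKCenter

namespace ConnectedKCenter

variable {n N : ℕ} {D : ℕ → ℝ≥0} {G : SimpleGraph (Fin n)}

/-! ## The table of a node -/

/-- The assignment of `x` to `c` respects the radius in the cell `r`. -/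
def within (n : ℕ) (D : ℕ → ℝ≥0) (r : ℕ) (x c : Fin n) : Prop := D (x * n + c) ≤ D r

/-- A correct table of the node `t`. -/
structure NodeTable (T : NiceTreeDecomposition G (Fin N)) (ok : Fin n → Fin n → Prop) (s : State)
    (lo : ℕ) (t : Fin N) : Prop where
  table : ∃ m ks vs, ChildTable s t (T.bag t) lo m ks vs ∧ (T.piece t).TableOK ok (tab m ks vs)
  verts : ∀ v : Fin n, s.arr aVT (t * n + v) ≠ 0 ↔ v ∈ (T.piece t).verts

/-- Compute the table of the node `rT`. -/
def fillTable : Cmd :=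
  .ite (.eq (.get aKind (.var rT)) (.lit 0)) (.assign rVal (.lit 0) ;; insertState)
  (.ite (.eq (.get aKind (.var rT)) (.lit 1)) introNode
  (.ite (.eq (.get aKind (.var rT)) (.lit 2)) edgeNode
  (.ite (.eq (.get aKind (.var rT)) (.lit 3)) forgetNode joinNode)))

/-- A bound for the time needed to compute the table of a node. -/
def fillTime (n b : ℕ) : ℕ := 1000 * (b + 1) ^ 2 * (n ^ b * Nat.bell b ^ 2)

/-- The common form of the time at all kinds of nodes: `m` counts the entries, or pairs, that are
treated, `b` is the size of the actual bag and `B` a bound for all bags. The constants 508 and 50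
leave room for loop control and the tests of the node type. -/
theorem le_fillTime {n b B m X : ℕ} (hn : 0 < n) (hb : b ≤ B)
    (hX : X ≤ m * (508 * (b + 1) ^ 2) + 50) (hm : m ≤ n ^ B * Nat.bell B ^ 2) :
    X ≤ fillTime n B := by
  have h1 : m * (508 * (b + 1) ^ 2) ≤ n ^ B * Nat.bell B ^ 2 * (508 * (B + 1) ^ 2) := by
    gcongr
  have h2 : 1 ≤ n ^ B * Nat.bell B ^ 2 * (B + 1) ^ 2 :=
    Nat.mul_pos (Nat.mul_pos (pow_pos hn _) (pow_pos (bell_pos _) _)) (by positivity)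
  have h3 : fillTime n B = 1000 * (n ^ B * Nat.bell B ^ 2 * (B + 1) ^ 2) := by
    unfold fillTime; ring
  have h4 : n ^ B * Nat.bell B ^ 2 * (508 * (B + 1) ^ 2) =
    508 * (n ^ B * Nat.bell B ^ 2 * (B + 1) ^ 2) := by ring
  omega

theorem pow_mul_bell_le {n b B : ℕ} (hn : 0 < n) (hb : b ≤ B) :
    n ^ b * Nat.bell b ≤ n ^ B * Nat.bell B ^ 2 := by
  have h1 : Nat.bell b ≤ Nat.bell B ^ 2 := (bell_mono hb).trans (Nat.le_self_pow (by omega) _)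
  exact Nat.mul_le_mul (Nat.pow_le_pow_right hn hb) h1

theorem Filled.tableOK {s₀ s : State} {P : Piece (Fin n)} {lo : ℕ} {S : Set (Key n × ℕ)}
    {ok : Fin n → Fin n → Prop} (h : Filled s₀ s P.bag lo S) (hS : P.TableOK ok S) :
    ∃ m ks vs, Building s₀ s P.bag lo m ks vs ∧ P.TableOK ok (tab m ks vs) :=
  let ⟨m, ks, vs, h1, h2⟩ := h
  ⟨m, ks, vs, h1, hS.of_dominates h2⟩

theorem Runs.skip {b : Test} {p q : Cmd} {s : State} {T : ℕ} {Q : State → Prop}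
    (hb : ¬ b.Holds D s) (hq : Runs D q s T Q) : Runs D (.ite b p q) s (b.cost + T) Q :=
  (Runs.ite (T₁ := T) (T₂ := T) (fun h => absurd h hb) fun _ => hq).mono (by simp)
    fun _ _ h => h

theorem Runs.take {b : Test} {p q : Cmd} {s : State} {T : ℕ} {Q : State → Prop}
    (hb : b.Holds D s) (hp : Runs D p s T Q) : Runs D (.ite b p q) s (b.cost + T) Q :=
  (Runs.ite (T₁ := T) (T₂ := T) (fun _ => hp) fun h => absurd hb h).mono (by simp)
    fun _ _ h => h

theorem Children.eq_fst {T : NiceTreeDecomposition G (Fin N)} {t c : Fin N} {a b : ℕ}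
    (h : Children T t a b) (hc : ∀ s, T.IsChild s t ↔ s = c) : a = c := by
  rcases h with ⟨_, _, h⟩ | ⟨c', h1, _, h⟩ | ⟨c₁, c₂, _, _, hne, h⟩
  · exact absurd ((hc c).2 rfl) (h c)
  · rw [h1, (hc c').1 ((h c').2 rfl)]
  · exact absurd (((hc c₁).1 ((h c₁).2 (.inl rfl))).trans ((hc c₂).1 ((h c₂).2 (.inr rfl))).symm) hne

theorem Children.of_two {T : NiceTreeDecomposition G (Fin N)} {t d₁ d₂ : Fin N} {a b : ℕ}
    (h : Children T t a b) (hne : d₁ ≠ d₂) (hc : ∀ s, T.IsChild s t ↔ s = d₁ ∨ s = d₂) :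
    a = d₁ ∧ b = d₂ ∨ a = d₂ ∧ b = d₁ := by
  have i1 := (hc d₁).2 (.inl rfl)
  have i2 := (hc d₂).2 (.inr rfl)
  rcases h with ⟨_, _, h⟩ | ⟨c', h1, _, h⟩ | ⟨c₁, c₂, h1, h2, hne', h⟩
  · exact absurd i1 (h _)
  · exact absurd (((h _).1 i1).trans ((h _).1 i2).symm) hne
  · rcases (h _).1 i1 with rfl | rfl <;> rcases (h _).1 i2 with rfl | rfl
    · exact absurd rfl hne
    · exact .inl ⟨h1, h2⟩
    · exact .inr ⟨h1, h2⟩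
    · exact absurd rfl hne

/-- The table of a child with a bag of size `b` has at most `n ^ b * bell b` entries. At an
introduced vertex each entry is tried with `n` centers, but the bag of the child is smaller by one;
at a join each entry meets at most `bell b` others; at the remaining nodes the work per entry is
quadratic in the bag. So one bound fits all kinds. -/
theorem fillTable_runs {T : NiceTreeDecomposition G (Fin N)} {s : State} {t : Fin N} {lo : ℕ}
    (hC : Consts n N s) (hI : Inputs T s) (hB : BagList s (T.bag t))
    (ht : s.reg rT = t) (hS : Filled s s (T.bag t) lo ∅)
    (hX : s.reg rX = (T.kind t).label₁) (hY : s.reg rY = (T.kind t).label₂)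
    (hch : Children T t (s.reg rS) (s.reg rS'))
    (hT : ∀ c, T.IsChild c t → NodeTable T (within n D (s.reg rRad)) s lo c) :
    Runs D fillTable s (fillTime n (T.width + 1)) fun s' => ∃ m ks vs,
      Building s s' (T.bag t) lo m ks vs ∧
      (T.piece t).TableOK (within n D (s.reg rRad)) (tab m ks vs) := by
  have hn : 0 < n := by have := hC.two_le; omega
  have hk := hI.kind t
  have hb := T.card_bag_le t
  have hVT : ∀ c : Fin N, s.reg rS = c → T.IsChild c t → ∀ v : Fin n,
      s.arr aVT (s.arr aMul (s.reg rS) + v) ≠ 0 ↔ v ∈ (T.piece c).verts := fun c hc hct v => by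
    rw [hc, hC.mul _ (by have := c.2; omega)]
    exact (hT c hct).verts v
  cases hkt : T.kind t with
  | leaf =>
    obtain ⟨_, h1, h2⟩ := T.piece_leaf hkt
    have hb0 : T.bag t = ∅ := h1
    rw [hkt] at hk
    refine (Runs.take (b := .eq (.get aKind (.var rT)) (.lit 0)) (by simp [ht, hk, NodeKind.code])
      (Runs.seq_le (T₁ := 2) (T₂ := 100) (T := 102) (Q := fun s' => s' = s.setReg rVal 0)
      (R := fun s' => ∃ m ks vs, Building s s' (T.bag t) lo m ks vs ∧
        (T.piece t).TableOK (within n D (s.reg rRad)) (tab m ks vs))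
      (Runs.straight_le rfl le_rfl rfl) ?_ le_rfl)).mono ?_ fun _ _ h => h
    · rintro _ _ rfl
      refine (insertState_runs (hC.setReg _ _) (hB.setReg _ _) (by simp [hb0])
        (hS.setReg _ _)).mono (by simp [hb0]) fun s' _ h => ?_
      refine Filled.tableOK (P := T.piece t) h ?_
      rw [Set.empty_union]
      exact Piece.tableOK_leaf h1 h2 _ _
    · have := le_fillTime (X := 1 * (508 * (0 + 1) ^ 2)) (m := 1) hn (Nat.zero_le (T.width + 1))
        (by omega) (Nat.mul_pos (pow_pos hn _) (pow_pos (bell_pos _) _))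
      simp only [Test.cost, Expr.cost]
      omega
  | introVertex v =>
    obtain ⟨c, hc, hP⟩ := T.piece_intro hkt
    have hcS := hch.eq_fst hc
    have hcc := (hc c).2 rfl
    obtain ⟨m, ks, vs, h1, h2⟩ := (hT c hcc).table
    rw [hkt] at hk hX
    have hm := h1.table.card_le
    have hbc : (T.bag t).card = (T.bag c).card + 1 := by
      have := hP.bag
      have h3 : v ∉ T.bag c := fun h => hP.notMem ((T.piece c).bag_sub h)
      change T.bag t = insert v (T.bag c) at this
      rw [this, Finset.card_insert_of_notMem h3]
    refine (Runs.skip (b := .eq (.get aKind (.var rT)) (.lit 0)) (by simp [ht, hk, NodeKind.code])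
      (Runs.take (by simp [ht, hk, NodeKind.code]) (introNode_runs hC hB hP hS
        (by rw [hcS]; exact h1) hX (hVT c hcS hcc)))).mono
      (le_fillTime (m := m * n) hn hb ?_ ?_) fun s' _ h => ?_
    · change _ + (_ + (m * n * (500 * ((T.bag t).card + 1) ^ 2) + 8 * m + 8)) ≤ _
      have e1 : m * 1 ≤ m * n := Nat.mul_le_mul_left _ hn
      have e2 : m * n * 1 ≤ m * n * ((T.bag t).card + 1) ^ 2 :=
        Nat.mul_le_mul_left _ (Nat.one_le_pow _ _ (by omega))
      have e3 : m * n * (508 * ((T.bag t).card + 1) ^ 2) = m * n * (500 * ((T.bag t).card + 1) ^ 2)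
        + 8 * (m * n * ((T.bag t).card + 1) ^ 2) := by ring
      simp only [Test.cost, Expr.cost]
      omega
    · calc m * n ≤ n ^ (T.bag c).card * Nat.bell (T.bag c).card * n := Nat.mul_le_mul_right _ hm
        _ = n ^ (T.bag t).card * Nat.bell (T.bag c).card := by rw [hbc, pow_succ]; ring
        _ ≤ n ^ (T.bag t).card * Nat.bell (T.bag t).card :=
            Nat.mul_le_mul_left _ (bell_mono (by omega))
        _ ≤ _ := pow_mul_bell_le hn hb
    · exact Filled.tableOK (P := T.piece t) h (hP.table h2)
  | introEdge u v =>
    obtain ⟨c, hc, hP⟩ := T.piece_edge hkt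
    have hcS := hch.eq_fst hc
    have hcc := (hc c).2 rfl
    obtain ⟨m, ks, vs, h1, h2⟩ := (hT c hcc).table
    rw [hkt] at hk hX hY
    have hm := h1.table.card_le
    refine (Runs.skip (b := .eq (.get aKind (.var rT)) (.lit 0)) (by simp [ht, hk, NodeKind.code])
      (Runs.skip (b := .eq (.get aKind (.var rT)) (.lit 1)) (by simp [ht, hk, NodeKind.code])
      (Runs.take (by simp [ht, hk, NodeKind.code]) (edgeNode_runs hC hB hP hS
        (by rw [hcS]; exact h1) hX hY)))).mono
      (le_fillTime (m := m) hn hb ?_ (hm.trans (pow_mul_bell_le hn (T.card_bag_le c))))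
      fun s' _ h => ?_
    · change _ + (_ + (_ + (m * (300 * ((T.bag t).card + 1) ^ 2 + 8) + 8))) ≤ _
      have e2 : m * 1 ≤ m * ((T.bag t).card + 1) ^ 2 :=
        Nat.mul_le_mul_left _ (Nat.one_le_pow _ _ (by omega))
      have e3 : m * (508 * ((T.bag t).card + 1) ^ 2) = m * (300 * ((T.bag t).card + 1) ^ 2 + 8)
        + 208 * (m * ((T.bag t).card + 1) ^ 2) - 8 * m := by
          rw [eq_tsub_iff_add_eq_of_le] <;> [ring; omega]
      simp only [Test.cost, Expr.cost]
      omega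
    · exact Filled.tableOK (P := T.piece t) h (hP.table h2)
  | forget v =>
    obtain ⟨c, hc, hP⟩ := T.piece_forget hkt
    have hcS := hch.eq_fst hc
    have hcc := (hc c).2 rfl
    obtain ⟨m, ks, vs, h1, h2⟩ := (hT c hcc).table
    rw [hkt] at hk hX
    have hm := h1.table.card_le
    refine (Runs.skip (b := .eq (.get aKind (.var rT)) (.lit 0)) (by simp [ht, hk, NodeKind.code])
      (Runs.skip (b := .eq (.get aKind (.var rT)) (.lit 1)) (by simp [ht, hk, NodeKind.code])
      (Runs.skip (b := .eq (.get aKind (.var rT)) (.lit 2)) (by simp [ht, hk, NodeKind.code])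
      (Runs.take (by simp [ht, hk, NodeKind.code]) (forgetNode_runs hC hB hP hS
        (by rw [hcS]; exact h1) hX (hVT c hcS hcc)))))).mono
      (le_fillTime (m := m) hn hb ?_ (hm.trans (pow_mul_bell_le hn (T.card_bag_le c))))
      fun s' _ h => ?_
    · change _ + (_ + (_ + (_ + (m * (300 * ((T.bag t).card + 1) ^ 2 + 8) + 8)))) ≤ _
      have e2 : m * 1 ≤ m * ((T.bag t).card + 1) ^ 2 :=
        Nat.mul_le_mul_left _ (Nat.one_le_pow _ _ (by omega))
      have e3 : m * (508 * ((T.bag t).card + 1) ^ 2) = m * (300 * ((T.bag t).card + 1) ^ 2 + 8)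
        + 208 * (m * ((T.bag t).card + 1) ^ 2) - 8 * m := by
          rw [eq_tsub_iff_add_eq_of_le] <;> [ring; omega]
      simp only [Test.cost, Expr.cost]
      omega
    · exact Filled.tableOK (P := T.piece t) h (hP.table h2)
  | join =>
    obtain ⟨c₁, c₂, hS₁, hS₂, hc₁, hc₂, hP⟩ : ∃ c₁ c₂ : Fin N, s.reg rS = c₁ ∧ s.reg rS' = c₂ ∧
        T.IsChild c₁ t ∧ T.IsChild c₂ t ∧ (T.piece c₁).IsJoin (T.piece c₂) (T.piece t) := by
      obtain ⟨c₁, c₂, hne, hc, hP⟩ := T.piece_join hkt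
      rcases hch.of_two hne hc with ⟨h1, h2⟩ | ⟨h1, h2⟩
      · exact ⟨c₁, c₂, h1, h2, (hc _).2 (.inl rfl), (hc _).2 (.inr rfl), hP⟩
      · exact ⟨c₂, c₁, h1, h2, (hc _).2 (.inr rfl), (hc _).2 (.inl rfl), hP.symm⟩
    obtain ⟨m₁, ks₁, vs₁, h1, h2⟩ := (hT c₁ hc₁).table
    obtain ⟨m₂, ks₂, vs₂, h3, h4⟩ := (hT c₂ hc₂).table
    have hb₁ : T.bag c₁ = T.bag t := hP.bag₁
    have hb₂ : T.bag c₂ = T.bag t := hP.bag₂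
    rw [hkt] at hk
    have hm := h1.table.card_le
    rw [hb₁] at h1 hm
    rw [hb₂] at h3
    refine (Runs.skip (b := .eq (.get aKind (.var rT)) (.lit 0)) (by simp [ht, hk, NodeKind.code])
      (Runs.skip (b := .eq (.get aKind (.var rT)) (.lit 1)) (by simp [ht, hk, NodeKind.code])
      (Runs.skip (b := .eq (.get aKind (.var rT)) (.lit 2)) (by simp [ht, hk, NodeKind.code])
      (Runs.skip (b := .eq (.get aKind (.var rT)) (.lit 3)) (by simp [ht, hk, NodeKind.code])
      (joinNode_runs hC hB hS (by rw [hS₁]; exact h1) (by rw [hS₂]; exact h3)))))).mono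
      (le_fillTime (m := m₁ * Nat.bell (T.bag t).card) hn hb ?_ ?_) fun s' _ h => ?_
    · have e3 := Nat.mul_le_mul_left (m₁ * Nat.bell (T.bag t).card)
        (show 500 * ((T.bag t).card + 1) ^ 2 ≤ 508 * ((T.bag t).card + 1) ^ 2 by omega)
      simp only [Test.cost, Expr.cost]
      omega
    · calc m₁ * Nat.bell (T.bag t).card
          ≤ n ^ (T.bag t).card * Nat.bell (T.bag t).card * Nat.bell (T.bag t).card :=
            Nat.mul_le_mul_right _ hm
        _ = n ^ (T.bag t).card * Nat.bell (T.bag t).card ^ 2 := by ring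
        _ ≤ _ := Nat.mul_le_mul (Nat.pow_le_pow_right hn hb)
            (Nat.pow_le_pow_left (bell_mono hb) _)
    · exact Filled.tableOK (P := T.piece t) h (hP.table h2 h4)

end ConnectedKCenter

namespace ConnectedKCenter

variable {n N : ℕ} {D : ℕ → ℝ≥0} {G : SimpleGraph (Fin n)}

/-! ## The dynamic program -/

/-- The state of memory while the tables are computed. -/
structure DPState (T : NiceTreeDecomposition G (Fin N)) (D : ℕ → ℝ≥0) (s : State) : Prop where
  consts : Consts n N s
  inputs : Inputs T s
  ptr : 0 < s.reg rPtr
  fresh : ∀ x ≥ s.reg rBase, s.arr aHash x = 0 ∧ s.arr aHead x = 0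
  vtN : ∀ v < n, s.arr aVT (N * n + v) = 0
  tables : ∀ t : Fin N, s.arr aDone t ≠ 0 →
    NodeTable T (within n D (s.reg rRad)) s (s.reg rPtr) t

/-- Compute the table of the node `rT`, and mark the node. -/
def processNode : Cmd :=
  listBag ;; findChildren ;; markVerts ;;
  (.store aLo (.var rT) (.var rPtr) ;; .store aBase (.var rT) (.var rBase) ;;
    .assign rX (.get aLab (.var rT)) ;; .assign rY (.get aLab' (.var rT))) ;;
  fillTable ;;
  (.store aHi (.var rT) (.var rPtr) ;; .assign rBase (.add (.var rBase) (.var rNnn)) ;;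
    .store aDone (.var rT) (.lit 1))

theorem NodeTable.congr {T : NiceTreeDecomposition G (Fin N)} {ok : Fin n → Fin n → Prop}
    {s s' : State} {lo lo' hb : ℕ} {t : Fin N} (h : NodeTable T ok s lo t)
    (hs : SameBelow lo hb s s') (hn : 0 < n) (hlo : lo ≤ lo') (hb1 : s.reg rBase ≤ hb)
    (hb2 : s.reg rBase ≤ s'.reg rBase)
    (h1 : s'.arr aLo t = s.arr aLo t) (h2 : s'.arr aHi t = s.arr aHi t)
    (h3 : s'.arr aBase t = s.arr aBase t)
    (h4 : ∀ v < n, s'.arr aVT (t * n + v) = s.arr aVT (t * n + v)) : NodeTable T ok s' lo' t where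
  table := by
    obtain ⟨m, ks, vs, hc, ht⟩ := h.table
    refine ⟨m, ks, vs, ⟨?_, by rw [h2, h1, hc.hi], by rw [h1]; exact hc.le.trans hlo,
      by rw [h3]; exact hc.base.trans hb2⟩, ht⟩
    rw [h1, h3]
    exact hc.table.congr hs hn hc.le (hc.base.trans hb1)
  verts v := by rw [h4 v v.2]; exact h.verts v

theorem Children.le {T : NiceTreeDecomposition G (Fin N)} {t : Fin N} {a b : ℕ}
    (h : Children T t a b) : (a ≤ N ∧ a ≠ t) ∧ b ≤ N ∧ b ≠ t := by
  have key : ∀ c : Fin N, T.IsChild c t → (c : ℕ) ≤ N ∧ (c : ℕ) ≠ t := fun c hc => by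
    refine ⟨c.2.le, fun h => ?_⟩
    have h1 : c = t := Fin.ext h
    subst h1
    have := T.dist_child hc
    omega
  have hN : N ≤ N ∧ N ≠ t := ⟨le_rfl, by have := t.2; omega⟩
  rcases h with ⟨rfl, h2, _⟩ | ⟨c', rfl, h2, h⟩ | ⟨c₁, c₂, rfl, rfl, hne, h⟩
  · rw [h2]; exact ⟨hN, hN⟩
  · rw [h2]; exact ⟨key _ ((h _).2 rfl), hN⟩
  · exact ⟨key _ ((h _).2 (.inl rfl)), key _ ((h _).2 (.inr rfl))⟩

theorem Children.verts {T : NiceTreeDecomposition G (Fin N)} {t : Fin N} {a b : ℕ}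
    (h : Children T t a b) {f : ℕ → ℕ} {v : Fin n} (hN : f N = 0)
    (hf : ∀ c : Fin N, T.IsChild c t → (f c ≠ 0 ↔ v ∈ (T.piece c).verts)) :
    f a + f b ≠ 0 ↔ ∃ c, T.IsChild c t ∧ v ∈ (T.piece c).verts := by
  rcases h with ⟨rfl, h2, h⟩ | ⟨c', rfl, h2, h⟩ | ⟨c₁, c₂, rfl, rfl, hne, h⟩
  · simp [h2, hN, h]
  · have := hf c' ((h _).2 rfl)
    simp [h2, hN, h, ← this]
  · have h1 := hf c₁ ((h _).2 (.inl rfl))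
    have h2 := hf c₂ ((h _).2 (.inr rfl))
    simp only [h, or_and_right, exists_or, exists_eq_left, ← h1, ← h2]
    omega

/-- Tables are never overwritten: the new entries start at `rPtr`, its heads and hash cells at
`rBase`, and both only grow. So the tables of all marked nodes remain correct. -/
theorem processNode_runs {T : NiceTreeDecomposition G (Fin N)} {s : State} {t : Fin N}
    (h : DPState T D s) (ht : s.reg rT = t) (hd : ∀ c, T.IsChild c t → s.arr aDone c ≠ 0) :
    Runs D processNode s (fillTime n (T.width + 1) + 70 * n + 40 * N + 80) fun s' =>
      DPState T D s' ∧ s'.arr aDone = Function.update (s.arr aDone) t 1 := by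
  have hn : 0 < n := by have := h.consts.two_le; omega
  refine Runs.seq_le (listBag_runs (B := T.bag t) h.consts.n_eq fun v => ?_)
    (T₂ := fillTime n (T.width + 1) + 40 * n + 40 * N + 70) ?_ (by omega)
  · rw [ht, h.consts.mul _ (by have := t.2; omega)]
    exact h.inputs.bag t v
  intro s₁ hk₁ hB₁
  refine Runs.seq_le (findChildren_runs (h.inputs.congr hk₁) (t := t) (by rw [hk₁.reg _ rfl, ht]))
    (T₂ := fillTime n (T.width + 1) + 40 * n + 50) ?_ (by omega)
  intro s₂ hk₂ hch
  have hC₂ : Consts n N s₂ := (h.consts.congr hk₁).congr hk₂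
  have ht₂ : s₂.reg rT = t := by rw [hk₂.reg _ rfl, hk₁.reg _ rfl, ht]
  obtain ⟨⟨ha, hat⟩, hb, hbt⟩ := hch.le
  refine Runs.seq_le (markVerts_runs hC₂ ht₂ rfl rfl t.2 ha hb hat hbt)
    (T₂ := fillTime n (T.width + 1) + 40) ?_ (by omega)
  rintro s₃ hk₃ ⟨hv, hv'⟩
  have ht₃ : s₃.reg rT = t := by rw [hk₃.reg _ rfl, ht₂]
  have hI₃ : Inputs T s₃ := ((h.inputs.congr hk₁).congr hk₂).congr hk₃
  have hC₃ : Consts n N s₃ := hC₂.congr hk₃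
  have eVT : s₂.arr aVT = s.arr aVT := by rw [hk₂.arr _ rfl, hk₁.arr _ rfl]
  have hverts : ∀ v : Fin n, s₃.arr aVT (t * n + v) ≠ 0 ↔ v ∈ (T.piece t).verts := fun v => by
    have e1 : s₂.arr aBag = s.arr aBag := by rw [hk₂.arr _ rfl, hk₁.arr _ rfl]
    rw [hv v v.2, T.piece_verts_iff, ← h.inputs.bag, ← hch.verts
      (f := fun c => s.arr aVT (c * n + v)) (h.vtN v v.2) fun c hc => (h.tables c (hd c hc)).verts v,
      eVT, e1]
    omega
  rw [eVT] at hv'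
  set s₄ := (((s₃.setArr aLo t (s.reg rPtr)).setArr aBase t (s.reg rBase)).setReg rX
    (T.kind t).label₁).setReg rY (T.kind t).label₂ with hs₄
  have p1 : s₃.reg rPtr = s.reg rPtr := by rw [hk₃.reg _ rfl, hk₂.reg _ rfl, hk₁.reg _ rfl]
  have p2 : s₃.reg rBase = s.reg rBase := by rw [hk₃.reg _ rfl, hk₂.reg _ rfl, hk₁.reg _ rfl]
  have p3 : s₃.reg rRad = s.reg rRad := by rw [hk₃.reg _ rfl, hk₂.reg _ rfl, hk₁.reg _ rfl]
  refine Runs.seq_le (T₁ := 20) (T₂ := fillTime n (T.width + 1) + 20)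
    (Q := fun s' => s' = s₄) (Runs.straight_le rfl (by decide) ?_) ?_ (by omega)
  · have e1 := hI₃.lab t
    have e2 := hI₃.lab' t
    simp [ht₃, p1, p2, hs₄, e1, e2]
  rintro _ _ rfl
  have hC₄ : Consts n N s₄ := by
    refine ⟨?_, hC₃.two_le, ?_, ?_, ?_, ?_⟩
    · simpa [hs₄] using hC₃.n_eq
    · simpa [hs₄] using hC₃.mul
    · simpa [hs₄] using hC₃.pow
    · simpa [hs₄] using hC₃.nn
    · simpa [hs₄] using hC₃.nnn
  have hI₄ : Inputs T s₄ := by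
    refine ⟨?_, ?_, ?_, ?_, ?_, ?_, ?_⟩
    · simpa [hs₄] using hI₃.nodes
    · simpa [hs₄] using hI₃.root
    · simpa [hs₄] using hI₃.par
    · simpa [hs₄] using hI₃.bag
    · simpa [hs₄] using hI₃.kind
    · simpa [hs₄] using hI₃.lab
    · simpa [hs₄] using hI₃.lab'
  have hB₄ : BagList s₄ (T.bag t) := by
    refine hB₁.congr ?_ ?_
    · simp only [hs₄, State.setReg_reg, State.setArr_reg]
      norm_num
      rw [hk₃.reg _ rfl, hk₂.reg _ rfl]
    · simp only [hs₄, State.setReg_arr, State.setArr_arr]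
      norm_num
      rw [hk₃.arr _ rfl, hk₂.arr _ rfl]
  have q1 : s₄.reg rPtr = s.reg rPtr := by simp [hs₄, p1]
  have q2 : s₄.reg rBase = s.reg rBase := by simp [hs₄, p2]
  have q3 : s₄.reg rRad = s.reg rRad := by simp [hs₄, p3]
  have q4 : s₄.reg rS = s₂.reg rS := by
    simp only [hs₄, State.setReg_reg, State.setArr_reg]
    norm_num
    rw [hk₃.reg _ rfl]
  have q5 : s₄.reg rS' = s₂.reg rS' := by
    simp only [hs₄, State.setReg_reg, State.setArr_reg]
    norm_num
    rw [hk₃.reg _ rfl]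
  have key : ∀ a, a ≠ aLo → a ≠ aBase → listBag.writesArr a = false →
      findChildren.writesArr a = false → markVerts.writesArr a = false →
      s₄.arr a = s.arr a := by
    intro a h1 h2 h3 h4 h5
    simp only [hs₄, State.setReg_arr, State.setArr_arr, h1, h2, if_false]
    rw [hk₃.arr _ h5, hk₂.arr _ h4, hk₁.arr _ h3]
  have r1 : s₄.arr aEF = s.arr aEF := key _ (by decide) (by decide) rfl rfl rfl
  have r2 : s₄.arr aER = s.arr aER := key _ (by decide) (by decide) rfl rfl rfl
  have r3 : s₄.arr aVal = s.arr aVal := key _ (by decide) (by decide) rfl rfl rfl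
  have r4 : s₄.arr aNxt = s.arr aNxt := key _ (by decide) (by decide) rfl rfl rfl
  have r5 : s₄.arr aHead = s.arr aHead := key _ (by decide) (by decide) rfl rfl rfl
  have r6 : s₄.arr aHash = s.arr aHash := key _ (by decide) (by decide) rfl rfl rfl
  have r7 : s₄.arr aHi = s.arr aHi := key _ (by decide) (by decide) rfl rfl rfl
  have r8 : s₄.arr aDone = s.arr aDone := key _ (by decide) (by decide) rfl rfl rfl
  have r9 : ∀ c ≠ (t : ℕ), s₄.arr aLo c = s.arr aLo c := by
    intro c hc
    simp only [hs₄, State.setReg_arr, State.setArr_arr]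
    norm_num [hc]
    rw [hk₃.arr _ rfl, hk₂.arr _ rfl, hk₁.arr _ rfl]
  have r10 : ∀ c ≠ (t : ℕ), s₄.arr aBase c = s.arr aBase c := by
    intro c hc
    simp only [hs₄, State.setReg_arr, State.setArr_arr]
    norm_num [hc]
    rw [hk₃.arr _ rfl, hk₂.arr _ rfl, hk₁.arr _ rfl]
  have r11 : s₄.arr aVT = s₃.arr aVT := by simp [hs₄]
  have r12 : s₄.arr aLo t = s.reg rPtr := by simp [hs₄]
  have r13 : s₄.arr aBase t = s.reg rBase := by simp [hs₄]
  have sb : SameBelow (s.reg rPtr) (s.reg rBase) s s₄ := by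
    constructor <;> intros <;> simp only [r1, r2, r3, r4, r5]
  have hT₄ : ∀ c : Fin N, c ≠ t → s.arr aDone c ≠ 0 →
      NodeTable T (within n D (s.reg rRad)) s₄ (s.reg rPtr) c := by
    intro c hct hc
    have hct' : (c : ℕ) ≠ t := fun h => hct (Fin.ext h)
    refine (h.tables c hc).congr sb hn le_rfl le_rfl q2.ge (r9 c hct') (by rw [r7])
      (r10 c hct') fun v hv => by rw [r11, hv' _ hct' v hv]
  have hne : ∀ c, T.IsChild c t → c ≠ t := by
    rintro c hc rfl
    have := T.dist_child hc
    omega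
  -- The empty table is represented correctly because all heads and hash cells from `rBase` on are
  -- still zero.
  have hF₄ : Filled s₄ s₄ (T.bag t) (s.reg rPtr) ∅ := by
    refine ⟨0, fun _ => default, fun _ => 0, ⟨⟨h.ptr, by simp, by simp, by simp, by simp, by simp,
      fun c _ => .inl ⟨?_, by simp⟩, by simp⟩, by simp [q1], .refl _ _ _, by simp,
      fun c _ => ?_, fun c _ => ?_⟩, ⟨by simp [tab], by simp⟩⟩
    · rw [r5, q2]; exact (h.fresh _ (by omega)).2
    · rw [r6, q2]; exact (h.fresh _ (by omega)).1
    · rw [r5, q2]; exact (h.fresh _ (by omega)).2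
  refine Runs.seq_le (fillTable_runs hC₄ hI₄ hB₄ (by simp [hs₄, ht₃]) hF₄ (by simp [hs₄])
    (by simp [hs₄]) (by rw [q4, q5]; exact hch) fun c hc => by
      rw [q3]; exact hT₄ c (hne c hc) (hd c hc)) (T₂ := 20) ?_ le_rfl
  rintro s₅ hk₅ ⟨m, ks, vs, hbd, hok⟩
  rw [q3] at hok
  have u1 : s₅.reg rT = t := by rw [hk₅.reg _ rfl]; simp [hs₄, ht₃]
  have u2 : s₅.reg rBase = s.reg rBase := by rw [hk₅.reg _ rfl, q2]
  have u3 : s₅.reg rNnn = n ^ (2 * n) := (hC₄.congr hk₅).nnn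
  have u4 : s₅.reg rRad = s.reg rRad := by rw [hk₅.reg _ rfl, q3]
  have u5 : s₅.arr aDone = s.arr aDone := by rw [hk₅.arr _ rfl, r8]
  have u6 : s₅.arr aLo = s₄.arr aLo := hk₅.arr _ rfl
  have u7 : s₅.arr aBase = s₄.arr aBase := hk₅.arr _ rfl
  have u8 : s₅.arr aHi = s₄.arr aHi := hk₅.arr _ rfl
  have u9 : s₅.arr aVT = s₄.arr aVT := hk₅.arr _ rfl
  have hC₅ : Consts n N s₅ := hC₄.congr hk₅
  have hI₅ : Inputs T s₅ := hI₄.congr hk₅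
  have hnn : n ^ n ≤ n ^ (2 * n) := Nat.pow_le_pow_right hn (by omega)
  have hptr := hbd.ptr
  refine Runs.straight_le rfl (by decide) ?_
  set s₆ := Cmd.run D (.store aHi (.var rT) (.var rPtr) ;;
    .assign rBase (.add (.var rBase) (.var rNnn)) ;; .store aDone (.var rT) (.lit 1)) s₅ with hs₆
  have w : s₆ = ((s₅.setArr aHi t (s.reg rPtr + n * m)).setReg rBase
      (s.reg rBase + n ^ (2 * n))).setArr aDone t 1 := by
    simp [hs₆, u1, u2, u3, hptr]
  have w1 : s₆.reg rBase = s.reg rBase + n ^ (2 * n) := by simp [w]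
  have w2 : s₆.reg rPtr = s.reg rPtr + n * m := by simp [w, hptr]
  have w3 : s₆.reg rRad = s.reg rRad := by simp [w, u4]
  have w4 : s₆.arr aDone = Function.update (s.arr aDone) t 1 := by simp [w, u5]
  have w5 : ∀ a, a ≠ aHi → a ≠ aDone → s₆.arr a = s₅.arr a := fun a h1 h2 => by
    simp [w, h1, h2]
  have w6 : s₆.arr aHi = Function.update (s₅.arr aHi) t (s.reg rPtr + n * m) := by simp [w]
  have sb' : SameBelow (s.reg rPtr) (s.reg rBase) s₄ s₆ := by
    have := hbd.same
    rw [u2] at this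
    constructor
    · rw [w5 _ (by decide) (by decide)]; exact this.ef
    · rw [w5 _ (by decide) (by decide)]; exact this.er
    · rw [w5 _ (by decide) (by decide)]; exact this.val
    · rw [w5 _ (by decide) (by decide)]; exact this.nxt
    · rw [w5 _ (by decide) (by decide)]; exact this.head
  refine ⟨⟨?_, ?_, by rw [w2]; have := h.ptr; omega, fun x hx => ?_, fun v hv => ?_, fun c hc => ?_⟩,
    w4⟩
  · rw [w]
    refine ⟨?_, hC₅.two_le, ?_, ?_, ?_, ?_⟩
    · simpa using hC₅.n_eq
    · simpa using hC₅.mul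
    · simpa using hC₅.pow
    · simpa using hC₅.nn
    · simpa using hC₅.nnn
  · rw [w]
    refine ⟨?_, ?_, ?_, ?_, ?_, ?_, ?_⟩
    · simpa using hI₅.nodes
    · simpa using hI₅.root
    · simpa using hI₅.par
    · simpa using hI₅.bag
    · simpa using hI₅.kind
    · simpa using hI₅.lab
    · simpa using hI₅.lab'
  · rw [w1] at hx
    rw [w5 _ (by decide) (by decide), w5 _ (by decide) (by decide)]
    -- All codes that occur are below `n ^ (2 * n)`, so nothing was written from the new base on.
    obtain ⟨y, rfl⟩ : ∃ y, x = s.reg rBase + y := ⟨x - s.reg rBase, by omega⟩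
    have h1 := hbd.fresh y fun i hi => by
      have := code_lt (hbd.table.good i hi).fst_lt (hbd.table.good i hi).snd_lt
      omega
    have h2 := hbd.fresh' y (by omega)
    rw [u2] at h1 h2
    exact ⟨h1, h2⟩
  · rw [w5 _ (by decide) (by decide), u9, r11]
    exact (hv' N (by have := t.2; omega) v hv).trans (h.vtN v hv)
  · rw [w3]
    by_cases hct : c = t
    · subst hct
      refine ⟨⟨m, ks, vs, ⟨?_, ?_, ?_, ?_⟩, hok⟩, fun v => ?_⟩
      · have htab := hbd.table
        rw [w5 aLo (by decide) (by decide), w5 aBase (by decide) (by decide), u6, u7, r12, r13]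
        rw [u2] at htab
        refine htab.congr (s' := s₆) (lo' := s.reg rPtr + n * m) (hb := s.reg rBase + n ^ n) ?_ hn
          le_rfl le_rfl
        constructor <;> intros <;> rw [w5 _ (by decide) (by decide)]
      · rw [w6, w5 aLo (by decide) (by decide), u6, r12]; simp
      · rw [w2, w5 aLo (by decide) (by decide), u6, r12]
      · rw [w1, w5 aBase (by decide) (by decide), u7, r13]; omega
      · rw [w5 _ (by decide) (by decide), u9, r11]
        exact hverts v
    · have hct' : (c : ℕ) ≠ t := fun h => hct (Fin.ext h)
      rw [w4, Function.update_of_ne hct'] at hc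
      refine (hT₄ c hct hc).congr sb' hn (by rw [w2]; omega) q2.le (by rw [q2, w1]; omega)
        ?_ ?_ ?_ fun v _ => ?_
      · rw [w5 aLo (by decide) (by decide), u6]
      · rw [w6, Function.update_of_ne hct', u8]
      · rw [w5 aBase (by decide) (by decide), u7]
      · rw [w5 aVT (by decide) (by decide), u9]

end ConnectedKCenter

/-! ### Processing all nodes from the leaves to the root. -/

namespace ConnectedKCenter

variable {n N : ℕ} {D : ℕ → ℝ≥0} {G : SimpleGraph (Fin n)}

notation "rStep" => 29
notation "rLim" => 30

/-- The state of memory before the tables are computed. -/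
structure DPBase (T : NiceTreeDecomposition G (Fin N)) (s : State) : Prop where
  consts : Consts n N s
  inputs : Inputs T s
  ptr : 0 < s.reg rPtr
  fresh : ∀ x ≥ s.reg rBase, s.arr aHash x = 0 ∧ s.arr aHead x = 0
  vtN : ∀ v < n, s.arr aVT (N * n + v) = 0

theorem DPState.base {T : NiceTreeDecomposition G (Fin N)} {s : State} (h : DPState T D s) :
    DPBase T s := ⟨h.consts, h.inputs, h.ptr, h.fresh, h.vtN⟩

/-- The registers used by `DPBase`. -/
def baseRegs : List ℕ := [rn, rNodes, rRoot, rPtr, rBase, rNn, rNnn]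

/-- The arrays used by `DPBase`. -/
def baseArrs : List ℕ := [aPar, aBag, aKind, aLab, aLab', aMul, aMP, aHead, aHash, aVT]

theorem Cmd.Keeps.reg_of_all {p : Cmd} {s s' : State} (hk : p.Keeps s s') {l : List ℕ}
    (h : (l.all fun x => !p.writesReg x) = true) : ∀ x ∈ l, s'.reg x = s.reg x := fun x hx =>
  hk.reg x (by simpa using List.all_eq_true.1 h x hx)

theorem Cmd.Keeps.arr_of_all {p : Cmd} {s s' : State} (hk : p.Keeps s s') {l : List ℕ}
    (h : (l.all fun x => !p.writesArr x) = true) : ∀ x ∈ l, s'.arr x = s.arr x := fun x hx =>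
  hk.arr x (by simpa using List.all_eq_true.1 h x hx)

theorem DPBase.of_eq {T : NiceTreeDecomposition G (Fin N)} {s s' : State} (h : DPBase T s)
    (hr : ∀ x ∈ baseRegs, s'.reg x = s.reg x) (ha : ∀ a ∈ baseArrs, s'.arr a = s.arr a) :
    DPBase T s' := by
  simp only [baseRegs, baseArrs, List.forall_mem_cons, List.not_mem_nil, false_imp_iff,
    implies_true, and_true] at hr ha
  obtain ⟨r1, r2, r3, r4, r5, r6, r7⟩ := hr
  obtain ⟨a1, a2, a3, a4, a5, a6, a7, a8, a9, a10⟩ := ha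
  have hc := h.consts
  have hi := h.inputs
  refine ⟨⟨r1.trans hc.n_eq, hc.two_le, ?_, ?_, r6.trans hc.nn, r7.trans hc.nnn⟩,
    ⟨r2.trans hi.nodes, r3.trans hi.root, ?_, ?_, ?_, ?_, ?_⟩, r4 ▸ h.ptr, ?_, ?_⟩
  · rw [a6]; exact hc.mul
  · rw [a7]; exact hc.pow
  · rw [a1]; exact hi.par
  · rw [a2]; exact hi.bag
  · rw [a3]; exact hi.kind
  · rw [a4]; exact hi.lab
  · rw [a5]; exact hi.lab'
  · rw [a8, a9, r5]; exact h.fresh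
  · rw [a10]; exact h.vtN

theorem DPBase.keeps {T : NiceTreeDecomposition G (Fin N)} {s s' : State} (h : DPBase T s)
    {p : Cmd} (hk : p.Keeps s s') (hr : (baseRegs.all fun x => !p.writesReg x) = true := by rfl)
    (ha : (baseArrs.all fun x => !p.writesArr x) = true := by rfl) : DPBase T s' :=
  h.of_eq (hk.reg_of_all hr) (hk.arr_of_all ha)

theorem DPBase.setReg {T : NiceTreeDecomposition G (Fin N)} {s : State} (h : DPBase T s)
    (x v : ℕ) (hx : x ∉ baseRegs := by decide) : DPBase T (s.setReg x v) :=
  h.of_eq (fun y hy => by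
    have : y ≠ x := by rintro rfl; exact hx hy
    simp [this]) fun _ _ => rfl

/-- The arrays used by the tables. -/
def tableArrs : List ℕ := [aEF, aER, aVal, aNxt, aLo, aHi, aBase, aDone]

theorem DPState.of_eq {T : NiceTreeDecomposition G (Fin N)} {s s' : State} (h : DPState T D s)
    (hr : ∀ x ∈ rRad :: baseRegs, s'.reg x = s.reg x)
    (ha : ∀ a ∈ tableArrs ++ baseArrs, s'.arr a = s.arr a) : DPState T D s' := by
  rw [List.forall_mem_cons] at hr
  rw [List.forall_mem_append] at ha
  have hn : 0 < n := by have := h.consts.two_le; omega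
  have hb := h.base.of_eq hr.2 ha.2
  have hB := hr.2 rBase (by decide)
  have hP := hr.2 rPtr (by decide)
  have hH := ha.2 aHead (by decide)
  have hV := ha.2 aVT (by decide)
  have hR := hr.1
  have hA := ha.1
  simp only [tableArrs, List.forall_mem_cons, List.not_mem_nil, false_imp_iff,
    implies_true, and_true] at hA
  obtain ⟨a1, a2, a3, a4, a5, a6, a7, a8⟩ := hA
  refine ⟨hb.consts, hb.inputs, hb.ptr, hb.fresh, hb.vtN, fun t ht => ?_⟩
  rw [a8] at ht
  rw [hR, hP]
  refine (h.tables t ht).congr (hb := s.reg rBase) ?_ hn le_rfl le_rfl hB.ge (by rw [a5])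
    (by rw [a6]) (by rw [a7]) fun v _ => by rw [hV]
  constructor <;> intros <;> simp only [a1, a2, a3, a4, hH]

theorem DPState.keeps {T : NiceTreeDecomposition G (Fin N)} {s s' : State} (h : DPState T D s)
    {p : Cmd} (hk : p.Keeps s s')
    (hr : ((rRad :: baseRegs).all fun x => !p.writesReg x) = true := by rfl)
    (ha : ((tableArrs ++ baseArrs).all fun x => !p.writesArr x) = true := by rfl) :
    DPState T D s' :=
  h.of_eq (hk.reg_of_all hr) (hk.arr_of_all ha)

theorem DPState.setReg {T : NiceTreeDecomposition G (Fin N)} {s : State} (h : DPState T D s)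
    (x v : ℕ) (hx : x ∉ rRad :: baseRegs := by decide) : DPState T D (s.setReg x v) :=
  h.of_eq (fun y hy => by
    have : y ≠ x := by rintro rfl; exact hx hy
    simp [this]) fun _ _ => rfl

/-- Unmark all nodes. -/
def clearDone : Cmd := .forc rI (.var rNodes) (.store aDone (.var rI) (.lit 0))

/-- Prepares a run for another radius: if no node is marked, no table has to be correct. The
pointers are not reset, so each run works in fresh memory. -/
theorem clearDone_runs {T : NiceTreeDecomposition G (Fin N)} {s : State} (h : DPBase T s) :
    Runs D clearDone s (10 * N + 10) fun s' => DPState T D s' ∧ ∀ t < N, s'.arr aDone t = 0 := by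
  refine (Runs.forc (T := 3) (fun i s' => ∀ t < i, s'.arr aDone t = 0) N rfl ?_ (by simp) ?_
    (by simp only [Expr.cost]; omega)).mono le_rfl ?_
  · intro s' hk
    simp only [Expr.eval]
    rw [hk.reg _ rfl, h.inputs.nodes]
  · intro i s' hi _ hi' hI
    refine Runs.straight_le rfl (by decide) ?_
    intro t ht
    by_cases hti : t = i
    · simp [hti, hi']
    · simp [hti, hi', hI t (by omega)]
  · rintro s' hk ⟨h1, -⟩
    have hb := h.keeps hk
    exact ⟨⟨hb.consts, hb.inputs, hb.ptr, hb.fresh, hb.vtN, fun t ht => absurd (h1 t t.2) ht⟩, h1⟩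

/-- A node that can be processed next. -/
def Ready (T : NiceTreeDecomposition G (Fin N)) (s : State) (t : Fin N) : Prop :=
  s.arr aDone t = 0 ∧ ∀ c, T.IsChild c t → s.arr aDone c ≠ 0

/-- Find a node that can be processed. -/
def pickNode : Cmd :=
  .forc rU (.var rNodes) (.ite (.eq (.get aDone (.var rU)) (.lit 0))
    (.assign rF (.lit 1) ;;
      .forc rI (.var rNodes) (.ite (.and (.not (.eq (.var rI) (.var rRoot)))
        (.and (.eq (.get aPar (.var rI)) (.var rU)) (.eq (.get aDone (.var rI)) (.lit 0))))
        (.assign rF (.lit 0)) .nop) ;;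
      .ite (.eq (.var rF) (.lit 1)) (.assign rT (.var rU)) .nop) .nop)

theorem pickNode_runs {T : NiceTreeDecomposition G (Fin N)} {s : State} (hI : Inputs T s)
    (hR : ∃ t, Ready T s t) :
    Runs D pickNode s (N * (40 * N + 60) + 10) fun s' =>
      ∃ t : Fin N, s'.reg rT = t ∧ Ready T s t := by
  refine (Runs.forc (T := 30 * N + 40) (fun i s' => ∀ t : Fin N, (t : ℕ) < i → Ready T s t →
    ∃ t : Fin N, s'.reg rT = t ∧ Ready T s t) N rfl ?_ (by simp) ?_ ?_).mono le_rfl ?_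
  · intro s' hk
    simp only [Expr.eval]
    rw [hk.reg _ rfl, hI.nodes]
  · intro i s' hi hk hi' hinv
    have e1 : s'.arr aDone = s.arr aDone := hk.arr _ rfl
    have hI' : Inputs T s' := hI.congr hk
    refine Runs.ite_le (T₁ := 30 * N + 30) (fun h => ?_) (fun h => ?_)
      (by simp only [Test.cost, Expr.cost]; omega)
    · simp only [Test.Holds, Expr.eval, hi', e1] at h
      refine Runs.seq_le (T₁ := 2) (T₂ := 30 * N + 20) (Q := fun s'' => s'' = s'.setReg rF 1)
        (Runs.straight_le rfl le_rfl rfl) ?_ (by omega)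
      rintro _ _ rfl
      refine Runs.seq_le (Q := fun s'' => (s''.reg rF = 0 ∨ s''.reg rF = 1) ∧ (s''.reg rF = 1 ↔
        ∀ c, T.IsChild c ⟨i, hi⟩ → s.arr aDone c ≠ 0)) (T₁ := 30 * N + 10) (T₂ := 10) ?_ ?_
        (by omega)
      · refine (Runs.forc (T := 20) (fun j s'' => (s''.reg rF = 0 ∨ s''.reg rF = 1) ∧
          (s''.reg rF = 1 ↔ ∀ c : Fin N, (c : ℕ) < j → T.IsChild c ⟨i, hi⟩ →
            s.arr aDone c ≠ 0)) N rfl ?_ (by simp) ?_ (by simp only [Expr.cost]; omega)).mono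
            le_rfl ?_
        · intro s'' hk'
          simp only [Expr.eval]
          rw [hk'.reg _ rfl]; simpa using hI'.nodes
        · rintro j s'' hj hk' hj' ⟨h01, hiff⟩
          have hI'' : Inputs T s'' := (hI'.setReg _ _).congr hk'
          have e2 : s''.arr aDone = s.arr aDone := (hk'.arr _ rfl).trans e1
          have e3 : s''.reg rU = i := by rw [hk'.reg _ rfl]; simpa using hi'
          have e4 := hI''.par ⟨j, hj⟩
          have e5 := hI''.root
          have htest : (¬ j = (T.root : ℕ) ∧ (T.parent ⟨j, hj⟩ : ℕ) = i) ↔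
              T.IsChild ⟨j, hj⟩ ⟨i, hi⟩ :=
            ⟨fun h => ⟨fun h' => h.1 (by rw [← h']), Fin.ext h.2⟩,
              fun h => ⟨fun h' => h.1 (Fin.ext h'), by rw [h.2]⟩⟩
          by_cases hc : ¬ j = (T.root : ℕ) ∧ (T.parent ⟨j, hj⟩ : ℕ) = i ∧ s.arr aDone j = 0
          · refine Runs.straight_le rfl (by decide) ?_
            simp only [Cmd.run, Test.Holds, Expr.eval, hj', e2, e3, e4, e5, hc]
            simp
            exact ⟨⟨j, hj⟩, by simp, htest.1 ⟨hc.1, hc.2.1⟩, hc.2.2⟩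
          · refine Runs.straight_le rfl (by decide) ?_
            simp only [Cmd.run, Test.Holds, Expr.eval, hj', e2, e3, e4, e5, hc, if_false]
            refine ⟨by simpa using h01, ?_⟩
            have : (s''.setReg rI (j + 1)).reg rF = s''.reg rF := by simp
            rw [this, hiff]
            refine ⟨fun h c hcj hct => ?_, fun h c hcj => h c (by omega)⟩
            by_cases hcj' : (c : ℕ) = j
            · have : c = ⟨j, hj⟩ := Fin.ext hcj'
              subst this
              have := htest.2 hct
              exact fun h0 => hc ⟨this.1, this.2, h0⟩
            · exact h c (by omega) hct
        · rintro s'' _ ⟨⟨h01, h1⟩, -⟩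
          exact ⟨h01, h1.trans ⟨fun h c => h c c.2, fun h c _ => h c⟩⟩
      · rintro s'' hk' ⟨h01, hiff⟩
        have e3 : s''.reg rU = i := by rw [hk'.reg _ rfl]; simpa using hi'
        have e4 : s''.reg rT = s'.reg rT := by rw [hk'.reg _ rfl]; simp
        by_cases hF : s''.reg rF = 1
        · refine Runs.straight_le rfl (by decide) fun t ht hR => ⟨⟨i, hi⟩, ?_, h, hiff.1 hF⟩
          simp [hF, e3]
        · refine Runs.straight_le rfl (by decide) fun t ht hR => ?_
          by_cases hti : (t : ℕ) = i
          · have : t = ⟨i, hi⟩ := Fin.ext hti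
            subst this
            exact absurd (hiff.2 hR.2) hF
          · simp [hF, e4]
            exact hinv t (by omega) hR
    · simp only [Test.Holds, Expr.eval, hi', e1] at h
      refine Runs.straight_le rfl (by simp [Cmd.time]) fun t ht hR => ?_
      by_cases hti : (t : ℕ) = i
      · exact absurd (hti ▸ hR.1) h
      · simpa using hinv t (by omega) hR
  · simp only [Expr.cost]
    have : N * (30 * N + 40 + 1 + 6) ≤ N * (40 * N + 60) := Nat.mul_le_mul_left _ (by omega)
    omega
  · rintro s' _ ⟨h, -⟩
    obtain ⟨t, ht⟩ := hR
    exact h t t.2 ht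

/-- Compute all tables for the radius in the cell `rRad`. -/
def runDP : Cmd := clearDone ;; .forc rStep (.var rNodes) (pickNode ;; processNode)

/-- A bound for the running time of `runDP`. -/
def dpTime (n N b : ℕ) : ℕ := N * (fillTime n b + 70 * n + N * (40 * N + 100) + 200) + 30

/-- The children of an unmarked node that is farthest from the root are all marked. -/
theorem exists_ready {T : NiceTreeDecomposition G (Fin N)} {s : State}
    (h : ∃ t : Fin N, s.arr aDone t = 0) : ∃ t, Ready T s t := by
  classical
  have hne : (Finset.univ.filter fun t : Fin N => s.arr aDone t = 0).Nonempty := by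
    obtain ⟨t, ht⟩ := h
    exact ⟨t, by simpa using ht⟩
  obtain ⟨t, ht, hmax⟩ := Finset.exists_max_image _ (fun t => T.tree.dist T.root t) hne
  refine ⟨t, by simpa using ht, fun c hc h0 => ?_⟩
  have h1 := hmax c (by simpa using h0)
  have := T.dist_child hc
  omega

theorem runDP_runs {T : NiceTreeDecomposition G (Fin N)} {s : State} (h : DPBase T s) :
    Runs D runDP s (dpTime n N (T.width + 1)) fun s' =>
      DPState T D s' ∧ ∀ t : Fin N, s'.arr aDone t ≠ 0 := by
  classical
  refine Runs.seq_le (clearDone_runs h) (T₂ := N * (fillTime n (T.width + 1) + 70 * n +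
    N * (40 * N + 100) + 100) + 10) ?_ (by unfold dpTime; ring_nf; omega)
  rintro s₁ hk₁ ⟨h₁, hz⟩
  refine (Runs.forc (T := fillTime n (T.width + 1) + 70 * n + N * (40 * N + 100) + 90)
    (fun i s' => DPState T D s' ∧
      (Finset.univ.filter fun t : Fin N => s'.arr aDone t ≠ 0).card = i) N rfl ?_ ?_ ?_ ?_).mono
      le_rfl ?_
  · intro s' hk
    simp only [Expr.eval]
    rw [hk.reg _ rfl, h₁.inputs.nodes]
  · refine ⟨h₁.setReg _ _, ?_⟩
    rw [Finset.card_eq_zero, Finset.filter_eq_empty_iff]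
    intro t _
    simpa using hz t t.2
  · rintro i s' hi hk hi' ⟨hst, hcard⟩
    have hex : ∃ t : Fin N, s'.arr aDone t = 0 := by
      by_contra! hcon
      rw [Finset.filter_true_of_mem fun t _ => hcon t, Finset.card_univ, Fintype.card_fin] at hcard
      omega
    refine Runs.seq_le (pickNode_runs hst.inputs (exists_ready hex))
      (T₂ := fillTime n (T.width + 1) + 70 * n + 40 * N + 80) ?_ (by ring_nf; omega)
    rintro s'' hk' ⟨t, ht, hR⟩
    have hst' : DPState T D s'' := hst.keeps hk'
    have e1 : s''.arr aDone = s'.arr aDone := hk'.arr _ rfl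
    refine (processNode_runs hst' ht (by rw [e1]; exact hR.2)).mono le_rfl ?_
    rintro s₃ _ ⟨h3, h4⟩
    refine ⟨h3.setReg _ _, ?_⟩
    simp only [State.setReg_arr, h4, e1]
    rw [← hcard, ← Finset.card_insert_of_notMem (a := t) (by simp [hR.1])]
    congr 1
    ext c
    by_cases hc : c = t
    · subst hc; simp
    · have : (c : ℕ) ≠ t := fun h => hc (Fin.ext h)
      simp [hc, this]
  · simp only [Expr.cost]
    ring_nf; omega
  · rintro s' _ ⟨⟨h1, h2⟩, -⟩
    refine ⟨h1, fun t => ?_⟩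
    have : (Finset.univ.filter fun t : Fin N => s'.arr aDone t ≠ 0) = Finset.univ := by
      rw [← Finset.card_eq_iff_eq_univ, h2, Fintype.card_fin]
    have ht := Finset.mem_univ t
    rw [← this, Finset.mem_filter] at ht
    exact ht.2

/-! ## Testing a radius -/

/-- The radius in the cell `r` can be achieved with at most `k` centers. -/
def FeasibleAt (D : ℕ → ℝ≥0) (G : SimpleGraph (Fin n)) (k r : ℕ) : Prop :=
  ∃ a : Fin n → Fin n, Centered G a ∧ (∀ x, within n D r x (a x)) ∧ (centers a).card ≤ k

/-- Look for a small value in the table of the root. -/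
def testRoot : Cmd :=
  (.assign rS (.var rRoot) ;; .assign rF (.lit 0)) ;;
  .forEntries (.ite (.lt (.get aVal (.var rP)) (.var rLim))
    (.assign rF (.lit 1) ;; .assign rVal (.get aVal (.var rP))) .nop)

/-- With an empty bag there is at most one key, hence at most one entry, and it carries the least
value. Comparing it with `(k + 1) * n ^ n` decides feasibility, and the value itself encodes an
assignment. -/
theorem testRoot_runs {T : NiceTreeDecomposition G (Fin N)} {s : State} {k : ℕ}
    (h : DPState T D s) (hd : s.arr aDone T.root ≠ 0) (hk : s.reg rLim = (k + 1) * n ^ n) :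
    Runs D testRoot s 60 fun s' =>
      (s'.reg rF = 0 ∧ ¬ FeasibleAt D G k (s.reg rRad)) ∨
      (s'.reg rF = 1 ∧ ∃ a : Fin n → Fin n, Centered G a ∧
        (∀ x, within n D (s.reg rRad) x (a x)) ∧ (centers a).card ≤ k ∧
        s'.reg rVal = fcode (fun v => (a v : ℕ)) + (centers a).card * n ^ n) := by
  have hn : 0 < n := by have := h.consts.two_le; omega
  obtain ⟨m, ks, vs, hc, hok⟩ := (h.tables _ hd).table
  have hm : m ≤ 1 := by
    have := hc.table.card_le
    simpa [T.root_bag] using this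
  refine Runs.seq_le (T₁ := 10) (T₂ := 50)
    (Q := fun s' => s' = (s.setReg rS T.root).setReg rF 0)
    (Runs.straight_le rfl (by decide) (by simp [h.inputs.root])) ?_ le_rfl
  rintro _ _ rfl
  refine (Runs.forEntries (T := 25) (fun i s' => (s'.reg rF = 0 ∧ ∀ j < i, (k + 1) * n ^ n ≤ vs j) ∨
      (s'.reg rF = 1 ∧ ∃ j < m, vs j < (k + 1) * n ^ n ∧ s'.reg rVal = vs j))
    (by simpa using h.consts.n_eq) hn rfl (by simpa using hc.hi) rfl rfl rfl rfl (by simp)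
    ?_ (by omega)).mono le_rfl ?_
  · intro i s' hi hk' hP hI
    have e1 : s'.reg rLim = (k + 1) * n ^ n := by rw [hk'.reg _ rfl]; simpa using hk
    have e2 : s'.arr aVal (s'.reg rP) = vs i := by
      rw [hP, hk'.arr _ rfl]
      simpa using hc.table.val i hi
    by_cases hlt : vs i < (k + 1) * n ^ n
    · refine Runs.straight_le rfl (by decide) (.inr ⟨?_, i, hi, hlt, ?_⟩) <;>
      simp [e1, e2, hlt]
    · refine Runs.straight_le rfl (by decide) ?_
      rcases hI with ⟨h1, h2⟩ | ⟨h1, j, h2, h3, h4⟩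
      · refine .inl ⟨by simp [e1, e2, hlt, h1], fun j hj => ?_⟩
        rcases Nat.lt_succ_iff_lt_or_eq.1 hj with h | rfl
        · exact h2 j h
        · omega
      · refine .inr ⟨by simp [e1, e2, hlt, h1], j, h2, h3, by simp [e1, e2, hlt, h4]⟩
  · rintro s' _ (⟨h1, h2⟩ | ⟨h1, j, h2, h3, h4⟩)
    · refine .inl ⟨h1, ?_⟩
      rintro ⟨a, ha, hw, hcard⟩
      obtain ⟨x, hx, j, hj, he⟩ := hok.complete a _ (T.valid_root_iff.2 ⟨ha, hw⟩)
        (Piece.isKey_mkKey (F := fun v => (a v : ℕ)) (R := fun _ => 0) (fun _ _ => rfl)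
          (fun x hx => by rw [T.piece_root_bag] at hx; simp at hx))
      obtain ⟨-, rfl⟩ := Prod.mk_inj.1 he
      have := h2 j hj
      have := (T.val_root_lt_iff hn a k).2 hcard
      omega
    · refine .inr ⟨h1, ?_⟩
      obtain ⟨a, ha, -, hval⟩ := hok.sound (ks j) (vs j) ⟨j, h2, rfl⟩
      obtain ⟨hc1, hw⟩ := T.valid_root_iff.1 ha
      rw [← hval] at h3
      exact ⟨a, hc1, hw, (T.val_root_lt_iff hn a k).1 h3, by rw [h4, ← hval, T.val_root, fcode]⟩

end ConnectedKCenter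

namespace ConnectedKCenter

variable {n N : ℕ} {D : ℕ → ℝ≥0} {G : SimpleGraph (Fin n)}

/-! ## Precomputation -/

/-- Compute the multiples of `n`. -/
def mulTable : Cmd :=
  .assign rX (.lit 0) ;;
  .forc rI (.add (.add (.var rn) (.var rn)) (.var rNodes))
    (.store aMul (.var rI) (.var rX) ;; .assign rX (.add (.var rX) (.var rn)))

theorem mulTable_runs {s : State} (hn : s.reg rn = n) (hN : s.reg rNodes = N) :
    Runs D mulTable s (20 * (2 * n + N) + 20) fun s' => ∀ i < 2 * n + N, s'.arr aMul i = i * n := by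
  refine Runs.seq_le (T₁ := 2) (T₂ := 20 * (2 * n + N) + 10) (Q := fun s' => s' = s.setReg rX 0)
    (Runs.straight_le rfl le_rfl rfl) ?_ (by omega)
  rintro _ _ rfl
  refine (Runs.forc (T := 8) (fun i s' => s'.reg rX = i * n ∧ ∀ j < i, s'.arr aMul j = j * n)
    (2 * n + N) rfl ?_ (by simp) ?_ (by simp only [Expr.cost]; omega)).mono le_rfl
    fun _ _ h => h.1.2
  · intro s' hk
    simp only [Expr.eval]
    rw [hk.reg _ rfl, hk.reg _ rfl]
    simp [hn, hN]
    omega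
  · rintro i s' hi hk hi' ⟨h1, h2⟩
    have e1 : s'.reg rn = n := by rw [hk.reg _ rfl]; simpa using hn
    refine Runs.straight_le rfl (by decide) ?_
    simp [hi', h1, e1]
    refine ⟨by ring, fun j hj => ?_⟩
    by_cases hji : j = i
    · simp [hji]
    · simp [hji, h2 j (by omega)]

/-- Does the graph have an edge? -/
def findEdge : Cmd :=
  .assign rF (.lit 0) ;;
  .forc rI (.get aMul (.var rn))
    (.ite (.eq (.get aAdj (.var rI)) (.lit 0)) .nop (.assign rF (.lit 1)))

theorem findEdge_runs {s : State} (hm : s.arr aMul (s.reg rn) = n * n) :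
    Runs D findEdge s (20 * (n * n) + 20) fun s' =>
      s'.reg rF = 0 ↔ ∀ x < n * n, s.arr aAdj x = 0 := by
  refine Runs.seq_le (T₁ := 2) (T₂ := 20 * (n * n) + 10) (Q := fun s' => s' = s.setReg rF 0)
    (Runs.straight_le rfl le_rfl rfl) ?_ (by omega)
  rintro _ _ rfl
  refine (Runs.forc (T := 8) (fun i s' => s'.reg rF = 0 ↔ ∀ x < i, s.arr aAdj x = 0)
    (n * n) rfl ?_ (by simp) ?_ (by simp only [Expr.cost]; omega)).mono le_rfl
    fun _ _ h => h.1
  · intro s' hk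
    simp only [Expr.eval]
    rw [hk.reg _ rfl, hk.arr _ rfl]
    simpa using hm
  · intro i s' hi hk hi' h1
    have e1 : s'.arr aAdj = s.arr aAdj := hk.arr _ rfl
    by_cases h : s.arr aAdj i = 0
    · refine Runs.straight_le rfl (by decide) ?_
      simp [hi', e1, h, h1]
      refine ⟨fun h' x hx => ?_, fun h' x hx => h' x (by omega)⟩
      by_cases hxi : x = i
      · rw [hxi, h]
      · exact h' x (by omega)
    · refine Runs.straight_le rfl (by decide) ?_
      simp [hi', e1, h]
      exact ⟨i, by omega, h⟩

/-- Compute the multiples of powers of `n`. -/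
def powTable : Cmd :=
  .assign rX (.lit 1) ;;
  .forc rI (.add (.var rn) (.var rn))
    (.assign rY (.lit 0) ;;
      .forc rJ (.var rn) (.store aMP (.add (.get aMul (.var rI)) (.var rJ)) (.var rY) ;;
        .assign rY (.add (.var rY) (.var rX))) ;;
      .assign rX (.var rY)) ;;
  (.assign rNn (.get aMP (.add (.get aMul (.var rn)) (.lit 1))) ;; .assign rNnn (.var rX))

/-- The multiples `c * n ^ v` are produced by repeated addition of `n ^ v`; after `n` additions the
sum is the next power. Exponents from `n` to `2 * n - 1` belong to the component labels in the code
of a state. -/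
theorem powTable_runs {s : State} (hn : s.reg rn = n) (h2 : 2 ≤ n)
    (hm : ∀ i < 2 * n + N, s.arr aMul i = i * n) :
    Runs D powTable s (2 * n * (30 * n + 40) + 40) (Consts n N) := by
  refine Runs.seq_le (T₁ := 2) (T₂ := 2 * n * (30 * n + 40) + 30)
    (Q := fun s' => s' = s.setReg rX 1) (Runs.straight_le rfl le_rfl rfl) ?_ (by omega)
  rintro _ _ rfl
  refine Runs.seq_le (T₁ := 2 * n * (30 * n + 40) + 10) (T₂ := 20)
    (Q := fun s' => s'.reg rX = n ^ (2 * n) ∧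
      ∀ v < 2 * n, ∀ c < n, s'.arr aMP (v * n + c) = c * n ^ v) ?_ ?_ (by omega)
  · refine (Runs.forc (T := 30 * n + 20) (fun i s' => s'.reg rX = n ^ i ∧
      ∀ v < i, ∀ c < n, s'.arr aMP (v * n + c) = c * n ^ v) (2 * n) rfl ?_ (by simp) ?_
      ?_).mono le_rfl fun _ _ h => h.1
    · intro s' hk
      simp only [Expr.eval]
      rw [hk.reg _ rfl]
      simp [hn]
      omega
    · rintro i s' hi hk hi' ⟨h1, h3⟩
      have e1 : s'.reg rn = n := by rw [hk.reg _ rfl]; simpa using hn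
      have e2 : s'.arr aMul i = i * n := by rw [hk.arr _ rfl]; exact hm i (by omega)
      refine Runs.seq_le (T₁ := 2) (T₂ := 30 * n + 15)
        (Q := fun s'' => s'' = s'.setReg rY 0) (Runs.straight_le rfl le_rfl rfl) ?_ (by omega)
      rintro _ _ rfl
      refine Runs.seq_le (T₁ := 30 * n + 10) (T₂ := 2) (Q := fun s'' => s''.reg rY = n * n ^ i ∧
        ∀ v < i + 1, ∀ c < n, s''.arr aMP (v * n + c) = c * n ^ v) ?_ ?_ (by omega)
      · refine (Runs.forc (T := 15) (fun j s'' => s''.reg rY = j * n ^ i ∧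
          (∀ v < i, ∀ c < n, s''.arr aMP (v * n + c) = c * n ^ v) ∧
          ∀ c < j, s''.arr aMP (i * n + c) = c * n ^ i) n rfl ?_ (by simpa using h3) ?_
          (by simp only [Expr.cost]; omega)).mono le_rfl ?_
        · intro s'' hk'
          simp only [Expr.eval]
          rw [hk'.reg _ rfl]
          simpa using e1
        · rintro j s'' hj hk' hj' ⟨h4, h5, h6⟩
          have e3 : s''.reg rI = i := by rw [hk'.reg _ rfl]; simpa using hi'
          have e4 : s''.arr aMul i = i * n := by rw [hk'.arr _ rfl]; simpa using e2
          have e5 : s''.reg rX = n ^ i := by rw [hk'.reg _ rfl]; simpa using h1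
          refine Runs.straight_le rfl (by decide) ?_
          simp [hj', e3, e4, e5, h4]
          refine ⟨by ring, fun v hv c hc => ?_, fun c hc => ?_⟩
          · have : ¬ v * n + c = i * n + j := fun h => by
              have := (mul_add_inj hc hj h).1
              omega
            simp [this, h5 v hv c hc]
          · by_cases hcj : c = j
            · simp [hcj]
            · simp [hcj, h6 c (by omega)]
        · rintro s'' _ ⟨⟨h4, h5, h6⟩, -⟩
          refine ⟨h4, fun v hv c hc => ?_⟩
          rcases Nat.lt_succ_iff_lt_or_eq.1 hv with h | rfl
          · exact h5 v h c hc
          · exact h6 c hc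
      · rintro s'' _ ⟨h4, h5⟩
        refine Runs.straight_le rfl (by decide) ?_
        simp [h4]
        exact ⟨by ring, fun v hv => h5 v (by omega)⟩
    · simp only [Expr.cost]
      have : 2 * n * (30 * n + 20 + (1 + 1 + 1) + 6) ≤ 2 * n * (30 * n + 40) :=
        Nat.mul_le_mul_left _ (by omega)
      omega
  · rintro s' hk ⟨h1, h3⟩
    have e1 : s'.reg rn = n := by rw [hk.reg _ rfl]; simpa using hn
    have e2 : s'.arr aMul = s.arr aMul := hk.arr _ rfl
    have e3 := hm n (by omega)
    have e4 := h3 n (by omega) 1 (by omega)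
    refine Runs.straight_le rfl (by decide) ?_
    refine ⟨?_, h2, ?_, ?_, ?_, ?_⟩
    · simpa using e1
    · simpa [e2] using hm
    · simpa using h3
    · simp [e1, e2, e3, e4]
    · simp [h1]

/-- Compute the bound for the values of solutions with at most `k` centers. -/
def limit : Cmd :=
  .assign rLim (.var rNn) ;;
  .forc rI (.var rk) (.assign rLim (.add (.var rLim) (.var rNn)))

theorem limit_runs {s : State} {k : ℕ} (hk : s.reg rk = k) (hn : s.reg rNn = n ^ n) :
    Runs D limit s (20 * k + 20) fun s' => s'.reg rLim = (k + 1) * n ^ n := by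
  refine Runs.seq_le (T₁ := 2) (T₂ := 20 * k + 10) (Q := fun s' => s' = s.setReg rLim (n ^ n))
    (Runs.straight_le rfl le_rfl (by simp [hn])) ?_ (by omega)
  rintro _ _ rfl
  refine (Runs.forc (T := 4) (fun i s' => s'.reg rLim = (i + 1) * n ^ n)
    k rfl ?_ (by simp) ?_ (by simp only [Expr.cost]; omega)).mono le_rfl
    fun _ _ h => h.1
  · intro s' hk'
    simp only [Expr.eval]
    rw [hk'.reg _ rfl]
    simpa using hk
  · intro i s' hi hk' hi' h1
    have e1 : s'.reg rNn = n ^ n := by rw [hk'.reg _ rfl]; simpa using hn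
    refine Runs.straight_le rfl (by decide) ?_
    simp [h1, e1]
    ring

end ConnectedKCenter

namespace ConnectedKCenter

variable {n N : ℕ} {D : ℕ → ℝ≥0} {G : SimpleGraph (Fin n)}

notation "aUsed" => 23
notation "aRM" => 24
notation "aRF" => 25
notation "aOut" => 26

/-! ## Sorting the distances -/

/-- Find a cell `e` with the smallest entry among those with `f = 0`, where `e` and `f` depend on
the register `rJ`. -/
def argMin (f e : Expr) : Cmd :=
  .assign rF (.lit 1) ;;
  .forc rJ (.var rn) (.ite (.and (.eq f (.lit 0))
      (.not (.and (.eq (.var rF) (.lit 0)) (.not (.realLe e (.var rX))))))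
    (.assign rX e ;; .assign rY (.var rJ) ;; .assign rF (.lit 0)) .nop)

theorem argMin_runs {s : State} {f e : Expr} {F C : ℕ → ℕ} (hn : s.reg rn = n)
    (hf : ∀ s', (argMin f e).Keeps s s' → f.eval s' = F (s'.reg rJ))
    (he : ∀ s', (argMin f e).Keeps s s' → e.eval s' = C (s'.reg rJ)) :
    Runs D (argMin f e) s (n * (f.cost + 2 * e.cost + 40) + 10) fun s' =>
      (s'.reg rF = 1 ∧ ∀ j < n, F j ≠ 0) ∨ (s'.reg rF = 0 ∧ ∃ j < n, F j = 0 ∧ s'.reg rY = j ∧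
        s'.reg rX = C j ∧ ∀ j' < n, F j' = 0 → D (C j) ≤ D (C j')) := by
  refine Runs.seq_le (T₁ := 2) (T₂ := n * (f.cost + 2 * e.cost + 40) + 5)
    (Q := fun s' => s' = s.setReg rF 1) (Runs.straight_le rfl le_rfl rfl) ?_ (by omega)
  rintro _ hk0 rfl
  have key : ∀ s', (Cmd.forc rJ (.var rn) (.ite (.and (.eq f (.lit 0))
      (.not (.and (.eq (.var rF) (.lit 0)) (.not (.realLe e (.var rX))))))
    (.assign rX e ;; .assign rY (.var rJ) ;; .assign rF (.lit 0)) .nop)).Keeps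
      (s.setReg rF 1) s' → (argMin f e).Keeps s s' := by
    intro s' hk
    refine Cmd.Keeps.trans (s' := s.setReg rF 1) ⟨fun y hy => ?_, fun _ _ => rfl⟩ (hk.mono ?_ ?_)
    · have : y ≠ rF := by rintro rfl; simp [argMin, Cmd.writesReg] at hy
      simp [this]
    · simp +contextual [argMin, Cmd.writesReg]
    · simp +contextual [argMin, Cmd.writesArr]
  refine (Runs.forc (T := f.cost + 2 * e.cost + 30) (fun i s' =>
      (s'.reg rF = 1 ∧ ∀ j < i, F j ≠ 0) ∨ (s'.reg rF = 0 ∧ ∃ j < n, F j = 0 ∧ s'.reg rY = j ∧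
        s'.reg rX = C j ∧ ∀ j' < i, F j' = 0 → D (C j) ≤ D (C j'))) n rfl ?_ (by simp) ?_
      ?_).mono le_rfl fun _ _ h => h.1
  · intro s' hk
    simp only [Expr.eval]
    rw [(key s' hk).reg _ rfl, hn]
  · intro i s' hi hk hi' h
    have e1 := hf s' (key s' hk)
    have e2 := he s' (key s' hk)
    rw [hi'] at e1 e2
    by_cases ht : F i = 0 ∧ ¬ (s'.reg rF = 0 ∧ ¬ D (C i) ≤ D (s'.reg rX))
    · refine Runs.straight_le rfl (by simp only [Cmd.time, Test.cost, Expr.cost]; omega)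
        (.inr ⟨?_, i, hi, ht.1, ?_, ?_, ?_⟩)
      · simp only [Cmd.run, Test.Holds, Expr.eval, e1, e2]
        rw [if_pos ht]; simp
      · simp only [Cmd.run, Test.Holds, Expr.eval, e1, e2]
        rw [if_pos ht]; simp [hi']
      · simp only [Cmd.run, Test.Holds, Expr.eval, e1, e2]
        rw [if_pos ht]; simp
      · intro j' hj' hF
        rcases Nat.lt_succ_iff_lt_or_eq.1 hj' with hlt | rfl
        · rcases h with ⟨_, h2⟩ | ⟨h1, j, _, _, _, h5, h6⟩
          · exact absurd hF (h2 j' hlt)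
          · have := ht.2
            rw [not_and, not_not, h5] at this
            exact (this h1).trans (h6 j' hlt hF)
        · exact le_rfl
    · refine Runs.straight_le rfl (by simp only [Cmd.time, Test.cost, Expr.cost]; omega) ?_
      simp only [Cmd.run, Test.Holds, Expr.eval, e1, e2]
      rw [if_neg ht]
      rcases h with ⟨h1, h2⟩ | ⟨h1, j, h3, h4, h5, h6, h7⟩
      · refine .inl ⟨by simpa using h1, fun j' hj' hF => ?_⟩
        rcases Nat.lt_succ_iff_lt_or_eq.1 hj' with hlt | rfl
        · exact h2 j' hlt hF
        · exact ht ⟨hF, fun h => by rw [h1] at h; exact absurd h.1 one_ne_zero⟩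
      · refine .inr ⟨by simpa using h1, j, h3, h4, by simpa using h5, by simpa using h6,
          fun j' hj' hF => ?_⟩
        rcases Nat.lt_succ_iff_lt_or_eq.1 hj' with hlt | rfl
        · exact h7 j' hlt hF
        · by_contra hlt
          refine ht ⟨hF, fun h => h.2 ?_⟩
          rw [h6]
          exact (not_le.1 hlt).le
  · simp only [Expr.cost]
    have : n * (f.cost + 2 * e.cost + 30 + 1 + 6) ≤ n * (f.cost + 2 * e.cost + 40) :=
      Nat.mul_le_mul_left _ (by omega)
    omega

/-- The entry of the row `u` in the arrays `aRM` and `aRF` is correct. -/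
def RowOK (n : ℕ) (D : ℕ → ℝ≥0) (s : State) (u : ℕ) : Prop :=
  (s.arr aRF u = 1 ∧ ∀ v < n, s.arr aUsed (u * n + v) ≠ 0) ∨
  (s.arr aRF u = 0 ∧ ∃ v < n, s.arr aRM u = u * n + v ∧ s.arr aUsed (u * n + v) = 0 ∧
    ∀ v' < n, s.arr aUsed (u * n + v') = 0 → D (u * n + v) ≤ D (u * n + v'))

/-- Find the least unused entry of the row `rU`. -/
def rowMin : Cmd :=
  argMin (.get aUsed (.add (.get aMul (.var rU)) (.var rJ))) (.add (.get aMul (.var rU)) (.var rJ)) ;;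
  (.store aRM (.var rU) (.var rX) ;; .store aRF (.var rU) (.var rF))

theorem rowMin_runs {s : State} {u : ℕ} (hC : Consts n N s) (hU : s.reg rU = u) (hu : u < n) :
    Runs D rowMin s (60 * n + 20) fun s' => RowOK n D s' u ∧
      ∀ u' ≠ u, s'.arr aRM u' = s.arr aRM u' ∧ s'.arr aRF u' = s.arr aRF u' := by
  have hm : s.arr aMul u = u * n := hC.mul u (by omega)
  refine Runs.seq_le (argMin_runs (F := fun j => s.arr aUsed (u * n + j))
    (C := fun j => u * n + j) hC.n_eq ?_ ?_) (T₂ := 10) ?_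
    (by simp only [Expr.cost]; omega)
  · intro s' hk
    simp only [Expr.eval]
    rw [hk.reg rU rfl, hk.arr aMul rfl, hk.arr aUsed rfl, hU, hm]
  · intro s' hk
    simp only [Expr.eval]
    rw [hk.reg rU rfl, hk.arr aMul rfl, hU, hm]
  · intro s' hk h
    have e1 : s'.reg rU = u := by rw [hk.reg _ rfl, hU]
    have e2 : s'.arr aUsed = s.arr aUsed := hk.arr _ rfl
    have e3 : s'.arr aRM = s.arr aRM := hk.arr _ rfl
    have e4 : s'.arr aRF = s.arr aRF := hk.arr _ rfl
    refine Runs.straight_le rfl (by decide) ⟨?_, fun u' hu' => by simp [e1, e3, e4, hu']⟩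
    rcases h with ⟨h1, h2⟩ | ⟨h1, j, h2, h3, h4, h5, h6⟩
    · exact .inl ⟨by simp [e1, h1], by simpa [e2] using h2⟩
    · refine .inr ⟨by simp [e1, h1], j, h2, by simp [e1, h5], by simpa [e2] using h3, ?_⟩
      simpa [e2] using h6

/-- Write the cells of the distance matrix to `aOut`, in the order of their entries. -/
def sortCells : Cmd :=
  .forc rU (.var rn) rowMin ;;
  .forc rI (.get aMul (.var rn))
    (argMin (.get aRF (.var rJ)) (.get aRM (.var rJ)) ;;
      (.store aOut (.var rI) (.var rX) ;; .store aUsed (.var rX) (.lit 1) ;;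
        .assign rU (.var rY)) ;; rowMin)

/-- The cells of the distance matrix in the order of their entries. -/
structure Sorted (n : ℕ) (D : ℕ → ℝ≥0) (out : ℕ → ℕ) : Prop where
  lt : ∀ i < n * n, out i < n * n
  surj : ∀ x < n * n, ∃ i < n * n, out i = x
  mono : ∀ i j, i ≤ j → j < n * n → D (out i) ≤ D (out j)

theorem RowOK.congr {s s' : State} {u : ℕ} (h : RowOK n D s u)
    (h1 : s'.arr aRF u = s.arr aRF u) (h2 : s'.arr aRM u = s.arr aRM u)
    (h3 : ∀ v < n, s'.arr aUsed (u * n + v) = s.arr aUsed (u * n + v)) : RowOK n D s' u := by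
  rcases h with ⟨h4, h5⟩ | ⟨h4, v, hv, h5, h6, h7⟩
  · exact .inl ⟨h1.trans h4, fun v hv => by rw [h3 v hv]; exact h5 v hv⟩
  · exact .inr ⟨h1.trans h4, v, hv, h2.trans h5, (h3 v hv).trans h6, fun v' hv' h => h7 v' hv' (by
      rwa [h3 v' hv'] at h)⟩

/-- Selection sort with the least unused cell of each row kept in memory: an extraction scans `n`
row minima and renews one row, so that `n * n` extractions take cubic time. A scan of the whole
matrix for each of them would be too slow for width 1. -/
theorem sortCells_runs {s : State} (hC : Consts n N s) (hU : ∀ x < n * n, s.arr aUsed x = 0) :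
    Runs D sortCells s (n * n * (150 * n + 100) + n * (60 * n + 40) + 20) fun s' =>
      Sorted n D (s'.arr aOut) := by
  have hn := hC.two_le
  have hlt : ∀ u v, u < n → v < n → u * n + v < n * n := fun u v hu hv => by
    have : (u + 1) * n ≤ n * n := Nat.mul_le_mul_right _ hu
    rw [add_mul, one_mul] at this
    omega
  refine Runs.seq_le (T₁ := n * (60 * n + 40) + 10) (T₂ := n * n * (150 * n + 100) + 10)
    (Q := fun s' => ∀ u < n, RowOK n D s' u) ?_ ?_ (by omega)
  · refine (Runs.forc (T := 60 * n + 20) (fun i s' => ∀ u < i, RowOK n D s' u) n rfl ?_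
      (by simp) ?_ ?_).mono le_rfl fun _ _ h => h.1
    · intro s' hk
      simp only [Expr.eval]
      rw [hk.reg _ rfl, hC.n_eq]
    · intro i s' hi hk hi' h
      refine (rowMin_runs (hC.congr hk) hi' hi).mono le_rfl fun s'' hk' h' u hu => ?_
      rcases Nat.lt_succ_iff_lt_or_eq.1 hu with h1 | rfl
      · have h2 := h'.2 u (by omega)
        exact (h u h1).congr h2.2 h2.1 fun v _ => by rw [State.setReg_arr, hk'.arr _ rfl]
      · exact h'.1
    · simp only [Expr.cost]
      have : n * (60 * n + 20 + 1 + 6) ≤ n * (60 * n + 40) := Nat.mul_le_mul_left _ (by omega)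
      omega
  intro s₁ hk₁ hrow
  have hC₁ : Consts n N s₁ := hC.congr hk₁
  have hU₁ : ∀ x < n * n, s₁.arr aUsed x = 0 := by rw [hk₁.arr _ rfl]; exact hU
  -- The last clause counts the used cells. It guarantees that an unused cell exists in every round,
  -- and at the end that all cells have been written.
  refine (Runs.forc (T := 150 * n + 60) (fun i s' => (∀ u < n, RowOK n D s' u) ∧
    (∀ j < i, s'.arr aOut j < n * n ∧ s'.arr aUsed (s'.arr aOut j) ≠ 0) ∧
    (∀ x < n * n, s'.arr aUsed x ≠ 0 → ∃ j < i, s'.arr aOut j = x) ∧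
    (∀ j < i, ∀ x < n * n, s'.arr aUsed x = 0 → D (s'.arr aOut j) ≤ D x) ∧
    (∀ j j', j ≤ j' → j' < i → D (s'.arr aOut j) ≤ D (s'.arr aOut j')) ∧
    ((Finset.range (n * n)).filter fun x => s'.arr aUsed x ≠ 0).card = i) (n * n) rfl ?_ ?_ ?_
    ?_).mono le_rfl ?_
  · intro s' hk
    simp only [Expr.eval]
    rw [hk.reg _ rfl, hk.arr _ rfl, hC₁.n_eq, hC₁.mul n (by omega)]
  · refine ⟨fun u hu => (hrow u hu).congr rfl rfl fun _ _ => rfl, by simp,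
      fun x hx h => absurd (hU₁ x hx) h, by simp, by simp, ?_⟩
    rw [Finset.card_eq_zero, Finset.filter_eq_empty_iff]
    intro x hx
    simpa using hU₁ x (Finset.mem_range.1 hx)
  · rintro i s' hi hk hi' ⟨h1, h2, h3, h4, h5, h6⟩
    have hC' : Consts n N s' := hC₁.congr hk
    have hex : ∃ u < n, s'.arr aRF u = 0 := by
      obtain ⟨x, hx, hx0⟩ : ∃ x < n * n, s'.arr aUsed x = 0 := by
        by_contra! hcon
        rw [Finset.filter_true_of_mem fun x hx => hcon x (Finset.mem_range.1 hx),
          Finset.card_range] at h6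
        omega
      have hu : x / n < n := Nat.div_lt_of_lt_mul hx
      rcases h1 _ hu with ⟨_, h⟩ | ⟨h, _⟩
      · have := h (x % n) (Nat.mod_lt _ (by omega))
        rw [mul_comm, Nat.div_add_mod] at this
        exact absurd hx0 this
      · exact ⟨_, hu, h⟩
    refine Runs.seq_le (argMin_runs (F := fun j => s'.arr aRF j) (C := fun j => s'.arr aRM j)
      hC'.n_eq ?_ ?_) (T₂ := 60 * n + 40) ?_ (by simp only [Expr.cost]; omega)
    · intro s'' hk'
      simp only [Expr.eval]
      rw [hk'.arr _ rfl]
    · intro s'' hk'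
      simp only [Expr.eval]
      rw [hk'.arr _ rfl]
    rintro s₂ hk₂ (⟨_, h⟩ | ⟨_, u, hu, hF, hY, hX, hmin⟩)
    · obtain ⟨u, hu, hu0⟩ := hex
      exact absurd hu0 (h u hu)
    obtain ⟨v, hv, hRM, hv0, hvmin⟩ : ∃ v < n, s'.arr aRM u = u * n + v ∧
        s'.arr aUsed (u * n + v) = 0 ∧ ∀ v' < n, s'.arr aUsed (u * n + v') = 0 →
        D (u * n + v) ≤ D (u * n + v') := by
      rcases h1 u hu with ⟨h, _⟩ | ⟨_, h⟩
      · rw [hF] at h; exact absurd h zero_ne_one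
      · exact h
    rw [hRM] at hX hmin
    set x := u * n + v with hx
    have hxn : x < n * n := hlt u v hu hv
    have hmin' : ∀ y < n * n, s'.arr aUsed y = 0 → D x ≤ D y := by
      intro y hy hy0
      have hyu : y / n < n := Nat.div_lt_of_lt_mul hy
      have hym : y % n < n := Nat.mod_lt _ (by omega)
      have hyd : y / n * n + y % n = y := by rw [mul_comm, Nat.div_add_mod]
      rcases h1 _ hyu with ⟨_, h⟩ | ⟨h, w, hw, hRM', _, hwmin⟩
      · have := h _ hym
        rw [hyd] at this
        exact absurd hy0 this
      · have hm1 := hmin _ hyu h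
        rw [hRM'] at hm1
        have hm2 := hwmin _ hym (by rw [hyd]; exact hy0)
        rw [hyd] at hm2
        exact hm1.trans hm2
    have a1 : s₂.arr aUsed = s'.arr aUsed := hk₂.arr _ rfl
    have a2 : s₂.arr aOut = s'.arr aOut := hk₂.arr _ rfl
    have a3 : s₂.arr aRM = s'.arr aRM := hk₂.arr _ rfl
    have a4 : s₂.arr aRF = s'.arr aRF := hk₂.arr _ rfl
    have a5 : s₂.reg rI = i := by rw [hk₂.reg _ rfl, hi']
    refine Runs.seq_le (T₁ := 10) (T₂ := 60 * n + 20)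
      (Q := fun s₃ => s₃ = ((s₂.setArr aOut i x).setArr aUsed x 1).setReg rU u)
      (Runs.straight_le rfl (by decide) (by simp [a5, hX, hY])) ?_ (by omega)
    rintro _ _ rfl
    have hC₂ : Consts n N s₂ := hC'.congr hk₂
    refine (rowMin_runs (N := N) (u := u) ?_ (by simp) hu).mono le_rfl ?_
    · refine ⟨?_, hC₂.two_le, ?_, ?_, ?_, ?_⟩
      · simpa using hC₂.n_eq
      · simpa using hC₂.mul
      · simpa using hC₂.pow
      · simpa using hC₂.nn
      · simpa using hC₂.nnn
    rintro s₄ hk₄ ⟨hr1, hr2⟩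
    have b1 : s₄.arr aUsed = Function.update (s'.arr aUsed) x 1 := by
      rw [hk₄.arr _ rfl]; simp [a1]
    have b2 : s₄.arr aOut = Function.update (s'.arr aOut) i x := by
      rw [hk₄.arr _ rfl]; simp [a2]
    simp only [State.setReg_arr, b1, b2]
    have hout : ∀ j < i, Function.update (s'.arr aOut) i x j = s'.arr aOut j := fun j hj =>
      Function.update_of_ne (by omega) _ _
    have hused : ∀ y, Function.update (s'.arr aUsed) x 1 y = 0 → s'.arr aUsed y = 0 ∧ y ≠ x := by
      intro y hy
      by_cases hyx : y = x
      · simp [hyx] at hy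
      · exact ⟨by simpa [hyx] using hy, hyx⟩
    refine ⟨fun u' hu' => ?_, fun j hj => ?_, fun y hy hy' => ?_, fun j hj y hy hy0 => ?_,
      fun j j' hjj hj' => ?_, ?_⟩
    · by_cases huu : u' = u
      · subst huu; exact hr1.congr rfl rfl fun _ _ => rfl
      · obtain ⟨c1, c2⟩ := hr2 u' huu
        simp only [State.setReg_arr, State.setArr_arr] at c1 c2
        norm_num at c1 c2
        refine (h1 u' hu').congr (by rw [State.setReg_arr, c2, a4])
          (by rw [State.setReg_arr, c1, a3]) fun w hw => ?_
        rw [State.setReg_arr, b1, Function.update_of_ne]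
        exact fun h => huu (mul_add_inj hw hv h).1
    · rcases Nat.lt_succ_iff_lt_or_eq.1 hj with h | rfl
      · rw [hout j h]
        refine ⟨(h2 j h).1, fun h0 => (h2 j h).2 (hused _ h0).1⟩
      · simp [hxn]
    · by_cases hyx : y = x
      · exact ⟨i, by omega, by simp [hyx]⟩
      · rw [Function.update_of_ne hyx] at hy'
        obtain ⟨j, hj, he⟩ := h3 y hy hy'
        exact ⟨j, by omega, by rw [hout j hj, he]⟩
    · obtain ⟨hy1, hy2⟩ := hused y hy0
      rcases Nat.lt_succ_iff_lt_or_eq.1 hj with h | rfl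
      · rw [hout j h]; exact h4 j h y hy hy1
      · rw [Function.update_self]; exact hmin' y hy hy1
    · rcases Nat.lt_succ_iff_lt_or_eq.1 hj' with h | rfl
      · rw [hout j (by omega), hout j' h]; exact h5 j j' hjj h
      · rw [Function.update_self]
        rcases Nat.lt_or_eq_of_le hjj with h | rfl
        · rw [hout j h]; exact h4 j h x hxn hv0
        · rw [Function.update_self]
    · rw [← h6, ← Finset.card_insert_of_notMem (a := x) (by simp [hv0])]
      congr 1
      ext y
      by_cases hyx : y = x
      · subst hyx; simp [hxn]
      · simp [hyx]
  · simp only [Expr.cost]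
    have : n * n * (150 * n + 60 + (1 + 1) + 6) ≤ n * n * (150 * n + 100) :=
      Nat.mul_le_mul_left _ (by omega)
    omega
  · rintro s' _ ⟨⟨h1, h2, h3, h4, h5, h6⟩, -⟩
    have hall : ∀ x < n * n, s'.arr aUsed x ≠ 0 := by
      have := Finset.eq_of_subset_of_card_le (Finset.filter_subset
        (fun x => s'.arr aUsed x ≠ 0) (Finset.range (n * n))) (by rw [h6, Finset.card_range])
      intro x hx
      have hx' := Finset.mem_range.2 hx
      rw [← this, Finset.mem_filter] at hx'
      exact hx'.2
    exact ⟨fun i hi => (h2 i hi).1, fun x hx => h3 x hx (hall x hx), h5⟩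

end ConnectedKCenter

namespace ConnectedKCenter

variable {n N : ℕ} {D : ℕ → ℝ≥0} {G : SimpleGraph (Fin n)}

notation "rPos" => 31
notation "rLev" => 32
notation "rL" => 33
notation "aPw" => 27

/-! ## The search for the optimal radius -/

/-- List the powers of two up to the square of `n`. -/
def powTwo : Cmd :=
  (.assign rL (.lit 0) ;; .assign rX (.lit 1)) ;;
  .loop (.lt (.var rX) (.add (.get aMul (.var rn)) (.lit 1)))
    (.store aPw (.var rL) (.var rX) ;; .assign rX (.add (.var rX) (.var rX)) ;;
      .assign rL (.add (.var rL) (.lit 1)))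

/-- Halving is not available, so the step sizes of the binary search are prepared by doubling. -/
theorem powTwo_runs {s : State} (hC : Consts n N s) :
    Runs D powTwo s (30 * (Nat.log 2 (n * n) + 1) + 20) fun s' =>
      s'.reg rL ≤ Nat.log 2 (n * n) + 1 ∧ n * n < 2 ^ s'.reg rL ∧
      ∀ i < s'.reg rL, s'.arr aPw i = 2 ^ i := by
  have hn := hC.two_le
  refine Runs.seq_le (T₁ := 10) (T₂ := 30 * (Nat.log 2 (n * n) + 1) + 10)
    (Q := fun s' => s' = (s.setReg rL 0).setReg rX 1)
    (Runs.straight_le rfl (by decide) (by simp)) ?_ (by omega)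
  rintro _ _ rfl
  refine (Runs.loop (T := 15) (fun i s' => s'.reg rL = i ∧ s'.reg rX = 2 ^ i ∧
    ∀ j < i, s'.arr aPw j = 2 ^ j) (Nat.log 2 (n * n) + 1) (by simp) ?_).mono ?_ ?_
  · rintro i s' hk ⟨h1, h2, h3⟩ hb
    have e1 : s'.arr aMul (s'.reg rn) = n * n := by
      rw [hk.reg _ rfl, hk.arr _ rfl]
      simp [hC.n_eq, hC.mul n (by omega)]
    simp only [Test.Holds, Expr.eval, e1, h2] at hb
    have hi : i ≤ Nat.log 2 (n * n) := Nat.le_log_of_pow_le (by omega) (by omega)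
    refine ⟨by omega, Runs.straight_le rfl (by decide) ?_⟩
    simp [h1, h2]
    refine ⟨by rw [pow_succ]; ring, fun j hj => ?_⟩
    by_cases hji : j = i
    · simp [hji]
    · simp [hji, h3 j (by omega)]
  · simp only [Test.cost, Expr.cost]
    omega
  · rintro s' hk ⟨i, hi, ⟨h1, h2, h3⟩, hb⟩
    have e1 : s'.arr aMul (s'.reg rn) = n * n := by
      rw [hk.reg _ rfl, hk.arr _ rfl]
      simp [hC.n_eq, hC.mul n (by omega)]
    simp only [Test.Holds, Expr.eval, e1, h2] at hb
    rw [h1]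
    exact ⟨hi, by omega, h3⟩

/-- The step of the search. -/
def stepExpr : Expr := .get aPw (.sub (.sub (.var rL) (.lit 1)) (.var rLev))

/-- Find the first cell in `aOut` whose entry can be achieved as a radius. -/
def search : Cmd :=
  .assign rPos (.lit 0) ;;
  .forc rLev (.var rL)
    (.ite (.lt (.add (.var rPos) stepExpr) (.add (.get aMul (.var rn)) (.lit 1)))
      (.assign rRad (.get aOut (.sub (.add (.var rPos) stepExpr) (.lit 1))) ;;
        runDP ;; testRoot ;;
        .ite (.eq (.var rF) (.lit 0)) (.assign rPos (.add (.var rPos) stepExpr)) .nop) .nop)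

theorem FeasibleAt.mono {k r r' : ℕ} (h : FeasibleAt D G k r) (hr : D r ≤ D r') :
    FeasibleAt D G k r' :=
  let ⟨a, h1, h2, h3⟩ := h
  ⟨a, h1, fun x => (h2 x).trans hr, h3⟩

/-- Bitwise binary search. The cells before `rPos` are infeasible, those from `rPos + 2 ^ (L - i) -
1` on are feasible; round `i` tries to advance by `2 ^ (L - 1 - i)`, and after `L` rounds the gap is
closed. The position `n * n` means that no radius is feasible. -/
theorem search_runs {T : NiceTreeDecomposition G (Fin N)} {s : State} {k L : ℕ}
    (h : DPBase T s) (hk : s.reg rLim = (k + 1) * n ^ n) (hO : Sorted n D (s.arr aOut))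
    (hL : s.reg rL = L) (hL2 : n * n < 2 ^ L) (hpw : ∀ i < L, s.arr aPw i = 2 ^ i) :
    Runs D search s (L * (dpTime n N (T.width + 1) + 150) + 20) fun s' => DPBase T s' ∧
      s'.reg rPos ≤ n * n ∧ (∀ j < s'.reg rPos, ¬ FeasibleAt D G k (s.arr aOut j)) ∧
      ∀ j < n * n, s'.reg rPos ≤ j → FeasibleAt D G k (s.arr aOut j) := by
  have hn := h.consts.two_le
  refine Runs.seq_le (T₁ := 2) (T₂ := L * (dpTime n N (T.width + 1) + 150) + 10)
    (Q := fun s' => s' = s.setReg rPos 0) (Runs.straight_le rfl le_rfl rfl) ?_ (by omega)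
  rintro _ _ rfl
  refine (Runs.forc (T := dpTime n N (T.width + 1) + 130) (fun i s' => DPBase T s' ∧
      s'.reg rPos ≤ n * n ∧ (∀ j < s'.reg rPos, ¬ FeasibleAt D G k (s.arr aOut j)) ∧
      ∀ j < n * n, s'.reg rPos + 2 ^ (L - i) ≤ j + 1 → FeasibleAt D G k (s.arr aOut j)) L rfl
      ?_ ?_ ?_ ?_).mono le_rfl ?_
  · intro s' hk'
    simp only [Expr.eval]
    rw [hk'.reg _ rfl]
    simpa using hL
  · refine ⟨(h.setReg _ _).setReg _ _, by simp, by simp, fun j hj h => ?_⟩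
    rw [Nat.sub_zero] at h
    omega
  · rintro i s' hi hk' hi' ⟨h1, h2, h3, h4⟩
    have e1 : s'.reg rL = L := by rw [hk'.reg _ rfl]; simpa using hL
    have e2 : s'.arr aPw (L - 1 - i) = 2 ^ (L - 1 - i) := by
      rw [hk'.arr _ rfl]; exact hpw _ (by omega)
    have e3 : s'.arr aMul (s'.reg rn) = n * n := by
      rw [h1.consts.n_eq]; exact h1.consts.mul n (by omega)
    have e4 : s'.arr aOut = s.arr aOut := hk'.arr _ rfl
    have e5 : s'.reg rLim = (k + 1) * n ^ n := by rw [hk'.reg _ rfl]; simpa using hk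
    have hst : stepExpr.eval s' = 2 ^ (L - 1 - i) := by
      simp only [stepExpr, Expr.eval, e1, hi', e2]
    set st := 2 ^ (L - 1 - i) with hst'
    have hst0 : 0 < st := by positivity
    have hpow : 2 ^ (L - i) = st + st := by
      rw [hst', ← two_mul, ← pow_succ']
      congr 1
      omega
    have hpow' : L - (i + 1) = L - 1 - i := by omega
    rw [hpow] at h4
    refine Runs.ite_le (T₁ := dpTime n N (T.width + 1) + 110) (fun hb => ?_) (fun hb => ?_)
      (by simp only [Test.cost, Expr.cost, stepExpr]; omega)
    · simp only [Test.Holds, Expr.eval, hst, e3] at hb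
      -- The last cell to be skipped is tested: if its radius is infeasible, so are all smaller
      -- ones.
      have hj0 : s'.reg rPos + st - 1 < n * n := by omega
      refine Runs.seq_le (T₁ := 20) (T₂ := dpTime n N (T.width + 1) + 90)
        (Q := fun s'' => s'' = s'.setReg rRad (s.arr aOut (s'.reg rPos + st - 1)))
        (Runs.straight_le rfl (by decide) (by simp [hst, e4])) ?_ (by omega)
      rintro _ _ rfl
      refine Runs.seq_le (runDP_runs (h1.setReg _ _)) (T₂ := 90) ?_ le_rfl
      rintro s₂ hk₂ ⟨h5, h6⟩
      refine Runs.seq_le (testRoot_runs (k := k) h5 (h6 _) (by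
        rw [hk₂.reg _ rfl]; simpa using e5)) (T₂ := 30) ?_ le_rfl
      intro s₃ hk₃ hres
      have e6 : s₂.reg rRad = s.arr aOut (s'.reg rPos + st - 1) := by
        rw [hk₂.reg _ rfl]; simp
      have e7 : s₃.reg rPos = s'.reg rPos := by
        rw [hk₃.reg _ rfl, hk₂.reg _ rfl]; simp
      have e8 : stepExpr.eval s₃ = st := by
        rw [← hst]
        simp only [stepExpr, Expr.eval]
        rw [hk₃.arr _ rfl, hk₃.reg _ rfl, hk₃.reg _ rfl, hk₂.arr _ rfl, hk₂.reg _ rfl,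
          hk₂.reg _ rfl]
        simp
      have h7 : DPBase T s₃ := h5.base.keeps hk₃
      rw [e6] at hres
      rw [hpow', ← hst']
      rcases hres with ⟨hF, hno⟩ | ⟨hF, a, ha1, ha2, ha3, -⟩
      · refine Runs.straight_le rfl (by decide) ?_
        simp only [Cmd.run, Test.Holds, Expr.eval, hF, e7, e8]
        refine ⟨(h7.setReg _ _).setReg _ _, by simp; omega, ?_, ?_⟩
        · simp
          intro j hj hfe
          exact hno (hfe.mono (hO.mono j _ (by omega) hj0))
        · simp
          intro j hj hle
          exact h4 j hj (by omega)
      · refine Runs.straight_le rfl (by decide) ?_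
        simp only [Cmd.run, Test.Holds, Expr.eval, hF, one_ne_zero, if_false]
        refine ⟨h7.setReg _ _, by simpa [e7] using h2, by simpa [e7] using h3, ?_⟩
        simp [e7]
        intro j hj hle
        exact FeasibleAt.mono ⟨a, ha1, ha2, ha3⟩ (hO.mono _ j (by omega) hj)
    · simp only [Test.Holds, Expr.eval, hst, e3] at hb
      refine Runs.straight_le rfl (by simp [Cmd.time]) ?_
      rw [hpow', ← hst']
      refine ⟨h1.setReg _ _, by simpa using h2, by simpa using h3, ?_⟩
      simp
      intro j hj hle
      omega
  · simp only [Expr.cost]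
    have : L * (dpTime n N (T.width + 1) + 130 + 1 + 6) ≤
      L * (dpTime n N (T.width + 1) + 150) := Nat.mul_le_mul_left _ (by omega)
    omega
  · rintro s' _ ⟨⟨h1, h2, h3, h4⟩, -⟩
    refine ⟨h1, h2, h3, fun j hj hle => h4 j hj ?_⟩
    rw [Nat.sub_self]
    omega

end ConnectedKCenter

namespace ConnectedKCenter

variable {n N : ℕ} {D : ℕ → ℝ≥0} {G : SimpleGraph (Fin n)}

notation "aA" => 28
notation "aA'" => 29
notation "aIdx" => 30

/-! ## Decoding the solution -/

/-- Read off the assignment from its value. -/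
def decode : Cmd :=
  .forc rI (.var rn) (.ite (.lt (.var rVal) (.var rNn)) .nop
    (.assign rVal (.sub (.var rVal) (.var rNn)))) ;;
  .forc rI (.var rn)
    ((.assign rV (.sub (.sub (.var rn) (.lit 1)) (.var rI)) ;; .assign rX (.lit 0)) ;;
      .forc rC (.var rn) (.ite (.lt (.var rVal) (.get aMP (.add (.get aMul (.var rV)) (.var rC))))
        .nop (.assign rX (.var rC))) ;;
      (.store aA (.var rV) (.var rX) ;;
        .assign rVal (.sub (.var rVal) (.get aMP (.add (.get aMul (.var rV)) (.var rX))))))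

/-- The number of centers is removed by subtracting `n ^ n` as long as possible, at most `n` times;
the digits of the assignment remain. -/
theorem removeCount_runs {s : State} {x m : ℕ} (hC : Consts n N s) (hx : x < n ^ n) (hm : m ≤ n)
    (hv : s.reg rVal = x + m * n ^ n) :
    Runs D (.forc rI (.var rn) (.ite (.lt (.var rVal) (.var rNn)) .nop
      (.assign rVal (.sub (.var rVal) (.var rNn))))) s (20 * n + 10) fun s' => s'.reg rVal = x := by
  refine (Runs.forc (T := 10) (fun i s' => s'.reg rVal = x + (m - i) * n ^ n) n rfl ?_
    (by simpa using hv) ?_ (by simp only [Expr.cost]; omega)).mono le_rfl ?_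
  · intro s' hk
    simp only [Expr.eval]
    rw [hk.reg _ rfl, hC.n_eq]
  · intro i s' hi hk hi' h
    have e1 : s'.reg rNn = n ^ n := by rw [hk.reg _ rfl, hC.nn]
    by_cases him : i < m
    · obtain ⟨d, rfl⟩ : ∃ d, m = i + 1 + d := ⟨m - (i + 1), by omega⟩
      have e2 : i + 1 + d - i = d + 1 := by omega
      have e3 : i + 1 + d - (i + 1) = d := by omega
      rw [e2] at h
      have hge : ¬ x + (d + 1) * n ^ n < n ^ n := by rw [add_mul, one_mul]; omega
      refine Runs.straight_le rfl (by decide) ?_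
      simp [h, e1, hge, e3]
      rw [add_mul, one_mul]
      omega
    · have e2 : m - i = 0 := by omega
      have e3 : m - (i + 1) = 0 := by omega
      rw [e2, zero_mul, add_zero] at h
      refine Runs.straight_le rfl (by decide) ?_
      simp [h, e1, hx, e3]
  · rintro s' _ ⟨h, -⟩
    rw [h, Nat.sub_eq_zero_of_le hm]
    omega

/-- Digits are read from the highest on. The digit of `v` is the largest `c` with `c * n ^ v` at
most the current value, because the lower digits contribute less than `n ^ v`. -/
theorem decode_runs {s : State} {a : Fin n → Fin n} {m : ℕ} (hC : Consts n N s) (hm : m ≤ n)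
    (hv : s.reg rVal = fcode (fun v => (a v : ℕ)) + m * n ^ n) :
    Runs D decode s (n * (40 * n + 60) + 20 * n + 30) fun s' => ∀ v : Fin n, s'.arr aA v = a v := by
  have hn := hC.two_le
  refine Runs.seq_le (removeCount_runs hC (fcode_lt fun v => (a v).2) hm hv)
    (T₂ := n * (40 * n + 60) + 10) ?_ (by omega)
  intro s₁ hk₁ hv₁
  set g : ℕ → ℕ := fun i => if h : i < n then a ⟨i, h⟩ else 0 with hg
  have hglt : ∀ i < n, g i < n := fun i hi => by simp [hg, hi]
  have hcode : fcode (fun v => (a v : ℕ)) = ∑ i ∈ Finset.range n, g i * n ^ i := by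
    rw [Finset.sum_range]; simp [fcode, hg]
  rw [hcode] at hv₁
  have hC₁ : Consts n N s₁ := hC.congr hk₁
  refine (Runs.forc (T := 40 * n + 50) (fun i s' =>
    s'.reg rVal = ∑ u ∈ Finset.range (n - i), g u * n ^ u ∧
    ∀ v < n, n - i ≤ v → s'.arr aA v = g v) n rfl ?_ ?_ ?_ ?_).mono le_rfl ?_
  · intro s' hk
    simp only [Expr.eval]
    rw [hk.reg _ rfl, hC₁.n_eq]
  · refine ⟨by simpa using hv₁, fun v hv hv' => by omega⟩
  · rintro i s' hi hk hi' ⟨h1, h2⟩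
    have hC' : Consts n N s' := hC₁.congr hk
    obtain ⟨v, hvi⟩ : ∃ v, n - i = v + 1 := ⟨n - i - 1, by omega⟩
    have hvn : v < n := by omega
    rw [hvi, Finset.sum_range_succ] at h1
    set x := ∑ u ∈ Finset.range v, g u * n ^ u with hx
    have hxlt : x < n ^ v := sum_digits_lt g v fun u hu => hglt u (by omega)
    have hle : ∀ c, c * n ^ v ≤ x + g v * n ^ v ↔ c ≤ g v := by
      intro c
      constructor
      · intro h
        by_contra hlt
        have : (g v + 1) * n ^ v ≤ c * n ^ v := Nat.mul_le_mul_right _ (by omega)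
        rw [add_mul, one_mul] at this
        omega
      · intro h
        have : c * n ^ v ≤ g v * n ^ v := Nat.mul_le_mul_right _ h
        omega
    refine Runs.seq_le (T₁ := 20) (T₂ := 40 * n + 30)
      (Q := fun s'' => s'' = (s'.setReg rV v).setReg rX 0)
      (Runs.straight_le rfl (by decide) ?_) ?_ (by omega)
    · have : n - 1 - i = v := by omega
      simp [hC'.n_eq, hi', this]
    rintro _ _ rfl
    refine Runs.seq_le (T₁ := 30 * n + 10) (T₂ := 20) (Q := fun s'' => s''.reg rX = g v) ?_ ?_
      (by omega)
    -- The largest candidate so far is `c - 1`, unless the digit is smaller; truncation makes this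
    -- agree with the initial value `0`.
    · refine (Runs.forc (T := 18) (fun c s'' => s''.reg rX = min (c - 1) (g v)) n rfl ?_ (by simp)
        ?_ (by simp only [Expr.cost]; omega)).mono le_rfl ?_
      · intro s'' hk'
        simp only [Expr.eval]
        rw [hk'.reg _ rfl]
        simpa using hC'.n_eq
      · intro c s'' hc hk' hc' hI
        have e1 : s''.reg rVal = x + g v * n ^ v := by rw [hk'.reg _ rfl]; simpa using h1
        have e2 : s''.reg rV = v := by rw [hk'.reg _ rfl]; simp
        have e3 : s''.arr aMul v = v * n := by
          rw [hk'.arr _ rfl]; exact hC'.mul v (by omega)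
        have e4 : s''.arr aMP (v * n + c) = c * n ^ v := by
          rw [hk'.arr _ rfl]; exact hC'.pow v (by omega) c hc
        by_cases hcg : c ≤ g v
        · have := (hle c).2 hcg
          refine Runs.straight_le rfl (by decide) ?_
          simp [e1, e2, e3, hc', e4, not_lt.2 this, hcg]
        · have := mt (hle c).1 hcg
          refine Runs.straight_le rfl (by decide) ?_
          simp [e1, e2, e3, hc', e4, not_le.1 this, hI]
          omega
      · rintro s'' _ ⟨h, -⟩
        have := hglt v hvn
        rw [h]
        omega
    · intro s'' hk' hX
      have e1 : s''.reg rVal = x + g v * n ^ v := by rw [hk'.reg _ rfl]; simpa using h1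
      have e2 : s''.reg rV = v := by rw [hk'.reg _ rfl]; simp
      have e3 : s''.arr aMul v = v * n := by
        rw [hk'.arr _ rfl]; exact hC'.mul v (by omega)
      have e4 : s''.arr aMP (v * n + g v) = g v * n ^ v := by
        rw [hk'.arr _ rfl]; exact hC'.pow v (by omega) _ (hglt v hvn)
      have e5 : s''.arr aA = s'.arr aA := by rw [hk'.arr _ rfl]; simp
      have e6 : n - (i + 1) = v := by omega
      refine Runs.straight_le rfl (by decide) ?_
      rw [e6]
      simp [e1, e2, e3, hX, e4, e5, hx]
      intro u hu hvu
      by_cases huv : u = v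
      · simp [huv]
      · simp [huv, h2 u hu (by omega)]
  · simp only [Expr.cost]
    have : n * (40 * n + 50 + 1 + 6) ≤ n * (40 * n + 60) := Nat.mul_le_mul_left _ (by omega)
    omega
  · rintro s' _ ⟨⟨-, h⟩, -⟩ v
    have := h v v.2 (by omega)
    simpa [hg] using this

/-! ## Splitting off vertices -/

/-- Find a vertex that can be moved back to its cluster. -/
def findSplit : Cmd :=
  .forc rV (.var rn) (.forc rU (.var rn)
    (.ite (.and (.not (.eq (.get aAdj (.add (.get aMul (.var rV)) (.var rU))) (.lit 0)))
      (.and (.not (.eq (.get aA' (.var rV)) (.get aA (.var rV))))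
        (.and (.eq (.get aA' (.var rU)) (.get aA (.var rU)))
          (.eq (.get aA (.var rU)) (.get aA (.var rV))))))
      (.assign rX (.var rV)) .nop))

/-- The vertex `v` can be moved back to its cluster along the edge to `u`. -/
def CanMove (G : SimpleGraph (Fin n)) (a a' : Fin n → Fin n) (v u : Fin n) : Prop :=
  G.Adj v u ∧ a' v ≠ a v ∧ a' u = a u ∧ a u = a v

theorem findSplit_runs {s : State} {a a' : Fin n → Fin n} (hC : Consts n N s)
    (hG : ∀ u v : Fin n, s.arr aAdj (u * n + v) ≠ 0 ↔ G.Adj u v)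
    (hA : ∀ v : Fin n, s.arr aA v = a v) (hA' : ∀ v : Fin n, s.arr aA' v = a' v)
    (hex : ∃ v u, CanMove G a a' v u) :
    Runs D findSplit s (n * (70 * n + 20) + 10) fun s' =>
      ∃ v u, CanMove G a a' v u ∧ s'.reg rX = v := by
  refine (Runs.forc (T := 60 * n + 10) (fun i s' => ∀ v u : Fin n, (v : ℕ) < i →
    CanMove G a a' v u → ∃ v u, CanMove G a a' v u ∧ s'.reg rX = v) n rfl ?_ (by simp) ?_
    ?_).mono le_rfl ?_
  · intro s' hk
    simp only [Expr.eval]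
    rw [hk.reg _ rfl, hC.n_eq]
  · intro i s' hi hk hi' hI
    have hC' : Consts n N s' := hC.congr hk
    refine (Runs.forc (T := 50) (fun j s'' => ∀ v u : Fin n, ((v : ℕ) < i ∨ (v : ℕ) = i ∧
      (u : ℕ) < j) → CanMove G a a' v u → ∃ v u, CanMove G a a' v u ∧ s''.reg rX = v) n rfl ?_
      ?_ ?_ (by simp only [Expr.cost]; omega)).mono le_rfl ?_
    · intro s'' hk'
      simp only [Expr.eval]
      rw [hk'.reg _ rfl, hC'.n_eq]
    · simpa using hI
    · intro j s'' hj hk' hj' hJ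
      have e1 : s''.reg rV = i := by rw [hk'.reg _ rfl, hi']
      have e2 : s''.arr aMul i = i * n := by rw [hk'.arr _ rfl]; exact hC'.mul i (by omega)
      have e3 : s''.arr aAdj = s.arr aAdj := by rw [hk'.arr _ rfl, hk.arr _ rfl]
      have e4 : s''.arr aA = s.arr aA := by rw [hk'.arr _ rfl, hk.arr _ rfl]
      have e5 : s''.arr aA' = s.arr aA' := by rw [hk'.arr _ rfl, hk.arr _ rfl]
      have htest : (¬ s.arr aAdj (i * n + j) = 0 ∧ ¬ s.arr aA' i = s.arr aA i ∧
          s.arr aA' j = s.arr aA j ∧ s.arr aA j = s.arr aA i) ↔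
          CanMove G a a' ⟨i, hi⟩ ⟨j, hj⟩ := by
        have h1 := hG ⟨i, hi⟩ ⟨j, hj⟩
        have h2 := hA ⟨i, hi⟩
        have h3 := hA ⟨j, hj⟩
        have h4 := hA' ⟨i, hi⟩
        have h5 := hA' ⟨j, hj⟩
        simp only at h1 h2 h3 h4 h5
        rw [CanMove, ← h1, h2, h3, h4, h5, Fin.val_inj, Fin.val_inj, Fin.val_inj]
      by_cases hm : CanMove G a a' ⟨i, hi⟩ ⟨j, hj⟩
      · have hm' := htest.2 hm
        refine Runs.straight_le rfl (by decide) fun _ _ _ _ => ⟨_, _, hm, ?_⟩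
        simp only [Cmd.run, Test.Holds, Expr.eval, e1, e2, e3, e4, e5, hj']
        rw [if_pos hm']
        simp
      · have hm' := mt htest.1 hm
        refine Runs.straight_le rfl (by decide) fun v u hvu hmv => ?_
        simp only [Cmd.run, Test.Holds, Expr.eval, e1, e2, e3, e4, e5, hj']
        rw [if_neg hm']
        have : (v : ℕ) < i ∨ (v : ℕ) = i ∧ (u : ℕ) < j := by
          rcases hvu with h | ⟨h1, h2⟩
          · exact .inl h
          · refine .inr ⟨h1, ?_⟩
            by_contra hge
            have hv : v = ⟨i, hi⟩ := Fin.ext h1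
            have hu : u = ⟨j, hj⟩ := Fin.ext (show (u : ℕ) = j by omega)
            subst hv hu
            exact hm hmv
        simpa using hJ v u this hmv
    · rintro s'' _ ⟨h, -⟩ v u hv hmv
      have := h v u (by
        rcases Nat.lt_succ_iff_lt_or_eq.1 hv with h | h
        · exact .inl h
        · exact .inr ⟨h, u.2⟩) hmv
      simpa using this
  · simp only [Expr.cost]
    have : n * (60 * n + 10 + 1 + 6) ≤ n * (70 * n + 20) := Nat.mul_le_mul_left _ (by omega)
    omega
  · rintro s' _ ⟨h, -⟩
    obtain ⟨v, u, hm⟩ := hex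
    exact h v u v.2 hm

/-- Make every vertex its own center. -/
def singletons : Cmd := .forc rI (.var rn) (.store aA' (.var rI) (.var rI))

theorem singletons_runs {s : State} (hn : s.reg rn = n) :
    Runs D singletons s (10 * n + 10) fun s' => ∀ i < n, s'.arr aA' i = i := by
  refine (Runs.forc (T := 3) (fun i s' => ∀ j < i, s'.arr aA' j = j) n rfl ?_ (by simp) ?_
    (by simp only [Expr.cost]; omega)).mono le_rfl fun _ _ h => h.1
  · intro s' hk'
    simp only [Expr.eval]
    rw [hk'.reg _ rfl, hn]
  · intro i s' hi _ hi' hI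
    refine Runs.straight_le rfl (by decide) fun j hj => ?_
    by_cases hji : j = i
    · simp [hji, hi']
    · simp [hji, hi', hI j (by omega)]

/-- Split off single vertices, until there are `rk` clusters. -/
def split : Cmd :=
  singletons ;;
  .forc rStep (.sub (.var rn) (.var rk))
    (findSplit ;; .store aA' (.var rX) (.get aA (.var rX)))

/-- After `i` moves there are `n - i` centers. As long as these are more than `k`, they are more
than those of `a`, so `a'` differs from `a` and `Splits.exists_edge` provides the next move. -/
theorem split_runs {s : State} {a : Fin n → Fin n} {k : ℕ} (hC : Consts n N s)
    (hG : ∀ u v : Fin n, s.arr aAdj (u * n + v) ≠ 0 ↔ G.Adj u v)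
    (hA : ∀ v : Fin n, s.arr aA v = a v) (hk : s.reg rk = k) (hkn : k ≤ n)
    (ha : Centered G a) (hak : (centers a).card ≤ k) :
    Runs D split s (n * (n * (70 * n + 20) + 40) + 10 * n + 20) fun s' =>
      ∃ a', Splits G a a' ∧ (centers a').card = k ∧ ∀ v : Fin n, s'.arr aA' v = (a' v : ℕ) := by
  refine Runs.seq_le (singletons_runs hC.n_eq)
    (T₂ := n * (n * (70 * n + 20) + 40) + 10) ?_ (by omega)
  · intro s₁ hk₁ hid
    have hC₁ : Consts n N s₁ := hC.congr hk₁
    refine (Runs.forc (T := n * (70 * n + 20) + 20) (fun i s' => ∃ a', Splits G a a' ∧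
      (centers a').card + i = n ∧ ∀ v : Fin n, s'.arr aA' v = (a' v : ℕ)) (n - k) rfl ?_ ?_ ?_
      ?_).mono le_rfl ?_
    · intro s' hk'
      simp only [Expr.eval]
      rw [hk'.reg rn rfl, hk'.reg rk rfl, hC₁.n_eq, hk₁.reg _ rfl, hk]
    · refine ⟨id, ⟨fun v => .inl rfl, centered_id G⟩, by simp [centers], fun v => ?_⟩
      simpa using hid v v.2
    · rintro i s' hi hk' hi' ⟨a', h1, h2, h3⟩
      have hC' : Consts n N s' := hC₁.congr hk'
      have e1 : s'.arr aA = s.arr aA := by rw [hk'.arr _ rfl, hk₁.arr _ rfl]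
      have e2 : s'.arr aAdj = s.arr aAdj := by rw [hk'.arr _ rfl, hk₁.arr _ rfl]
      obtain ⟨x, hx⟩ := Splits.exists_ne (a := a) (a' := a') (by omega)
      refine Runs.seq_le (findSplit_runs (a := a) (a' := a') hC' (by rw [e2]; exact hG)
        (by rw [e1]; exact hA) h3 (h1.exists_edge ha hx)) (T₂ := 10) ?_ (by omega)
      rintro s'' hk'' ⟨v, u, ⟨g1, g2, g3, g4⟩, hX⟩
      obtain ⟨h4, h5⟩ := h1.update ha g1 g2 g3 g4
      have e3 : s''.arr aA' = s'.arr aA' := hk''.arr _ rfl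
      have e4 : s''.arr aA v = a v := by rw [hk''.arr _ rfl, e1]; exact hA v
      refine Runs.straight_le rfl (by decide) ⟨_, h4, by omega, fun w => ?_⟩
      by_cases hw : w = v
      · subst hw; simp [hX, e4]
      · have hw' : (w : ℕ) ≠ v := fun h => hw (Fin.ext h)
        simp [hX, hw, hw', e3, h3 w]
    · simp only [Expr.cost]
      have : (n - k) * (n * (70 * n + 20) + 20 + (1 + 1 + 1) + 6) ≤
        n * (n * (70 * n + 20) + 40) := Nat.mul_le_mul (by omega) (by omega)
      omega
    · rintro s' _ ⟨⟨a', h1, h2, h3⟩, -⟩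
      exact ⟨a', h1, by omega, h3⟩

/-! ## The output -/

/-- Write the clusters and the centers. -/
def output : Cmd :=
  .assign rC (.lit 0) ;;
  .forc rV (.var rn) (.ite (.eq (.get aA' (.var rV)) (.var rV))
    (.store aIdx (.var rV) (.var rC) ;; .store 1 (.var rC) (.var rV) ;;
      .assign rC (.add (.var rC) (.lit 1))) .nop) ;;
  .forc rV (.var rn) (.store 0 (.var rV) (.get aIdx (.get aA' (.var rV)))) ;;
  .assign 0 (.lit 1)

/-- The output replaces the adjacency matrix in array `0`, the parents in array `1` and `n` in
register `0`. Therefore register `0` is written last, after the loops that it bounds. -/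
theorem output_runs {s : State} {a : Fin n → Fin n} {k : ℕ} (hn : s.reg rn = n)
    (hA : ∀ v : Fin n, s.arr aA' v = a v) (hfix : ∀ v, a (a v) = a v)
    (hk : (centers a).card = k) :
    Runs D output s (50 * n + 40) fun s' => s'.reg 0 = 1 ∧ ∃ c : Fin k → Fin n,
      Function.Injective c ∧ (∀ v, a v = v ↔ ∃ i, c i = v) ∧
      s'.Describes (fun i => Finset.univ.filter fun v => a v = c i) c := by
  refine Runs.seq_le (T₁ := 2) (T₂ := 50 * n + 30) (Q := fun s' => s' = s.setReg rC 0)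
    (Runs.straight_le rfl le_rfl rfl) ?_ (by omega)
  rintro _ _ rfl
  refine Runs.seq_le (T₁ := 30 * n + 10) (T₂ := 20 * n + 20) (Q := fun s' =>
    (∀ v : Fin n, a v = v → s'.arr aIdx v < k ∧ s'.arr 1 (s'.arr aIdx v) = v) ∧
    ∀ j < k, ∃ v : Fin n, a v = v ∧ s'.arr 1 j = v ∧ s'.arr aIdx v = j) ?_ ?_ (by omega)
  · refine (Runs.forc (T := 20) (fun i s' =>
      (∀ v : Fin n, (v : ℕ) < i → a v = v →
        s'.arr aIdx v < s'.reg rC ∧ s'.arr 1 (s'.arr aIdx v) = v) ∧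
      (∀ j < s'.reg rC, ∃ v : Fin n, (v : ℕ) < i ∧ a v = v ∧ s'.arr 1 j = v ∧ s'.arr aIdx v = j) ∧
      s'.reg rC = ((centers a).filter fun v : Fin n => (v : ℕ) < i).card) n rfl ?_ (by simp) ?_
      (by simp only [Expr.cost]; omega)).mono le_rfl ?_
    · intro s' hk'
      simp only [Expr.eval]
      rw [hk'.reg _ rfl]
      simpa using hn
    · rintro i s' hi hk' hi' ⟨h1, h2, h3⟩
      have e1 : s'.arr aA' i = a ⟨i, hi⟩ := by rw [hk'.arr _ rfl]; exact hA ⟨i, hi⟩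
      by_cases hf : a ⟨i, hi⟩ = ⟨i, hi⟩
      · have hcard : ((centers a).filter fun v : Fin n => (v : ℕ) < i + 1).card =
            ((centers a).filter fun v : Fin n => (v : ℕ) < i).card + 1 := by
          rw [← Finset.card_insert_of_notMem (a := (⟨i, hi⟩ : Fin n)) (by simp)]
          congr 1
          ext v
          simp only [Finset.mem_filter, Finset.mem_insert, centers, Finset.mem_univ, true_and]
          constructor
          · rintro ⟨h4, h5⟩
            by_cases hv : (v : ℕ) = i
            · exact .inl (Fin.ext hv)
            · exact .inr ⟨h4, by omega⟩
          · rintro (rfl | ⟨h4, h5⟩)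
            · exact ⟨hf, by simp⟩
            · exact ⟨h4, by omega⟩
        have hf' : s'.arr aA' i = i := by rw [e1, hf]
        refine Runs.straight_le rfl (by decide) ?_
        simp only [Cmd.run, Test.Holds, Expr.eval, hi', hf', if_true]
        refine ⟨fun v hv hav => ?_, fun j hj => ?_, ?_⟩
        · by_cases hvi : (v : ℕ) = i
          · simp [hvi, hi']
          · have h4 := h1 v (by omega) hav
            have : ¬ s'.arr aIdx v = s'.reg rC := by omega
            simp [hvi, this, h4.2]
            omega
        · simp only [State.setReg_reg, State.setArr_reg] at hj
          norm_num at hj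
          by_cases hjc : j = s'.reg rC
          · exact ⟨⟨i, hi⟩, by simp, hf, by simp [hjc, hi'], by simp [hjc, hi']⟩
          · obtain ⟨v, g1, g2, g3, g4⟩ := h2 j (by omega)
            have : ¬ (v : ℕ) = i := by omega
            exact ⟨v, by omega, g2, by simp [hjc, g3], by simp [this, g4]⟩
        · rw [hcard, ← h3]; simp
      · have hf' : ¬ s'.arr aA' i = i := by
          rw [e1]; exact fun h => hf (Fin.ext h)
        have hskip : ∀ v : Fin n, (v : ℕ) < i + 1 → a v = v → (v : ℕ) < i := by
          intro v hv hav
          by_contra hge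
          have : v = ⟨i, hi⟩ := Fin.ext (show (v : ℕ) = i by omega)
          exact hf (this ▸ hav)
        refine Runs.straight_le rfl (by decide) ?_
        simp only [Cmd.run, Test.Holds, Expr.eval, hi', hf', if_false]
        refine ⟨fun v hv hav => by simpa using h1 v (hskip v hv hav) hav, fun j hj => ?_, ?_⟩
        · obtain ⟨v, g1, g2, g3, g4⟩ := h2 j (by simpa using hj)
          exact ⟨v, by omega, g2, by simpa using g3, by simpa using g4⟩
        · have : ((centers a).filter fun v : Fin n => (v : ℕ) < i + 1) =
              (centers a).filter fun v : Fin n => (v : ℕ) < i := by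
            refine Finset.filter_congr fun v hv => ⟨fun h => hskip v h ?_, fun h => by omega⟩
            simpa [centers] using hv
          rw [this]
          simpa using h3
    · rintro s' _ ⟨⟨h1, h2, h3⟩, -⟩
      have : ((centers a).filter fun v : Fin n => (v : ℕ) < n) = centers a :=
        Finset.filter_true_of_mem fun v _ => v.2
      rw [this, hk] at h3
      rw [h3] at h1 h2
      refine ⟨fun v => h1 v v.2, fun j hj => ?_⟩
      obtain ⟨v, -, h⟩ := h2 j hj
      exact ⟨v, h⟩
  rintro s₁ hk₁ ⟨h1, h2⟩
  have hA₁ : s₁.arr aA' = s.arr aA' := hk₁.arr _ rfl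
  refine Runs.seq_le (T₁ := 20 * n + 10) (T₂ := 2) (Q := fun s' =>
    ∀ v : Fin n, s'.arr 0 v = s₁.arr aIdx (a v)) ?_ ?_ (by omega)
  · refine (Runs.forc (T := 8) (fun i s' => ∀ v : Fin n, (v : ℕ) < i →
      s'.arr 0 v = s₁.arr aIdx (a v)) n rfl ?_ (by simp) ?_
      (by simp only [Expr.cost]; omega)).mono le_rfl fun s' _ h v => h.1 v v.2
    · intro s' hk'
      simp only [Expr.eval]
      rw [hk'.reg _ rfl, hk₁.reg _ rfl]
      simpa using hn
    · intro i s' hi hk' hi' hI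
      have e1 : s'.arr aA' i = a ⟨i, hi⟩ := by rw [hk'.arr _ rfl, hA₁]; exact hA ⟨i, hi⟩
      have e2 : s'.arr aIdx = s₁.arr aIdx := hk'.arr _ rfl
      refine Runs.straight_le rfl (by decide) fun v hv => ?_
      by_cases hvi : (v : ℕ) = i
      · have : v = ⟨i, hi⟩ := Fin.ext hvi
        subst this
        simp [hi', e1, e2]
      · simp [hi', hvi, hI v (by omega)]
  · intro s₂ hk₂ h3
    choose c hc1 hc2 hc3 using fun j : Fin k => h2 j j.2
    have e1 : s₂.arr 1 = s₁.arr 1 := hk₂.arr _ rfl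
    refine Runs.straight_le rfl (by decide) ⟨by simp, c, fun i j hij => ?_, fun v => ⟨fun hv => ?_, ?_⟩,
      fun i v => ?_, fun i => ?_⟩
    · refine Fin.ext ?_
      rw [← hc3 i, ← hc3 j, hij]
    · obtain ⟨h4, h5⟩ := h1 v hv
      refine ⟨⟨_, h4⟩, Fin.ext ?_⟩
      rw [← hc2]
      exact h5
    · rintro ⟨i, rfl⟩
      exact hc1 i
    · simp only [Cmd.run, State.setReg_arr, h3, Finset.mem_filter, Finset.mem_univ, true_and]
      obtain ⟨h4, h5⟩ := h1 (a v) (hfix v)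
      constructor
      · intro h
        rw [h, hc3]
      · intro h
        refine Fin.ext ?_
        rw [← h5, h, hc2]
    · simp only [Cmd.run, State.setReg_arr, e1, hc2]

end ConnectedKCenter

namespace ConnectedKCenter

variable {n N : ℕ} {D : ℕ → ℝ≥0} {G : SimpleGraph (Fin n)}

/-! ## The input -/

theorem vecArray_apply {α : Type*} [Zero α] {m : ℕ} (f : Fin m → α) (i : Fin m) :
    vecArray f i = f i := by simp [vecArray]

theorem matArray_apply {α : Type*} [Zero α] {m n : ℕ} (f : Fin m → Fin n → α) (i : Fin m)
    (j : Fin n) : matArray f (i * n + j) = f i j := by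
  have hn : 0 < n := j.pos
  have hlt : (i : ℕ) * n + j < m * n :=
    calc (i : ℕ) * n + j < (i + 1) * n := by rw [add_mul]; omega
      _ ≤ m * n := Nat.mul_le_mul_right n i.2
  have h1 : ((i : ℕ) * n + j) / n = i := by
    rw [mul_comm, Nat.mul_add_div hn, Nat.div_eq_of_lt j.2, add_zero]
  have h2 : ((i : ℕ) * n + j) % n = j := by
    rw [mul_comm, Nat.mul_add_mod, Nat.mod_eq_of_lt j.2]
  rw [matArray, vecArray, dif_pos hlt]
  congr 1 <;> exact Fin.ext (by simp [Fin.divNat, Fin.modNat, h1, h2])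

theorem distArray_apply (M : MetricSpace (Fin n)) (u v : Fin n) :
    distArray M (u * n + v) = distance M u v := matArray_apply _ u v

theorem inputs_inputState (k : ℕ) (T : NiceTreeDecomposition G (Fin N)) :
    Inputs T (inputState k T) where
  nodes := rfl
  root := rfl
  par t := vecArray_apply (fun t : Fin N => (T.parent t : ℕ)) t
  bag t v := by
    simp only [inputState]
    rw [matArray_apply]
    simp
  kind t := vecArray_apply (fun t : Fin N => (T.kind t).code) t
  lab t := vecArray_apply (fun t : Fin N => (T.kind t).label₁) t
  lab' t := vecArray_apply (fun t : Fin N => (T.kind t).label₂) t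

theorem inputState_adj (k : ℕ) (T : NiceTreeDecomposition G (Fin N)) (u v : Fin n) :
    (inputState k T).arr aAdj (u * n + v) ≠ 0 ↔ G.Adj u v := by
  simp only [inputState]
  rw [matArray_apply]
  simp

/-! ## The correctness of the answers -/

section

variable {M : MetricSpace (Fin n)} {k : ℕ} {s : State}

theorem isCorrectOutput_of_not
    (h : ¬ ∃ (P : Fin k → Finset (Fin n)) (c : Fin k → Fin n), IsSolution G P c)
    (h0 : s.reg 0 = 0) : IsCorrectOutput M G k s := ⟨fun h' => absurd h' h, fun _ => h0⟩

theorem isCorrectOutput_of_centered {a : Fin n → Fin n} {c : Fin k → Fin n} {r : ℝ≥0}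
    (ha : Centered G a) (hc : Function.Injective c) (hac : ∀ v, a v = v ↔ ∃ i, c i = v)
    (hr : ∀ v, distance M v (a v) ≤ r)
    (hmin : ∀ (P : Fin k → Finset (Fin n)) (c : Fin k → Fin n), IsSolution G P c → r ≤ cost M P c)
    (h0 : s.reg 0 = 1) (hs : s.Describes (fun i => Finset.univ.filter fun v => a v = c i) c) :
    IsCorrectOutput M G k s := by
  have hsol := ha.isSolution hc hac
  refine ⟨fun _ => ⟨h0, _, c, ⟨hsol, fun P' c' h' => le_trans (cost_le_iff.2 fun i v hv => ?_)
    (hmin P' c' h')⟩, hs⟩, fun h => absurd ⟨_, _, hsol⟩ h⟩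
  have : a v = c i := by simpa using hv
  exact this ▸ hr v

theorem IsSolution.card_le {P : Fin k → Finset (Fin n)} {c : Fin k → Fin n}
    (h : IsSolution G P c) : k ≤ n := by
  obtain ⟨a, -, h2, -⟩ := h.exists_centered
  rw [← h2]
  simpa using Finset.card_le_univ (centers a)

/-- Without edges, components are single vertices, so every vertex is its own center. -/
theorem IsSolution.card_eq_of_no_edge {P : Fin k → Finset (Fin n)} {c : Fin k → Fin n}
    (h : IsSolution G P c) (hG : ∀ u v, ¬ G.Adj u v) : k = n := by
  obtain ⟨a, h1, h2, -⟩ := h.exists_centered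
  have : centers a = Finset.univ := Finset.filter_true_of_mem fun x _ =>
    ((h1 x).iff_of_closed (C := fun y => y = x) fun u v huv _ => absurd huv (hG u v)).1 rfl
  rw [← h2, this]
  simp

theorem FeasibleAt.of_isSolution (hD : ∀ u v : Fin n, D (u * n + v) = distance M u v)
    {P : Fin k → Finset (Fin n)} {c : Fin k → Fin n} (h : IsSolution G P c) {r : ℕ}
    (hr : cost M P c ≤ D r) : FeasibleAt D G k r := by
  obtain ⟨a, h1, h2, h3⟩ := h.feasible
  exact ⟨a, h1, fun x => by rw [within, hD]; exact (h2 x).trans hr, h3⟩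

/-- Every solution has the cost of some cell of the sorted list of distances, which hence is
achievable. -/
theorem IsSolution.exists_feasibleAt (hn : 0 < n)
    (hD : ∀ u v : Fin n, D (u * n + v) = distance M u v)
    {out : ℕ → ℕ} (hO : Sorted n D out) {P : Fin k → Finset (Fin n)} {c : Fin k → Fin n}
    (h : IsSolution G P c) : ∃ j < n * n, cost M P c = D (out j) ∧ FeasibleAt D G k (out j) := by
  have : Nonempty (Fin n) := ⟨⟨0, hn⟩⟩
  obtain ⟨u, v, huv⟩ := exists_cost_eq (M := M) h
  have hlt : (u : ℕ) * n + v < n * n :=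
    calc (u : ℕ) * n + v < (u + 1) * n := by rw [add_mul]; omega
      _ ≤ n * n := Nat.mul_le_mul_right n u.2
  obtain ⟨j, hj, hj'⟩ := hO.surj _ hlt
  have : cost M P c = D (out j) := by rw [hj', hD, huv]
  exact ⟨j, hj, this, .of_isSolution hD h this.le⟩

end

/-! ## The main program -/

/-- Construct a solution for the radius in the cell `rRad`. -/
def construct : Cmd := runDP ;; testRoot ;; decode ;; split ;; output

/-- Solve an instance with at least one edge and with fewer clusters than vertices. -/
def solve : Cmd :=
  (powTable ;; limit ;; .assign rPtr (.lit 1)) ;; sortCells ;; powTwo ;; search ;;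
  .ite (.lt (.var rPos) (.get aMul (.var rn)))
    (.assign rRad (.get aOut (.var rPos)) ;; construct) (.assign 0 (.lit 0))

/-- The algorithm. -/
def main : Cmd :=
  .ite (.lt (.var rn) (.var rk)) (.assign 0 (.lit 0))
    (.ite (.eq (.var rk) (.var rn)) (singletons ;; output)
      (mulTable ;; findEdge ;; .ite (.eq (.var rF) (.lit 0)) (.assign 0 (.lit 0)) solve))

/-- The search ends with a position only. The dynamic program is run once more for the radius found,
and the value at the root of this run is decoded. -/
theorem construct_runs {T : NiceTreeDecomposition G (Fin N)} {s : State} {k : ℕ}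
    (h : DPBase T s) (hlim : s.reg rLim = (k + 1) * n ^ n) (hk : s.reg rk = k) (hkn : k ≤ n)
    (hG : ∀ u v : Fin n, s.arr aAdj (u * n + v) ≠ 0 ↔ G.Adj u v)
    (hf : FeasibleAt D G k (s.reg rRad)) :
    Runs D construct s (dpTime n N (T.width + 1) + 1000 * n ^ 3 + 500) fun s' => s'.reg 0 = 1 ∧
      ∃ (a a' : Fin n → Fin n) (c : Fin k → Fin n), (∀ x, within n D (s.reg rRad) x (a x)) ∧
        Splits G a a' ∧ Function.Injective c ∧ (∀ v, a' v = v ↔ ∃ i, c i = v) ∧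
        s'.Describes (fun i => Finset.univ.filter fun v => a' v = c i) c := by
  have hn := h.consts.two_le
  refine Runs.seq_le (runDP_runs h) (T₂ := 1000 * n ^ 3 + 500) ?_ (by omega)
  rintro s₁ hk₁ ⟨h₁, hd⟩
  have e1 : s₁.reg rLim = (k + 1) * n ^ n := by rw [hk₁.reg _ rfl, hlim]
  have e2 : s₁.reg rRad = s.reg rRad := hk₁.reg _ rfl
  refine Runs.seq_le (testRoot_runs h₁ (hd _) e1) (T₂ := 1000 * n ^ 3 + 440) ?_ (by omega)
  rintro s₂ hk₂ (⟨-, h2⟩ | ⟨-, a, ha, har, hak, hv⟩)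
  · exact absurd (e2 ▸ hf) h2
  have hC₂ : Consts n N s₂ := h₁.consts.congr hk₂
  refine Runs.seq_le (decode_runs (a := a) hC₂ (hak.trans hkn) hv)
    (T₂ := n * (n * (70 * n + 20) + 40) + 60 * n + 60) ?_ ?_
  · intro s₃ hk₃ hA
    have hC₃ : Consts n N s₃ := hC₂.congr hk₃
    have e3 : s₃.arr aAdj = s.arr aAdj := by rw [hk₃.arr _ rfl, hk₂.arr _ rfl, hk₁.arr _ rfl]
    have e4 : s₃.reg rk = k := by rw [hk₃.reg _ rfl, hk₂.reg _ rfl, hk₁.reg _ rfl, hk]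
    refine Runs.seq_le (split_runs hC₃ (by rw [e3]; exact hG) hA e4 hkn ha hak)
      (T₂ := 50 * n + 40) ?_ (by omega)
    rintro s₄ hk₄ ⟨a', hs, hcard, hA'⟩
    have e5 : s₄.reg rn = n := by rw [hk₄.reg _ rfl, hC₃.n_eq]
    refine (output_runs e5 hA' hs.centered.fix hcard).mono le_rfl ?_
    rintro s₅ _ ⟨g1, c, g2, g3, g4⟩
    exact ⟨g1, a, a', c, by rw [← e2]; exact har, hs, g2, g3, g4⟩
  · have h2 : n * n ≤ n * n * n := Nat.le_mul_of_pos_right _ (by omega)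
    have h3 : n ≤ n * n := Nat.le_mul_of_pos_right _ (by omega)
    ring_nf at h2 h3 ⊢
    omega

/-- Optimality: the cost of any solution is the entry of some cell, which is then a feasible radius.
The search shows that all cells before `rPos` are infeasible, so this cell comes at `rPos` or later
and its entry is at least the radius used. -/
theorem solve_runs {T : NiceTreeDecomposition G (Fin N)} {s : State} {k : ℕ} (h2n : 2 ≤ n)
    {M : MetricSpace (Fin n)} (hD : ∀ u v : Fin n, D (u * n + v) = distance M u v)
    (hI : Inputs T s) (hn : s.reg rn = n) (hk : s.reg rk = k) (hkn : k ≤ n)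
    (hG : ∀ u v : Fin n, s.arr aAdj (u * n + v) ≠ 0 ↔ G.Adj u v)
    (hm : ∀ i < 2 * n + N, s.arr aMul i = i * n)
    (hz : ∀ a ∈ [aHash, aHead, aVT, aUsed], ∀ x, s.arr a x = 0) :
    Runs D solve s ((Nat.log 2 (n * n) + 1) * (2 * dpTime n N (T.width + 1) + 2000 * n ^ 3 + 1000))
      (IsCorrectOutput M G k) := by
  have hp3 : n * n ≤ n * n * n := Nat.le_mul_of_pos_right _ (by omega)
  have hp2 : n ≤ n * n := Nat.le_mul_of_pos_right _ (by omega)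
  simp only [List.forall_mem_cons, List.not_mem_nil, false_imp_iff, implies_true, and_true] at hz
  obtain ⟨z1, z2, z3, z4⟩ := hz
  obtain ⟨L, hL⟩ : ∃ L, Nat.log 2 (n * n) + 1 = L := ⟨_, rfl⟩
  obtain ⟨dp, hdp⟩ : ∃ dp, dpTime n N (T.width + 1) = dp := ⟨_, rfl⟩
  rw [hL, hdp]
  have hbig : L * (dp + 180) + dp + 2000 * n ^ 3 + 800 ≤
      L * (2 * dp + 2000 * n ^ 3 + 1000) := by
    have : 1 ≤ L := by omega
    obtain ⟨l, hl⟩ : ∃ l, L = l + 1 := ⟨L - 1, by omega⟩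
    rw [hl]
    nlinarith [Nat.zero_le (l * dp), Nat.zero_le (l * n ^ 3)]
  refine Runs.mono ?_ hbig fun _ _ h => h
  clear hbig
  refine Runs.seq_le (T₁ := 2 * n * (30 * n + 40) + 20 * k + 70)
    (T₂ := n * n * (150 * n + 100) + n * (60 * n + 40) +
      (L * (dp + 180) + dp + 1000 * n ^ 3 + 620)) (Q := fun s' =>
      DPBase T s' ∧ s'.reg rLim = (k + 1) * n ^ n ∧ s'.reg rk = k ∧ s'.arr aAdj = s.arr aAdj ∧
        ∀ x, s'.arr aUsed x = 0) ?_ ?_ ?_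
  · refine Runs.seq_le (powTable_runs hn h2n hm) (T₂ := 20 * k + 30) ?_ (by omega)
    intro s₁ hk₁ hC₁
    have f1 : s₁.reg rk = k := by rw [hk₁.reg _ rfl, hk]
    refine Runs.seq_le (limit_runs f1 hC₁.nn) (T₂ := 2) ?_ (by omega)
    intro s₂ hk₂ hl
    refine Runs.straight_le rfl le_rfl ?_
    have hk₃ : Cmd.Keeps (.assign rPtr (.lit 1)) s₂
        ((Cmd.assign rPtr (.lit 1)).run D s₂) := (Exec.assign (D := D) _ _ _).keeps
    refine ⟨⟨(hC₁.congr hk₂).congr hk₃, ((hI.congr hk₁).congr hk₂).congr hk₃, by simp,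
      fun x _ => ?_, fun v _ => ?_⟩, ?_, ?_, ?_, fun x => ?_⟩
    · rw [hk₃.arr _ rfl, hk₂.arr _ rfl, hk₁.arr _ rfl, hk₃.arr _ rfl, hk₂.arr _ rfl, hk₁.arr _ rfl]
      exact ⟨z1 x, z2 x⟩
    · rw [hk₃.arr _ rfl, hk₂.arr _ rfl, hk₁.arr _ rfl]
      exact z3 _
    · rw [hk₃.reg _ rfl, hl]
    · rw [hk₃.reg _ rfl, hk₂.reg _ rfl, f1]
    · rw [hk₃.arr _ rfl, hk₂.arr _ rfl, hk₁.arr _ rfl]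
    · rw [hk₃.arr _ rfl, hk₂.arr _ rfl, hk₁.arr _ rfl]
      exact z4 x
  · rintro s₁ hk₁ ⟨h₁, l₁, k₁, a₁, u₁⟩
    refine Runs.seq_le (sortCells_runs h₁.consts fun x _ => u₁ x)
      (T₂ := L * (dp + 180) + dp + 1000 * n ^ 3 + 600) ?_ (by omega)
    intro s₂ hk₂ hO
    have h₂ : DPBase T s₂ := h₁.keeps hk₂
    refine Runs.seq_le (powTwo_runs h₂.consts)
      (T₂ := L * (dp + 150) + dp + 1000 * n ^ 3 + 580) ?_ (by rw [hL, mul_add, mul_add]; omega)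
    rintro s₃ hk₃ ⟨p1, p2, p3⟩
    have h₃ : DPBase T s₃ := h₂.keeps hk₃
    have e1 : s₃.arr aOut = s₂.arr aOut := hk₃.arr _ rfl
    have e2 : s₃.reg rLim = (k + 1) * n ^ n := by rw [hk₃.reg _ rfl, hk₂.reg _ rfl, l₁]
    have hs := search_runs h₃ e2 (by rw [e1]; exact hO) rfl p2 p3
    rw [hL] at p1
    rw [hdp] at hs
    refine Runs.seq_le hs
      (T₂ := dp + 1000 * n ^ 3 + 560) ?_ ?_
    · rintro s₄ hk₄ ⟨h₄, q1, q2, q3⟩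
      rw [e1] at q2 q3
      have e3 : s₄.arr aOut = s₂.arr aOut := by rw [hk₄.arr _ rfl, e1]
      have e4 : s₄.arr aAdj = s.arr aAdj := by
        rw [hk₄.arr _ rfl, hk₃.arr _ rfl, hk₂.arr _ rfl, a₁]
      have e5 : s₄.reg rk = k := by rw [hk₄.reg _ rfl, hk₃.reg _ rfl, hk₂.reg _ rfl, k₁]
      have e6 : s₄.reg rLim = (k + 1) * n ^ n := by rw [hk₄.reg _ rfl, e2]
      have e7 : s₄.arr aMul n = n * n := h₄.consts.mul n (by omega)
      refine Runs.ite_le (T₁ := dp + 1000 * n ^ 3 + 520) (fun hlt => ?_) (fun hge => ?_)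
        (by simp only [Test.cost, Expr.cost]; omega)
      · simp only [Test.Holds, Expr.eval, h₄.consts.n_eq, e7] at hlt
        refine Runs.seq_le (T₁ := 3)
          (Q := fun s' => s' = s₄.setReg rRad (s₂.arr aOut (s₄.reg rPos)))
          (Runs.straight_le rfl (by decide) (by simp [e3])) (T₂ := dp + 1000 * n ^ 3 + 500) ?_
          (by omega)
        rintro _ _ rfl
        rw [← hdp]
        refine (construct_runs (k := k) (h₄.setReg _ _) (by simpa using e6) (by simpa using e5)
          hkn (by simpa [e4] using hG) (by simpa using q3 _ hlt le_rfl)).mono le_rfl ?_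
        rintro s₅ _ ⟨g0, a, a', c, g1, g2, g3, g4, g5⟩
        have hr : ∀ v, distance M v (a v) ≤ D (s₂.arr aOut (s₄.reg rPos)) := fun v => by
          rw [← hD]; simpa [within] using g1 v
        refine isCorrectOutput_of_centered (r := D (s₂.arr aOut (s₄.reg rPos))) g2.centered g3 g4
          (fun v => ?_) (fun P' c' h' => ?_) g0 g5
        -- A vertex that was split off is its own center, at distance zero.
        · rcases g2.or v with h | h
          · rw [h]; simp [distance]
          · rw [h]; exact hr v
        · obtain ⟨j, hj, hc, hf⟩ := h'.exists_feasibleAt (by omega) hD hO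
          rw [hc]
          refine hO.mono _ _ ?_ hj
          by_contra hlt'
          exact q2 j (by omega) hf
      · simp only [Test.Holds, Expr.eval, h₄.consts.n_eq, e7] at hge
        refine Runs.straight_le rfl (show 2 ≤ _ by omega) (isCorrectOutput_of_not ?_ (by simp))
        rintro ⟨P, c, h⟩
        obtain ⟨j, hj, -, hf⟩ := h.exists_feasibleAt (by omega) hD hO
        exact q2 j (by omega) hf
    · have : s₃.reg rL * (dp + 150) ≤ L * (dp + 150) := Nat.mul_le_mul_right _ p1
      omega
  · ring_nf at hp3 hp2 ⊢
    omega

/-- A bound for the running time of the algorithm. -/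
def mainTime (n N w : ℕ) : ℕ :=
  100 * (n * n + N) + 200 + if w = 0 then 0 else
    (Nat.log 2 (n * n) + 1) * (2 * dpTime n N (w + 1) + 2000 * n ^ 3 + 1000)

/-- An edge forces a bag with two vertices. So whenever `solve` is reached, `n ^ 3 ≤ n ^ (w + 2)`.
-/
theorem TreeDecomposition.width_ne_zero {V Node : Type*} [Fintype V] {G : SimpleGraph V}
    [Fintype Node] (T : TreeDecomposition G Node) {u v : V} (h : G.Adj u v) : T.width ≠ 0 := by
  classical
  obtain ⟨t, hu, hv⟩ := T.edge_cover u v h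
  have h1 : 1 < (T.bag t).card := Finset.one_lt_card.2 ⟨u, hu, v, hv, h.ne⟩
  have h2 : (T.bag t).card ≤ Finset.univ.sup fun t => (T.bag t).card :=
    Finset.le_sup (f := fun t => (T.bag t).card) (Finset.mem_univ t)
  unfold TreeDecomposition.width
  omega

/-- The special cases matter for the running time. For `w = 0` the bound permits only about `n ^ 2 *
log n` steps, too few for the preprocessing; but then there is no edge and only `k = n` is feasible,
with singletons. Rejecting `n < k` at once makes the time independent of `k`. -/
theorem main_runs (T : NiceTreeDecomposition G (Fin N)) (k : ℕ) (h2n : 2 ≤ n)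
    (M : MetricSpace (Fin n)) :
    Runs (distArray M) main (inputState k T) (mainTime n N T.width) (IsCorrectOutput M G k) := by
  have hp2 : n ≤ n * n := Nat.le_mul_of_pos_right _ (by omega)
  have hn : (inputState k T).reg rn = n := rfl
  have hk : (inputState k T).reg rk = k := rfl
  have hI := inputs_inputState k T
  have hG := inputState_adj k T
  have hz : ∀ a ∈ [aHash, aHead, aVT, aUsed], ∀ x, (inputState k T).arr a x = 0 := by
    simp [inputState]
  generalize inputState k T = s at *
  unfold mainTime
  generalize hX : (if T.width = 0 then 0 else
    (Nat.log 2 (n * n) + 1) * (2 * dpTime n N (T.width + 1) + 2000 * n ^ 3 + 1000)) = X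
  refine Runs.ite_le (T₁ := 100 * (n * n + N) + 180 + X) (fun hlt => ?_) (fun hge => ?_)
    (by simp only [Test.cost, Expr.cost]; omega)
  · simp only [Test.Holds, Expr.eval, hn, hk] at hlt
    refine Runs.straight_le rfl (show 2 ≤ _ by omega) (isCorrectOutput_of_not ?_ (by simp))
    rintro ⟨P, c, h⟩
    have := h.card_le
    omega
  simp only [Test.Holds, Expr.eval, hn, hk] at hge
  refine Runs.ite_le (T₁ := 100 * (n * n + N) + 160 + X) (fun heq => ?_) (fun hne => ?_)
    (by simp only [Test.cost, Expr.cost]; omega)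
  · simp only [Test.Holds, Expr.eval, hn, hk] at heq
    subst heq
    refine Runs.seq_le (singletons_runs hn) (T₂ := 50 * k + 40) ?_ (by omega)
    intro s₁ hk₁ hA
    refine (output_runs (a := id) (k := k) (by rw [hk₁.reg _ rfl, hn]) (fun v => hA v v.2)
      (fun _ => rfl) (by simp [centers])).mono le_rfl ?_
    rintro s₂ _ ⟨h0, c, h1, h2, h3⟩
    exact isCorrectOutput_of_centered (r := 0) (centered_id G) h1 h2 (by simp [distance])
      (fun _ _ _ => zero_le) h0 h3
  simp only [Test.Holds, Expr.eval, hn, hk] at hne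
  refine Runs.seq_le (mulTable_runs hn hI.nodes) (T₂ := 20 * (n * n) + 60 + X) ?_ (by omega)
  intro s₁ hk₁ hm
  have hn₁ : s₁.reg rn = n := by rw [hk₁.reg _ rfl, hn]
  have a₁ : s₁.arr aAdj = s.arr aAdj := hk₁.arr _ rfl
  refine Runs.seq_le (findEdge_runs (n := n) (by rw [hn₁]; exact hm n (by omega)))
    (T₂ := 30 + X) ?_ (by omega)
  intro s₂ hk₂ hF
  rw [a₁] at hF
  have hEdge : s₂.reg rF = 0 ↔ ∀ u v, ¬ G.Adj u v := by
    rw [hF]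
    refine ⟨fun h u v huv => (hG u v).2 huv (h _ ?_), fun h x hx => ?_⟩
    · calc (u : ℕ) * n + v < (u + 1) * n := by rw [add_mul]; omega
        _ ≤ n * n := Nat.mul_le_mul_right n u.2
    · have h1 := hG ⟨x / n, Nat.div_lt_of_lt_mul hx⟩ ⟨x % n, Nat.mod_lt _ (by omega)⟩
      simp only [Nat.div_add_mod'] at h1
      by_contra hne'
      exact h _ _ (h1.1 hne')
  refine Runs.ite_le (T₁ := 10 + X) (fun h0 => ?_) (fun h0 => ?_)
    (by simp only [Test.cost, Expr.cost]; omega)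
  · simp only [Test.Holds, Expr.eval] at h0
    refine Runs.straight_le rfl (show 2 ≤ _ by omega) (isCorrectOutput_of_not ?_ (by simp))
    rintro ⟨P, c, h⟩
    exact hne (h.card_eq_of_no_edge (hEdge.1 h0))
  · simp only [Test.Holds, Expr.eval, hEdge] at h0
    push Not at h0
    obtain ⟨u, v, huv⟩ := h0
    rw [if_neg (T.toTreeDecomposition.width_ne_zero huv)] at hX
    refine (solve_runs (k := k) h2n (distArray_apply M) ((hI.congr hk₁).congr hk₂)
      (by rw [hk₂.reg _ rfl, hn₁]) (by rw [hk₂.reg _ rfl, hk₁.reg _ rfl, hk]) (by omega)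
      ?_ ?_ ?_).mono (by omega) fun _ _ h => h
    · rw [hk₂.arr _ rfl, a₁]; exact hG
    · rw [hk₂.arr _ rfl]; exact hm
    · intro a ha x
      rw [show s₂.arr a = s.arr a by
        simp only [List.mem_cons, List.not_mem_nil, or_false] at ha
        rcases ha with rfl | rfl | rfl | rfl <;> rw [hk₂.arr _ rfl, hk₁.arr _ rfl]]
      exact hz a ha x

end ConnectedKCenter

namespace ConnectedKCenter

/-! ## The running time -/

/-- Of the factor `(w + 2) ^ 3`, one power comes from the number of nodes and two from the work per
state. The cube also absorbs the term `N ^ 3` that stems from searching a ready node in every step;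
there `1 ≤ w` is needed for `n ^ 3 ≤ n ^ (w + 2)`. -/
theorem dpTime_le {n N w c : ℕ} (hn : 1 ≤ n) (hw : 1 ≤ w) (hN : N ≤ c * (n * (w + 1))) :
    dpTime n N (w + 1) ≤
      1500 * (c + 1) ^ 3 * (n ^ (w + 2) * Nat.bell (w + 1) ^ 2 * (w + 2) ^ 3) := by
  set Y := n ^ (w + 2) * Nat.bell (w + 1) ^ 2 * (w + 2) ^ 3 with hY
  have hB : 1 ≤ Nat.bell (w + 1) ^ 2 := Nat.one_le_pow _ _ (bell_pos _)
  have hn3 : n ^ 3 ≤ n ^ (w + 2) := Nat.pow_le_pow_right hn (by omega)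
  have hnB : n ^ 3 * 1 ≤ n ^ (w + 2) * Nat.bell (w + 1) ^ 2 := Nat.mul_le_mul hn3 hB
  have h3 : N ^ 3 ≤ c ^ 3 * Y := by
    calc N ^ 3 ≤ (c * (n * (w + 2))) ^ 3 :=
          Nat.pow_le_pow_left (hN.trans (by gcongr; omega)) _
      _ = c ^ 3 * (n ^ 3 * 1 * (w + 2) ^ 3) := by ring
      _ ≤ c ^ 3 * Y := by rw [hY]; gcongr
  have hfill : N * fillTime n (w + 1) ≤ 1000 * c * Y := by
    calc N * fillTime n (w + 1)
        ≤ c * (n * (w + 2)) *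
          (1000 * (w + 2) ^ 2 * (n ^ (w + 1) * Nat.bell (w + 1) ^ 2)) := by
          unfold fillTime
          gcongr ?_ * ?_
          · exact hN.trans (by gcongr; omega)
          · exact le_rfl
      _ = 1000 * c * Y := by rw [hY]; ring
  have hNn : N * n ≤ c * Y := by
    calc N * n ≤ c * (n * (w + 2)) * n := by
          gcongr; exact hN.trans (by gcongr; omega)
      _ = c * (n ^ 2 * (w + 2) ^ 1) := by ring
      _ ≤ c * Y := by
        rw [hY]
        gcongr c * (?_ * ?_)
        · calc n ^ 2 ≤ n ^ 3 := Nat.pow_le_pow_right hn (by omega)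
            _ ≤ _ := by simpa using hnB
        · exact Nat.pow_le_pow_right (by omega) (by omega)
  have hN1 : N ≤ N ^ 3 := Nat.le_self_pow (by omega) N
  have hN2 : N * N ≤ N ^ 3 := by
    rcases Nat.eq_zero_or_pos N with h | h
    · simp [h]
    · calc N * N = N ^ 2 := by ring
        _ ≤ N ^ 3 := Nat.pow_le_pow_right h (by omega)
  have hY1 : 1 ≤ Y := by
    rw [hY]
    have := Nat.one_le_pow (w + 2) n hn
    have := Nat.one_le_pow 3 (w + 2) (by omega)
    exact Nat.mul_pos (Nat.mul_pos ‹_› hB) ‹_›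
  calc dpTime n N (w + 1)
      = N * fillTime n (w + 1) + 70 * (N * n) + 40 * N ^ 3 + 100 * (N * N) + 200 * N + 30 := by
        unfold dpTime; ring
    _ ≤ 1000 * c * Y + 70 * (c * Y) + 40 * (c ^ 3 * Y) + 100 * (c ^ 3 * Y) + 200 * (c ^ 3 * Y) +
        30 * Y := by
        have := hN1.trans h3
        have := hN2.trans h3
        gcongr
        omega
    _ = (1070 * c + 340 * c ^ 3 + 30) * Y := by ring
    _ ≤ 1500 * (c + 1) ^ 3 * Y := by
        gcongr
        ring_nf
        nlinarith [Nat.zero_le c, Nat.zero_le (c ^ 2), Nat.zero_le (c ^ 3)]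

theorem mainTime_le {n N w c : ℕ} (hn : 2 ≤ n) (hN : N ≤ c * (n * (w + 1))) :
    mainTime n N w ≤ 10000 * (c + 1) ^ 3 *
      ((Nat.log 2 (n * n) + 1) * (n ^ (w + 2) * Nat.bell (w + 1) ^ 2 * (w + 2) ^ 3)) := by
  set Y := n ^ (w + 2) * Nat.bell (w + 1) ^ 2 * (w + 2) ^ 3 with hY
  obtain ⟨L, hL⟩ : ∃ L, Nat.log 2 (n * n) + 1 = L := ⟨_, rfl⟩
  have hL1 : 1 ≤ L := by omega
  have hB : 1 ≤ Nat.bell (w + 1) ^ 2 := Nat.one_le_pow _ _ (bell_pos _)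
  have hmul : ∀ j ≤ w + 2, n ^ j * (w + 2) ≤ Y := fun j hj => by
    calc n ^ j * (w + 2) = n ^ j * 1 * (w + 2) ^ 1 := by ring
      _ ≤ Y := by
        rw [hY]
        gcongr
        · omega
        · omega
        · omega
  have hn2 : n * n ≤ Y := by
    calc n * n = n ^ 2 * 1 := by ring
      _ ≤ n ^ 2 * (w + 2) := by gcongr; omega
      _ ≤ Y := hmul 2 (by omega)
  have hNY : N ≤ c * Y := by
    calc N ≤ c * (n ^ 1 * (w + 2)) := hN.trans (by rw [pow_one]; gcongr; omega)
      _ ≤ c * Y := by gcongr; exact hmul 1 (by omega)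
  have hY1 : 1 ≤ Y := le_trans (by nlinarith) hn2
  have hLY : Y ≤ L * Y := Nat.le_mul_of_pos_left _ hL1
  have hbase : 100 * (n * n + N) + 200 ≤ (300 + 100 * c) * (L * Y) := by
    calc 100 * (n * n + N) + 200 ≤ 100 * (Y + c * Y) + 200 * Y := by gcongr; omega
      _ = (300 + 100 * c) * Y := by ring
      _ ≤ _ := by gcongr
  have hcore : (if w = 0 then 0 else L * (2 * dpTime n N (w + 1) + 2000 * n ^ 3 + 1000)) ≤
      (3000 * (c + 1) ^ 3 + 3000) * (L * Y) := by
    split_ifs with hw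
    · exact Nat.zero_le _
    · have h1 := dpTime_le (by omega : 1 ≤ n) (by omega : 1 ≤ w) hN
      rw [← hY] at h1
      have h2 : n ^ 3 ≤ Y := le_trans (Nat.le_mul_of_pos_right _ (by omega)) (hmul 3 (by omega))
      calc L * (2 * dpTime n N (w + 1) + 2000 * n ^ 3 + 1000)
          ≤ L * (2 * (1500 * (c + 1) ^ 3 * Y) + 2000 * Y + 1000 * Y) := by gcongr; omega
        _ = (3000 * (c + 1) ^ 3 + 3000) * (L * Y) := by ring
  have hc : 1 ≤ (c + 1) ^ 3 := Nat.one_le_pow _ _ (by omega)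
  have hc' : c ≤ (c + 1) ^ 3 := le_trans (by omega) (Nat.le_self_pow (by omega) (c + 1))
  rw [mainTime, hL]
  calc _ ≤ (300 + 100 * c) * (L * Y) + (3000 * (c + 1) ^ 3 + 3000) * (L * Y) :=
        Nat.add_le_add hbase hcore
    _ = (300 + 100 * c + (3000 * (c + 1) ^ 3 + 3000)) * (L * Y) := by ring
    _ ≤ 10000 * (c + 1) ^ 3 * (L * Y) := by gcongr; omega

/-- The square gives `2 * Real.log n` and the summand `1` is at most `Real.log n / Real.log 2`, so
the constant `3 / Real.log 2` would do, which is below 5. -/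
theorem log_two_sq_le {n : ℕ} (hn : 2 ≤ n) :
    ((Nat.log 2 (n * n) + 1 : ℕ) : ℝ) ≤ 5 * Real.log n := by
  have h1 : ((Nat.log 2 (n * n) : ℕ) : ℝ) * Real.log 2 ≤ 2 * Real.log n := by
    have h : ((2 ^ Nat.log 2 (n * n) : ℕ) : ℝ) ≤ ((n * n : ℕ) : ℝ) :=
      Nat.cast_le.2 (Nat.pow_log_le_self 2 (by positivity))
    have := Real.log_le_log (by positivity) h
    push_cast at this
    rw [Real.log_pow, Real.log_mul (by positivity) (by positivity)] at this
    linarith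
  have h2 : Real.log 2 ≤ Real.log n := Real.log_le_log (by norm_num) (by exact_mod_cast hn)
  have h3 := Real.log_two_gt_d9
  push_cast
  nlinarith

end ConnectedKCenter


theorem mainTheorem4 :
    ∃ (prog : ConnectedKCenter.Cmd) (p : Polynomial ℕ), ∀ c : ℕ, ∃ C : ℝ,
      ∀ (n k N w : ℕ) (M : MetricSpace (Fin n)) (G : SimpleGraph (Fin n))
        (T : ConnectedKCenter.NiceTreeDecomposition G (Fin N)),
        2 ≤ n → T.width = w → N ≤ c * (n * (w + 1)) →
        ∃ (t : ℕ) (s : ConnectedKCenter.State),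
          ConnectedKCenter.Exec (ConnectedKCenter.distArray M) prog
            (ConnectedKCenter.inputState k T) t s ∧
          ConnectedKCenter.IsCorrectOutput M G k s ∧
          (t : ℝ) ≤ C * (Real.log n * (n : ℝ) ^ (w + 2) * (Nat.bell (w + 1) : ℝ) ^ 2 *
            ((p.eval w : ℕ) : ℝ)) := by
  -- The polynomial is the factor `(w + 2) ^ 3` of `mainTime_le`; the constant is `10000` from there
  -- times `5` from `log_two_sq_le`.
  refine ⟨ConnectedKCenter.main, (Polynomial.X + Polynomial.C 2) ^ 3, fun c =>
    ⟨50000 * ((c : ℝ) + 1) ^ 3, fun n k N w M G T hn hw hN => ?_⟩⟩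
  obtain ⟨t, s, h1, h2, h3⟩ := ConnectedKCenter.main_runs T k hn M
  refine ⟨t, s, h1, h3, ?_⟩
  rw [hw] at h2
  have h4 : (t : ℝ) ≤ _ := Nat.cast_le.2 (h2.trans (ConnectedKCenter.mainTime_le hn hN))
  have h5 := ConnectedKCenter.log_two_sq_le hn
  rw [Nat.cast_mul (10000 * (c + 1) ^ 3), Nat.cast_mul (Nat.log 2 (n * n) + 1)] at h4
  refine h4.trans ?_
  calc ((10000 * (c + 1) ^ 3 : ℕ) : ℝ) * (((Nat.log 2 (n * n) + 1 : ℕ) : ℝ) *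
        ((n ^ (w + 2) * Nat.bell (w + 1) ^ 2 * (w + 2) ^ 3 : ℕ) : ℝ))
      ≤ ((10000 * (c + 1) ^ 3 : ℕ) : ℝ) * (5 * Real.log n *
        ((n ^ (w + 2) * Nat.bell (w + 1) ^ 2 * (w + 2) ^ 3 : ℕ) : ℝ)) := by gcongr
    _ = _ := by
      simp only [Polynomial.eval_pow, Polynomial.eval_add, Polynomial.eval_X, Polynomial.eval_C]
      push_cast
      ring
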